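/- Let $Q$ be a smooth compact oriented 3-manifold with (possibly empty) smooth boundary $\partial Q$, and let $\mathcal B$ be the set of exact smooth 2-forms $B$ on $Q$ whose restriction to $\partial Q$ is zero. Let $\mathcal B^\circ\subseteq\mathcal B$ be the set of forms without zeros, and let $\mathcal D=\mathrm{Diff}_0(Q)$ be the group of diffeomorphisms of $Q$ that are smoothly isotopic to the identity. Let $\varkappa=H_2(Q,\partial Q;\mathbb Q)/\operatorname{Im}(H_2(Q;\mathbb Q)\to H_2(Q,\partial Q;\mathbb Q))$. For $\Phi\in\operatorname{Hom}_{\mathbb Q}(\varkappa,\mathbb R)$ let $\mathrm{Flux}^{-1}(\Phi)$ be the set of $B\in\mathcal B$ with $\int_\Pi B=\Phi[\Pi]$ for every (smooth) 2-chain $\Pi$ in $Q$ with boundary in $\partial Q$. Let $\varkappa^\perp\subseteq H_1(\partial Q;\mathbb Q)$ be any subspace complementary to $\ker(H_1(\partial Q;\mathbb Q)\to H_1(Q;\mathbb Q))$. The helicity of $B\in\mathcal B$ is $\mathcal H_{\varkappa^\perp}(B)=\int_Q B\wedge A$, where $A$ is any smooth 1-form on $Q$ with $dA=B$ and $\oint_\gamma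 A=0$ for every 1-cycle $\gamma$ in $\partial Q$ with $[\gamma]\in\varkappa^\perp$. For sets $\mathcal B'''\subseteq\mathcal B''\subseteq\mathcal B$, the set $\mathcal B'''$ is called $\mathcal H_{\varkappa^\perp}|_{\mathcal B''}$-connected if any two of its elements with the same value $c$ of $\mathcal H_{\varkappa^\perp}$ can be joined by a piecewise smooth path in $\mathcal H_{\varkappa^\perp}^{-1}(c)\cap\mathcal B''$. (A) Let $\mathcal B''\subseteq\mathcal B$ be $C^1$-open in $\mathcal B$, and let $B\in\mathcal B''$ with $\mathcal H_{\varkappa^\perp}(B)\ne0$. Then every sufficiently small $C^1$-neighbourhood $\mathcal B'''$ of $B$ in $\mathcal B''$ is $\mathcal H_{\varkappa^\perp}|_{\mathcal B''}$-connected. (B) Let $Q=M\times S^1$, where $M$ is a compact smooth oriented surface with nonempty boundary and $S^1=\mathbb R/\mathbb Z$, and let $\pi_M,\pi_{S^1}$ be the projections. Let $\mathcal B'$ be either $\mathcal B$ or $\mathrm{Flux}^{-1}(\Phi)$ for some $\Phi\in\operatorname{Hom}_{\mathbb Q}(\varkappa,\mathbb R)$. Let $\mathcal B''$ be the set of all 2-forms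 $\psi^*B_{\omega,H}$, where $\psi\in\mathcal D$, $\omega$ is an exact positive area form on $M$, $H\in C^\infty(Q)$, and $B_{\omega,H}:=\pi_M^*\omega-dH\wedge d\pi_{S^1}$ belongs to $\mathcal B'$. Then $\mathcal B''\subseteq\mathcal B'\cap\mathcal B^\circ$, and the whole set $\mathcal B''$ is $\mathcal H_{\varkappa^\perp}|_{\mathcal B''}$-connected. -/

import Mathlib

open Set Filter Topology MeasureTheory Module
open scoped Manifold ContDiff

noncomputable section

namespace Helicity

/-! ### Differential forms on manifolds with boundary -/

section Forms

variable {E H Q : Type*} [NormedAddCommGroup E] [NormedSpace ℝ E] [TopologicalSpace H]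
  {E' H' Q' : Type*} [NormedAddCommGroup E'] [NormedSpace ℝ E'] [TopologicalSpace H']

/-- Fields of alternating `k`-forms on a manifold `Q` modelled on `E`, with no regularity imposed.
(The tangent space `TangentSpace I x` of Mathlib is by definition the space `E`.) -/
abbrev Form (E Q : Type*) [NormedAddCommGroup E] [NormedSpace ℝ E] (k : ℕ) : Type _ :=
  Q → E [⋀^Fin k]→L[ℝ] ℝ

variable (I : ModelWithCorners ℝ E H) [TopologicalSpace Q] [ChartedSpace H Q]
  (I' : ModelWithCorners ℝ E' H') [TopologicalSpace Q'] [ChartedSpace H' Q']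

/-- The pullback `f^* η` of a form by a differentiable map `f : Q → Q'`. -/
def pullback {k : ℕ} (f : Q → Q') (η : Form E' Q' k) : Form E Q k := fun x =>
  (η (f x)).compContinuousLinearMap (mfderiv I I' f x : E →L[ℝ] E')

/-- The coordinate expression of `η` in the preferred chart at `x₀`: the pullback of `η` by the
inverse of that chart. It is meaningful on `(extChartAt I x₀).target`. -/
def inChart {k : ℕ} (η : Form E Q k) (x₀ : Q) : E → E [⋀^Fin k]→L[ℝ] ℝ := fun y =>
  (η ((extChartAt I x₀).symm y)).compContinuousLinearMap
    (mfderivWithin 𝓘(ℝ, E) I (extChartAt I x₀).symm (range I) y : E →L[ℝ] E)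

/-- `η` is a smooth (`C^∞`) differential form. -/
def IsSmoothForm {k : ℕ} (η : Form E Q k) : Prop :=
  ∀ x₀ : Q, ContDiffOn ℝ ∞ (inChart I η x₀) (extChartAt I x₀).target

/-- The exterior derivative, computed at `x` in the preferred chart at `x`. -/
def extD {k : ℕ} (η : Form E Q k) : Form E Q (k + 1) := fun x =>
  (extDerivWithin (inChart I η x) (range I) (extChartAt I x x)).compContinuousLinearMap
    (mfderiv I 𝓘(ℝ, E) (extChartAt I x) x : E →L[ℝ] E)

/-- A covector, as an alternating `1`-form. -/
def ofCovector (a : E →L[ℝ] ℝ) : E [⋀^Fin 1]→L[ℝ] ℝ :=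
  ContinuousAlternatingMap.ofSubsingleton ℝ E ℝ 0 a

/-- The exterior product `α ∧ η` of a `1`-form with a `k`-form:
`(α ∧ η)(v₀, …, v_k) = ∑ i, (-1)^i α(v_i) η(v₀, …, v̂_i, …, v_k)`. -/
def wedgeOne {k : ℕ} (α : Form E Q 1) (η : Form E Q k) : Form E Q (k + 1) := fun x =>
  ContinuousAlternatingMap.alternatizeUncurryFin
    (((ContinuousAlternatingMap.ofSubsingleton ℝ E ℝ (0 : Fin 1)).symm (α x)).smulRight (η x))

/-- The differential of a function, as a `1`-form. -/
def differential (f : Q → ℝ) : Form E Q 1 := fun x =>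
  ofCovector (mfderiv I 𝓘(ℝ, ℝ) f x : E →L[ℝ] ℝ)

/-- `η` is an exact form: it has a smooth primitive. -/
def IsExact {k : ℕ} (η : Form E Q (k + 1)) : Prop :=
  ∃ α : Form E Q k, IsSmoothForm I α ∧ extD I α = η

/-- `v` is tangent at `x` to the boundary of `Q`: it is the velocity at `x` of a curve that runs in
the boundary. -/
def IsTangentToBoundary (x : Q) (v : E) : Prop :=
  ∃ γ : ℝ → Q, γ 0 = x ∧ (∀ᶠ t in 𝓝 (0 : ℝ), γ t ∈ I.boundary Q) ∧
    HasMFDerivAt 𝓘(ℝ, ℝ) I γ 0 (ContinuousLinearMap.toSpanSingleton ℝ v : ℝ →L[ℝ] E)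

/-- The restriction (pullback) of `η` to the boundary of `Q` is zero. -/
def VanishesOnBoundary {k : ℕ} (η : Form E Q k) : Prop :=
  ∀ x ∈ I.boundary Q, ∀ v : Fin k → E, (∀ i, IsTangentToBoundary I x (v i)) → η x v = 0

/-- A smooth form of top degree without zeros. Such a form orients the manifold; an orientable
manifold is one that has such a form. -/
def IsVolumeForm {n : ℕ} (μ : Form E Q n) : Prop :=
  IsSmoothForm I μ ∧ ∀ x, μ x ≠ 0

/-- `η` is a positive volume (area) form with respect to the orientation given by `μ`. -/
def IsPositiveVolumeForm {n : ℕ} (μ η : Form E Q n) : Prop :=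
  IsSmoothForm I η ∧ ∀ x, ∃ a : ℝ, 0 < a ∧ η x = a • μ x

/-- The integral over a compact `n`-manifold `Q`, oriented by the volume form `μ`, of an `n`-form
`η`, through a smooth partition of unity subordinate to the preferred charts. In each chart the
coefficient of `η` with respect to a basis of `E` is integrated against the Lebesgue measure
normalized on that basis, with the sign of the basis in the orientation. -/
def formIntegral [FiniteDimensional ℝ E] [MeasurableSpace E] [BorelSpace E]
    [IsManifold I ∞ Q] [T2Space Q] [CompactSpace Q] {n : ℕ} [hn : Fact (finrank ℝ E = n)]
    (μ η : Form E Q n) : ℝ :=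
  let ρ := (SmoothPartitionOfUnity.exists_isSubordinate_chartAt_source I Q).choose
  let b : Basis (Fin n) ℝ E := finBasisOfFinrankEq ℝ E hn.out
  ∑ᶠ i : Q, ∫ y in (extChartAt I i).target,
    ρ i ((extChartAt I i).symm y) * (SignType.sign (inChart I μ i y b) : ℝ) * inChart I η i y b
      ∂b.addHaar

/-- The `C^1`-topology on `k`-forms: uniform convergence, on compact subsets of the charts, of the
coefficients and of their first derivatives. It is only used on sets of smooth forms. -/
@[reducible]
def c1Topology (k : ℕ) : TopologicalSpace (Form E Q k) :=
  ⨅ x : Q,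
    TopologicalSpace.induced
        (fun η => UniformOnFun.ofFun {K : Set E | IsCompact K ∧ K ⊆ (extChartAt I x).target}
          (inChart I η x)) inferInstance ⊓
      TopologicalSpace.induced
        (fun η => UniformOnFun.ofFun {K : Set E | IsCompact K ∧ K ⊆ (extChartAt I x).target}
          (fderivWithin ℝ (inChart I η x) (range I))) inferInstance

/-- `S` is a `C^1`-open subset of the set `T` of forms. -/
def IsC1OpenIn {k : ℕ} (S T : Set (Form E Q k)) : Prop :=
  ∃ U : Set (Form E Q k), IsOpen[c1Topology I k] U ∧ S = U ∩ T

/-- `N` is a `C^1`-neighbourhood of `η` in the set `T` of forms. -/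
def IsC1NhdIn {k : ℕ} (N T : Set (Form E Q k)) (η : Form E Q k) : Prop :=
  N ⊆ T ∧ ∃ U : Set (Form E Q k), IsOpen[c1Topology I k] U ∧ η ∈ U ∩ T ∧ U ∩ T ⊆ N

/-- The family `u ↦ β u`, `u ∈ [a, b]`, of forms is smooth: it is smooth jointly in the parameter
and the point. -/
def IsSmoothFamilyOn {k : ℕ} (β : ℝ → Form E Q k) (a b : ℝ) : Prop :=
  ∀ x₀ : Q, ContDiffOn ℝ ∞ (fun p : ℝ × E => inChart I (β p.1) x₀ p.2)
    (Icc a b ×ˢ (extChartAt I x₀).target)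

/-- `u ↦ β u`, `u ∈ [0, 1]`, is a piecewise smooth path of forms. -/
def IsPiecewiseSmoothPath {k : ℕ} (β : ℝ → Form E Q k) : Prop :=
  ∃ (n : ℕ) (t : Fin (n + 1) → ℝ), StrictMono t ∧ t 0 = 0 ∧ t (Fin.last n) = 1 ∧
    ∀ i : Fin n, IsSmoothFamilyOn I β (t i.castSucc) (t i.succ)

/-- `ψ` belongs to `Diff₀(Q)`: there is a smooth isotopy from the identity to `ψ` through
diffeomorphisms. -/
def IsIsotopicToId (ψ : Diffeomorph I I Q Q ∞) : Prop :=
  ∃ φ : ℝ → Diffeomorph I I Q Q ∞,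
    ContMDiffOn (𝓘(ℝ, ℝ).prod I) I ∞ (fun p : ℝ × Q => φ p.1 p.2) (Icc 0 1 ×ˢ univ) ∧
    φ 0 = Diffeomorph.refl I Q ∞ ∧ φ 1 = ψ

end Forms

/-! ### Smooth singular homology with rational coefficients -/

section Homology

/-- The standard `k`-simplex in `ℝ^k`, with vertices `0, e₀, …, e_{k-1}`. -/
def simplex (k : ℕ) : Set (Fin k → ℝ) := {t | (∀ i, 0 ≤ t i) ∧ ∑ i, t i ≤ 1}

theorem zero_mem_simplex (k : ℕ) : (0 : Fin k → ℝ) ∈ simplex k := by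
  simp [simplex]

/-- The affine map of `ℝ^k` to `ℝ^(k+1)` that carries the simplex onto the face opposite to the
`i`-th vertex, preserving the order of the vertices: in barycentric coordinates a zero is inserted
at the place `i`. -/
def faceMap {k : ℕ} (i : Fin (k + 2)) (t : Fin k → ℝ) : Fin (k + 1) → ℝ :=
  Fin.tail (i.insertNth (0 : ℝ) (Fin.cons (1 - ∑ j, t j) t : Fin (k + 1) → ℝ) : Fin (k + 2) → ℝ)

theorem faceMap_mem {k : ℕ} (i : Fin (k + 2)) {t : Fin k → ℝ} (ht : t ∈ simplex k) :
    faceMap i t ∈ simplex (k + 1) := by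
  have hnn : ∀ j, 0 ≤ (i.insertNth (0 : ℝ) (Fin.cons (1 - ∑ j, t j) t : Fin (k + 1) → ℝ) :
      Fin (k + 2) → ℝ) j := by
    intro j
    refine Fin.succAboveCases i ?_ (fun l => ?_) j
    · simp
    · rw [Fin.insertNth_apply_succAbove]
      refine Fin.cases ?_ (fun m => ?_) l
      · simpa using ht.2
      · simpa using ht.1 m
  have hsum : ∑ j, (i.insertNth (0 : ℝ) (Fin.cons (1 - ∑ j, t j) t : Fin (k + 1) → ℝ) :
      Fin (k + 2) → ℝ) j = 1 := by
    rw [Fin.sum_univ_succAbove _ i]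
    simp [Fin.sum_univ_succ]
  refine ⟨fun j => hnn j.succ, ?_⟩
  rw [Fin.sum_univ_succ] at hsum
  have h0 := hnn 0
  simp only [faceMap, Fin.tail]
  linarith

theorem contDiff_faceMap {k : ℕ} (i : Fin (k + 2)) : ContDiff ℝ ∞ (faceMap (k := k) i) := by
  rw [contDiff_pi]
  intro j
  simp only [faceMap, Fin.tail]
  rcases Fin.eq_self_or_eq_succAbove i j.succ with h | ⟨l, hl⟩
  · rw [h]; simpa using contDiff_const
  · rw [hl]
    simp only [Fin.insertNth_apply_succAbove]
    refine Fin.cases ?_ (fun m => ?_) l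
    · simp only [Fin.cons_zero]
      fun_prop
    · simp only [Fin.cons_succ]
      fun_prop

/-- A map on the simplex, extended to all of `ℝ^k` by a constant. -/
def extendSimplex {Q : Type*} {k : ℕ} (f : simplex k → Q) : (Fin k → ℝ) → Q := by
  classical
  exact fun t => if h : t ∈ simplex k then f ⟨t, h⟩ else f ⟨0, zero_mem_simplex k⟩

variable {E H Q : Type*} [NormedAddCommGroup E] [NormedSpace ℝ E] [TopologicalSpace H]
  (I : ModelWithCorners ℝ E H) [TopologicalSpace Q] [ChartedSpace H Q]

variable (Q) in
/-- A smooth singular `k`-simplex of `Q`. -/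
structure SmoothSimplex (k : ℕ) where
  toFun : simplex k → Q
  smooth : ContMDiffOn 𝓘(ℝ, Fin k → ℝ) I ∞ (extendSimplex toFun) (simplex k)

variable {I}

/-- The `i`-th face of a smooth singular simplex. -/
def SmoothSimplex.face {k : ℕ} (σ : SmoothSimplex Q I (k + 1)) (i : Fin (k + 2)) :
    SmoothSimplex Q I k where
  toFun t := σ.toFun ⟨faceMap i t.1, faceMap_mem i t.2⟩
  smooth := by
    refine (σ.smooth.comp (contDiff_faceMap i).contMDiff.contMDiffOn
      (fun t ht => faceMap_mem i ht)).congr ?_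
    intro t ht
    simp [extendSimplex, ht, faceMap_mem i ht]

variable (Q I)

/-- Smooth singular `k`-chains of `Q` with rational coefficients. -/
abbrev Chain (k : ℕ) : Type _ := SmoothSimplex Q I k →₀ ℚ

/-- The boundary operator `∂ : C_{k+1} → C_k`, the alternating sum of the faces. -/
def bdry (k : ℕ) : Chain Q I (k + 1) →ₗ[ℚ] Chain Q I k :=
  Finsupp.linearCombination ℚ
    (fun σ => ∑ i : Fin (k + 2), ((-1 : ℚ) ^ (i : ℕ)) • Finsupp.single (σ.face i) 1)

variable {Q}

/-- The chains of `Q` that lie in a subset `S` of `Q`. -/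
def chainsIn (S : Set Q) (k : ℕ) : Submodule ℚ (Chain Q I k) :=
  Finsupp.supported ℚ ℚ {σ | range σ.toFun ⊆ S}

/-- The relative cycles of degree `k + 1` of a pair `(T, S)`: chains in `T` with boundary in `S`. -/
def relCycles (T S : Set Q) (k : ℕ) : Submodule ℚ (Chain Q I (k + 1)) :=
  chainsIn I T (k + 1) ⊓ (chainsIn I S k).comap (bdry Q I k)

/-- The chains of degree `k + 1` that are zero in the homology of the pair `(T, S)`. -/
def relBoundaries (T S : Set Q) (k : ℕ) : Submodule ℚ (Chain Q I (k + 1)) :=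
  chainsIn I S (k + 1) ⊔ (chainsIn I T (k + 2)).map (bdry Q I (k + 1))

/-- The homology `H_{k+1}(T, S; ℚ)` of a pair of subsets `S ⊆ T` of `Q`. With `S = ∅` it is
`H_{k+1}(T; ℚ)`. -/
abbrev RelHomology (T S : Set Q) (k : ℕ) : Type _ :=
  relCycles I T S k ⧸ (relBoundaries I T S k).submoduleOf (relCycles I T S k)

theorem chainsIn_mono {S S' : Set Q} (h : S ⊆ S') (k : ℕ) : chainsIn I S k ≤ chainsIn I S' k :=
  Finsupp.supported_mono fun _ hσ => hσ.trans h

theorem relCycles_mono {T S T' S' : Set Q} (hT : T ⊆ T') (hS : S ⊆ S') (k : ℕ) :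
    relCycles I T S k ≤ relCycles I T' S' k :=
  inf_le_inf (chainsIn_mono I hT _) (Submodule.comap_mono (chainsIn_mono I hS _))

theorem relBoundaries_mono {T S T' S' : Set Q} (hT : T ⊆ T') (hS : S ⊆ S') (k : ℕ) :
    relBoundaries I T S k ≤ relBoundaries I T' S' k :=
  sup_le_sup (chainsIn_mono I hS _) (Submodule.map_mono (chainsIn_mono I hT _))

/-- The map of homology induced by the inclusion of pairs `(T, S) ⊆ (T', S')`. -/
def homologyMap {T S T' S' : Set Q} (hT : T ⊆ T') (hS : S ⊆ S') (k : ℕ) :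
    RelHomology I T S k →ₗ[ℚ] RelHomology I T' S' k :=
  Submodule.mapQ _ _ (Submodule.inclusion (relCycles_mono I hT hS k))
    (fun _ hx => relBoundaries_mono I hT hS k hx)

variable (Q)

/-- `H_1(∂Q; ℚ)`. -/
abbrev H1Boundary : Type _ := RelHomology I (I.boundary Q) ∅ 0

/-- The map `H_1(∂Q; ℚ) → H_1(Q; ℚ)` induced by the inclusion. -/
def inclH1 : H1Boundary Q I →ₗ[ℚ] RelHomology I (univ : Set Q) ∅ 0 :=
  homologyMap I (subset_univ _) subset_rfl 0

/-- `ϰ = H_2(Q, ∂Q; ℚ) / Im (H_2(Q; ℚ) → H_2(Q, ∂Q; ℚ))`. -/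
abbrev Kappa : Type _ :=
  RelHomology I (univ : Set Q) (I.boundary Q) 1 ⧸
    LinearMap.range (homologyMap I (subset_rfl : (univ : Set Q) ⊆ univ)
      (empty_subset (I.boundary Q)) 1)

variable {Q}

/-- The class in `ϰ` of a `2`-chain with boundary in `∂Q`. -/
def kappaClass (z : relCycles I (univ : Set Q) (I.boundary Q) 1) : Kappa Q I :=
  Submodule.Quotient.mk (Submodule.Quotient.mk z)

/-- The integral of a `k`-form over a smooth singular `k`-simplex. -/
def simplexIntegral {k : ℕ} (η : Form E Q k) (σ : SmoothSimplex Q I k) : ℝ :=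
  ∫ t in simplex k, η (extendSimplex σ.toFun t) fun j =>
    (mfderivWithin 𝓘(ℝ, Fin k → ℝ) I (extendSimplex σ.toFun) (simplex k) t :
      (Fin k → ℝ) →L[ℝ] E) (Pi.single j 1)

/-- The integral of a `k`-form over a `k`-chain. -/
def chainIntegral {k : ℕ} (η : Form E Q k) (c : Chain Q I k) : ℝ :=
  c.sum fun σ q => (q : ℝ) * simplexIntegral I η σ

end Homology

/-! ### Exact fields, flux and helicity -/

section Fields

variable {E H Q : Type*} [NormedAddCommGroup E] [NormedSpace ℝ E] [TopologicalSpace H]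
  (I : ModelWithCorners ℝ E H) [TopologicalSpace Q] [ChartedSpace H Q]

variable (Q) in
/-- The set `𝓑` of the smooth exact `2`-forms on `Q` whose restriction to `∂Q` is zero. -/
def exactFields : Set (Form E Q 2) :=
  {B | IsSmoothForm I B ∧ IsExact I B ∧ VanishesOnBoundary I B}

variable (Q) in
/-- The set `𝓑°` of the elements of `𝓑` without zeros. -/
def nonvanishingFields : Set (Form E Q 2) := {B | B ∈ exactFields Q I ∧ ∀ x, B x ≠ 0}

/-- The set `Flux⁻¹(Φ)` of the elements `B` of `𝓑` with `∫_Π B = Φ⟦Π⟧` for every `2`-chain `Π` in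
`Q` with boundary in `∂Q`. -/
def fluxFiber (Φ : Kappa Q I →ₗ[ℚ] ℝ) : Set (Form E Q 2) :=
  {B | B ∈ exactFields Q I ∧
    ∀ z : relCycles I (univ : Set Q) (I.boundary Q) 1,
      chainIntegral I B (z : Chain Q I 2) = Φ (kappaClass I z)}

/-- The periods of `A` over the `1`-cycles of `∂Q` with class in `P ⊆ H_1(∂Q; ℚ)` are zero. -/
def HasZeroPeriods (P : Submodule ℚ (H1Boundary Q I)) (A : Form E Q 1) : Prop :=
  ∀ z : relCycles I (I.boundary Q) ∅ 0, (Submodule.Quotient.mk z : H1Boundary Q I) ∈ P →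
    chainIntegral I A (z : Chain Q I 1) = 0

variable [FiniteDimensional ℝ E] [MeasurableSpace E] [BorelSpace E]
    [IsManifold I ∞ Q] [T2Space Q] [CompactSpace Q] [Fact (finrank ℝ E = 3)]

/-- The helicity of `B`, with respect to the orientation of `Q` given by `μ` and the subspace
`P = ϰ^⊥` of `H_1(∂Q; ℚ)`, is defined and equal to `c`: there is a smooth `1`-form `A` with
`dA = B`, with zero periods on `P`, and with `∫_Q B ∧ A = c`. (As `B` has degree two,
`B ∧ A = A ∧ B`.) -/
def HasHelicity (μ : Form E Q 3) (P : Submodule ℚ (H1Boundary Q I)) (B : Form E Q 2) (c : ℝ) :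
    Prop :=
  ∃ A : Form E Q 1, IsSmoothForm I A ∧ extD I A = B ∧ HasZeroPeriods I P A ∧
    formIntegral I μ (wedgeOne A B) = c

/-- The subset `S` of `T` is helicity-connected relative to `T`: any two elements of `S` with the
same helicity `c` are joined by a piecewise smooth path in the set of elements of `T` with
helicity `c`. -/
def IsHelicityConnected (μ : Form E Q 3) (P : Submodule ℚ (H1Boundary Q I))
    (S T : Set (Form E Q 2)) : Prop :=
  ∀ (c : ℝ), ∀ B₀ ∈ S, ∀ B₁ ∈ S, HasHelicity I μ P B₀ c → HasHelicity I μ P B₁ c →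
    ∃ β : ℝ → Form E Q 2, IsPiecewiseSmoothPath I β ∧ β 0 = B₀ ∧ β 1 = B₁ ∧
      ∀ u ∈ Icc (0 : ℝ) 1, β u ∈ T ∧ HasHelicity I μ P (β u) c

end Fields

/-! ### The product of a surface with the circle -/

section Product

/-- The model of `M × S^1` for a surface `M` with boundary. -/
abbrev prodModel : ModelWithCorners ℝ (EuclideanSpace ℝ (Fin 2) × EuclideanSpace ℝ (Fin 1))
    (ModelProd (EuclideanHalfSpace 2) (EuclideanSpace ℝ (Fin 1))) := (𝓡∂ 2).prod (𝓡 1)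

instance fact_finrank_three : Fact (finrank ℝ (EuclideanSpace ℝ (Fin 3)) = 3) := ⟨by simp⟩

instance fact_finrank_prod :
    Fact (finrank ℝ (EuclideanSpace ℝ (Fin 2) × EuclideanSpace ℝ (Fin 1)) = 3) := ⟨by simp⟩

/-- The form `dt` on `S^1 = ℝ/ℤ`, where `ℝ/ℤ` is identified with the unit circle of `ℂ` by
`t ↦ exp(2πit)`. -/
def circleForm : Form (EuclideanSpace ℝ (Fin 1)) Circle 1 := fun z =>
  ofCovector ((2 * Real.pi)⁻¹ • (Complex.imCLM.comp
    ((ContinuousLinearMap.mul ℝ ℂ (starRingEnd ℂ (z : ℂ))).comp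
      (mfderiv (𝓡 1) 𝓘(ℝ, ℂ) (fun w : Circle => (w : ℂ)) z :
        EuclideanSpace ℝ (Fin 1) →L[ℝ] ℂ))))

variable {M : Type*} [TopologicalSpace M] [ChartedSpace (EuclideanHalfSpace 2) M]

/-- `B_{η,F} = π_M^* η - dF ∧ dπ_{S^1}` on `M × S^1`. -/
def suspensionForm (η : Form (EuclideanSpace ℝ (Fin 2)) M 2) (F : M × Circle → ℝ) :
    Form (EuclideanSpace ℝ (Fin 2) × EuclideanSpace ℝ (Fin 1)) (M × Circle) 2 :=
  pullback prodModel (𝓡∂ 2) Prod.fst η -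
    wedgeOne (differential prodModel F) (pullback prodModel (𝓡 1) Prod.snd circleForm)

/-- The set of the forms `ψ^* B_{η,F}` with `ψ ∈ Diff₀(M × S^1)`, `η` an exact positive area form on
the surface `M` oriented by `τ`, `F` a smooth function on `M × S^1`, and `B_{η,F} ∈ 𝓑'`. -/
def suspensionFields (τ : Form (EuclideanSpace ℝ (Fin 2)) M 2)
    (B' : Set (Form (EuclideanSpace ℝ (Fin 2) × EuclideanSpace ℝ (Fin 1)) (M × Circle) 2)) :
    Set (Form (EuclideanSpace ℝ (Fin 2) × EuclideanSpace ℝ (Fin 1)) (M × Circle) 2) :=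
  {B | ∃ (ψ : Diffeomorph prodModel prodModel (M × Circle) (M × Circle) ∞)
      (η : Form (EuclideanSpace ℝ (Fin 2)) M 2) (F : M × Circle → ℝ),
    IsIsotopicToId prodModel ψ ∧ IsPositiveVolumeForm (𝓡∂ 2) τ η ∧ IsExact (𝓡∂ 2) η ∧
    ContMDiff prodModel 𝓘(ℝ, ℝ) ∞ F ∧ suspensionForm η F ∈ B' ∧
    B = pullback prodModel prodModel ψ (suspensionForm η F)}

end Product

end Helicity

end

open Helicity

set_option linter.unusedSectionVars false

noncomputable section

/-! Helicity is a quadratic function of the field, and it does not depend on the primitive. Two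
admissible primitives differ by a closed `ζ` whose periods over the cycles of the boundary all
vanish: on `P` by assumption, on the complementary kernel by Stokes. So `ζ` agrees along the
boundary with some `dF`. In `ζ ∧ B = dF ∧ B + (ζ - dF) ∧ dA` both terms are, up to sign,
differentials of forms whose restriction to the boundary is zero, namely of `F B` and `(ζ - dF) ∧
A`. Their integrals vanish (`formIntegral_wedgeOne_eq_zero_of_hasZeroPeriods`).

Part (A). Along the straight segment `B_u` between two fields near `B` with common helicity `c'`,
the helicity `h u` stays close to `c ≠ 0`, so it is nonzero and has the sign of `c'`. Helicity is
homogeneous of degree two, so `√(c' / h u) • B_u` has helicity `c'`; it is close to `B_u`, hence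
still in the open set (`exists_helicityConnected_nhd`). This needs the continuity of helicity in the
field (`exists_abs_helicity_sub_le`), although closeness of fields does not make given primitives
close. The remedy is `exists_closed_near`: a `1`-form `D` with zero periods on `P` is within
`O(|dD|)` of a closed form with zero periods on `P`, and the latter does not contribute to helicity.

The estimate is proved by a Čech argument with finite-dimensional linear algebra. On small chart
balls the radial homotopy gives functions `g i` with `D - d(g i) = O(ε)`. On overlaps `g i - g j` is
a constant `m i j` up to `O(ε)`. Glued by a partition of unity, `D` is within `O(ε)` of `dF -
cechForm m`. The cocycle equations and the period conditions are linear in `m` and hold up to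
`O(ε)`, so `m` is `O(ε)`-close to an exact solution `z` (`exists_near_common_kernel`), and `dF -
cechForm z` is the closed form sought.

Part (B). The area form is seen on vectors tangent to `M`, where `dt` vanishes, so suspension forms
have no zeros. Pulling back along an isotopy keeps the helicity and the flux, which reduces the
claim to two forms `B_{η,F}`. Interpolating `η` and `F` linearly stays in the class but may change
the helicity. It is corrected by adding `k(u) dκ` with `κ = G dt` and `G = 0` on the boundary, which
amounts to replacing `F` by `F - k G` and does not affect the flux. Since `κ ∧ dκ = 0`, the helicity
is affine in `k` with slope `2 ∫ κ ∧ B = 2 ∫ G dt ∧ η`. The function `G` is chosen so that this is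
positive, and one solves for `k(u)` (`exists_corrected_path`,
`exists_path_between_suspensionForms`). -/

namespace Helicity

/-! ### Alternating forms at a point and the Leibniz rules in a vector space. -/

section Alternating

variable {E F : Type*} [NormedAddCommGroup E] [NormedSpace ℝ E]
  [NormedAddCommGroup F] [NormedSpace ℝ F]

/-- Alternatization of continuous multilinear forms, as a continuous linear map. -/
def alternatizationCLM (E : Type*) [NormedAddCommGroup E] [NormedSpace ℝ E] (k : ℕ) :
    ContinuousMultilinearMap ℝ (fun _ : Fin k => E) ℝ →L[ℝ] E [⋀^Fin k]→L[ℝ] ℝ :=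
  LinearMap.mkContinuous
    { toFun := ContinuousMultilinearMap.alternatization
      map_add' := map_add _
      map_smul' := fun c f => by
        ext v
        simp only [ContinuousMultilinearMap.alternatization_apply_apply,
          _root_.smul_apply, RingHom.id_apply,
          ContinuousAlternatingMap.smul_apply, Finset.smul_sum]
        exact Finset.sum_congr rfl fun σ _ => smul_comm _ _ _ }
    (Fintype.card (Equiv.Perm (Fin k))) (fun f => by
      refine ContinuousAlternatingMap.opNorm_le_bound _ (by positivity) fun v => ?_
      simp only [LinearMap.coe_mk, AddHom.coe_mk,
        ContinuousMultilinearMap.alternatization_apply_apply]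
      refine (norm_sum_le _ _).trans ?_
      have : ∀ σ ∈ (Finset.univ : Finset (Equiv.Perm (Fin k))),
          ‖Equiv.Perm.sign σ • f (v ∘ σ)‖ ≤ ‖f‖ * ∏ i, ‖v i‖ := by
        intro σ _
        have h1 : ‖Equiv.Perm.sign σ • f (v ∘ σ)‖ = ‖f (v ∘ σ)‖ := by
          rcases Int.units_eq_one_or (Equiv.Perm.sign σ) with h | h <;> rw [h] <;> simp
        rw [h1]
        refine (f.le_opNorm _).trans (le_of_eq ?_)
        congr 1
        exact Equiv.prod_comp σ fun i => ‖v i‖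
      refine (Finset.sum_le_card_nsmul _ _ _ this).trans (le_of_eq ?_)
      rw [nsmul_eq_mul, Finset.card_univ]
      ring)

theorem alternatizationCLM_toContinuousMultilinearMap {k : ℕ} (f : E [⋀^Fin k]→L[ℝ] ℝ) :
    alternatizationCLM E k f.toContinuousMultilinearMap =
      (Fintype.card (Equiv.Perm (Fin k)) : ℝ) • f := by
  ext v
  have h : ∀ σ ∈ (Finset.univ : Finset (Equiv.Perm (Fin k))),
      Equiv.Perm.sign σ • f.toContinuousMultilinearMap (v ∘ σ) = f v := by
    intro σ _
    have := f.toAlternatingMap.map_perm v σ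
    change Equiv.Perm.sign σ • f (v ∘ σ) = f v
    change f (v ∘ σ) = Equiv.Perm.sign σ • f v at this
    rw [this, smul_smul, Int.units_mul_self, one_smul]
  change ContinuousMultilinearMap.alternatization _ v = _
  rw [ContinuousMultilinearMap.alternatization_apply_apply, Finset.sum_congr rfl h]
  simp

/-- For multilinear maps the joint smoothness is known. Alternatization divided by `k!` is a linear
left inverse of the inclusion of alternating into multilinear forms, and it carries the result back.
-/
theorem contDiff_compContinuousLinearMap {k : ℕ} {n : WithTop ℕ∞} :
    ContDiff ℝ n fun p : (F [⋀^Fin k]→L[ℝ] ℝ) × (E →L[ℝ] F) =>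
      p.1.compContinuousLinearMap p.2 := by
  have h1 : ContDiff ℝ n fun p : (F [⋀^Fin k]→L[ℝ] ℝ) × (E →L[ℝ] F) =>
      (p.1.compContinuousLinearMap p.2).toContinuousMultilinearMap := by
    have h2 : ContDiff ℝ n fun p : (F [⋀^Fin k]→L[ℝ] ℝ) × (E →L[ℝ] F) =>
        (ContinuousMultilinearMap.compContinuousLinearMapContinuousMultilinear ℝ
          (fun _ : Fin k => E) (fun _ : Fin k => F) ℝ (fun _ => p.2))
          (ContinuousAlternatingMap.toContinuousMultilinearMapCLM ℝ p.1) := by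
      refine ContDiff.clm_apply ?_ ?_
      · exact (ContinuousMultilinearMap.contDiff _).comp (contDiff_pi.2 fun _ => contDiff_snd)
      · exact (ContinuousLinearMap.contDiff _).comp contDiff_fst
    exact h2
  have h3 := ((Fintype.card (Equiv.Perm (Fin k)) : ℝ)⁻¹ • alternatizationCLM E k).contDiff (n := n)
    |>.comp h1
  convert h3 using 1
  ext1 p
  simp only [Function.comp_apply, _root_.smul_apply,
    alternatizationCLM_toContinuousMultilinearMap, smul_smul]
  rw [inv_mul_cancel₀ (by exact_mod_cast Fintype.card_ne_zero), one_smul]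

/-- The exterior product of a covector with a `k`-form, at a point. -/
def wedgeForm {k : ℕ} (a : E [⋀^Fin 1]→L[ℝ] ℝ) (b : E [⋀^Fin k]→L[ℝ] ℝ) :
    E [⋀^Fin (k + 1)]→L[ℝ] ℝ :=
  ContinuousAlternatingMap.alternatizeUncurryFin
    (((ContinuousAlternatingMap.ofSubsingleton ℝ E ℝ (0 : Fin 1)).symm a).smulRight b)

theorem wedgeForm_apply {k : ℕ} (a : E [⋀^Fin 1]→L[ℝ] ℝ) (b : E [⋀^Fin k]→L[ℝ] ℝ)
    (v : Fin (k + 1) → E) :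
    wedgeForm a b v = ∑ i : Fin (k + 1), (-1) ^ (i : ℕ) * (a (fun _ => v i) * b (i.removeNth v)) := by
  rw [wedgeForm, ContinuousAlternatingMap.alternatizeUncurryFin_apply]
  refine Finset.sum_congr rfl fun i _ => ?_
  simp

theorem wedgeForm_comp {k : ℕ} (a : F [⋀^Fin 1]→L[ℝ] ℝ) (b : F [⋀^Fin k]→L[ℝ] ℝ) (g : E →L[ℝ] F) :
    (wedgeForm a b).compContinuousLinearMap g =
      wedgeForm (a.compContinuousLinearMap g) (b.compContinuousLinearMap g) := by
  ext v
  simp only [ContinuousAlternatingMap.compContinuousLinearMap_apply, wedgeForm_apply]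
  rfl

theorem norm_wedgeForm_le {k : ℕ} (a : E [⋀^Fin 1]→L[ℝ] ℝ) (b : E [⋀^Fin k]→L[ℝ] ℝ) :
    ‖wedgeForm a b‖ ≤ (k + 1) * ‖a‖ * ‖b‖ := by
  refine ContinuousAlternatingMap.opNorm_le_bound _ (by positivity) fun v => ?_
  rw [wedgeForm_apply]
  refine (norm_sum_le _ _).trans ?_
  have : ∀ i ∈ (Finset.univ : Finset (Fin (k + 1))),
      ‖(-1) ^ (i : ℕ) * (a (fun _ => v i) * b (i.removeNth v))‖ ≤
        ‖a‖ * ‖b‖ * ∏ i, ‖v i‖ := by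
    intro i _
    rw [norm_mul, norm_mul, norm_pow, norm_neg, norm_one, one_pow, one_mul,
      Fin.prod_univ_succAbove _ i]
    have h1 := a.le_opNorm fun _ => v i
    have h2 := b.le_opNorm (i.removeNth v)
    simp only [Fin.prod_univ_one] at h1
    calc _ ≤ (‖a‖ * ‖v i‖) * (‖b‖ * ∏ j, ‖i.removeNth v j‖) := by gcongr
      _ = _ := by simp only [Fin.removeNth]; ring
  refine (Finset.sum_le_card_nsmul _ _ _ this).trans (le_of_eq ?_)
  rw [nsmul_eq_mul, Finset.card_univ, Fintype.card_fin]
  push_cast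
  ring

/-- The exterior product with covectors as a continuous bilinear map. -/
def wedgeCLM (E : Type*) [NormedAddCommGroup E] [NormedSpace ℝ E] (k : ℕ) :
    (E [⋀^Fin 1]→L[ℝ] ℝ) →L[ℝ] (E [⋀^Fin k]→L[ℝ] ℝ) →L[ℝ] E [⋀^Fin (k + 1)]→L[ℝ] ℝ :=
  LinearMap.mkContinuous₂
    (LinearMap.mk₂ ℝ wedgeForm
      (by intros; ext v; simp [wedgeForm_apply, add_mul, mul_add, Finset.sum_add_distrib])
      (by intros; ext v; simp only [wedgeForm_apply, ContinuousAlternatingMap.smul_apply,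
            smul_eq_mul, Finset.mul_sum]; exact Finset.sum_congr rfl fun _ _ => by ring)
      (by intros; ext v; simp [wedgeForm_apply, mul_add, Finset.sum_add_distrib])
      (by intros; ext v; simp only [wedgeForm_apply, ContinuousAlternatingMap.smul_apply,
            smul_eq_mul, Finset.mul_sum]; exact Finset.sum_congr rfl fun _ _ => by ring))
    (k + 1) (fun a b => norm_wedgeForm_le a b)

theorem wedgeCLM_apply {k : ℕ} (a : E [⋀^Fin 1]→L[ℝ] ℝ) (b : E [⋀^Fin k]→L[ℝ] ℝ) :
    wedgeCLM E k a b = wedgeForm a b := rfl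

theorem alternatizeUncurryFin_one_apply (L : E →L[ℝ] E [⋀^Fin 1]→L[ℝ] ℝ) (v : Fin 2 → E) :
    ContinuousAlternatingMap.alternatizeUncurryFin L v =
      L (v 0) (fun _ => v 1) - L (v 1) (fun _ => v 0) := by
  rw [ContinuousAlternatingMap.alternatizeUncurryFin_apply, Fin.sum_univ_two]
  have h0 : (0 : Fin 2).removeNth v = fun _ => v 1 := by
    ext i; fin_cases i; rfl
  have h1 : (1 : Fin 2).removeNth v = fun _ => v 0 := by
    ext i; fin_cases i; rfl
  rw [h0, h1]
  simp [sub_eq_add_neg]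

theorem alternatizeUncurryFin_two_apply (L : E →L[ℝ] E [⋀^Fin 2]→L[ℝ] ℝ) (v : Fin 3 → E) :
    ContinuousAlternatingMap.alternatizeUncurryFin L v =
      L (v 0) ![v 1, v 2] - L (v 1) ![v 0, v 2] + L (v 2) ![v 0, v 1] := by
  rw [ContinuousAlternatingMap.alternatizeUncurryFin_apply, Fin.sum_univ_three]
  have h0 : (0 : Fin 3).removeNth v = ![v 1, v 2] := by
    ext i; fin_cases i <;> rfl
  have h1 : (1 : Fin 3).removeNth v = ![v 0, v 2] := by
    ext i; fin_cases i <;> rfl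
  have h2 : (2 : Fin 3).removeNth v = ![v 0, v 1] := by
    ext i; fin_cases i <;> rfl
  rw [h0, h1, h2]
  simp [sub_eq_add_neg]

theorem wedgeForm_one_apply (a b : E [⋀^Fin 1]→L[ℝ] ℝ) (v : Fin 2 → E) :
    wedgeForm a b v = a (fun _ => v 0) * b (fun _ => v 1) - a (fun _ => v 1) * b (fun _ => v 0) := by
  rw [wedgeForm, alternatizeUncurryFin_one_apply]
  rfl

theorem wedgeForm_two_apply (a : E [⋀^Fin 1]→L[ℝ] ℝ) (b : E [⋀^Fin 2]→L[ℝ] ℝ) (v : Fin 3 → E) :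
    wedgeForm a b v = a (fun _ => v 0) * b ![v 1, v 2] - a (fun _ => v 1) * b ![v 0, v 2] +
      a (fun _ => v 2) * b ![v 0, v 1] := by
  rw [wedgeForm, alternatizeUncurryFin_two_apply]
  rfl

/-- The Leibniz rule for the product of a function and a form. -/
theorem extDerivWithin_smul_form {k : ℕ} {s : Set E} {y : E} {f : E → ℝ}
    {θ : E → E [⋀^Fin k]→L[ℝ] ℝ} (hs : UniqueDiffWithinAt ℝ s y)
    (hf : DifferentiableWithinAt ℝ f s y) (hθ : DifferentiableWithinAt ℝ θ s y) :
    extDerivWithin (fun z => f z • θ z) s y =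
      wedgeForm (ofCovector (fderivWithin ℝ f s y)) (θ y) + f y • extDerivWithin θ s y := by
  ext v
  rw [extDerivWithin, fderivWithin_fun_smul hs hf hθ]
  simp only [ContinuousAlternatingMap.add_apply, ContinuousAlternatingMap.smul_apply,
    wedgeForm_apply, extDerivWithin, ContinuousAlternatingMap.alternatizeUncurryFin_apply,
    _root_.add_apply, _root_.smul_apply,
    ContinuousLinearMap.smulRight_apply, ofCovector, smul_add, Finset.sum_add_distrib]
  rw [add_comm]
  congr 1
  · refine Finset.sum_congr rfl fun i _ => ?_
    simp
  · simp only [Finset.smul_sum]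
    refine Finset.sum_congr rfl fun i _ => ?_
    rw [smul_comm]

/-- The Leibniz rule for the product of two `1`-forms. -/
theorem extDerivWithin_wedgeForm {s : Set E} {y : E} {a b : E → E [⋀^Fin 1]→L[ℝ] ℝ}
    (hs : UniqueDiffWithinAt ℝ s y)
    (ha : DifferentiableWithinAt ℝ a s y) (hb : DifferentiableWithinAt ℝ b s y) :
    extDerivWithin (fun z => wedgeForm (a z) (b z)) s y =
      wedgeForm (b y) (extDerivWithin a s y) - wedgeForm (a y) (extDerivWithin b s y) := by
  have h := ((wedgeCLM E 1).hasFDerivWithinAt_of_bilinear ha.hasFDerivWithinAt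
    hb.hasFDerivWithinAt).fderivWithin hs
  simp only [wedgeCLM_apply] at h
  ext v
  rw [extDerivWithin, h]
  simp only [alternatizeUncurryFin_two_apply, ContinuousAlternatingMap.sub_apply,
    wedgeForm_two_apply, extDerivWithin, alternatizeUncurryFin_one_apply, _root_.add_apply,
    ContinuousLinearMap.precompR_apply, ContinuousLinearMap.compL_apply,
    ContinuousLinearMap.comp_apply, ContinuousAlternatingMap.add_apply,
    ContinuousLinearMap.precompL_apply, wedgeCLM_apply, wedgeForm_one_apply, Matrix.cons_val_zero,
    Matrix.cons_val_one]
  ring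

end Alternating

theorem minSmoothness_two_le_infty : minSmoothness ℝ 2 ≤ ∞ := by
  simp only [minSmoothness_of_isRCLikeNormedField]
  exact WithTop.coe_le_coe.2 (le_top : (2 : ℕ∞) ≤ ⊤)

/-! ### Coordinate expressions, pullbacks to vector spaces and the exterior derivative. -/

section Pull

variable {E H Q : Type*} [NormedAddCommGroup E] [NormedSpace ℝ E] [TopologicalSpace H]
  {E₁ : Type*} [NormedAddCommGroup E₁] [NormedSpace ℝ E₁]
  (I : ModelWithCorners ℝ E H) [TopologicalSpace Q] [ChartedSpace H Q]

/-- The pullback of a form on `Q` by a map `f` that is differentiable on a subset `s` of a normed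
space. -/
def pullWithin {k : ℕ} (s : Set E₁) (f : E₁ → Q) (η : Form E Q k) :
    E₁ → E₁ [⋀^Fin k]→L[ℝ] ℝ := fun t =>
  (η (f t)).compContinuousLinearMap (mfderivWithin 𝓘(ℝ, E₁) I f s t : E₁ →L[ℝ] E)

variable {I}

theorem inChart_apply_extChartAt {k : ℕ} (η : Form E Q k) (x₀ : Q) {x : Q}
    (hx : x ∈ (extChartAt I x₀).source) :
    inChart I η x₀ (extChartAt I x₀ x) = (η x).compContinuousLinearMap
      (mfderivWithin 𝓘(ℝ, E) I (extChartAt I x₀).symm (range I) (extChartAt I x₀ x) : E →L[ℝ] E) := by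
  simp only [inChart, (extChartAt I x₀).left_inv hx]
  rfl

theorem IsSmoothForm.contDiffWithinAt {k : ℕ} {η : Form E Q k} (hη : IsSmoothForm I η)
    (x₀ : Q) {y : E} (hy : y ∈ (extChartAt I x₀).target) :
    ContDiffWithinAt ℝ ∞ (inChart I η x₀) (range I) y :=
  ((hη x₀) y hy).mono_of_mem_nhdsWithin (extChartAt_target_mem_nhdsWithin_of_mem hy)

theorem extChartAt_mem_range (x₀ x : Q) : extChartAt I x₀ x ∈ range I := by
  simp [extChartAt]

theorem isSmoothForm_of_contDiffWithinAt {k : ℕ} {η : Form E Q k}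
    (h : ∀ x₀ : Q, ∀ y ∈ (extChartAt I x₀).target,
      ContDiffWithinAt ℝ ∞ (inChart I η x₀) (range I) y) : IsSmoothForm I η :=
  fun x₀ y hy => (h x₀ y hy).mono (extChartAt_target_subset_range x₀)

variable [IsManifold I ∞ Q]

theorem isManifold_one (I : ModelWithCorners ℝ E H) [IsManifold I ∞ Q] : IsManifold I 1 Q :=
  IsManifold.of_le (n := ∞) (by exact_mod_cast le_top)

theorem eq_inChart_comp {k : ℕ} (η : Form E Q k) (x₀ : Q) {x : Q}
    (hx : x ∈ (extChartAt I x₀).source) :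
    η x = (inChart I η x₀ (extChartAt I x₀ x)).compContinuousLinearMap
      (mfderiv I 𝓘(ℝ, E) (extChartAt I x₀) x : E →L[ℝ] E) := by
  have : IsManifold I 1 Q := isManifold_one I
  rw [inChart_apply_extChartAt η x₀ hx]
  have h := mfderivWithin_extChartAt_symm_comp_mfderiv_extChartAt' (I := I) hx
  ext v
  refine congrArg (η x) ?_
  ext i
  have := DFunLike.congr_fun h (v i)
  exact this.symm

/-- The derivative of the preferred chart at its own base point is the identity of `E`, by the way
the tangent space is identified with `E`. -/
theorem inChart_self {k : ℕ} (η : Form E Q k) (x : Q) :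
    inChart I η x (extChartAt I x x) = η x := by
  have : IsManifold I 1 Q := isManifold_one I
  conv_rhs => rw [eq_inChart_comp (I := I) η x (mem_extChartAt_source x)]
  rw [mfderiv_extChartAt_self]
  ext v
  rfl

theorem extD_eq {k : ℕ} (η : Form E Q k) (x : Q) :
    extD I η x = extDerivWithin (inChart I η x) (range I) (extChartAt I x x) := by
  have : IsManifold I 1 Q := isManifold_one I
  rw [extD, mfderiv_extChartAt_self]
  ext v
  rfl

theorem pullWithin_eq_inChart {k : ℕ} {s : Set E₁} {f : E₁ → Q} (η : Form E Q k) (x₀ : Q) {t : E₁}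
    (hf : MDifferentiableWithinAt 𝓘(ℝ, E₁) I f s t) (hs : UniqueDiffWithinAt ℝ s t)
    (ht : f t ∈ (extChartAt I x₀).source) :
    pullWithin I s f η t = (inChart I η x₀ (extChartAt I x₀ (f t))).compContinuousLinearMap
      (fderivWithin ℝ (extChartAt I x₀ ∘ f) s t) := by
  have : IsManifold I 1 Q := isManifold_one I
  have h1 : mfderivWithin 𝓘(ℝ, E₁) 𝓘(ℝ, E) (extChartAt I x₀ ∘ f) s t =
      (mfderiv I 𝓘(ℝ, E) (extChartAt I x₀) (f t)).comp (mfderivWithin 𝓘(ℝ, E₁) I f s t) := by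
    apply mfderiv_comp_mfderivWithin
    · exact mdifferentiableAt_extChartAt (by simpa using ht)
    · exact hf
    · exact hs.uniqueMDiffWithinAt
  rw [mfderivWithin_eq_fderivWithin] at h1
  rw [h1, pullWithin]
  nth_rewrite 1 [eq_inChart_comp (I := I) η x₀ ht]
  ext v
  rfl

theorem contDiffWithinAt_extChartAt_comp {s : Set E₁} {f : E₁ → Q} {t : E₁} (x₀ : Q)
    (hf : ContMDiffWithinAt 𝓘(ℝ, E₁) I ∞ f s t) (ht : f t ∈ (extChartAt I x₀).source) :
    ContDiffWithinAt ℝ ∞ (extChartAt I x₀ ∘ f) s t := by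
  have h1 : ContMDiffWithinAt 𝓘(ℝ, E₁) 𝓘(ℝ, E) ∞ (extChartAt I x₀ ∘ f) s t :=
    (contMDiffAt_extChartAt' (by simpa using ht)).comp_contMDiffWithinAt t hf
  exact h1.contDiffWithinAt

/-- The chart is frozen at `f t` while `u` varies. This turns the pullback near `t` into an
expression between vector spaces, to which ordinary calculus applies. -/
theorem pullWithin_eventuallyEq {k : ℕ} (η : Form E Q k)
    {s : Set E₁} {f : E₁ → Q} (hf : ContMDiffOn 𝓘(ℝ, E₁) I ∞ f s) (hs : UniqueDiffOn ℝ s)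
    {t : E₁} (ht : t ∈ s) :
    pullWithin I s f η =ᶠ[𝓝[s] t] fun u =>
      (inChart I η (f t) ((extChartAt I (f t) ∘ f) u)).compContinuousLinearMap
        (fderivWithin ℝ (extChartAt I (f t) ∘ f) s u) := by
  have hsrc : ∀ᶠ u in 𝓝[s] t, f u ∈ (extChartAt I (f t)).source :=
    (hf t ht).continuousWithinAt (extChartAt_source_mem_nhds (I := I) (f t))
  filter_upwards [hsrc, self_mem_nhdsWithin] with u hu hus
  exact pullWithin_eq_inChart η _ ((hf u hus).mdifferentiableWithinAt (by simp)) (hs u hus) hu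

theorem IsSmoothForm.contDiffOn_pullWithin {k : ℕ} {η : Form E Q k} (hη : IsSmoothForm I η)
    {s : Set E₁} {f : E₁ → Q} (hf : ContMDiffOn 𝓘(ℝ, E₁) I ∞ f s) (hs : UniqueDiffOn ℝ s) :
    ContDiffOn ℝ ∞ (pullWithin I s f η) s := by
  intro t ht
  have hgt := contDiffWithinAt_extChartAt_comp (f t) (hf t ht) (mem_extChartAt_source (f t))
  have hev := pullWithin_eventuallyEq η hf hs ht
  refine ContDiffWithinAt.congr_of_eventuallyEq ?_ hev (hev.self_of_nhdsWithin ht)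
  have h2 : ContDiffWithinAt ℝ ∞ (fderivWithin ℝ (extChartAt I (f t) ∘ f) s) s t :=
    hgt.fderivWithin_right hs (by simp) ht
  have h3 : ContDiffWithinAt ℝ ∞ (inChart I η (f t) ∘ (extChartAt I (f t) ∘ f)) s t :=
    (hη.contDiffWithinAt (f t) (mem_extChartAt_target (I := I) (f t))).comp t hgt
      fun u _ => extChartAt_mem_range _ _
  exact contDiff_compContinuousLinearMap.contDiffAt.comp_contDiffWithinAt t (h3.prodMk h2)

/-- Naturality of `d` rests on the symmetry of the second derivative of the map; `hti` secures it at
points of `s` that are not interior. -/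
theorem IsSmoothForm.extDerivWithin_pullWithin {k : ℕ} {η : Form E Q k} (hη : IsSmoothForm I η)
    {s : Set E₁} {f : E₁ → Q} (hf : ContMDiffOn 𝓘(ℝ, E₁) I ∞ f s) (hs : UniqueDiffOn ℝ s)
    {t : E₁} (ht : t ∈ s) (hti : t ∈ closure (interior s)) :
    extDerivWithin (pullWithin I s f η) s t = pullWithin I s f (extD I η) t := by
  have hgt := contDiffWithinAt_extChartAt_comp (f t) (hf t ht) (mem_extChartAt_source (f t))
  have hev := pullWithin_eventuallyEq η hf hs ht
  rw [hev.extDerivWithin_eq_of_mem ht, extDerivWithin_pullback (t := range I) (r := ∞)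
    (f := extChartAt I (f t) ∘ f) ((hη.contDiffWithinAt (f t) (mem_extChartAt_target (I := I) (f t))).differentiableWithinAt
      (by simp)) hgt minSmoothness_two_le_infty hs hti ht
    (fun u _ => extChartAt_mem_range _ _)]
  rw [pullWithin_eq_inChart (extD I η) (f t) ((hf t ht).mdifferentiableWithinAt (by simp)) (hs t ht)
    (mem_extChartAt_source (f t)), inChart_self, extD_eq]
  rfl

/-- Derivatives within `range I` and within the target agree, as the target has unique derivatives.
Coordinate expressions thereby become pullbacks, and results on pullbacks apply to charts. -/
theorem inChart_eq_pullWithin {k : ℕ} (η : Form E Q k) (x₀ : Q) {y : E}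
    (hy : y ∈ (extChartAt I x₀).target) :
    inChart I η x₀ y = pullWithin I (extChartAt I x₀).target (extChartAt I x₀).symm η y := by
  have : IsManifold I 1 Q := isManifold_one I
  rw [inChart, pullWithin, mfderivWithin_subset
    (extChartAt_target_subset_range x₀)
    ((uniqueDiffOn_extChartAt_target x₀) y hy).uniqueMDiffWithinAt
    ((mdifferentiableWithinAt_extChartAt_symm hy))]

theorem extDerivWithin_of_subset {k : ℕ} {θ : E₁ → E₁ [⋀^Fin k]→L[ℝ] ℝ} {s t : Set E₁} {y : E₁}
    (st : s ⊆ t) (hs : UniqueDiffWithinAt ℝ s y) (h : DifferentiableWithinAt ℝ θ t y) :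
    extDerivWithin θ s y = extDerivWithin θ t y := by
  rw [extDerivWithin, extDerivWithin, fderivWithin_subset st hs h]

theorem mem_closure_interior_target {x₀ : Q} {y : E} (hy : y ∈ (extChartAt I x₀).target) :
    y ∈ closure (interior (extChartAt I x₀).target) :=
  extChartAt_target_subset_closure_interior hy

/-- `extD` uses a different chart at each point; naturality under the inverse of a fixed chart shows
that every chart computes it. Smoothness of `extD I η` and `d ∘ d = 0` then reduce to one chart. -/
theorem IsSmoothForm.inChart_extD {k : ℕ} {η : Form E Q k} (hη : IsSmoothForm I η) (x₀ : Q) {y : E}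
    (hy : y ∈ (extChartAt I x₀).target) :
    inChart I (extD I η) x₀ y = extDerivWithin (inChart I η x₀) (range I) y := by
  have hU := uniqueDiffOn_extChartAt_target (I := I) x₀
  rw [inChart_eq_pullWithin _ _ hy, ← hη.extDerivWithin_pullWithin (contMDiffOn_extChartAt_symm x₀)
    hU hy (mem_closure_interior_target hy),
    ← extDerivWithin_of_subset (extChartAt_target_subset_range x₀) (hU y hy)
      ((hη.contDiffWithinAt x₀ hy).differentiableWithinAt (by simp))]
  exact extDerivWithin_congr' (fun z hz => (inChart_eq_pullWithin η x₀ hz).symm) hy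

theorem ContDiffWithinAt.extDerivWithin_form {k : ℕ} {θ : E₁ → E₁ [⋀^Fin k]→L[ℝ] ℝ} {s : Set E₁}
    {y : E₁} (h : ContDiffWithinAt ℝ ∞ θ s y) (hs : UniqueDiffOn ℝ s) (hy : y ∈ s) :
    ContDiffWithinAt ℝ ∞ (extDerivWithin θ s) s y :=
  (ContinuousAlternatingMap.alternatizeUncurryFinCLM ℝ E₁ ℝ).contDiff.contDiffAt
    |>.comp_contDiffWithinAt y (h.fderivWithin_right hs (by simp) hy)

theorem IsSmoothForm.extD {k : ℕ} {η : Form E Q k} (hη : IsSmoothForm I η) :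
    IsSmoothForm I (extD I η) := by
  refine isSmoothForm_of_contDiffWithinAt fun x₀ y hy => ?_
  refine (ContDiffWithinAt.extDerivWithin_form (hη.contDiffWithinAt x₀ hy) I.uniqueDiffOn
    (extChartAt_target_subset_range x₀ hy)).congr_of_eventuallyEq ?_ (hη.inChart_extD x₀ hy)
  filter_upwards [extChartAt_target_mem_nhdsWithin_of_mem hy] with z hz
  exact hη.inChart_extD x₀ hz

theorem IsSmoothForm.extD_extD {k : ℕ} {η : Form E Q k} (hη : IsSmoothForm I η) :
    Helicity.extD I (Helicity.extD I η) = 0 := by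
  ext1 x
  have hx := mem_extChartAt_target (I := I) x
  have hr := extChartAt_target_subset_range (I := I) x hx
  rw [extD_eq]
  have : inChart I (Helicity.extD I η) x =ᶠ[𝓝[range I] (extChartAt I x x)]
      extDerivWithin (inChart I η x) (range I) := by
    filter_upwards [extChartAt_target_mem_nhdsWithin_of_mem hx] with z hz
    exact hη.inChart_extD x hz
  rw [this.extDerivWithin_eq_of_mem hr]
  exact extDerivWithin_extDerivWithin_apply (hη.contDiffWithinAt x hx) minSmoothness_two_le_infty I.uniqueDiffOn
    (I.range_subset_closure_interior hr) hr

end Pull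

/-! ### Linearity, products and Leibniz rules for forms on a manifold. -/

section Algebra

variable {E H Q : Type*} [NormedAddCommGroup E] [NormedSpace ℝ E] [TopologicalSpace H]
  {I : ModelWithCorners ℝ E H} [TopologicalSpace Q] [ChartedSpace H Q]

theorem inChart_add {k : ℕ} (η θ : Form E Q k) (x₀ : Q) :
    inChart I (η + θ) x₀ = inChart I η x₀ + inChart I θ x₀ := rfl

theorem inChart_sub {k : ℕ} (η θ : Form E Q k) (x₀ : Q) :
    inChart I (η - θ) x₀ = inChart I η x₀ - inChart I θ x₀ := rfl

theorem inChart_smul {k : ℕ} (c : ℝ) (η : Form E Q k) (x₀ : Q) :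
    inChart I (c • η) x₀ = c • inChart I η x₀ := rfl

theorem inChart_fun_smul {k : ℕ} (f : Q → ℝ) (η : Form E Q k) (x₀ : Q) :
    inChart I (fun x => f x • η x) x₀ =
      fun y => f ((extChartAt I x₀).symm y) • inChart I η x₀ y := rfl

theorem inChart_wedgeOne {k : ℕ} (α : Form E Q 1) (η : Form E Q k) (x₀ : Q) :
    inChart I (wedgeOne α η) x₀ = fun y => wedgeForm (inChart I α x₀ y) (inChart I η x₀ y) := by
  ext1 y
  exact wedgeForm_comp _ _ _

theorem IsSmoothForm.add {k : ℕ} {η θ : Form E Q k} (hη : IsSmoothForm I η)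
    (hθ : IsSmoothForm I θ) : IsSmoothForm I (η + θ) :=
  fun x₀ => (hη x₀).add (hθ x₀)

theorem IsSmoothForm.sub {k : ℕ} {η θ : Form E Q k} (hη : IsSmoothForm I η)
    (hθ : IsSmoothForm I θ) : IsSmoothForm I (η - θ) :=
  fun x₀ => (hη x₀).sub (hθ x₀)

theorem IsSmoothForm.const_smul {k : ℕ} {η : Form E Q k} (c : ℝ) (hη : IsSmoothForm I η) :
    IsSmoothForm I (c • η) :=
  fun x₀ => (hη x₀).const_smul c

theorem isSmoothForm_zero {k : ℕ} : IsSmoothForm I (0 : Form E Q k) :=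
  fun _ => contDiffOn_const (c := 0)

theorem IsSmoothForm.wedgeOne {k : ℕ} {α : Form E Q 1} {η : Form E Q k} (hα : IsSmoothForm I α)
    (hη : IsSmoothForm I η) : IsSmoothForm I (wedgeOne α η) := by
  intro x₀
  rw [inChart_wedgeOne]
  intro y hy
  exact (wedgeCLM E k).isBoundedBilinearMap.contDiff.contDiffAt.comp_contDiffWithinAt y
    (((hα x₀) y hy).prodMk ((hη x₀) y hy))

theorem wedgeOne_add_left {k : ℕ} (α β : Form E Q 1) (η : Form E Q k) :
    wedgeOne (α + β) η = wedgeOne α η + wedgeOne β η := by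
  ext1 x
  exact (wedgeCLM E k).map_add₂ (α x) (β x) (η x)

theorem wedgeOne_sub_left {k : ℕ} (α β : Form E Q 1) (η : Form E Q k) :
    wedgeOne (α - β) η = wedgeOne α η - wedgeOne β η := by
  ext1 x
  exact (wedgeCLM E k).map_sub₂ (α x) (β x) (η x)

theorem wedgeOne_smul_left {k : ℕ} (c : ℝ) (α : Form E Q 1) (η : Form E Q k) :
    wedgeOne (c • α) η = c • wedgeOne α η := by
  ext1 x
  exact (wedgeCLM E k).map_smul₂ c (α x) (η x)

theorem wedgeOne_add_right {k : ℕ} (α : Form E Q 1) (η θ : Form E Q k) :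
    wedgeOne α (η + θ) = wedgeOne α η + wedgeOne α θ := by
  ext1 x
  exact (wedgeCLM E k (α x)).map_add (η x) (θ x)

theorem wedgeOne_sub_right {k : ℕ} (α : Form E Q 1) (η θ : Form E Q k) :
    wedgeOne α (η - θ) = wedgeOne α η - wedgeOne α θ := by
  ext1 x
  exact (wedgeCLM E k (α x)).map_sub (η x) (θ x)

theorem wedgeOne_smul_right {k : ℕ} (c : ℝ) (α : Form E Q 1) (η : Form E Q k) :
    wedgeOne α (c • η) = c • wedgeOne α η := by
  ext1 x
  exact (wedgeCLM E k (α x)).map_smul c (η x)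

variable [IsManifold I ∞ Q]

theorem contDiffWithinAt_comp_symm {F : Type*} [NormedAddCommGroup F] [NormedSpace ℝ F]
    {f : Q → F} (x₀ : Q) {y : E} (hy : y ∈ (extChartAt I x₀).target)
    (hf : ContMDiffAt I 𝓘(ℝ, F) ∞ f ((extChartAt I x₀).symm y)) :
    ContDiffWithinAt ℝ ∞ (f ∘ (extChartAt I x₀).symm) (range I) y := by
  have h1 : ContMDiffWithinAt 𝓘(ℝ, E) I ∞ (extChartAt I x₀).symm (range I) y :=
    (contMDiffWithinAt_extChartAt_symm_range x₀ hy)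
  have h2 : ContMDiffWithinAt 𝓘(ℝ, E) 𝓘(ℝ, F) ∞ (f ∘ (extChartAt I x₀).symm) (range I) y :=
    hf.comp_contMDiffWithinAt y h1
  exact h2.contDiffWithinAt

theorem IsSmoothForm.fun_smul {k : ℕ} {η : Form E Q k} {f : Q → ℝ} (hf : ContMDiff I 𝓘(ℝ, ℝ) ∞ f)
    (hη : IsSmoothForm I η) : IsSmoothForm I (fun x => f x • η x) := by
  refine isSmoothForm_of_contDiffWithinAt fun x₀ y hy => ?_
  rw [inChart_fun_smul]
  exact (contDiffWithinAt_comp_symm x₀ hy hf.contMDiffAt).smul (hη.contDiffWithinAt x₀ hy)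

theorem inChart_differential {f : Q → ℝ} (x₀ : Q) {y : E} (hy : y ∈ (extChartAt I x₀).target)
    (hf : MDifferentiableAt I 𝓘(ℝ, ℝ) f ((extChartAt I x₀).symm y)) :
    inChart I (differential I f) x₀ y =
      ofCovector (fderivWithin ℝ (f ∘ (extChartAt I x₀).symm) (range I) y) := by
  have : IsManifold I 1 Q := isManifold_one I
  have h1 : mfderivWithin 𝓘(ℝ, E) 𝓘(ℝ, ℝ) (f ∘ (extChartAt I x₀).symm) (range I) y = _ :=
    mfderiv_comp_mfderivWithin y hf (mdifferentiableWithinAt_extChartAt_symm hy)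
      (I.uniqueDiffOn y (extChartAt_target_subset_range x₀ hy)).uniqueMDiffWithinAt
  rw [mfderivWithin_eq_fderivWithin] at h1
  rw [h1]
  ext v
  rfl

theorem isSmoothForm_differential {f : Q → ℝ} (hf : ContMDiff I 𝓘(ℝ, ℝ) ∞ f) :
    IsSmoothForm I (differential I f) := by
  refine isSmoothForm_of_contDiffWithinAt fun x₀ y hy => ?_
  have h := (contDiffWithinAt_comp_symm (I := I) x₀ hy hf.contMDiffAt).fderivWithin_right
    I.uniqueDiffOn (m := ∞) (by simp) (extChartAt_target_subset_range x₀ hy)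
  have h2 : ContDiffWithinAt ℝ ∞ (fun z => ofCovector
      (fderivWithin ℝ (f ∘ (extChartAt I x₀).symm) (range I) z)) (range I) y :=
    (ContinuousAlternatingMap.ofSubsingletonLIE (0 : Fin 1) :
      (E →L[ℝ] ℝ) ≃ₗᵢ[ℝ] (E [⋀^Fin 1]→L[ℝ] ℝ)).contDiff.contDiffAt
      |>.comp_contDiffWithinAt y h
  refine h2.congr_of_eventuallyEq ?_ ?_
  · filter_upwards [extChartAt_target_mem_nhdsWithin_of_mem hy] with z hz
    exact inChart_differential x₀ hz (hf.mdifferentiable (by simp) _)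
  · exact inChart_differential x₀ hy (hf.mdifferentiable (by simp) _)

/-- In coordinates `df` is the exterior derivative of `f` seen as a `0`-form, so this is again `d ∘
d = 0`. -/
theorem extD_differential {f : Q → ℝ} (hf : ContMDiff I 𝓘(ℝ, ℝ) ∞ f) :
    extD I (differential I f) = 0 := by
  ext1 x
  have hx := mem_extChartAt_target (I := I) x
  have hr := extChartAt_target_subset_range (I := I) x hx
  rw [extD_eq]
  have : inChart I (differential I f) x =ᶠ[𝓝[range I] (extChartAt I x x)]
      extDerivWithin (fun z => ContinuousAlternatingMap.constOfIsEmpty ℝ E (Fin 0)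
        ((f ∘ (extChartAt I x).symm) z)) (range I) := by
    filter_upwards [extChartAt_target_mem_nhdsWithin_of_mem hx] with z hz
    rw [inChart_differential x hz (hf.mdifferentiable (by simp) _),
      extDerivWithin_constOfIsEmpty _ (I.uniqueDiffOn z (extChartAt_target_subset_range x hz))]
    rfl
  rw [this.extDerivWithin_eq_of_mem hr]
  refine extDerivWithin_extDerivWithin_apply (r := ∞) ?_ minSmoothness_two_le_infty I.uniqueDiffOn
    (I.range_subset_closure_interior hr) hr
  exact (ContinuousAlternatingMap.constOfIsEmptyLIE ℝ E ℝ (Fin 0)).contDiff.contDiffAt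
    |>.comp_contDiffWithinAt _ (contDiffWithinAt_comp_symm x hx hf.contMDiffAt)

theorem extD_add {k : ℕ} {η θ : Form E Q k} (hη : IsSmoothForm I η) (hθ : IsSmoothForm I θ) :
    extD I (η + θ) = extD I η + extD I θ := by
  ext1 x
  have hx := mem_extChartAt_target (I := I) x
  rw [Pi.add_apply, extD_eq, extD_eq, extD_eq, inChart_add]
  exact extDerivWithin_add (I.uniqueDiffOn _ (extChartAt_target_subset_range (I := I) x hx))
    ((hη.contDiffWithinAt x hx).differentiableWithinAt (by simp))
    ((hθ.contDiffWithinAt x hx).differentiableWithinAt (by simp))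

theorem extD_smul {k : ℕ} (c : ℝ) (η : Form E Q k) :
    extD I (c • η) = c • extD I η := by
  ext1 x
  have hx := mem_extChartAt_target (I := I) x
  rw [Pi.smul_apply, extD_eq, extD_eq, inChart_smul]
  exact extDerivWithin_smul c _ (I.uniqueDiffOn _ (extChartAt_target_subset_range (I := I) x hx))

theorem extD_sub {k : ℕ} {η θ : Form E Q k} (hη : IsSmoothForm I η) (hθ : IsSmoothForm I θ) :
    extD I (η - θ) = extD I η - extD I θ := by
  ext1 x
  have hx := mem_extChartAt_target (I := I) x
  rw [Pi.sub_apply, extD_eq, extD_eq, extD_eq, inChart_sub, extDerivWithin,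
    fderivWithin_sub (I.uniqueDiffOn _ (extChartAt_target_subset_range (I := I) x hx))
      ((hη.contDiffWithinAt x hx).differentiableWithinAt (by simp))
      ((hθ.contDiffWithinAt x hx).differentiableWithinAt (by simp))]
  exact map_sub (ContinuousAlternatingMap.alternatizeUncurryFinCLM ℝ E ℝ) _ _

theorem extD_fun_smul {k : ℕ} {η : Form E Q k} {f : Q → ℝ} (hf : ContMDiff I 𝓘(ℝ, ℝ) ∞ f)
    (hη : IsSmoothForm I η) :
    extD I (fun x => f x • η x) =
      wedgeOne (differential I f) η + fun x => f x • extD I η x := by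
  ext1 x
  have hx := mem_extChartAt_target (I := I) x
  have hr := extChartAt_target_subset_range (I := I) x hx
  rw [Pi.add_apply, extD_eq, extD_eq, inChart_fun_smul]
  have h := extDerivWithin_smul_form (I.uniqueDiffOn _ hr)
    ((contDiffWithinAt_comp_symm (I := I) x hx hf.contMDiffAt).differentiableWithinAt (by simp))
    ((hη.contDiffWithinAt x hx).differentiableWithinAt (by simp))
  refine h.trans ?_
  rw [← inChart_differential x hx (hf.mdifferentiable (by simp) _), inChart_self, inChart_self]
  simp only [Function.comp_apply, extChartAt_to_inv]
  rfl

/-- The first term is `dα ∧ β`, written with the `1`-form in front; moving it past the `2`-form `dα`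
costs no sign. -/
theorem extD_wedgeOne {α β : Form E Q 1} (hα : IsSmoothForm I α) (hβ : IsSmoothForm I β) :
    extD I (wedgeOne α β) = wedgeOne β (extD I α) - wedgeOne α (extD I β) := by
  ext1 x
  have hx := mem_extChartAt_target (I := I) x
  have hr := extChartAt_target_subset_range (I := I) x hx
  rw [Pi.sub_apply, extD_eq, inChart_wedgeOne]
  have h := extDerivWithin_wedgeForm (I.uniqueDiffOn _ hr)
    ((hα.contDiffWithinAt x hx).differentiableWithinAt (by simp))
    ((hβ.contDiffWithinAt x hx).differentiableWithinAt (by simp))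
  refine h.trans ?_
  rw [inChart_self, inChart_self, ← extD_eq, ← extD_eq]
  rfl

end Algebra

/-! ### Functoriality of pullbacks and smooth families of forms. -/

section Pullback

variable {E H Q : Type*} [NormedAddCommGroup E] [NormedSpace ℝ E] [TopologicalSpace H]
  {E' H' Q' : Type*} [NormedAddCommGroup E'] [NormedSpace ℝ E'] [TopologicalSpace H']
  {E₁ E₂ : Type*} [NormedAddCommGroup E₁] [NormedSpace ℝ E₁]
  [NormedAddCommGroup E₂] [NormedSpace ℝ E₂]
  {I : ModelWithCorners ℝ E H} [TopologicalSpace Q] [ChartedSpace H Q]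
  {I' : ModelWithCorners ℝ E' H'} [TopologicalSpace Q'] [ChartedSpace H' Q']

theorem pullWithin_comp {k : ℕ} {s : Set E₁} {f : E₁ → Q} {s₂ : Set E₂} {g : E₂ → E₁} {t : E₂}
    (η : Form E Q k) (hf : MDifferentiableWithinAt 𝓘(ℝ, E₁) I f s (g t))
    (hg : DifferentiableWithinAt ℝ g s₂ t) (hgs : MapsTo g s₂ s) (hu : UniqueDiffWithinAt ℝ s₂ t) :
    pullWithin I s₂ (f ∘ g) η t =
      (pullWithin I s f η (g t)).compContinuousLinearMap (fderivWithin ℝ g s₂ t) := by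
  have h := mfderivWithin_comp t hf hg.mdifferentiableWithinAt hgs hu.uniqueMDiffWithinAt
  rw [pullWithin, h, mfderivWithin_eq_fderivWithin]
  ext v
  rfl

theorem pullWithin_pullback {k : ℕ} {s : Set E₁} {g : E₁ → Q} {f : Q → Q'} {t : E₁}
    (η : Form E' Q' k) (hf : MDifferentiableAt I I' f (g t))
    (hg : MDifferentiableWithinAt 𝓘(ℝ, E₁) I g s t) (hu : UniqueDiffWithinAt ℝ s t) :
    pullWithin I s g (pullback I I' f η) t = pullWithin I' s (f ∘ g) η t := by
  have h := mfderiv_comp_mfderivWithin t hf hg hu.uniqueMDiffWithinAt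
  rw [pullWithin, pullWithin, h]
  ext v
  rfl

theorem pullback_pullback {E'' H'' Q'' : Type*} [NormedAddCommGroup E''] [NormedSpace ℝ E'']
    [TopologicalSpace H''] {I'' : ModelWithCorners ℝ E'' H''} [TopologicalSpace Q'']
    [ChartedSpace H'' Q''] {k : ℕ} {f : Q → Q'} {g : Q' → Q''} (η : Form E'' Q'' k)
    (hf : MDifferentiable I I' f) (hg : MDifferentiable I' I'' g) :
    pullback I I' f (pullback I' I'' g η) = pullback I I'' (g ∘ f) η := by
  ext1 x
  have h := mfderiv_comp x (hg (f x)) (hf x)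
  rw [pullback, pullback, pullback, h]
  ext v
  rfl

theorem pullback_id {k : ℕ} (η : Form E Q k) : pullback I I id η = η := by
  ext1 x
  rw [pullback, mfderiv_id]
  ext v
  rfl

theorem pullback_add {k : ℕ} (f : Q → Q') (η θ : Form E' Q' k) :
    pullback I I' f (η + θ) = pullback I I' f η + pullback I I' f θ := rfl

theorem pullback_smul {k : ℕ} (f : Q → Q') (c : ℝ) (η : Form E' Q' k) :
    pullback I I' f (c • η) = c • pullback I I' f η := rfl

theorem pullback_wedgeOne {k : ℕ} (f : Q → Q') (α : Form E' Q' 1) (η : Form E' Q' k) :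
    pullback I I' f (wedgeOne α η) = wedgeOne (pullback I I' f α) (pullback I I' f η) := by
  ext1 x
  exact wedgeForm_comp _ _ _

variable [IsManifold I ∞ Q] [IsManifold I' ∞ Q']

theorem inChart_pullback {k : ℕ} {f : Q → Q'} (η : Form E' Q' k) (x₀ : Q) {y : E}
    (hy : y ∈ (extChartAt I x₀).target)
    (hf : MDifferentiableAt I I' f ((extChartAt I x₀).symm y)) :
    inChart I (pullback I I' f η) x₀ y =
      pullWithin I' (extChartAt I x₀).target (f ∘ (extChartAt I x₀).symm) η y := by
  have : IsManifold I 1 Q := isManifold_one I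
  rw [inChart_eq_pullWithin _ _ hy]
  exact pullWithin_pullback η hf
    ((mdifferentiableWithinAt_extChartAt_symm hy).mono (extChartAt_target_subset_range x₀))
    (uniqueDiffOn_extChartAt_target x₀ y hy)

theorem contMDiffOn_comp_extChartAt_symm {f : Q → Q'} (hf : ContMDiff I I' ∞ f) (x₀ : Q) :
    ContMDiffOn 𝓘(ℝ, E) I' ∞ (f ∘ (extChartAt I x₀).symm) (extChartAt I x₀).target :=
  hf.comp_contMDiffOn (contMDiffOn_extChartAt_symm x₀)

theorem IsSmoothForm.pullback {k : ℕ} {f : Q → Q'} {η : Form E' Q' k} (hη : IsSmoothForm I' η)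
    (hf : ContMDiff I I' ∞ f) : IsSmoothForm I (pullback I I' f η) := fun x₀ =>
  (hη.contDiffOn_pullWithin (contMDiffOn_comp_extChartAt_symm hf x₀)
    (uniqueDiffOn_extChartAt_target x₀)).congr fun _ hy =>
      inChart_pullback η x₀ hy (hf.mdifferentiable (by simp) _)

theorem IsSmoothForm.extD_pullback {k : ℕ} {f : Q → Q'} {η : Form E' Q' k}
    (hη : IsSmoothForm I' η) (hf : ContMDiff I I' ∞ f) :
    Helicity.extD I (Helicity.pullback I I' f η) =
      Helicity.pullback I I' f (Helicity.extD I' η) := by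
  ext1 x
  have hx := mem_extChartAt_target (I := I) x
  have hU := uniqueDiffOn_extChartAt_target (I := I) x
  rw [← inChart_self (I := I) (Helicity.extD I _), ← inChart_self (I := I) (Helicity.pullback I I' f _),
    inChart_pullback _ x hx (hf.mdifferentiable (by simp) _),
    ← hη.extDerivWithin_pullWithin (contMDiffOn_comp_extChartAt_symm hf x) hU hx
      (mem_closure_interior_target hx), (hη.pullback hf).inChart_extD x hx,
    ← extDerivWithin_of_subset (extChartAt_target_subset_range x) (hU _ hx)
      (((hη.pullback hf).contDiffWithinAt x hx).differentiableWithinAt (by simp))]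
  exact extDerivWithin_congr'
    (fun z hz => inChart_pullback η x hz (hf.mdifferentiable (by simp) _)) hx

/-- The pullbacks of a smooth form by a smooth family of maps form a smooth family. -/
theorem IsSmoothForm.isSmoothFamilyOn_pullback {k : ℕ} {φ : ℝ → Q → Q'} {η : Form E' Q' k}
    (hη : IsSmoothForm I' η) {a b : ℝ} (hab : a < b)
    (hφ : ContMDiffOn (𝓘(ℝ, ℝ).prod I) I' ∞ (fun p : ℝ × Q => φ p.1 p.2) (Icc a b ×ˢ univ)) :
    IsSmoothFamilyOn I (fun u => Helicity.pullback I I' (φ u) η) a b := by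
  intro x₀
  have hU : UniqueDiffOn ℝ (Icc a b ×ˢ (extChartAt I x₀).target) :=
    (uniqueDiffOn_Icc hab).prod (uniqueDiffOn_extChartAt_target x₀)
  -- The parameter becomes one more coordinate: the form is pulled back to `ℝ × E` in one go, and
  -- the member at time `u` is recovered by restriction to vectors tangent to `E`, through `inr`.
  set G : ℝ × E → Q' := fun p => φ p.1 ((extChartAt I x₀).symm p.2) with hGdef
  have hG : ContMDiffOn 𝓘(ℝ, ℝ × E) I' ∞ G (Icc a b ×ˢ (extChartAt I x₀).target) := by
    have h1 : ContMDiffOn 𝓘(ℝ, ℝ × E) (𝓘(ℝ, ℝ).prod I) ∞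
        (fun p : ℝ × E => (p.1, (extChartAt I x₀).symm p.2))
        (Icc a b ×ˢ (extChartAt I x₀).target) := by
      refine ContMDiffOn.prodMk ?_ ?_
      · exact contDiff_fst.contMDiff.contMDiffOn
      · exact (contMDiffOn_extChartAt_symm x₀).comp contDiff_snd.contMDiff.contMDiffOn
          fun p hp => hp.2
    exact hφ.comp h1 fun p hp => ⟨hp.1, mem_univ _⟩
  have hφu : ∀ u ∈ Icc a b, ContMDiff I I' ∞ (φ u) := by
    intro u hu x
    have h1 : ContMDiff I (𝓘(ℝ, ℝ).prod I) ∞ (fun x : Q => ((u, x) : ℝ × Q)) :=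
      contMDiff_const.prodMk contMDiff_id
    have h2 := hφ.comp (s := univ) h1.contMDiffOn (fun x _ => ⟨hu, mem_univ _⟩)
    exact h2.contMDiffAt univ_mem
  have h3 := hη.contDiffOn_pullWithin hG hU
  have h4 : ContDiffOn ℝ ∞ (fun p => (pullWithin I' (Icc a b ×ˢ (extChartAt I x₀).target) G η
      p).compContinuousLinearMap (ContinuousLinearMap.inr ℝ ℝ E))
      (Icc a b ×ˢ (extChartAt I x₀).target) := by
    intro p hp
    exact contDiff_compContinuousLinearMap.contDiffAt.comp_contDiffWithinAt p
      ((h3 p hp).prodMk contDiffWithinAt_const)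
  refine h4.congr fun p hp => ?_
  have hUt := uniqueDiffOn_extChartAt_target (I := I) x₀ p.2 hp.2
  rw [inChart_pullback _ x₀ hp.2 ((hφu p.1 hp.1).mdifferentiable (by simp) _)]
  have h5 := pullWithin_comp (I := I') (s := Icc a b ×ˢ (extChartAt I x₀).target) (f := G)
    (s₂ := (extChartAt I x₀).target) (g := fun y => (p.1, y)) (t := p.2) η
    ((hG p hp).mdifferentiableWithinAt (by simp))
    ((hasFDerivAt_prodMk_right p.1 p.2).differentiableAt.differentiableWithinAt)
    (fun y hy => ⟨hp.1, hy⟩) hUt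
  rw [(hasFDerivAt_prodMk_right p.1 p.2).hasFDerivWithinAt.fderivWithin hUt] at h5
  exact h5

theorem contMDiff_of_family {φ : ℝ → Q → Q'} {s : Set ℝ}
    (hφ : ContMDiffOn (𝓘(ℝ, ℝ).prod I) I' ∞ (fun p : ℝ × Q => φ p.1 p.2) (s ×ˢ univ))
    {u : ℝ} (hu : u ∈ s) : ContMDiff I I' ∞ (φ u) := by
  intro x
  have h1 : ContMDiff I (𝓘(ℝ, ℝ).prod I) ∞ (fun x : Q => ((u, x) : ℝ × Q)) :=
    contMDiff_const.prodMk contMDiff_id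
  have h2 := hφ.comp (s := univ) h1.contMDiffOn (fun x _ => ⟨hu, mem_univ _⟩)
  exact h2.contMDiffAt univ_mem

theorem IsSmoothFamilyOn.add {k : ℕ} {β γ : ℝ → Form E Q k} {a b : ℝ}
    (hβ : IsSmoothFamilyOn I β a b) (hγ : IsSmoothFamilyOn I γ a b) :
    IsSmoothFamilyOn I (fun u => β u + γ u) a b :=
  fun x₀ => (hβ x₀).add (hγ x₀)

theorem IsSmoothForm.isSmoothFamilyOn_smul {k : ℕ} {η : Form E Q k} (hη : IsSmoothForm I η)
    {c : ℝ → ℝ} {a b : ℝ} (hc : ContDiffOn ℝ ∞ c (Icc a b)) :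
    IsSmoothFamilyOn I (fun u => c u • η) a b := by
  intro x₀
  exact (hc.comp contDiff_fst.contDiffOn fun p hp => hp.1).smul
    ((hη x₀).comp contDiff_snd.contDiffOn fun p hp => hp.2)

theorem IsSmoothFamilyOn.congr {k : ℕ} {β γ : ℝ → Form E Q k} {a b : ℝ}
    (hβ : IsSmoothFamilyOn I β a b) (h : ∀ u ∈ Icc a b, γ u = β u) :
    IsSmoothFamilyOn I γ a b :=
  fun x₀ => (hβ x₀).congr fun p hp => by rw [h p.1 hp.1]

/-- A smooth affine reparametrization of a smooth family. -/
theorem IsSmoothFamilyOn.comp_affine {k : ℕ} {β : ℝ → Form E Q k} {a b a' b' p q : ℝ}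
    (hβ : IsSmoothFamilyOn I β a b) (h : ∀ u ∈ Icc a' b', p * u + q ∈ Icc a b) :
    IsSmoothFamilyOn I (fun u => β (p * u + q)) a' b' := by
  intro x₀
  have h1 : ContDiff ℝ ∞ (fun z : ℝ × E => ((p * z.1 + q, z.2) : ℝ × E)) := by fun_prop
  exact (hβ x₀).comp h1.contDiffOn fun z hz => ⟨h z.1 hz.1, hz.2⟩

end Pullback

/-! ### Integration of forms of top degree. -/

section FormIntegral

variable {E H Q : Type*} [NormedAddCommGroup E] [NormedSpace ℝ E] [TopologicalSpace H]
  {I : ModelWithCorners ℝ E H} [TopologicalSpace Q] [ChartedSpace H Q]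
  [FiniteDimensional ℝ E] [MeasurableSpace E] [BorelSpace E]

/-- The basis used to normalize Lebesgue measure in the charts. -/
def modelBasis (E : Type*) [NormedAddCommGroup E] [NormedSpace ℝ E] [FiniteDimensional ℝ E] (n : ℕ)
    [hn : Fact (finrank ℝ E = n)] : Basis (Fin n) ℝ E := finBasisOfFinrankEq ℝ E hn.out

/-- The integral of a form of top degree in the preferred chart at `i`. -/
def chartIntegral (I : ModelWithCorners ℝ E H) {n : ℕ} [hn : Fact (finrank ℝ E = n)]
    (μ ν : Form E Q n) (i : Q) : ℝ :=
  ∫ y in (extChartAt I i).target, (SignType.sign (inChart I μ i y (modelBasis E n)) : ℝ) *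
    inChart I ν i y (modelBasis E n) ∂(modelBasis E n).addHaar

theorem comp_apply_basis {n : ℕ} (b : Basis (Fin n) ℝ E) (θ : E [⋀^Fin n]→L[ℝ] ℝ) (L : E →L[ℝ] E) :
    θ.compContinuousLinearMap L b = L.det * θ b := by
  have h := congrArg (fun f : E [⋀^Fin n]→ₗ[ℝ] ℝ => f (L ∘ b))
    (AlternatingMap.eq_smul_basis_det b θ.toAlternatingMap)
  have h2 := b.det_comp (L : E →ₗ[ℝ] E) b
  rw [Basis.det_self, mul_one] at h2
  change θ (L ∘ b) = _
  change θ (L ∘ b) = θ b • b.det (L ∘ b) at h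
  change b.det (L ∘ b) = _ at h2
  rw [h, h2, smul_eq_mul, mul_comm]

/-- The target of a chart is the trace of an open set on the closed set `range I`. -/
theorem measurableSet_target_inter (i : Q) {U : Set Q} (hU : IsOpen U) :
    MeasurableSet ((extChartAt I i).target ∩ (extChartAt I i).symm ⁻¹' U) := by
  have h : (extChartAt I i).target ∩ (extChartAt I i).symm ⁻¹' U =
      range I ∩ I.symm ⁻¹' ((chartAt H i).target ∩ (chartAt H i).symm ⁻¹' U) := by
    ext y
    simp only [extChartAt, mfld_simps]
    tauto
  rw [h]
  refine (I.isClosed_range).measurableSet.inter (IsOpen.measurableSet ?_)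
  exact ((chartAt H i).isOpen_inter_preimage_symm hU).preimage I.continuous_symm

theorem measurableSet_target (i : Q) : MeasurableSet (extChartAt I i).target := by
  simpa using measurableSet_target_inter (I := I) i isOpen_univ

variable [IsManifold I ∞ Q] {n : ℕ} [hn : Fact (finrank ℝ E = n)]

theorem chartIntegral_eq_setIntegral (μ ν : Form E Q n) (i : Q) {S : Set E}
    (hS : S ⊆ (extChartAt I i).target)
    (h : ∀ y ∈ (extChartAt I i).target, y ∉ S → ν ((extChartAt I i).symm y) = 0) :
    chartIntegral I μ ν i = ∫ y in S, (SignType.sign (inChart I μ i y (modelBasis E n)) : ℝ) *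
      inChart I ν i y (modelBasis E n) ∂(modelBasis E n).addHaar := by
  rw [chartIntegral]
  apply setIntegral_eq_of_subset_of_forall_sdiff_eq_zero (measurableSet_target i) hS
  intro y hy
  have h0 : inChart I ν i y = 0 := by rw [inChart, h y hy.1 hy.2]; rfl
  rw [h0]
  exact mul_zero _

/-- Change of variables for `χ` read in the charts `i` and `j`. The coefficient of `ν` is multiplied
by the Jacobian determinant, and the sign of the coefficient of `μ` by the sign of that determinant,
because `χ` preserves the orientation; together they give the absolute value in the formula. By `hν`
the forms live where both charts are available. With `χ` the identity the lemma compares two charts.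
-/
theorem chartIntegral_pullback {μ : Form E Q n} (χ : Diffeomorph I I Q Q ∞)
    (hχ : ∀ x, ∃ a : ℝ, 0 < a ∧ pullback I I χ μ x = a • μ x) (ν : Form E Q n) (i j : Q)
    (hν : ∀ x, ν (χ x) ≠ 0 → x ∈ (extChartAt I i).source ∧ χ x ∈ (extChartAt I j).source) :
    chartIntegral I μ (pullback I I χ ν) i = chartIntegral I μ ν j := by
  have : IsManifold I 1 Q := isManifold_one I
  set b : Basis (Fin n) ℝ E := modelBasis E n with hb
  set S : Set E := (extChartAt I i).target ∩ (extChartAt I i).symm ⁻¹' (χ ⁻¹' (extChartAt I j).source)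
    with hS
  set T : Set E := (extChartAt I j).target ∩
    (extChartAt I j).symm ⁻¹' (χ.symm ⁻¹' (extChartAt I i).source) with hT
  have hSm : MeasurableSet S := measurableSet_target_inter i
    ((isOpen_extChartAt_source j).preimage χ.continuous)
  have hTm : MeasurableSet T := measurableSet_target_inter j
    ((isOpen_extChartAt_source i).preimage χ.symm.continuous)
  set h : E → E := extChartAt I j ∘ (χ ∘ (extChartAt I i).symm) with hh
  have hinj : InjOn h S := by
    intro y hy z hz hyz
    have h1 := (extChartAt I j).injOn hy.2 hz.2 hyz
    have h2 := χ.injective h1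
    exact (extChartAt I i).symm.injOn hy.1 hz.1 h2
  have himg : h '' S = T := by
    ext z
    constructor
    · rintro ⟨y, hy, rfl⟩
      refine ⟨(extChartAt I j).map_source hy.2, ?_⟩
      simp only [mem_preimage, hh, Function.comp_apply]
      rw [(extChartAt I j).left_inv hy.2, χ.symm_apply_apply]
      exact (extChartAt I i).map_target hy.1
    · intro hz
      refine ⟨extChartAt I i (χ.symm ((extChartAt I j).symm z)), ⟨(extChartAt I i).map_source hz.2, ?_⟩, ?_⟩
      · simp only [mem_preimage]
        rw [(extChartAt I i).left_inv hz.2, χ.apply_symm_apply]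
        exact (extChartAt I j).map_target hz.1
      · simp only [hh, Function.comp_apply]
        rw [(extChartAt I i).left_inv hz.2, χ.apply_symm_apply, (extChartAt I j).right_inv hz.1]
  have hchart : ∀ θ : Form E Q n, ∀ y ∈ S, inChart I (pullback I I χ θ) i y b =
      (fderivWithin ℝ h (extChartAt I i).target y).det * inChart I θ j (h y) b := by
    intro θ y hy
    rw [inChart_pullback θ i hy.1 (χ.contMDiff.mdifferentiable (by simp) _),
      pullWithin_eq_inChart θ j (((contMDiffOn_comp_extChartAt_symm χ.contMDiff i) y
        hy.1).mdifferentiableWithinAt (by simp)) (uniqueDiffOn_extChartAt_target i y hy.1) hy.2,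
      comp_apply_basis]
    rfl
  have hderiv : ∀ y ∈ S, HasFDerivWithinAt h (fderivWithin ℝ h (extChartAt I i).target y) S y := by
    intro y hy
    have h1 := contDiffWithinAt_extChartAt_comp j ((contMDiffOn_comp_extChartAt_symm
      χ.contMDiff i) y hy.1) hy.2
    exact (h1.differentiableWithinAt (by simp)).hasFDerivWithinAt.mono inter_subset_left
  have hL : chartIntegral I μ (pullback I I χ ν) i =
      ∫ y in S, (SignType.sign (inChart I μ i y b) : ℝ) * inChart I (pullback I I χ ν) i y b
        ∂b.addHaar := by
    refine chartIntegral_eq_setIntegral _ _ _ inter_subset_left fun y hy hyS => ?_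
    have h0 : pullback I I χ ν ((extChartAt I i).symm y) = 0 := by
      by_contra hne
      have hne' : ν (χ ((extChartAt I i).symm y)) ≠ 0 := by
        intro h0
        apply hne
        rw [pullback, h0]
        rfl
      exact hyS ⟨hy, (hν _ hne').2⟩
    exact h0
  have hR : chartIntegral I μ ν j =
      ∫ y in T, (SignType.sign (inChart I μ j y b) : ℝ) * inChart I ν j y b ∂b.addHaar := by
    refine chartIntegral_eq_setIntegral _ _ _ inter_subset_left fun y hy hyS => ?_
    have h0 : ν ((extChartAt I j).symm y) = 0 := by
      by_contra hne
      have h1 := hν (χ.symm ((extChartAt I j).symm y))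
      rw [χ.apply_symm_apply] at h1
      exact hyS ⟨hy, (h1 hne).1⟩
    exact h0
  rw [hL, hR, ← himg, integral_image_eq_integral_abs_det_fderiv_smul b.addHaar hSm hderiv hinj]
  refine setIntegral_congr_fun hSm fun y hy => ?_
  rw [hchart ν y hy]
  obtain ⟨a, ha, hae⟩ := hχ ((extChartAt I i).symm y)
  have hsign : inChart I (pullback I I χ μ) i y b = a * inChart I μ i y b := by
    rw [inChart, hae]
    rfl
  rw [hchart μ y hy] at hsign
  have hs2 : SignType.sign (inChart I μ i y b) =
      SignType.sign (fderivWithin ℝ h (extChartAt I i).target y).det *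
        SignType.sign (inChart I μ j (h y) b) := by
    rw [← sign_mul, hsign, sign_mul, sign_pos ha, one_mul]
  rw [hs2, SignType.coe_mul, smul_eq_mul, ← sign_mul_self]
  ring

/-- A form of top degree multiplied by a function supported in a chart is integrable there. -/
theorem integrableOn_chart {μ ν : Form E Q n} (hμ : IsVolumeForm I μ) (hν : IsSmoothForm I ν)
    [CompactSpace Q] {f : Q → ℝ} (hf : Continuous f) {i : Q} (hfi : tsupport f ⊆ (extChartAt I i).source) :
    IntegrableOn (fun y => (SignType.sign (inChart I μ i y (modelBasis E n)) : ℝ) *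
      inChart I (fun x => f x • ν x) i y (modelBasis E n)) (extChartAt I i).target
      (modelBasis E n).addHaar := by
  set b := modelBasis E n
  set K : Set E := extChartAt I i '' tsupport f with hK
  have hKc : IsCompact K := ((isClosed_tsupport f).isCompact).image_of_continuousOn
    ((continuousOn_extChartAt i).mono hfi)
  have hKt : K ⊆ (extChartAt I i).target := by
    rintro _ ⟨x, hx, rfl⟩
    exact (extChartAt I i).map_source (hfi hx)
  have hev : ∀ θ : Form E Q n, IsSmoothForm I θ →
      ContinuousOn (fun y => inChart I θ i y b) (extChartAt I i).target := by
    intro θ hθ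
    have h1 := (hθ i).continuousOn
    have h2 : Continuous fun g : E [⋀^Fin n]→L[ℝ] ℝ => g b :=
      (ContinuousAlternatingMap.apply ℝ E ℝ b).continuous
    exact h2.comp_continuousOn h1
  have hcont : ContinuousOn (fun y => (SignType.sign (inChart I μ i y b) : ℝ) *
      inChart I (fun x => f x • ν x) i y b) (extChartAt I i).target := by
    refine ContinuousOn.mul ?_ ?_
    · intro y hy
      have hne : inChart I μ i y b ≠ 0 := by
        intro h0
        have h1 : inChart I μ i y = 0 := by
          ext v
          have := AlternatingMap.eq_smul_basis_det b (inChart I μ i y).toAlternatingMap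
          change _ = (inChart I μ i y b) • _ at this
          rw [h0, zero_smul] at this
          exact congrArg (fun g : E [⋀^Fin n]→ₗ[ℝ] ℝ => g v) this
        refine hμ.2 ((extChartAt I i).symm y) ?_
        rw [eq_inChart_comp (I := I) μ i ((extChartAt I i).map_target hy),
          (extChartAt I i).right_inv hy, h1]
        rfl
      have h1 : ContinuousAt (fun r : ℝ => (SignType.sign r : ℝ)) (inChart I μ i y b) :=
        (continuous_of_discreteTopology (f := fun s : SignType => (s : ℝ))).continuousAt.comp
          (continuousAt_sign_of_ne_zero hne)
      exact ContinuousAt.comp_continuousWithinAt (f := fun y => inChart I μ i y b) h1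
        (hev μ hμ.1 y hy)
    · simp only [inChart_fun_smul]
      exact (hf.comp_continuousOn (continuousOn_extChartAt_symm i)).mul (hev ν hν)
  have hzero : ∀ y ∈ (extChartAt I i).target, y ∉ K → (SignType.sign (inChart I μ i y b) : ℝ) *
      inChart I (fun x => f x • ν x) i y b = 0 := by
    intro y hy hyK
    have h0 : f ((extChartAt I i).symm y) = 0 := by
      by_contra hne
      exact hyK ⟨_, subset_tsupport f hne, (extChartAt I i).right_inv hy⟩
    rw [inChart_fun_smul]
    simp only [h0, zero_smul]
    exact mul_zero _
  have h1 := (hcont.mono hKt).integrableOn_compact (μ := b.addHaar) hKc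
  exact h1.of_forall_sdiff_eq_zero (measurableSet_target i) fun y hy => hzero y hy.1 hy.2

theorem chartIntegral_add {μ ν ν' : Form E Q n} (hμ : IsVolumeForm I μ) (hν : IsSmoothForm I ν)
    (hν' : IsSmoothForm I ν') [CompactSpace Q] {f g : Q → ℝ} (hf : Continuous f)
    (hg : Continuous g) {i : Q} (hfi : tsupport f ⊆ (extChartAt I i).source)
    (hgi : tsupport g ⊆ (extChartAt I i).source) :
    chartIntegral I μ ((fun x => f x • ν x) + fun x => g x • ν' x) i =
      chartIntegral I μ (fun x => f x • ν x) i + chartIntegral I μ (fun x => g x • ν' x) i := by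
  rw [chartIntegral, chartIntegral, chartIntegral,
    ← integral_add (integrableOn_chart hμ hν hf hfi) (integrableOn_chart hμ hν' hg hgi)]
  congr 1
  ext y
  rw [inChart_add]
  simp [mul_add]

theorem chartIntegral_smul (c : ℝ) (μ ν : Form E Q n) (i : Q) :
    chartIntegral I μ (c • ν) i = c * chartIntegral I μ ν i := by
  rw [chartIntegral, chartIntegral, ← integral_const_mul]
  congr 1
  ext y
  rw [inChart_smul]
  simp only [Pi.smul_apply, ContinuousAlternatingMap.smul_apply, smul_eq_mul]
  ring

theorem chartIntegral_sum {μ ν : Form E Q n} (hμ : IsVolumeForm I μ) (hν : IsSmoothForm I ν)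
    [CompactSpace Q] {ι : Type*} (s : Finset ι) {f : ι → Q → ℝ} (hf : ∀ j ∈ s, Continuous (f j))
    {i : Q} (hfi : ∀ j ∈ s, tsupport (f j) ⊆ (extChartAt I i).source) :
    chartIntegral I μ (fun x => (∑ j ∈ s, f j x) • ν x) i =
      ∑ j ∈ s, chartIntegral I μ (fun x => f j x • ν x) i := by
  simp only [chartIntegral]
  rw [← integral_finsetSum _ fun j hj => integrableOn_chart hμ hν (hf j hj) (hfi j hj)]
  congr 1
  ext y
  simp only [inChart_fun_smul, ContinuousAlternatingMap.smul_apply, smul_eq_mul, Finset.sum_mul,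
    Finset.mul_sum]

variable (I Q) in
/-- The partition of unity used in the definition of the integral. -/
def chartPartition [T2Space Q] [CompactSpace Q] : SmoothPartitionOfUnity Q I Q univ :=
  (SmoothPartitionOfUnity.exists_isSubordinate_chartAt_source I Q).choose

variable [T2Space Q] [CompactSpace Q]

theorem tsupport_chartPartition (i : Q) :
    tsupport (chartPartition Q I i) ⊆ (extChartAt I i).source := by
  rw [extChartAt_source]
  exact (SmoothPartitionOfUnity.exists_isSubordinate_chartAt_source I Q).choose_spec i

/-- A finite set of indices outside of which a partition of unity vanishes. -/
theorem exists_finset_partition {ι : Type*} (ρ : SmoothPartitionOfUnity ι I Q univ) :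
    ∃ s : Finset ι, (∀ i ∉ s, ∀ x, ρ i x = 0) ∧ ∀ x, ∑ i ∈ s, ρ i x = 1 := by
  have h := ρ.locallyFinite.finite_nonempty_of_compact
  refine ⟨h.toFinset, fun i hi x => ?_, fun x => ?_⟩
  · by_contra hne
    exact hi (h.mem_toFinset.2 ⟨x, hne⟩)
  · rw [← ρ.sum_eq_one (mem_univ x)]
    refine (finsum_eq_sum_of_support_subset _ fun i hi => ?_).symm
    exact h.mem_toFinset.2 ⟨x, hi⟩

/-- By compactness only finitely many functions of the partition are nonzero, so the `finsum` over
all points of `Q` is an honest sum. -/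
theorem formIntegral_eq_sum (μ ν : Form E Q n) {s : Finset Q}
    (hs : ∀ i ∉ s, ∀ x, chartPartition Q I i x = 0) :
    formIntegral I μ ν =
      ∑ i ∈ s, chartIntegral I μ (fun x => chartPartition Q I i x • ν x) i := by
  have h1 : formIntegral I μ ν =
      ∑ᶠ i, chartIntegral I μ (fun x => chartPartition Q I i x • ν x) i := by
    rw [formIntegral]
    refine finsum_congr fun i => ?_
    rw [chartIntegral]
    congr 1
    ext y
    rw [inChart_fun_smul]
    simp only [ContinuousAlternatingMap.smul_apply, smul_eq_mul]
    rw [mul_assoc, mul_left_comm]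
    rfl
  rw [h1]
  refine finsum_eq_sum_of_support_subset _ fun i hi => ?_
  by_contra his
  apply hi
  have : (fun x => chartPartition Q I i x • ν x) = (0 : ℝ) • ν := by
    ext1 x
    rw [hs i his x]
    rfl
  change chartIntegral I μ (fun x => chartPartition Q I i x • ν x) i = 0
  rw [this, chartIntegral_smul, zero_mul]

theorem formIntegral_add {μ ν ν' : Form E Q n} (hμ : IsVolumeForm I μ) (hν : IsSmoothForm I ν)
    (hν' : IsSmoothForm I ν') :
    formIntegral I μ (ν + ν') = formIntegral I μ ν + formIntegral I μ ν' := by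
  obtain ⟨s, hs, -⟩ := exists_finset_partition (chartPartition Q I)
  rw [formIntegral_eq_sum μ _ hs, formIntegral_eq_sum μ _ hs, formIntegral_eq_sum μ _ hs,
    ← Finset.sum_add_distrib]
  refine Finset.sum_congr rfl fun i _ => ?_
  rw [← chartIntegral_add hμ hν hν' (chartPartition Q I i).contMDiff.continuous
    (chartPartition Q I i).contMDiff.continuous (tsupport_chartPartition i)
    (tsupport_chartPartition i)]
  congr 1
  ext1 x
  simp only [Pi.add_apply, smul_add]

theorem formIntegral_smul (c : ℝ) (μ ν : Form E Q n) :
    formIntegral I μ (c • ν) = c * formIntegral I μ ν := by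
  obtain ⟨s, hs, -⟩ := exists_finset_partition (chartPartition Q I)
  rw [formIntegral_eq_sum μ _ hs, formIntegral_eq_sum μ _ hs, Finset.mul_sum]
  refine Finset.sum_congr rfl fun i _ => ?_
  rw [← chartIntegral_smul]
  congr 1
  ext1 x
  simp only [Pi.smul_apply]
  rw [smul_comm]

theorem formIntegral_sub {μ ν ν' : Form E Q n} (hμ : IsVolumeForm I μ) (hν : IsSmoothForm I ν)
    (hν' : IsSmoothForm I ν') :
    formIntegral I μ (ν - ν') = formIntegral I μ ν - formIntegral I μ ν' := by
  have h : ν = (ν - ν') + ν' := by simp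
  nth_rewrite 2 [h]
  rw [formIntegral_add hμ (hν.sub hν') hν']
  ring

/-- The integral does not change under a diffeomorphism that preserves the orientation. -/
theorem formIntegral_pullback {μ ν : Form E Q n} (hμ : IsVolumeForm I μ) (hν : IsSmoothForm I ν)
    (χ : Diffeomorph I I Q Q ∞)
    (hχ : ∀ x, ∃ a : ℝ, 0 < a ∧ pullback I I χ μ x = a • μ x) :
    formIntegral I μ (pullback I I χ ν) = formIntegral I μ ν := by
  obtain ⟨s, hs, hs1⟩ := exists_finset_partition (chartPartition Q I)
  set ρ := chartPartition Q I
  have hρc : ∀ i, Continuous (ρ i) := fun i => (ρ i).contMDiff.continuous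
  have hsub : ∀ i (g : Q → ℝ), tsupport (fun x => g x * ρ i x) ⊆ (extChartAt I i).source :=
    fun i g => (tsupport_mul_subset_right).trans (tsupport_chartPartition i)
  rw [formIntegral_eq_sum μ _ hs, formIntegral_eq_sum μ _ hs]
  -- Both integrals are cut by the products of `ρ i` with `ρ j ∘ χ`; each piece lies in the chart
  -- `i` before `χ` and in the chart `j` after it.
  have hL : ∀ i ∈ s, chartIntegral I μ (fun x => ρ i x • pullback I I χ ν x) i =
      ∑ j ∈ s, chartIntegral I μ (fun x => (ρ j (χ x) * ρ i x) • pullback I I χ ν x) i := by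
    intro i _
    rw [← chartIntegral_sum hμ (hν.pullback χ.contMDiff) s (f := fun j x => ρ j (χ x) * ρ i x)
      (fun j _ => ((hρc j).comp χ.continuous).mul (hρc i)) (fun j _ => hsub i _)]
    congr 1
    ext1 x
    rw [← Finset.sum_mul, hs1, one_mul]
  have hR : ∀ j ∈ s, chartIntegral I μ (fun x => ρ j x • ν x) j =
      ∑ i ∈ s, chartIntegral I μ (fun x => (ρ i (χ.symm x) * ρ j x) • ν x) j := by
    intro j _
    rw [← chartIntegral_sum hμ hν s (f := fun i x => ρ i (χ.symm x) * ρ j x)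
      (fun i _ => ((hρc i).comp χ.symm.continuous).mul (hρc j)) (fun i _ => hsub j _)]
    congr 1
    ext1 x
    rw [← Finset.sum_mul, hs1, one_mul]
  rw [Finset.sum_congr rfl hL, Finset.sum_congr rfl hR, Finset.sum_comm]
  refine Finset.sum_congr rfl fun j _ => Finset.sum_congr rfl fun i _ => ?_
  rw [← chartIntegral_pullback χ hχ _ i j]
  · congr 1
    ext1 x
    rw [pullback, pullback]
    simp only [χ.symm_apply_apply]
    rw [mul_comm]
    rfl
  · intro x hx
    have h1 : ρ i (χ.symm (χ x)) * ρ j (χ x) ≠ 0 := fun h0 => hx (by rw [h0, zero_smul])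
    rw [χ.symm_apply_apply] at h1
    exact ⟨tsupport_chartPartition i (subset_tsupport _ (left_ne_zero_of_mul h1)),
      tsupport_chartPartition j (subset_tsupport _ (right_ne_zero_of_mul h1))⟩

/-- The integral is bounded by the size of the coefficients in finitely many charts. -/
theorem exists_abs_formIntegral_le (μ : Form E Q n) {s : Finset Q}
    (hs : ∀ i ∉ s, ∀ x, chartPartition Q I i x = 0) :
    ∃ C : ℝ, 0 ≤ C ∧ ∀ (ν : Form E Q n) (m : ℝ), 0 ≤ m →
      (∀ i ∈ s, ∀ x ∈ tsupport (chartPartition Q I i), ‖inChart I ν i (extChartAt I i x)‖ ≤ m) →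
      |formIntegral I μ ν| ≤ C * m := by
  set b := modelBasis E n
  set K : Q → Set E := fun i => extChartAt I i '' tsupport (chartPartition Q I i) with hK
  have hKc : ∀ i, IsCompact (K i) := fun i =>
    ((isClosed_tsupport _).isCompact).image_of_continuousOn
      ((continuousOn_extChartAt i).mono (tsupport_chartPartition i))
  have hKt : ∀ i, K i ⊆ (extChartAt I i).target := by
    rintro i _ ⟨x, hx, rfl⟩
    exact (extChartAt I i).map_source (tsupport_chartPartition i hx)
  set P : ℝ := ∏ j, ‖b j‖ with hP
  have hP0 : 0 ≤ P := Finset.prod_nonneg fun _ _ => norm_nonneg _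
  refine ⟨∑ i ∈ s, P * (b.addHaar (K i)).toReal, Finset.sum_nonneg fun i _ => by positivity,
    fun ν m hm hν => ?_⟩
  rw [formIntegral_eq_sum μ ν hs, Finset.sum_mul]
  refine (Finset.abs_sum_le_sum_abs _ _).trans (Finset.sum_le_sum fun i hi => ?_)
  have h1 : chartIntegral I μ (fun x => chartPartition Q I i x • ν x) i =
      ∫ y in K i, (SignType.sign (inChart I μ i y b) : ℝ) *
        inChart I (fun x => chartPartition Q I i x • ν x) i y b ∂b.addHaar := by
    refine chartIntegral_eq_setIntegral _ _ _ (hKt i) fun y hy hyK => ?_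
    have h0 : chartPartition Q I i ((extChartAt I i).symm y) = 0 := by
      by_contra hne
      exact hyK ⟨_, subset_tsupport _ hne, (extChartAt I i).right_inv hy⟩
    rw [h0, zero_smul]
  rw [h1]
  have h2 : ∀ y ∈ K i, ‖(SignType.sign (inChart I μ i y b) : ℝ) *
      inChart I (fun x => chartPartition Q I i x • ν x) i y b‖ ≤ m * P := by
    rintro _ ⟨x, hx, rfl⟩
    have hxs := tsupport_chartPartition i hx
    rw [inChart_fun_smul]
    simp only [ContinuousAlternatingMap.smul_apply, smul_eq_mul, norm_mul, Real.norm_eq_abs]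
    have e1 : |((SignType.sign (inChart I μ i (extChartAt I i x) b) : SignType) : ℝ)| ≤ 1 := by
      rcases SignType.trichotomy (SignType.sign (inChart I μ i (extChartAt I i x) b)) with h | h | h <;>
        rw [h] <;> simp
    have e2 : |chartPartition Q I i ((extChartAt I i).symm (extChartAt I i x))| ≤ 1 := by
      rw [abs_of_nonneg (SmoothPartitionOfUnity.nonneg _ _ _)]
      exact SmoothPartitionOfUnity.le_one _ _ _
    have e3 : |inChart I ν i (extChartAt I i x) b| ≤ m * P := by
      refine ((inChart I ν i (extChartAt I i x)).le_opNorm b).trans ?_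
      exact mul_le_mul_of_nonneg_right (hν i hi x hx) hP0
    calc _ ≤ 1 * (1 * (m * P)) := by gcongr
      _ = m * P := by ring
  refine (norm_setIntegral_le_of_norm_le_const (hKc i).measure_lt_top h2).trans (le_of_eq ?_)
  rw [Measure.real]
  ring

end FormIntegral

/-! ### Stokes' theorem in a half-space. -/

section HalfSpace

variable {E : Type*} [NormedAddCommGroup E] [NormedSpace ℝ E]

/-- The derivative is bounded on the compact part and zero off `K`; convexity of `S` turns the bound
into a Lipschitz constant. -/
theorem exists_lipschitz_along {g : E → ℝ} {S K : Set E} (hS : Convex ℝ S) (hSu : UniqueDiffOn ℝ S)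
    (hSc : IsClosed S) (hg : ContDiffOn ℝ 1 g S) (hK : IsCompact K) (hgK : ∀ y ∉ K, g y = 0) :
    ∃ C : ℝ, 0 ≤ C ∧ ∀ y ∈ S, ∀ z ∈ S, |g z - g y| ≤ C * ‖z - y‖ := by
  have hcont : ContinuousOn (fderivWithin ℝ g S) S := hg.continuousOn_fderivWithin hSu le_rfl
  obtain ⟨C, hC⟩ := (hK.inter_right hSc).exists_bound_of_continuousOn (f := fderivWithin ℝ g S)
    (hcont.mono inter_subset_right)
  have hbound : ∀ y ∈ S, ‖fderivWithin ℝ g S y‖ ≤ max C 0 := by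
    intro y hy
    by_cases hyK : y ∈ K
    · exact (hC y ⟨hyK, hy⟩).trans (le_max_left _ _)
    · have h0 : g =ᶠ[𝓝[S] y] fun _ => 0 := by
        filter_upwards [mem_nhdsWithin_of_mem_nhds (hK.isClosed.isOpen_compl.mem_nhds hyK)] with z hz
        exact hgK z hz
      rw [h0.fderivWithin_eq (hgK y hyK)]
      simp
  refine ⟨max C 0, le_max_right _ _, fun y hy z hz => ?_⟩
  exact hS.norm_image_sub_le_of_norm_fderivWithin_le (𝕜 := ℝ)
    (hg.differentiableOn one_ne_zero) hbound hy hz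

theorem exists_pos_of_ne_zero {ℓ : E →L[ℝ] ℝ} (hℓ : ℓ ≠ 0) : ∃ w, 0 < ℓ w := by
  obtain ⟨w, hw⟩ : ∃ w, ℓ w ≠ 0 := by
    by_contra hcon
    push Not at hcon
    exact hℓ (ContinuousLinearMap.ext hcon)
  rcases lt_or_gt_of_ne hw with h1 | h1
  · exact ⟨-w, by simpa using h1⟩
  · exact ⟨w, h1⟩

theorem convex_halfSpace (ℓ : E →L[ℝ] ℝ) : Convex ℝ {y | 0 ≤ ℓ y} :=
  convex_halfSpace_ge ℓ.toLinearMap.isLinear 0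

theorem interior_halfSpace {ℓ : E →L[ℝ] ℝ} (hℓ : ℓ ≠ 0) :
    interior {y | 0 ≤ ℓ y} = {y | 0 < ℓ y} := by
  refine Subset.antisymm (fun y hy => ?_)
    (interior_maximal (fun y hy => show (0 : ℝ) ≤ ℓ y from le_of_lt hy)
      (isOpen_lt continuous_const ℓ.continuous))
  obtain ⟨w, hw⟩ := exists_pos_of_ne_zero hℓ
  have hc : ContinuousAt (fun t : ℝ => y - t • w) 0 := by fun_prop
  have h1 : ∀ᶠ t : ℝ in 𝓝 0, y - t • w ∈ {y | 0 ≤ ℓ y} :=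
    hc (by simpa using mem_interior_iff_mem_nhds.1 hy)
  obtain ⟨ε, hε, h2⟩ := Metric.eventually_nhds_iff.1 h1
  have h3 : (0 : ℝ) ≤ ℓ (y - (ε / 2) • w) := h2 (by
    rw [Real.dist_eq, sub_zero, abs_of_pos (by positivity)]; linarith)
  simp only [map_sub, map_smul, smul_eq_mul] at h3
  change 0 < ℓ y
  have : 0 < ε / 2 * ℓ w := by positivity
  linarith

theorem uniqueDiffOn_halfSpace {ℓ : E →L[ℝ] ℝ} (hℓ : ℓ ≠ 0) : UniqueDiffOn ℝ {y | 0 ≤ ℓ y} := by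
  obtain ⟨w, hw⟩ := exists_pos_of_ne_zero hℓ
  exact uniqueDiffOn_convex (convex_halfSpace ℓ) ⟨w, by rw [interior_halfSpace hℓ]; exact hw⟩

variable [FiniteDimensional ℝ E] [MeasurableSpace E] [BorelSpace E]

/-- By translation invariance `t ↦ ∫ g (y + t • v)` is constant, and its derivative at `0` is `∫
g'`. The Lipschitz bound dominates the difference quotients. Differentiability is asked only almost
everywhere, because the lemma is meant for functions on a half-space extended by zero. -/
theorem integral_eq_zero_of_lipschitz_along (μ : Measure E) [μ.IsAddHaarMeasure] {g g' : E → ℝ}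
    {v : E} {K : Set E} (hK : IsCompact K) (hgK : ∀ y ∉ K, g y = 0) (hgi : Integrable g μ)
    {C : ℝ} (hC : 0 ≤ C) (hlip : ∀ y : E, ∀ t : ℝ, |g (y + t • v) - g y| ≤ C * |t|)
    (hg'm : AEStronglyMeasurable g' μ)
    (hder : ∀ᵐ y ∂μ, HasDerivAt (fun t : ℝ => g (y + t • v)) (g' y) 0) :
    ∫ y, g' y ∂μ = 0 := by
  -- `K'` collects the points from which `K` can be reached in time at most `1`; outside it the
  -- translated function is locally constant in `t`, so `C` on `K'` is an integrable majorant.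
  set K' : Set E := (fun p : E × ℝ => p.1 - p.2 • v) '' (K ×ˢ Icc (-1 : ℝ) 1) with hK'
  have hK'c : IsCompact K' := (hK.prod isCompact_Icc).image (by fun_prop)
  have hout : ∀ y ∉ K', ∀ t ∈ Metric.ball (0 : ℝ) 1, g (y + t • v) = 0 := by
    intro y hy t ht
    apply hgK
    intro hmem
    apply hy
    rw [Metric.mem_ball, dist_zero_right, Real.norm_eq_abs, abs_lt] at ht
    exact ⟨(y + t • v, t), ⟨hmem, ht.1.le, ht.2.le⟩, by simp⟩
  have h := hasDerivAt_integral_of_dominated_loc_of_lip (μ := μ)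
    (F := fun t y => g (y + t • v)) (F' := g') (x₀ := (0 : ℝ)) (s := Metric.ball 0 1)
    (bound := K'.indicator fun _ => C) (Metric.ball_mem_nhds _ one_pos) ?_ ?_ hg'm ?_ ?_ hder
  · have hconst : (fun t : ℝ => ∫ y, g (y + t • v) ∂μ) = fun _ => ∫ y, g y ∂μ := by
      ext t
      exact integral_add_right_eq_self g (t • v)
    have h2 := h.2
    rw [hconst] at h2
    exact h2.unique (hasDerivAt_const _ _)
  · refine Eventually.of_forall fun t => ?_
    exact (hgi.comp_add_right (t • v)).aestronglyMeasurable
  · simpa using hgi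
  · refine Eventually.of_forall fun y => ?_
    by_cases hy : y ∈ K'
    · refine LipschitzOnWith.of_dist_le_mul fun t _ u _ => ?_
      have := hlip (y + u • v) (t - u)
      rw [indicator_of_mem hy, Real.dist_eq, Real.dist_eq]
      have e : y + u • v + (t - u) • v = y + t • v := by module
      rw [e] at this
      simpa [abs_of_nonneg hC] using this
    · refine LipschitzOnWith.of_dist_le_mul fun t ht u hu => ?_
      rw [hout y hy t ht, hout y hy u hu, dist_self]
      positivity
  · rw [integrable_indicator_iff hK'c.measurableSet]
    exact integrableOn_const hK'c.measure_lt_top.ne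

/-- The integral over a half-space of a directional derivative of a function with compact support
is zero if the direction is tangent to the boundary, or the function is zero there. -/
theorem setIntegral_fderivWithin_halfSpace_eq_zero (μ : Measure E) [μ.IsAddHaarMeasure]
    {ℓ : E →L[ℝ] ℝ} (hℓ : ℓ ≠ 0) {g : E → ℝ} {K : Set E} (hg : ContDiffOn ℝ 1 g {y | 0 ≤ ℓ y})
    (hK : IsCompact K) (hgK : ∀ y ∉ K, g y = 0) {v : E}
    (h : ℓ v = 0 ∨ ∀ y, ℓ y = 0 → g y = 0) :
    ∫ y in {y | 0 ≤ ℓ y}, fderivWithin ℝ g {y | 0 ≤ ℓ y} y v ∂μ = 0 := by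
  set S : Set E := {y | 0 ≤ ℓ y} with hSdef
  have hSc : IsClosed S := isClosed_le continuous_const ℓ.continuous
  have hSconv : Convex ℝ S := convex_halfSpace ℓ
  obtain ⟨w, hw⟩ := exists_pos_of_ne_zero hℓ
  have hpos : {y | 0 < ℓ y} ⊆ interior S := (interior_halfSpace hℓ).ge
  have hSu : UniqueDiffOn ℝ S := uniqueDiffOn_halfSpace hℓ
  obtain ⟨C, hC, hlip⟩ := exists_lipschitz_along hSconv hSu hSc hg hK hgK
  have hcont : ContinuousOn (fun y => fderivWithin ℝ g S y v) S :=
    (hg.continuousOn_fderivWithin hSu le_rfl).clm_apply continuousOn_const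
  have hgint : Integrable (S.indicator g) μ := by
    rw [integrable_indicator_iff hSc.measurableSet]
    have h1 : IntegrableOn g (K ∩ S) μ :=
      (hg.continuousOn.mono inter_subset_right).integrableOn_compact (hK.inter_right hSc)
    exact h1.of_forall_sdiff_eq_zero hSc.measurableSet fun y hy => hgK y fun hyK => hy.2 ⟨hyK, hy.1⟩
  rw [← integral_indicator hSc.measurableSet]
  refine integral_eq_zero_of_lipschitz_along μ (g := S.indicator g) (v := v) hK ?_ hgint
    (C := C * ‖v‖) (by positivity) ?_ ?_ ?_
  · intro y hy
    by_cases hyS : y ∈ S <;> simp [hyS, hgK y hy]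
  -- A segment that leaves the half-space crosses its boundary at a time `τ` with `|τ| ≤ |t|`, and
  -- `g` vanishes there. So extension by zero keeps the Lipschitz bound. If `ℓ v = 0` no segment
  -- leaves.
  · have key : ∀ y z : E, ∀ t : ℝ, z = y + t • v → y ∈ S → z ∉ S → |g y| ≤ C * ‖v‖ * |t| := by
      intro y z t hz hy hzS
      simp only [hSdef, mem_ofPred_eq, not_le] at hy hzS
      rw [hz] at hzS
      simp only [map_add, map_smul, smul_eq_mul] at hzS
      have hv : ℓ v ≠ 0 := by
        rintro h0
        rw [h0] at hzS
        linarith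
      have hg0 := h.resolve_left hv
      set τ := -(ℓ y) / ℓ v with hτ
      have hτv : ℓ (y + τ • v) = 0 := by
        simp only [map_add, map_smul, smul_eq_mul, hτ]
        field_simp
        ring
      have h1 := hlip y hy (y + τ • v) (by simp [hSdef, hτv])
      rw [hg0 _ hτv, zero_sub, abs_neg, add_sub_cancel_left, norm_smul, Real.norm_eq_abs] at h1
      have h2 : |τ| ≤ |t| := by
        rw [hτ, abs_div, abs_neg, div_le_iff₀ (abs_pos.2 hv), ← abs_mul, abs_of_nonneg hy]
        have : -(t * ℓ v) ≤ |t * ℓ v| := neg_le_abs _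
        linarith
      calc |g y| ≤ C * (|τ| * ‖v‖) := h1
        _ ≤ C * (|t| * ‖v‖) := by gcongr
        _ = _ := by ring
    intro y t
    by_cases hy : y ∈ S <;> by_cases hz : y + t • v ∈ S
    · rw [indicator_of_mem hy, indicator_of_mem hz]
      have := hlip y hy _ hz
      rw [add_sub_cancel_left, norm_smul, Real.norm_eq_abs] at this
      linarith
    · rw [indicator_of_mem hy, indicator_of_notMem hz, zero_sub, abs_neg]
      exact key y _ t rfl hy hz
    · rw [indicator_of_notMem hy, indicator_of_mem hz, sub_zero]
      have := key (y + t • v) y (-t) (by module) hz hy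
      rwa [abs_neg] at this
    · rw [indicator_of_notMem hy, indicator_of_notMem hz]
      simp
      positivity
  · exact (aestronglyMeasurable_indicator_iff hSc.measurableSet).2
      (hcont.aestronglyMeasurable hSc.measurableSet)
  -- Differentiability of the extension along `v` can fail only on the boundary hyperplane, which is
  -- a null set.
  · have hnull : μ {y | ℓ y = 0} = 0 := by
      have h1 := Measure.addHaar_submodule μ (LinearMap.ker (ℓ : E →ₗ[ℝ] ℝ)) (by
        intro htop
        have : w ∈ LinearMap.ker (ℓ : E →ₗ[ℝ] ℝ) := htop ▸ Submodule.mem_top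
        exact hw.ne' this)
      exact h1
    have hae : ∀ᵐ y ∂μ, ℓ y ≠ 0 := by
      rw [ae_iff]
      simpa using hnull
    filter_upwards [hae] with y hy
    have hline : HasDerivAt (fun t : ℝ => y + t • v) v 0 := by
      simpa using ((hasDerivAt_id (0 : ℝ)).smul_const v).const_add y
    rcases lt_or_gt_of_ne hy with hneg | hpo
    · have hyS : y ∉ S := not_le.2 hneg
      rw [indicator_of_notMem hyS]
      have h0 : (fun t : ℝ => S.indicator g (y + t • v)) =ᶠ[𝓝 0] fun _ => 0 := by
        have hopen : IsOpen {z : E | ℓ z < 0} := isOpen_lt ℓ.continuous continuous_const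
        have hmem := hline.continuousAt.preimage_mem_nhds
          (hopen.mem_nhds (by simpa using hneg))
        filter_upwards [hmem] with t ht
        exact indicator_of_notMem (s := S) (not_le.2 (show ℓ (y + t • v) < 0 from ht)) g
      exact (hasDerivAt_const _ _).congr_of_eventuallyEq h0
    · have hyS : y ∈ S := le_of_lt hpo
      rw [indicator_of_mem hyS]
      have hnhds : S ∈ 𝓝 y := mem_interior_iff_mem_nhds.1 (hpos hpo)
      have hd : HasFDerivAt g (fderivWithin ℝ g S y) y :=
        ((hg.differentiableOn one_ne_zero) y hyS).hasFDerivWithinAt.hasFDerivAt hnhds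
      have hd' : HasFDerivAt g (fderivWithin ℝ g S y) (y + (0 : ℝ) • v) := by simpa using hd
      have h1 := hd'.comp_hasDerivAt (0 : ℝ) hline
      refine h1.congr_of_eventuallyEq ?_
      have hmem := hline.continuousAt.preimage_mem_nhds (t := S) (by simpa using hnhds)
      filter_upwards [hmem] with t ht
      exact indicator_of_mem (show y + t • v ∈ S from ht) g

/-- Stokes' theorem in a half-space, for forms of compact support whose restriction to the boundary
is zero. -/
theorem setIntegral_extDerivWithin_halfSpace_eq_zero (μ : Measure E) [μ.IsAddHaarMeasure]
    {ℓ : E →L[ℝ] ℝ} (hℓ : ℓ ≠ 0) {m : ℕ} (b : Basis (Fin (m + 1)) ℝ E)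
    {θ : E → E [⋀^Fin m]→L[ℝ] ℝ} {K : Set E} (hθ : ContDiffOn ℝ 1 θ {y | 0 ≤ ℓ y})
    (hK : IsCompact K) (hθK : ∀ y ∉ K, θ y = 0)
    (hbd : ∀ y, ℓ y = 0 → ∀ v : Fin m → E, (∀ j, ℓ (v j) = 0) → θ y v = 0) :
    ∫ y in {y | 0 ≤ ℓ y}, extDerivWithin θ {y | 0 ≤ ℓ y} y b ∂μ = 0 := by
  set S : Set E := {y | 0 ≤ ℓ y} with hSdef
  have hSc : IsClosed S := isClosed_le continuous_const ℓ.continuous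
  have hSu : UniqueDiffOn ℝ S := uniqueDiffOn_halfSpace hℓ
  obtain ⟨w, hw⟩ : ∃ w, ℓ w ≠ 0 := by
    by_contra hcon
    push Not at hcon
    exact hℓ (ContinuousLinearMap.ext hcon)
  have hℓ' : (ℓ : E →ₗ[ℝ] ℝ) ≠ 0 := fun h0 => hw (by simpa using congrArg (fun f => f w) h0)
  have hfin : finrank ℝ (LinearMap.ker (ℓ : E →ₗ[ℝ] ℝ)) = m := by
    have h1 := Module.Dual.finrank_ker_add_one_of_ne_zero (f := (ℓ : E →ₗ[ℝ] ℝ)) hℓ'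
    rw [Module.finrank_eq_card_basis b, Fintype.card_fin] at h1
    omega
  -- An adapted basis: `w` is transverse to the boundary and the other vectors are tangent to it. In
  -- the formula for `d`, a derivative along a tangent vector integrates to zero by itself, and the
  -- derivative along `w` acts on the value of `θ` on tangent vectors, which is zero on the
  -- boundary.
  set bk : Basis (Fin m) ℝ (LinearMap.ker (ℓ : E →ₗ[ℝ] ℝ)) := finBasisOfFinrankEq ℝ _ hfin
  set b' : Basis (Fin (m + 1)) ℝ E := Basis.mkFinCons w bk
    (by
      intro c x hx hcx
      have h1 := congrArg ℓ hcx
      have hx' : ℓ x = 0 := hx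
      simp only [map_add, map_smul, hx', smul_eq_mul, add_zero, map_zero] at h1
      exact (mul_eq_zero.1 h1).resolve_right hw)
    (by
      intro z
      refine ⟨-(ℓ z / ℓ w), ?_⟩
      change ℓ (z + -(ℓ z / ℓ w) • w) = 0
      simp only [map_add, map_smul, smul_eq_mul]
      field_simp
      ring) with hb'
  have hb's : ∀ j : Fin m, ℓ (b' j.succ) = 0 := by
    intro j
    rw [hb', Basis.coe_mkFinCons, Fin.cons_succ]
    exact (bk j).2
  have hdet : ∀ y, extDerivWithin θ S y b = b'.det b * extDerivWithin θ S y b' := by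
    intro y
    have h := congrArg (fun f : E [⋀^Fin (m + 1)]→ₗ[ℝ] ℝ => f b)
      (AlternatingMap.eq_smul_basis_det b' (extDerivWithin θ S y).toAlternatingMap)
    rw [mul_comm]
    exact h
  simp only [hdet]
  rw [integral_const_mul]
  refine mul_eq_zero_of_right _ ?_
  have hg : ∀ i : Fin (m + 1), ContDiffOn ℝ 1 (fun y => θ y (i.removeNth b')) S := fun i =>
    (ContinuousAlternatingMap.apply ℝ E ℝ (i.removeNth b')).contDiff.comp_contDiffOn hθ
  have hgK : ∀ i : Fin (m + 1), ∀ y ∉ K, θ y (i.removeNth b') = 0 := fun i y hy => by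
    rw [hθK y hy]
    rfl
  have hsum : EqOn (fun y => extDerivWithin θ S y b') (fun y => ∑ i : Fin (m + 1),
      (-1 : ℤ) ^ i.val • fderivWithin ℝ (fun y => θ y (i.removeNth b')) S y (b' i)) S :=
    fun y hy => extDerivWithin_apply ((hθ.differentiableOn one_ne_zero) y hy) (hSu y hy) b'
  rw [setIntegral_congr_fun hSc.measurableSet hsum, integral_finsetSum]
  · refine Finset.sum_eq_zero fun i _ => ?_
    simp only [zsmul_eq_mul]
    rw [integral_const_mul]
    refine mul_eq_zero_of_right _ ?_
    refine setIntegral_fderivWithin_halfSpace_eq_zero μ hℓ (hg i) hK (hgK i) ?_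
    refine Fin.cases (Or.inr fun y hy => ?_) (fun j => Or.inl (hb's j)) i
    exact hbd y hy _ fun j => by simpa [Fin.removeNth] using hb's j
  · intro i _
    simp only [zsmul_eq_mul]
    refine Integrable.const_mul ?_ _
    have hcont : ContinuousOn (fun y => fderivWithin ℝ (fun y => θ y (i.removeNth b')) S y (b' i)) S :=
      ((hg i).continuousOn_fderivWithin hSu le_rfl).clm_apply continuousOn_const
    have h1 : IntegrableOn (fun y => fderivWithin ℝ (fun y => θ y (i.removeNth b')) S y (b' i))
        (K ∩ S) μ :=
      (hcont.mono inter_subset_right).integrableOn_compact (hK.inter_right hSc)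
    refine h1.of_forall_sdiff_eq_zero hSc.measurableSet fun y hy => ?_
    have hyK : y ∉ K := fun hyK => hy.2 ⟨hyK, hy.1⟩
    have h0 : (fun y => θ y (i.removeNth b')) =ᶠ[𝓝[S] y] fun _ => 0 := by
      filter_upwards [mem_nhdsWithin_of_mem_nhds (hK.isClosed.isOpen_compl.mem_nhds hyK)] with z hz
      exact hgK i z hz
    rw [h0.fderivWithin_eq (hgK i y hyK)]
    simp

end HalfSpace

/-! ### The boundary of a manifold modelled on a half-space. -/

section Boundary

variable {E H Q : Type*} [NormedAddCommGroup E] [NormedSpace ℝ E] [TopologicalSpace H]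
  {I : ModelWithCorners ℝ E H} [TopologicalSpace Q] [ChartedSpace H Q] [IsManifold I ∞ Q]

/-- The model space is a closed half-space, given by the linear function `ℓ`. -/
structure IsHalfSpaceModel (I : ModelWithCorners ℝ E H) (ℓ : E →L[ℝ] ℝ) : Prop where
  ne_zero : ℓ ≠ 0
  range_eq : range I = {y | 0 ≤ ℓ y}

variable {ℓ : E →L[ℝ] ℝ}

theorem IsHalfSpaceModel.mem_range (hI : IsHalfSpaceModel I ℓ) {y : E} : y ∈ range I ↔ 0 ≤ ℓ y := by
  rw [hI.range_eq]
  rfl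

/-- Being an interior point can be tested in any chart, not only in the preferred one, and the
interior of the half-space is `ℓ > 0`. -/
theorem IsHalfSpaceModel.mem_boundary_iff [FiniteDimensional ℝ E] (hI : IsHalfSpaceModel I ℓ)
    (i : Q) {x : Q} (hx : x ∈ (extChartAt I i).source) :
    x ∈ I.boundary Q ↔ ℓ (extChartAt I i x) = 0 := by
  have : IsManifold I 1 Q := isManifold_one I
  rw [← I.compl_interior, mem_compl_iff]
  have hx' : x ∈ (chartAt H i).source := by rwa [extChartAt_source] at hx
  have h1 : x ∈ I.interior Q ↔ extChartAt I i x ∈ interior (extChartAt I i).target :=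
    I.isInteriorPoint_iff_of_mem_atlas (n := 1) one_ne_zero (chart_mem_atlas H i) hx'
  have h2 : extChartAt I i x ∈ interior (extChartAt I i).target ↔
      extChartAt I i x ∈ interior (range I) :=
    ⟨fun h => OpenPartialHomeomorph.interior_extend_target_subset_interior_range _ h,
      fun h => (chartAt H i).mem_interior_extend_target ((chartAt H i).map_source hx') h⟩
  rw [h1, h2, hI.range_eq, interior_halfSpace hI.ne_zero]
  have h3 : 0 ≤ ℓ (extChartAt I i x) := hI.mem_range.1 (extChartAt_mem_range i x)
  change ¬ (0 < ℓ (extChartAt I i x)) ↔ _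
  rw [not_lt]
  exact ⟨fun h => le_antisymm h h3, fun h => h.le⟩

theorem IsHalfSpaceModel.mem_boundary_symm_iff [FiniteDimensional ℝ E] (hI : IsHalfSpaceModel I ℓ)
    (i : Q) {y : E} (hy : y ∈ (extChartAt I i).target) :
    (extChartAt I i).symm y ∈ I.boundary Q ↔ ℓ y = 0 := by
  rw [hI.mem_boundary_iff i ((extChartAt I i).map_target hy), (extChartAt I i).right_inv hy]

theorem comp_toSpanSingleton_eq {F : Type*} [NormedAddCommGroup F] [NormedSpace ℝ F]
    (L : E →L[ℝ] F) (v : E) : L.comp (ContinuousLinearMap.toSpanSingleton ℝ v) =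
      ContinuousLinearMap.toSpanSingleton ℝ (L v) := by
  ext
  simp [ContinuousLinearMap.toSpanSingleton_apply]

/-- The required curve is a straight line in the hyperplane `ℓ = 0`, carried to `Q` by the inverse
chart. -/
theorem IsHalfSpaceModel.isTangentToBoundary_symm [FiniteDimensional ℝ E]
    (hI : IsHalfSpaceModel I ℓ) (i : Q) {y v : E} (hy : y ∈ (extChartAt I i).target)
    (hℓy : ℓ y = 0) (hv : ℓ v = 0) :
    IsTangentToBoundary I ((extChartAt I i).symm y)
      ((mfderivWithin 𝓘(ℝ, E) I (extChartAt I i).symm (range I) y : E →L[ℝ] E) v) := by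
  have : IsManifold I 1 Q := isManifold_one I
  have hzero : ∀ t : ℝ, ℓ (y + t • v) = 0 := fun t => by simp [hℓy, hv]
  have hline : HasFDerivAt (fun t : ℝ => y + t • v) (ContinuousLinearMap.toSpanSingleton ℝ v) 0 := by
    have := (((hasDerivAt_id (0 : ℝ)).smul_const v).const_add y).hasFDerivAt
    simpa using this
  refine ⟨fun t => (extChartAt I i).symm (y + t • v), by simp, ?_, ?_⟩
  · have h1 : ∀ᶠ t : ℝ in 𝓝 0, y + t • v ∈ (extChartAt I i).target := by
      have h2 : Tendsto (fun t : ℝ => y + t • v) (𝓝 0) (𝓝[range I] y) := by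
        refine tendsto_nhdsWithin_iff.2 ⟨by simpa using hline.continuousAt.tendsto, ?_⟩
        exact Eventually.of_forall fun t => hI.mem_range.2 (hzero t).ge
      exact h2 (extChartAt_target_mem_nhdsWithin_of_mem hy)
    filter_upwards [h1] with t ht
    exact (hI.mem_boundary_symm_iff i ht).2 (hzero t)
  · have h1 := (mdifferentiableWithinAt_extChartAt_symm (I := I) hy).hasMFDerivWithinAt
    have h2 : HasMFDerivWithinAt 𝓘(ℝ, ℝ) 𝓘(ℝ, E) (fun t : ℝ => y + t • v) univ 0
        (ContinuousLinearMap.toSpanSingleton ℝ v) := hline.hasFDerivWithinAt.hasMFDerivWithinAt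
    have hy0 : y + (0 : ℝ) • v = y := by simp
    have h1' : HasMFDerivWithinAt 𝓘(ℝ, E) I (extChartAt I i).symm (range I) (y + (0 : ℝ) • v)
        (mfderivWithin 𝓘(ℝ, E) I (extChartAt I i).symm (range I) y : E →L[ℝ] E) := by
      rw [hy0]
      exact h1
    have h3 := HasMFDerivWithinAt.comp (0 : ℝ) h1' h2
      (show univ ⊆ (fun t : ℝ => y + t • v) ⁻¹' range I from
        fun t _ => hI.mem_range.2 (hzero t).ge)
    rw [hasMFDerivWithinAt_univ] at h3
    exact h3.congr_mfderiv (comp_toSpanSingleton_eq (E := E) (F := E)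
      (mfderivWithin 𝓘(ℝ, E) I (extChartAt I i).symm (range I) y : E →L[ℝ] E) v)

theorem VanishesOnBoundary.inChart_apply [FiniteDimensional ℝ E] (hI : IsHalfSpaceModel I ℓ) {k : ℕ}
    {η : Form E Q k} (hη : VanishesOnBoundary I η) (i : Q) {y : E}
    (hy : y ∈ (extChartAt I i).target) (hℓy : ℓ y = 0) {v : Fin k → E} (hv : ∀ j, ℓ (v j) = 0) :
    inChart I η i y v = 0 :=
  hη _ ((hI.mem_boundary_symm_iff i hy).2 hℓy) _ fun j =>
    hI.isTangentToBoundary_symm i hy hℓy (hv j)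

theorem VanishesOnBoundary.add {k : ℕ} {η θ : Form E Q k} (hη : VanishesOnBoundary I η)
    (hθ : VanishesOnBoundary I θ) : VanishesOnBoundary I (η + θ) := fun x hx v hv => by
  rw [Pi.add_apply, ContinuousAlternatingMap.add_apply, hη x hx v hv, hθ x hx v hv, add_zero]

theorem VanishesOnBoundary.fun_smul {k : ℕ} {η : Form E Q k} (hη : VanishesOnBoundary I η)
    (f : Q → ℝ) : VanishesOnBoundary I (fun x => f x • η x) := fun x hx v hv => by
  rw [ContinuousAlternatingMap.smul_apply, hη x hx v hv, smul_zero]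

theorem VanishesOnBoundary.const_smul {k : ℕ} {η : Form E Q k} (hη : VanishesOnBoundary I η)
    (c : ℝ) : VanishesOnBoundary I (c • η) := hη.fun_smul fun _ => c

theorem VanishesOnBoundary.wedgeOne_left {k : ℕ} {α : Form E Q 1} (hα : VanishesOnBoundary I α)
    (η : Form E Q k) : VanishesOnBoundary I (wedgeOne α η) := fun x hx v hv => by
  change wedgeForm (α x) (η x) v = 0
  rw [wedgeForm_apply]
  refine Finset.sum_eq_zero fun i _ => ?_
  rw [hα x hx _ fun _ => hv i]
  simp

theorem VanishesOnBoundary.wedgeOne_right {k : ℕ} (α : Form E Q 1) {η : Form E Q k}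
    (hη : VanishesOnBoundary I η) : VanishesOnBoundary I (wedgeOne α η) := fun x hx v hv => by
  change wedgeForm (α x) (η x) v = 0
  rw [wedgeForm_apply]
  refine Finset.sum_eq_zero fun i _ => ?_
  rw [hη x hx (i.removeNth v) fun j => hv _]
  simp

/-- A diffeomorphism preserves the boundary, hence carries curves in the boundary to such curves. -/
theorem VanishesOnBoundary.pullback [FiniteDimensional ℝ E] {k : ℕ} {η : Form E Q k}
    (hη : VanishesOnBoundary I η) (χ : Diffeomorph I I Q Q ∞) :
    VanishesOnBoundary I (pullback I I χ η) := by
  intro x hx v hv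
  have : IsManifold I 1 Q := isManifold_one I
  have hb : ∀ z ∈ I.boundary Q, χ z ∈ I.boundary Q := fun z hz => by
    rw [← Diffeomorph.preimage_boundary (n := ∞) (by simp) χ] at hz
    exact hz
  refine hη _ (hb x hx) _ fun j => ?_
  obtain ⟨γ, rfl, hγ, hd⟩ := hv j
  refine ⟨χ ∘ γ, rfl, hγ.mono fun t ht => hb _ ht, ?_⟩
  have h := HasMFDerivAt.comp (0 : ℝ) (χ.contMDiff.mdifferentiable (by simp) (γ 0)).hasMFDerivAt hd
  exact h.congr_mfderiv (comp_toSpanSingleton_eq (E := E) (F := E)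
    (mfderiv I I χ (γ 0) : E →L[ℝ] E) (v j))

theorem extD_congr {k : ℕ} {η θ : Form E Q k} {x : Q} (h : η =ᶠ[𝓝 x] θ) :
    extD I η x = extD I θ x := by
  rw [extD_eq, extD_eq]
  refine EventuallyEq.extDerivWithin_eq_of_mem ?_ (extChartAt_mem_range x x)
  have hc : Tendsto (extChartAt I x).symm (𝓝[range I] (extChartAt I x x)) (𝓝 x) := by
    have := (continuousAt_extChartAt_symm (I := I) x).tendsto
    rw [extChartAt_to_inv] at this
    exact this.mono_left nhdsWithin_le_nhds
  filter_upwards [hc h] with y hy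
  rw [inChart, inChart]
  rw [show η ((extChartAt I x).symm y) = θ ((extChartAt I x).symm y) from hy]

theorem extD_zero {k : ℕ} : extD I (0 : Form E Q k) = 0 := by
  have := extD_smul (I := I) (Q := Q) (k := k) 0 0
  simpa using this

theorem IsSmoothForm.sum {k : ℕ} {ι : Type*} (s : Finset ι) {η : ι → Form E Q k}
    (hη : ∀ i ∈ s, IsSmoothForm I (η i)) : IsSmoothForm I (∑ i ∈ s, η i) :=
  Finset.sum_induction η (IsSmoothForm I) (fun _ _ => IsSmoothForm.add) isSmoothForm_zero hη

theorem extD_sum {k : ℕ} {ι : Type*} (s : Finset ι) {η : ι → Form E Q k}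
    (hη : ∀ i ∈ s, IsSmoothForm I (η i)) : extD I (∑ i ∈ s, η i) = ∑ i ∈ s, extD I (η i) := by
  classical
  induction s using Finset.induction_on with
  | empty => simp [extD_zero]
  | insert a s ha ih =>
    rw [Finset.sum_insert ha, Finset.sum_insert ha, extD_add (hη a (Finset.mem_insert_self _ _))
      (IsSmoothForm.sum s fun i hi => hη i (Finset.mem_insert_of_mem hi)),
      ih fun i hi => hη i (Finset.mem_insert_of_mem hi)]

end Boundary

/-! ### Stokes' theorem on a compact manifold, for forms that restrict to zero on the boundary. -/

section Stokes

variable {E H Q : Type*} [NormedAddCommGroup E] [NormedSpace ℝ E] [TopologicalSpace H]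
  {I : ModelWithCorners ℝ E H} [TopologicalSpace Q] [ChartedSpace H Q] [IsManifold I ∞ Q]
  [FiniteDimensional ℝ E] [MeasurableSpace E] [BorelSpace E] [T2Space Q] [CompactSpace Q]
  {ℓ : E →L[ℝ] ℝ}

theorem formIntegral_sum {n : ℕ} [hn : Fact (finrank ℝ E = n)] {μ : Form E Q n}
    (hμ : IsVolumeForm I μ) {ι : Type*} (s : Finset ι) {η : ι → Form E Q n}
    (hη : ∀ i ∈ s, IsSmoothForm I (η i)) :
    formIntegral I μ (∑ i ∈ s, η i) = ∑ i ∈ s, formIntegral I μ (η i) := by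
  classical
  induction s using Finset.induction_on with
  | empty =>
    have := formIntegral_smul (I := I) (0 : ℝ) μ 0
    simpa using this
  | insert a s ha ih =>
    rw [Finset.sum_insert ha, Finset.sum_insert ha, formIntegral_add hμ
      (hη a (Finset.mem_insert_self _ _))
      (IsSmoothForm.sum s fun i hi => hη i (Finset.mem_insert_of_mem hi)),
      ih fun i hi => hη i (Finset.mem_insert_of_mem hi)]

/-- The integral of a form that is supported in a chart. -/
theorem formIntegral_eq_chartIntegral {n : ℕ} [hn : Fact (finrank ℝ E = n)] {μ ν : Form E Q n}
    (hμ : IsVolumeForm I μ) (hν : IsSmoothForm I ν) {K : Set Q} (hK : IsClosed K) (i : Q)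
    (hKi : K ⊆ (extChartAt I i).source) (hνK : ∀ x ∉ K, ν x = 0) :
    formIntegral I μ ν = chartIntegral I μ ν i := by
  obtain ⟨s, hs, hs1⟩ := exists_finset_partition (chartPartition Q I)
  set ρ := chartPartition Q I
  have hρc : ∀ i, Continuous (ρ i) := fun i => (ρ i).contMDiff.continuous
  -- A continuous cut-off equal to `1` on `K` and supported in the chart: `ν` equals `f • ν`, which
  -- has the shape required by the additivity of the chart integral.
  obtain ⟨W, hWo, hKW, hWi⟩ := normal_exists_closure_subset hK (isOpen_extChartAt_source i) hKi
  obtain ⟨f, hf0, hf1, -⟩ := exists_continuous_zero_one_of_isClosed (hWo.isClosed_compl) hK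
    (disjoint_left.2 fun x hx hx' => hx (hKW hx'))
  have hfs : tsupport f ⊆ (extChartAt I i).source := by
    refine (closure_mono fun x hx => ?_).trans hWi
    by_contra hxW
    exact hx (hf0 hxW)
  have hfν : ∀ x, f x • ν x = ν x := by
    intro x
    by_cases hx : x ∈ K
    · rw [hf1 hx]
      simp
    · rw [hνK x hx, smul_zero]
  rw [formIntegral_eq_sum μ _ hs]
  have h1 : chartIntegral I μ ν i = ∑ j ∈ s, chartIntegral I μ (fun x => (ρ j x * f x) • ν x) i := by
    rw [← chartIntegral_sum hμ hν s (f := fun j x => ρ j x * f x)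
      (fun j _ => (hρc j).mul f.continuous)
      (fun j _ => (tsupport_mul_subset_right).trans hfs)]
    congr 1
    ext1 x
    rw [← Finset.sum_mul, hs1, one_mul, hfν]
  rw [h1]
  refine Finset.sum_congr rfl fun j _ => ?_
  have h2 : (fun x => (ρ j x * f x) • ν x) = fun x => ρ j x • ν x := by
    ext1 x
    rw [mul_smul, hfν]
  rw [h2]
  -- The identity diffeomorphism moves the piece `ρ j • ν` from the chart `i` to the chart `j`.
  have h3 := chartIntegral_pullback (μ := μ) (Diffeomorph.refl I Q ∞)
    (fun x => ⟨1, one_pos, by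
      rw [one_smul]
      exact congrFun (pullback_id (I := I) μ) x⟩) (fun x => ρ j x • ν x) i j (by
      intro x hx
      have hx' : ρ j x • ν x ≠ 0 := hx
      refine ⟨hKi ?_, tsupport_chartPartition j (subset_tsupport _ ?_)⟩
      · by_contra hxK
        exact hx' (by rw [hνK x hxK, smul_zero])
      · intro h0
        have h0' : ρ j x = 0 := h0
        exact hx' (by rw [h0', zero_smul]))
  rw [← h3]
  congr 1
  exact pullback_id (I := I) _

theorem inChart_basis_ne_zero {n : ℕ} {μ : Form E Q n} (hμ : IsVolumeForm I μ) (i : Q)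
    (b : Basis (Fin n) ℝ E) {y : E} (hy : y ∈ (extChartAt I i).target) :
    inChart I μ i y b ≠ 0 := by
  intro h0
  have h1 : inChart I μ i y = 0 := by
    ext v
    have := AlternatingMap.eq_smul_basis_det b (inChart I μ i y).toAlternatingMap
    change _ = (inChart I μ i y b) • _ at this
    rw [h0, zero_smul] at this
    exact congrArg (fun g : E [⋀^Fin n]→ₗ[ℝ] ℝ => g v) this
  refine hμ.2 ((extChartAt I i).symm y) ?_
  rw [eq_inChart_comp (I := I) μ i ((extChartAt I i).map_target hy),
    (extChartAt I i).right_inv hy, h1]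
  rfl

/-- A volume form has a continuous coefficient without zeros. Hence the orientation sign is locally
constant and can be taken through derivatives. -/
theorem eventually_sign_inChart_eq {n : ℕ} {μ : Form E Q n} (hμ : IsVolumeForm I μ) (i : Q)
    (b : Basis (Fin n) ℝ E) {y : E} (hy : y ∈ (extChartAt I i).target) :
    ∀ᶠ z in 𝓝[range I] y, SignType.sign (inChart I μ i z b) =
      SignType.sign (inChart I μ i y b) := by
  have h1 : ContinuousWithinAt (fun z => inChart I μ i z b) (range I) y :=
    (ContinuousAlternatingMap.apply ℝ E ℝ b).continuous.continuousAt.comp_continuousWithinAt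
      (hμ.1.contDiffWithinAt i hy).continuousWithinAt
  have h2 : ContinuousAt SignType.sign (inChart I μ i y b) :=
    continuousAt_sign_of_ne_zero (inChart_basis_ne_zero hμ i b hy)
  have h3 := ContinuousAt.comp_continuousWithinAt (f := fun z => inChart I μ i z b) h2 h1
  exact h3.tendsto (by simp : {SignType.sign (inChart I μ i y b)} ∈ 𝓝 _)

theorem chartIntegral_extD_eq_zero (hI : IsHalfSpaceModel I ℓ) {m : ℕ}
    [hn : Fact (finrank ℝ E = m + 1)] {μ : Form E Q (m + 1)} (hμ : IsVolumeForm I μ)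
    {ν : Form E Q m} (hν : IsSmoothForm I ν) (hb : VanishesOnBoundary I ν) (i : Q) {K : Set Q}
    (hK : IsClosed K) (hKi : K ⊆ (extChartAt I i).source) (hνK : ∀ x ∉ K, ν x = 0) :
    chartIntegral I μ (extD I ν) i = 0 := by
  classical
  set b := modelBasis E (m + 1)
  set K' : Set E := extChartAt I i '' K with hK'
  have hKc : IsCompact K' := hK.isCompact.image_of_continuousOn ((continuousOn_extChartAt i).mono hKi)
  have hKt : K' ⊆ (extChartAt I i).target := by
    rintro _ ⟨x, hx, rfl⟩
    exact (extChartAt I i).map_source (hKi hx)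
  set sg : E → ℝ := fun y => (SignType.sign (inChart I μ i y b) : ℝ) with hsg
  -- The coefficients with their orientation sign, extended by zero to the half-space. The extension
  -- is `C^1` because the support is compact inside the target and the sign is locally constant.
  set θ : E → E [⋀^Fin m]→L[ℝ] ℝ := (extChartAt I i).target.indicator
    fun y => sg y • inChart I ν i y with hθ
  have hzero : ∀ y ∉ K', θ y = 0 := by
    intro y hy
    by_cases hyt : y ∈ (extChartAt I i).target
    · rw [hθ, indicator_of_mem hyt]
      have h0 : ν ((extChartAt I i).symm y) = 0 := hνK _ fun hmem =>
        hy ⟨_, hmem, (extChartAt I i).right_inv hyt⟩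
      have h1 : inChart I ν i y = 0 := by
        rw [inChart, h0]
        rfl
      rw [h1, smul_zero]
    · exact indicator_of_notMem hyt _
  have hloc : ∀ y ∈ (extChartAt I i).target,
      θ =ᶠ[𝓝[range I] y] fun z => sg y • inChart I ν i z := by
    intro y hy
    filter_upwards [eventually_sign_inChart_eq hμ i b hy,
      extChartAt_target_mem_nhdsWithin_of_mem hy] with z hz hzt
    rw [hθ, indicator_of_mem hzt]
    simp only [hsg, hz]
  have hloc0 : ∀ y ∉ (extChartAt I i).target, θ =ᶠ[𝓝[range I] y] fun _ => 0 := by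
    intro y hy
    filter_upwards [mem_nhdsWithin_of_mem_nhds
      (hKc.isClosed.isOpen_compl.mem_nhds fun h => hy (hKt h))] with z hz
    exact hzero z hz
  have hsmooth : ContDiffOn ℝ 1 θ (range I) := by
    intro y hy
    by_cases hyt : y ∈ (extChartAt I i).target
    · refine ContDiffWithinAt.congr_of_eventuallyEq ?_ (hloc y hyt)
        ((hloc y hyt).self_of_nhdsWithin hy)
      exact (((hν.contDiffWithinAt i hyt).of_le (by simp)).const_smul (sg y))
    · exact contDiffWithinAt_const.congr_of_eventuallyEq (hloc0 y hyt)
        ((hloc0 y hyt).self_of_nhdsWithin hy)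
  have hext : ∀ y ∈ range I, extDerivWithin θ (range I) y b =
      (extChartAt I i).target.indicator (fun y => sg y * inChart I (extD I ν) i y b) y := by
    intro y hy
    by_cases hyt : y ∈ (extChartAt I i).target
    · rw [indicator_of_mem hyt, (hloc y hyt).extDerivWithin_eq_of_mem hy, hν.inChart_extD i hyt,
        extDerivWithin_fun_smul]
      · rfl
      · exact I.uniqueDiffOn y hy
    · rw [indicator_of_notMem hyt, (hloc0 y hyt).extDerivWithin_eq_of_mem hy]
      simp [extDerivWithin, ContinuousAlternatingMap.alternatizeUncurryFin_apply]
  have hst := setIntegral_extDerivWithin_halfSpace_eq_zero b.addHaar hI.ne_zero b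
    (θ := θ) (K := K') (hI.range_eq ▸ hsmooth) hKc hzero (by
      intro y hy v hv
      by_cases hyt : y ∈ (extChartAt I i).target
      · rw [hθ, indicator_of_mem hyt, ContinuousAlternatingMap.smul_apply,
          hb.inChart_apply hI i hyt hy hv, smul_zero]
      · rw [hθ, indicator_of_notMem hyt]
        rfl)
  rw [← hI.range_eq, setIntegral_congr_fun I.isClosed_range.measurableSet hext,
    setIntegral_indicator (measurableSet_target i),
    inter_eq_self_of_subset_right (extChartAt_target_subset_range i)] at hst
  exact hst

/-- Stokes' theorem for forms whose restriction to the boundary is zero. -/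
theorem formIntegral_extD_eq_zero (hI : IsHalfSpaceModel I ℓ) {m : ℕ}
    [hn : Fact (finrank ℝ E = m + 1)] {μ : Form E Q (m + 1)} (hμ : IsVolumeForm I μ)
    {ν : Form E Q m} (hν : IsSmoothForm I ν) (hb : VanishesOnBoundary I ν) :
    formIntegral I μ (extD I ν) = 0 := by
  obtain ⟨s, hs, hs1⟩ := exists_finset_partition (chartPartition Q I)
  set ρ := chartPartition Q I
  have hsm : ∀ i ∈ s, IsSmoothForm I (fun x => ρ i x • ν x) := fun i _ =>
    hν.fun_smul (ρ i).contMDiff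
  have hsum : ν = ∑ i ∈ s, fun x => ρ i x • ν x := by
    ext1 x
    rw [Finset.sum_apply, ← Finset.sum_smul, hs1, one_smul]
  rw [hsum, extD_sum s hsm, formIntegral_sum hμ s fun i hi => (hsm i hi).extD]
  refine Finset.sum_eq_zero fun i hi => ?_
  have hout : ∀ x ∉ tsupport (ρ i), ρ i x • ν x = 0 := fun x hx => by
    rw [image_eq_zero_of_notMem_tsupport hx, zero_smul]
  rw [formIntegral_eq_chartIntegral hμ (hsm i hi).extD (isClosed_tsupport (ρ i)) i
    (tsupport_chartPartition i)]
  · exact chartIntegral_extD_eq_zero hI hμ (hsm i hi) (hb.fun_smul _) i (isClosed_tsupport (ρ i))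
      (tsupport_chartPartition i) hout
  · intro x hx
    have h0 : (fun x => ρ i x • ν x) =ᶠ[𝓝 x] (0 : Form E Q m) := by
      filter_upwards [(isClosed_tsupport (ρ i)).isOpen_compl.mem_nhds hx] with z hz
      exact hout z hz
    rw [extD_congr h0, extD_zero]
    rfl

end Stokes

/-! ### Poincaré's lemma on convex sets and line integrals. -/

section Lines

variable {E H Q : Type*} [NormedAddCommGroup E] [NormedSpace ℝ E] [TopologicalSpace H]
  {I : ModelWithCorners ℝ E H} [TopologicalSpace Q] [ChartedSpace H Q]
  {E' H' Q' : Type*} [NormedAddCommGroup E'] [NormedSpace ℝ E'] [TopologicalSpace H']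
  {I' : ModelWithCorners ℝ E' H'} [TopologicalSpace Q'] [ChartedSpace H' Q']
  {E₁ : Type*} [NormedAddCommGroup E₁] [NormedSpace ℝ E₁]

/-- An alternating `1`-form as a covector. -/
def toCovector (a : E [⋀^Fin 1]→L[ℝ] ℝ) : E →L[ℝ] ℝ :=
  (ContinuousAlternatingMap.ofSubsingleton ℝ E ℝ (0 : Fin 1)).symm a

/-- Poincaré's lemma for `1`-forms on convex sets. -/
theorem exists_primitive_of_extDerivWithin_eq_zero {S : Set E₁} (hS : Convex ℝ S)
    (hSu : UniqueDiffOn ℝ S) {θ : E₁ → E₁ [⋀^Fin 1]→L[ℝ] ℝ} (hθ : ContDiffOn ℝ ∞ θ S)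
    (hd : ∀ t ∈ S, extDerivWithin θ S t = 0) :
    ∃ T : E₁ → ℝ, ContDiffOn ℝ ∞ T S ∧ ∀ t ∈ S, HasFDerivWithinAt T (toCovector (θ t)) S t := by
  set L : (E₁ [⋀^Fin 1]→L[ℝ] ℝ) ≃ₗᵢ[ℝ] (E₁ →L[ℝ] ℝ) :=
    (ContinuousAlternatingMap.ofSubsingletonLIE (0 : Fin 1)).symm with hL
  have hdiff : DifferentiableOn ℝ θ S := hθ.differentiableOn (by simp)
  have hLθ : ContDiffOn ℝ ∞ (fun t => toCovector (θ t)) S := L.contDiff.comp_contDiffOn hθ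
  have hfd : ∀ t ∈ S, ∀ v w, fderivWithin ℝ (fun t => toCovector (θ t)) S t v w =
      fderivWithin ℝ θ S t v fun _ => w := by
    intro t ht v w
    have h1 := L.toContinuousLinearEquiv.comp_fderivWithin (f := θ) (hSu t ht)
    exact congrArg (fun f : E₁ →L[ℝ] E₁ →L[ℝ] ℝ => f v w) h1
  obtain ⟨T, hT⟩ := hS.exists_forall_hasFDerivWithinAt_of_fderivWithin_symmetric
    (hLθ.differentiableOn (by simp)) (fun t ht v _ w _ => by
      rw [hfd t ht, hfd t ht]
      have h1 := congrArg (fun f : E₁ [⋀^Fin 2]→L[ℝ] ℝ => f ![v, w]) (hd t ht)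
      change ContinuousAlternatingMap.alternatizeUncurryFin (fderivWithin ℝ θ S t) ![v, w] = 0 at h1
      rw [alternatizeUncurryFin_one_apply] at h1
      simp only [Matrix.cons_val_zero, Matrix.cons_val_one] at h1
      linarith)
  refine ⟨T, ?_, hT⟩
  -- The derivative of `T` is smooth, so `T` is; `∞ + 1 = ∞` makes this a single step.
  rw [show (∞ : WithTop ℕ∞) = ∞ + 1 from rfl, contDiffOn_succ_iff_fderivWithin hSu]
  refine ⟨fun t ht => (hT t ht).differentiableWithinAt, by simp, ?_⟩
  exact hLθ.congr fun t ht => (hT t ht).fderivWithin (hSu t ht)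

variable (I) in
/-- The integral of a `1`-form along a curve parametrized by `[0, 1]`. -/
def lineIntegral (η : Form E Q 1) (γ : ℝ → Q) : ℝ :=
  ∫ u in (0 : ℝ)..1, pullWithin I (Icc 0 1) γ η u fun _ => 1

theorem lineIntegral_congr (η : Form E Q 1) {γ γ' : ℝ → Q} (h : EqOn γ γ' (Icc 0 1)) :
    lineIntegral I η γ = lineIntegral I η γ' := by
  refine intervalIntegral.integral_congr fun u hu => ?_
  rw [uIcc_of_le zero_le_one] at hu
  have h1 : mfderivWithin 𝓘(ℝ, ℝ) I γ (Icc 0 1) u = mfderivWithin 𝓘(ℝ, ℝ) I γ' (Icc 0 1) u :=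
    mfderivWithin_congr h (h hu)
  change η (γ u) _ = η (γ' u) _
  rw [h1, h hu]

theorem uniqueDiffOn_unitInterval : UniqueDiffOn ℝ (Icc (0 : ℝ) 1) := uniqueDiffOn_Icc zero_lt_one

theorem lineIntegral_add_of_intervalIntegrable {η θ : Form E Q 1} {γ : ℝ → Q}
    (hη : IntervalIntegrable (fun u => pullWithin I (Icc 0 1) γ η u fun _ => 1) volume 0 1)
    (hθ : IntervalIntegrable (fun u => pullWithin I (Icc 0 1) γ θ u fun _ => 1) volume 0 1) :
    lineIntegral I (η + θ) γ = lineIntegral I η γ + lineIntegral I θ γ := by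
  rw [lineIntegral, lineIntegral, lineIntegral, ← intervalIntegral.integral_add hη hθ]
  rfl

theorem lineIntegral_smul (c : ℝ) (η : Form E Q 1) (γ : ℝ → Q) :
    lineIntegral I (c • η) γ = c * lineIntegral I η γ := by
  rw [lineIntegral, lineIntegral, ← intervalIntegral.integral_const_mul]
  rfl

theorem lineIntegral_pullback (η : Form E' Q' 1) {f : Q → Q'} (hf : MDifferentiable I I' f)
    {γ : ℝ → Q} (hγ : ContMDiffOn 𝓘(ℝ, ℝ) I ∞ γ (Icc 0 1)) :
    lineIntegral I (pullback I I' f η) γ = lineIntegral I' η (f ∘ γ) := by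
  refine intervalIntegral.integral_congr fun u hu => ?_
  rw [uIcc_of_le zero_le_one] at hu
  have := pullWithin_pullback (s := Icc (0 : ℝ) 1) (g := γ) (t := u) η (hf (γ u))
    ((hγ u hu).mdifferentiableWithinAt (by simp)) (uniqueDiffOn_unitInterval u hu)
  exact congrArg (fun a : ℝ [⋀^Fin 1]→L[ℝ] ℝ => a fun _ => 1) this

theorem lineIntegral_differential {f : Q → ℝ} (hf : ContMDiff I 𝓘(ℝ, ℝ) ∞ f) {γ : ℝ → Q}
    (hγ : ContMDiffOn 𝓘(ℝ, ℝ) I ∞ γ (Icc 0 1)) :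
    lineIntegral I (differential I f) γ = f (γ 1) - f (γ 0) := by
  have hfγ : ContDiffOn ℝ ∞ (f ∘ γ) (Icc 0 1) := (hf.comp_contMDiffOn hγ).contDiffOn
  have h1 : ∀ u ∈ Icc (0 : ℝ) 1, pullWithin I (Icc 0 1) γ (differential I f) u (fun _ => 1) =
      derivWithin (f ∘ γ) (Icc 0 1) u := by
    intro u hu
    have h2 := mfderiv_comp_mfderivWithin u (hf.mdifferentiable (by simp) (γ u))
      ((hγ u hu).mdifferentiableWithinAt (by simp)) (uniqueDiffOn_unitInterval u hu).uniqueMDiffWithinAt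
    rw [mfderivWithin_eq_fderivWithin] at h2
    exact congrArg (fun L : ℝ →L[ℝ] ℝ => L 1) h2.symm
  rw [lineIntegral, intervalIntegral.integral_congr (g := derivWithin (f ∘ γ) (Icc 0 1))
    (fun u hu => h1 u (by rwa [uIcc_of_le zero_le_one] at hu))]
  refine intervalIntegral.integral_eq_sub_of_hasDerivAt_of_le (f := f ∘ γ) zero_le_one
    hfγ.continuousOn (fun u hu => ?_) ?_
  · exact ((hfγ.differentiableOn (by simp)) u
      (Ioo_subset_Icc_self hu)).hasDerivWithinAt.hasDerivAt (Icc_mem_nhds hu.1 hu.2)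
  · refine ContinuousOn.intervalIntegrable ?_
    rw [uIcc_of_le zero_le_one]
    exact hfγ.continuousOn_derivWithin uniqueDiffOn_unitInterval (by simp)

variable [IsManifold I ∞ Q]

theorem IsSmoothForm.continuousOn_pullWithin_apply {η : Form E Q 1} (hη : IsSmoothForm I η)
    {S : Set E₁} {f : E₁ → Q} (hf : ContMDiffOn 𝓘(ℝ, E₁) I ∞ f S) (hS : UniqueDiffOn ℝ S) (v : E₁) :
    ContinuousOn (fun t => pullWithin I S f η t fun _ => v) S :=
  (ContinuousAlternatingMap.apply ℝ E₁ ℝ fun _ => v).continuous.comp_continuousOn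
    (hη.contDiffOn_pullWithin hf hS).continuousOn

theorem IsSmoothForm.intervalIntegrable_pullWithin {η : Form E Q 1} (hη : IsSmoothForm I η)
    {γ : ℝ → Q} (hγ : ContMDiffOn 𝓘(ℝ, ℝ) I ∞ γ (Icc 0 1)) :
    IntervalIntegrable (fun u => pullWithin I (Icc 0 1) γ η u fun _ => 1) volume 0 1 := by
  refine ContinuousOn.intervalIntegrable ?_
  rw [uIcc_of_le zero_le_one]
  exact hη.continuousOn_pullWithin_apply hγ uniqueDiffOn_unitInterval 1

theorem lineIntegral_add {η θ : Form E Q 1} (hη : IsSmoothForm I η) (hθ : IsSmoothForm I θ)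
    {γ : ℝ → Q} (hγ : ContMDiffOn 𝓘(ℝ, ℝ) I ∞ γ (Icc 0 1)) :
    lineIntegral I (η + θ) γ = lineIntegral I η γ + lineIntegral I θ γ :=
  lineIntegral_add_of_intervalIntegrable (hη.intervalIntegrable_pullWithin hγ)
    (hθ.intervalIntegrable_pullWithin hγ)

theorem pullWithin_line {S : Set E₁} (hS : Convex ℝ S) {f : E₁ → Q}
    (hf : ContMDiffOn 𝓘(ℝ, E₁) I ∞ f S) (η : Form E Q 1) {p q : E₁} (hp : p ∈ S) (hq : q ∈ S)
    {u : ℝ} (hu : u ∈ Icc (0 : ℝ) 1) :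
    pullWithin I (Icc 0 1) (fun u => f (p + u • (q - p))) η u (fun _ => 1) =
      pullWithin I S f η (p + u • (q - p)) fun _ => q - p := by
  have hd : HasDerivAt (fun u : ℝ => p + u • (q - p)) (q - p) u := by
    simpa using ((hasDerivAt_id u).smul_const (q - p)).const_add p
  have hm : MapsTo (fun u : ℝ => p + u • (q - p)) (Icc 0 1) S :=
    fun u hu => hS.add_smul_sub_mem hp hq hu
  have := pullWithin_comp (s := S) (f := f) (s₂ := Icc (0 : ℝ) 1)
    (g := fun u : ℝ => p + u • (q - p)) (t := u) η
    ((hf _ (hm hu)).mdifferentiableWithinAt (by simp)) hd.differentiableAt.differentiableWithinAt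
    hm (uniqueDiffOn_unitInterval u hu)
  refine (congrArg (fun a : ℝ [⋀^Fin 1]→L[ℝ] ℝ => a fun _ => 1) this).trans ?_
  refine congrArg (pullWithin I S f η (p + u • (q - p))) ?_
  ext1 _
  have h3 := hd.hasDerivWithinAt (s := Icc (0 : ℝ) 1)
    |>.hasFDerivWithinAt.fderivWithin (uniqueDiffOn_unitInterval u hu)
  exact (congrArg (fun L : ℝ →L[ℝ] E₁ => L 1) h3).trans (one_smul ℝ _)

theorem contMDiffOn_line {S : Set E₁} (hS : Convex ℝ S) {f : E₁ → Q}
    (hf : ContMDiffOn 𝓘(ℝ, E₁) I ∞ f S) {p q : E₁} (hp : p ∈ S) (hq : q ∈ S) :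
    ContMDiffOn 𝓘(ℝ, ℝ) I ∞ (fun u : ℝ => f (p + u • (q - p))) (Icc 0 1) := by
  have h1 : ContDiff ℝ ∞ fun u : ℝ => p + u • (q - p) := by fun_prop
  exact hf.comp h1.contMDiff.contMDiffOn fun u hu => hS.add_smul_sub_mem hp hq hu

/-- The integral along a segment in a convex set on which the form has a primitive. -/
theorem lineIntegral_eq_sub {S : Set E₁} (hS : Convex ℝ S)
    {f : E₁ → Q} (hf : ContMDiffOn 𝓘(ℝ, E₁) I ∞ f S) {η : Form E Q 1} (hη : IsSmoothForm I η)
    {T : E₁ → ℝ} (hT : ∀ t ∈ S, HasFDerivWithinAt T (toCovector (pullWithin I S f η t)) S t)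
    {p q : E₁} (hp : p ∈ S) (hq : q ∈ S) :
    lineIntegral I η (fun u => f (p + u • (q - p))) = T q - T p := by
  have hm : MapsTo (fun u : ℝ => p + u • (q - p)) (Icc 0 1) S :=
    fun u hu => hS.add_smul_sub_mem hp hq hu
  have hder : ∀ u ∈ Icc (0 : ℝ) 1, HasDerivWithinAt (fun u : ℝ => T (p + u • (q - p)))
      (pullWithin I (Icc 0 1) (fun u => f (p + u • (q - p))) η u fun _ => 1) (Icc 0 1) u := by
    intro u hu
    rw [pullWithin_line hS hf η hp hq hu]
    have hd : HasDerivAt (fun u : ℝ => p + u • (q - p)) (q - p) u := by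
      simpa using ((hasDerivAt_id u).smul_const (q - p)).const_add p
    exact (hT _ (hm hu)).comp_hasDerivWithinAt u hd.hasDerivWithinAt hm
  have h := intervalIntegral.integral_eq_sub_of_hasDerivAt_of_le
    (f := fun u : ℝ => T (p + u • (q - p))) zero_le_one
    (fun u hu => (hder u hu).continuousWithinAt)
    (fun u hu => (hder u (Ioo_subset_Icc_self hu)).hasDerivAt (Icc_mem_nhds hu.1 hu.2))
    (hη.intervalIntegrable_pullWithin (contMDiffOn_line hS hf hp hq))
  rw [lineIntegral, h]
  simp

/-- Only the pullback has to be closed, not `η` itself. This matters for squares swept out inside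
the boundary, where `dη` merely restricts to zero. -/
theorem exists_primitive_of_pullWithin_extD_eq_zero {S : Set E₁} (hS : Convex ℝ S)
    (hSi : (interior S).Nonempty) {f : E₁ → Q} (hf : ContMDiffOn 𝓘(ℝ, E₁) I ∞ f S)
    {η : Form E Q 1} (hη : IsSmoothForm I η) (hd : ∀ t ∈ S, pullWithin I S f (extD I η) t = 0) :
    ∃ T : E₁ → ℝ, ContDiffOn ℝ ∞ T S ∧
      ∀ t ∈ S, HasFDerivWithinAt T (toCovector (pullWithin I S f η t)) S t := by
  have hSu := uniqueDiffOn_convex hS hSi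
  refine exists_primitive_of_extDerivWithin_eq_zero hS hSu (hη.contDiffOn_pullWithin hf hSu) ?_
  intro t ht
  rw [hη.extDerivWithin_pullWithin hf hSu ht, hd t ht]
  rw [hS.closure_interior_eq_closure_of_nonempty_interior hSi]
  exact subset_closure ht

end Lines

/-! ### Integrals of partial derivatives over a triangle. -/

section Triangle

/-- The standard triangle in the plane. -/
def triangle : Set (ℝ × ℝ) := {p | 0 ≤ p.1 ∧ 0 ≤ p.2 ∧ p.1 + p.2 ≤ 1}

theorem isClosed_triangle : IsClosed triangle :=
  (isClosed_le continuous_const continuous_fst).inter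
    ((isClosed_le continuous_const continuous_snd).inter
      (isClosed_le (continuous_fst.add continuous_snd) continuous_const))

theorem isCompact_triangle : IsCompact triangle := by
  refine (isCompact_Icc (a := (0 : ℝ)) (b := 1)).prod (isCompact_Icc (a := (0 : ℝ)) (b := 1))
    |>.of_isClosed_subset isClosed_triangle ?_
  rintro ⟨x, y⟩ ⟨hx, hy, hxy⟩
  simp only at hx hy hxy
  exact ⟨⟨hx, by linarith⟩, hy, by linarith⟩

/-- Fubini, and the fundamental theorem of calculus on each slice; the slice over `x` is `[0, 1 -
x]`, and the derivative is needed only in its interior. -/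
theorem integral_triangle_deriv_snd {g g' : ℝ × ℝ → ℝ} (hg : ContinuousOn g triangle)
    (hg' : ContinuousOn g' triangle)
    (hd : ∀ x y : ℝ, 0 ≤ x → 0 < y → x + y < 1 → HasDerivAt (fun y => g (x, y)) (g' (x, y)) y) :
    ∫ p in triangle, g' p = ∫ x in (0 : ℝ)..1, (g (x, 1 - x) - g (x, 0)) := by
  have hgi : IntegrableOn g' triangle := hg'.integrableOn_compact isCompact_triangle
  rw [← integral_indicator isClosed_triangle.measurableSet, Measure.volume_eq_prod,
    integral_prod _ ((integrable_indicator_iff isClosed_triangle.measurableSet).2 hgi),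
    intervalIntegral.integral_of_le zero_le_one, ← integral_Icc_eq_integral_Ioc,
    ← integral_indicator measurableSet_Icc]
  congr 1
  ext x
  by_cases hx : x ∈ Icc (0 : ℝ) 1
  · rw [indicator_of_mem hx]
    have h1 : (fun y => triangle.indicator g' (x, y)) =
        (Icc 0 (1 - x)).indicator fun y => g' (x, y) := by
      ext y
      by_cases hy : y ∈ Icc 0 (1 - x)
      · rw [indicator_of_mem hy, indicator_of_mem]
        exact ⟨hx.1, hy.1, by simp only; linarith [hy.2]⟩
      · rw [indicator_of_notMem hy, indicator_of_notMem]
        rintro ⟨_, h2, h3⟩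
        simp only at h2 h3
        exact hy ⟨h2, by linarith⟩
    have hx1 : 0 ≤ 1 - x := by linarith [hx.2]
    have hmaps : MapsTo (fun y : ℝ => (x, y)) (Icc 0 (1 - x)) triangle := fun y hy =>
      ⟨hx.1, hy.1, by simp only; linarith [hy.2]⟩
    have hc : Continuous fun y : ℝ => (x, y) := by fun_prop
    rw [h1, integral_indicator measurableSet_Icc, integral_Icc_eq_integral_Ioc,
      ← intervalIntegral.integral_of_le hx1]
    refine intervalIntegral.integral_eq_sub_of_hasDerivAt_of_le (f := fun y => g (x, y)) hx1
      (hg.comp hc.continuousOn hmaps) (fun y hy => hd x y hx.1 hy.1 (by linarith [hy.2])) ?_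
    refine ContinuousOn.intervalIntegrable ?_
    rw [uIcc_of_le hx1]
    exact hg'.comp hc.continuousOn hmaps
  · rw [indicator_of_notMem hx]
    have h1 : (fun y => triangle.indicator g' (x, y)) = fun _ => 0 := by
      ext y
      refine indicator_of_notMem ?_ _
      rintro ⟨h1, h2, h3⟩
      simp only at h1 h2 h3
      exact hx ⟨h1, by linarith⟩
    rw [h1, integral_zero]

theorem integral_triangle_deriv_fst {g g' : ℝ × ℝ → ℝ} (hg : ContinuousOn g triangle)
    (hg' : ContinuousOn g' triangle)
    (hd : ∀ x y : ℝ, 0 ≤ y → 0 < x → x + y < 1 → HasDerivAt (fun x => g (x, y)) (g' (x, y)) x) :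
    ∫ p in triangle, g' p = ∫ y in (0 : ℝ)..1, (g (1 - y, y) - g (0, y)) := by
  have hswap : MapsTo Prod.swap triangle triangle := by
    rintro ⟨x, y⟩ ⟨h1, h2, h3⟩
    exact ⟨h2, h1, by simp only [Prod.fst_swap, Prod.snd_swap] at *; linarith⟩
  have hpre : Prod.swap ⁻¹' triangle = triangle := by
    refine Subset.antisymm (fun p hp => ?_) hswap
    have := hswap hp
    rwa [Prod.swap_swap] at this
  have h := integral_triangle_deriv_snd (g := g ∘ Prod.swap) (g' := g' ∘ Prod.swap)
    (hg.comp continuous_swap.continuousOn hswap) (hg'.comp continuous_swap.continuousOn hswap)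
    (fun x y hx hy hxy => hd y x hx hy (by linarith))
  have h2 := (Measure.measurePreserving_swap (μ := (volume : Measure ℝ))
    (ν := (volume : Measure ℝ))).setIntegral_preimage_emb
    MeasurableEquiv.prodComm.measurableEmbedding g' triangle
  rw [hpre] at h2
  exact h2.symm.trans h

end Triangle

/-! ### Integrals over singular simplices and Stokes' theorem in degree two. -/

section Simplices

variable {E H Q : Type*} [NormedAddCommGroup E] [NormedSpace ℝ E] [TopologicalSpace H]
  {I : ModelWithCorners ℝ E H} [TopologicalSpace Q] [ChartedSpace H Q]

theorem convex_simplex (k : ℕ) : Convex ℝ (simplex k) := by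
  intro s hs t ht a b ha hb hab
  refine ⟨fun i => ?_, ?_⟩
  · have := hs.1 i
    have := ht.1 i
    simp only [Pi.add_apply, Pi.smul_apply, smul_eq_mul]
    positivity
  · simp only [Pi.add_apply, Pi.smul_apply, smul_eq_mul, Finset.sum_add_distrib, ← Finset.mul_sum]
    calc a * ∑ i, s i + b * ∑ i, t i ≤ a * 1 + b * 1 := by
          have := hs.2
          have := ht.2
          gcongr
      _ = 1 := by linarith

theorem isClosed_simplex (k : ℕ) : IsClosed (simplex k) := by
  have h1 : simplex k = (⋂ i, {t : Fin k → ℝ | 0 ≤ t i}) ∩ {t | ∑ i, t i ≤ 1} := by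
    ext t
    simp [simplex]
  rw [h1]
  refine (isClosed_iInter fun i => isClosed_le continuous_const (continuous_apply i)).inter
    (isClosed_le (by fun_prop) continuous_const)

theorem interior_simplex_nonempty (k : ℕ) : (interior (simplex k)).Nonempty := by
  refine ⟨fun _ => 1 / (k + 1 : ℝ), ?_⟩
  rw [mem_interior]
  refine ⟨{t | (∀ i, 0 < t i) ∧ ∑ i, t i < 1}, fun t ht => ⟨fun i => (ht.1 i).le, ht.2.le⟩, ?_, ?_⟩
  · have h1 : {t : Fin k → ℝ | (∀ i, 0 < t i) ∧ ∑ i, t i < 1} =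
        (⋂ i, {t : Fin k → ℝ | 0 < t i}) ∩ {t | ∑ i, t i < 1} := by
      ext t
      simp
    rw [h1]
    exact (isOpen_iInter_of_finite fun i => isOpen_lt continuous_const (continuous_apply i)).inter
      (isOpen_lt (by fun_prop) continuous_const)
  · refine ⟨fun i => by positivity, ?_⟩
    simp only [Finset.sum_const, Finset.card_univ, Fintype.card_fin, nsmul_eq_mul]
    rw [mul_one_div, div_lt_one (by positivity)]
    linarith

theorem uniqueDiffOn_simplex (k : ℕ) : UniqueDiffOn ℝ (simplex k) :=
  uniqueDiffOn_convex (convex_simplex k) (interior_simplex_nonempty k)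

theorem extendSimplex_of_mem {k : ℕ} (f : simplex k → Q) {t : Fin k → ℝ} (ht : t ∈ simplex k) :
    extendSimplex f t = f ⟨t, ht⟩ := by
  simp [extendSimplex, ht]

/-- The curve that a singular `1`-simplex is. -/
def SmoothSimplex.edge (σ : SmoothSimplex Q I 1) (u : ℝ) : Q := extendSimplex σ.toFun fun _ => u

/-- The point that a singular `0`-simplex is. -/
def SmoothSimplex.point (τ : SmoothSimplex Q I 0) : Q := τ.toFun ⟨0, zero_mem_simplex 0⟩

theorem const_mem_simplex_one {u : ℝ} : (fun _ : Fin 1 => u) ∈ simplex 1 ↔ u ∈ Icc (0 : ℝ) 1 := by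
  simp [simplex]

theorem SmoothSimplex.contMDiffOn_edge (σ : SmoothSimplex Q I 1) :
    ContMDiffOn 𝓘(ℝ, ℝ) I ∞ σ.edge (Icc 0 1) := by
  have h1 : ContDiff ℝ ∞ fun u : ℝ => (fun _ : Fin 1 => u) := by fun_prop
  exact σ.smooth.comp h1.contMDiff.contMDiffOn fun u hu => const_mem_simplex_one.2 hu

theorem SmoothSimplex.edge_mem_range (σ : SmoothSimplex Q I 1) (u : ℝ) :
    σ.edge u ∈ range σ.toFun := by
  rw [edge, extendSimplex]
  split_ifs <;> exact mem_range_self _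

theorem SmoothSimplex.ext_point {τ τ' : SmoothSimplex Q I 0} (h : τ.point = τ'.point) : τ = τ' := by
  cases τ with | mk f hf => cases τ' with | mk g hg =>
  have : f = g := by
    ext t
    have ht : t = ⟨0, zero_mem_simplex 0⟩ := Subtype.ext (Subsingleton.elim _ _)
    rw [ht]
    exact h
  subst this
  rfl

variable (I) in
/-- A point as a singular `0`-simplex. -/
def pointSimplex (x : Q) : SmoothSimplex Q I 0 where
  toFun _ := x
  smooth := by
    have : extendSimplex (fun _ : simplex 0 => x) = fun _ => x := by
      ext t
      simp [extendSimplex]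
    rw [this]
    exact contMDiffOn_const

theorem pointSimplex_point (τ : SmoothSimplex Q I 0) : pointSimplex I τ.point = τ :=
  SmoothSimplex.ext_point rfl

theorem faceMap_one_zero (t : Fin 0 → ℝ) : faceMap (0 : Fin 2) t = fun _ => 1 := by
  ext j
  fin_cases j
  simp [faceMap, Fin.tail]

theorem faceMap_one_one (t : Fin 0 → ℝ) : faceMap (1 : Fin 2) t = fun _ => 0 := by
  ext j
  fin_cases j
  rfl

theorem faceMap_two_zero (u : ℝ) : faceMap (0 : Fin 3) (fun _ : Fin 1 => u) = ![1 - u, u] := by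
  ext j
  fin_cases j
  · simp [faceMap, Fin.tail]
  · rfl

theorem faceMap_two_one (u : ℝ) : faceMap (1 : Fin 3) (fun _ : Fin 1 => u) = ![0, u] := by
  ext j
  fin_cases j <;> rfl

theorem faceMap_two_two (u : ℝ) : faceMap (2 : Fin 3) (fun _ : Fin 1 => u) = ![u, 0] := by
  ext j
  fin_cases j <;> rfl

theorem SmoothSimplex.point_face_zero (σ : SmoothSimplex Q I 1) : (σ.face 0).point = σ.edge 1 := by
  rw [edge, extendSimplex_of_mem _ (const_mem_simplex_one.2 (by simp))]
  exact congrArg σ.toFun (Subtype.ext (faceMap_one_zero _))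

theorem SmoothSimplex.point_face_one (σ : SmoothSimplex Q I 1) : (σ.face 1).point = σ.edge 0 := by
  rw [edge, extendSimplex_of_mem _ (const_mem_simplex_one.2 (by simp))]
  exact congrArg σ.toFun (Subtype.ext (faceMap_one_one _))

theorem SmoothSimplex.edge_face (σ : SmoothSimplex Q I 2) (i : Fin 3) {u : ℝ}
    (hu : u ∈ Icc (0 : ℝ) 1) :
    (σ.face i).edge u = extendSimplex σ.toFun (faceMap i fun _ => u) := by
  rw [edge, extendSimplex_of_mem _ (const_mem_simplex_one.2 hu),
    extendSimplex_of_mem _ (faceMap_mem i (const_mem_simplex_one.2 hu))]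
  rfl

theorem simplexIntegral_eq_pullWithin {k : ℕ} (η : Form E Q k) (σ : SmoothSimplex Q I k) :
    simplexIntegral I η σ = ∫ t in simplex k,
      pullWithin I (simplex k) (extendSimplex σ.toFun) η t fun j => Pi.single j 1 := rfl

theorem simplexIntegral_eq_lineIntegral (η : Form E Q 1) (σ : SmoothSimplex Q I 1) :
    simplexIntegral I η σ = lineIntegral I η σ.edge := by
  have hpre : (MeasurableEquiv.funUnique (Fin 1) ℝ).symm ⁻¹' (simplex 1) = Icc 0 1 := by
    ext u
    exact const_mem_simplex_one
  have h := ((volume_preserving_funUnique (Fin 1) ℝ).symm _).setIntegral_preimage_emb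
    (MeasurableEquiv.funUnique (Fin 1) ℝ).symm.measurableEmbedding
    (fun t => pullWithin I (simplex 1) (extendSimplex σ.toFun) η t fun j => Pi.single j 1) (simplex 1)
  rw [hpre] at h
  refine h.symm.trans ?_
  rw [lineIntegral, intervalIntegral.integral_of_le zero_le_one, ← integral_Icc_eq_integral_Ioc]
  refine setIntegral_congr_fun measurableSet_Icc fun u hu => ?_
  have hd : HasDerivAt (fun u : ℝ => (fun _ : Fin 1 => u)) (fun _ => (1 : ℝ)) u := by
    rw [hasDerivAt_pi]
    exact fun _ => hasDerivAt_id u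
  have hmem : (fun _ : Fin 1 => u) ∈ simplex 1 := const_mem_simplex_one.2 hu
  have h2 := pullWithin_comp (I := I) (s := simplex 1) (f := extendSimplex σ.toFun)
    (s₂ := Icc (0 : ℝ) 1) (g := fun u : ℝ => (fun _ : Fin 1 => u)) (t := u) η
    ((σ.smooth _ hmem).mdifferentiableWithinAt (by simp))
    hd.differentiableAt.differentiableWithinAt (fun u hu => const_mem_simplex_one.2 hu)
    (uniqueDiffOn_unitInterval u hu)
  refine Eq.symm ((congrArg (fun a : ℝ [⋀^Fin 1]→L[ℝ] ℝ => a fun _ => 1) h2).trans ?_)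
  refine congrArg (pullWithin I (simplex 1) (extendSimplex σ.toFun) η fun _ => u) ?_
  ext1 j
  have h3 := hd.hasDerivWithinAt (s := Icc (0 : ℝ) 1)
    |>.hasFDerivWithinAt.fderivWithin (uniqueDiffOn_unitInterval u hu)
  refine (congrArg (fun L : ℝ →L[ℝ] (Fin 1 → ℝ) => L 1) h3).trans ?_
  ext l
  fin_cases j
  fin_cases l
  simp

theorem mem_simplex_two {x y : ℝ} : ![x, y] ∈ simplex 2 ↔ (x, y) ∈ triangle := by
  simp [simplex, triangle, Fin.forall_fin_two, and_assoc]

theorem integral_simplex_two (h : (Fin 2 → ℝ) → ℝ) :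
    ∫ t in simplex 2, h t = ∫ p in triangle, h ![p.1, p.2] := by
  have h1 := ((volume_preserving_finTwoArrow ℝ).symm _).setIntegral_preimage_emb
    (MeasurableEquiv.finTwoArrow (α := ℝ)).symm.measurableEmbedding h (simplex 2)
  have hpre : (MeasurableEquiv.finTwoArrow (α := ℝ)).symm ⁻¹' (simplex 2) = triangle := by
    ext ⟨x, y⟩
    exact mem_simplex_two
  rw [hpre] at h1
  exact h1.symm

theorem hasDerivAt_vec_fst (x y : ℝ) :
    HasDerivAt (fun x : ℝ => ![x, y]) (Pi.single 0 1) x := by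
  rw [hasDerivAt_pi]
  intro j
  fin_cases j
  · exact hasDerivAt_id' x
  · simpa using hasDerivAt_const x y

theorem hasDerivAt_vec_snd (x y : ℝ) :
    HasDerivAt (fun y : ℝ => ![x, y]) (Pi.single 1 1) y := by
  rw [hasDerivAt_pi]
  intro j
  fin_cases j
  · simpa using hasDerivAt_const y x
  · exact hasDerivAt_id' y

theorem continuous_vec : Continuous fun p : ℝ × ℝ => ![p.1, p.2] := by
  refine continuous_pi fun j => ?_
  fin_cases j
  · exact continuous_fst
  · exact continuous_snd

theorem integral_simplex_two_fderivWithin_zero {g : (Fin 2 → ℝ) → ℝ}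
    (hg : ContDiffOn ℝ 1 g (simplex 2)) :
    ∫ t in simplex 2, fderivWithin ℝ g (simplex 2) t (Pi.single 0 1) =
      ∫ y in (0 : ℝ)..1, (g ![1 - y, y] - g ![0, y]) := by
  have hmaps : MapsTo (fun p : ℝ × ℝ => ![p.1, p.2]) triangle (simplex 2) :=
    fun p hp => mem_simplex_two.2 hp
  have hc : ContinuousOn (fun t => fderivWithin ℝ g (simplex 2) t (Pi.single 0 1)) (simplex 2) :=
    (hg.continuousOn_fderivWithin (uniqueDiffOn_simplex 2) le_rfl).clm_apply continuousOn_const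
  rw [integral_simplex_two]
  refine integral_triangle_deriv_fst (g := fun p => g ![p.1, p.2])
    (hg.continuousOn.comp continuous_vec.continuousOn hmaps)
    (hc.comp continuous_vec.continuousOn hmaps) fun x y hy hx hxy => ?_
  have hmem : ![x, y] ∈ simplex 2 := mem_simplex_two.2 ⟨hx.le, hy, hxy.le⟩
  have h1 := ((hg.differentiableOn one_ne_zero) _ hmem).hasFDerivWithinAt.comp_hasDerivWithinAt
    (s := Ioo 0 (1 - y)) x (hasDerivAt_vec_fst x y).hasDerivWithinAt
    (fun z hz => mem_simplex_two.2 ⟨hz.1.le, hy, by simp only; linarith [hz.2]⟩)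
  exact h1.hasDerivAt (Ioo_mem_nhds hx (by linarith))

theorem integral_simplex_two_fderivWithin_one {g : (Fin 2 → ℝ) → ℝ}
    (hg : ContDiffOn ℝ 1 g (simplex 2)) :
    ∫ t in simplex 2, fderivWithin ℝ g (simplex 2) t (Pi.single 1 1) =
      ∫ x in (0 : ℝ)..1, (g ![x, 1 - x] - g ![x, 0]) := by
  have hmaps : MapsTo (fun p : ℝ × ℝ => ![p.1, p.2]) triangle (simplex 2) :=
    fun p hp => mem_simplex_two.2 hp
  have hc : ContinuousOn (fun t => fderivWithin ℝ g (simplex 2) t (Pi.single 1 1)) (simplex 2) :=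
    (hg.continuousOn_fderivWithin (uniqueDiffOn_simplex 2) le_rfl).clm_apply continuousOn_const
  rw [integral_simplex_two]
  refine integral_triangle_deriv_snd (g := fun p => g ![p.1, p.2])
    (hg.continuousOn.comp continuous_vec.continuousOn hmaps)
    (hc.comp continuous_vec.continuousOn hmaps) fun x y hx hy hxy => ?_
  have hmem : ![x, y] ∈ simplex 2 := mem_simplex_two.2 ⟨hx, hy.le, hxy.le⟩
  have h1 := ((hg.differentiableOn one_ne_zero) _ hmem).hasFDerivWithinAt.comp_hasDerivWithinAt
    (s := Ioo 0 (1 - x)) y (hasDerivAt_vec_snd x y).hasDerivWithinAt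
    (fun z hz => mem_simplex_two.2 ⟨hx, hz.1.le, by simp only; linarith [hz.2]⟩)
  exact h1.hasDerivAt (Ioo_mem_nhds hy (by linarith))

variable [IsManifold I ∞ Q]

/-- Stokes' theorem for a singular `2`-simplex. -/
theorem simplexIntegral_extD {η : Form E Q 1} (hη : IsSmoothForm I η) (σ : SmoothSimplex Q I 2) :
    simplexIntegral I (extD I η) σ =
      ∑ i : Fin 3, ((-1 : ℝ) ^ (i : ℕ)) * simplexIntegral I η (σ.face i) := by
  set f := extendSimplex σ.toFun with hf
  set S := simplex 2 with hSdef
  have hS := convex_simplex 2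
  have hSu := uniqueDiffOn_simplex 2
  set θ := pullWithin I S f η with hθdef
  have hθ : ContDiffOn ℝ ∞ θ S := hη.contDiffOn_pullWithin σ.smooth hSu
  set e₀ : Fin 2 → ℝ := Pi.single 0 1 with he₀
  set e₁ : Fin 2 → ℝ := Pi.single 1 1 with he₁
  have hev : ∀ v, ContDiffOn ℝ ∞ (fun t => θ t fun _ => v) S := fun v =>
    (ContinuousAlternatingMap.apply ℝ (Fin 2 → ℝ) ℝ (fun _ : Fin 1 => v)).contDiff.comp_contDiffOn hθ
  have hfd : ∀ v w, ∀ t ∈ S, fderivWithin ℝ (fun t => θ t fun _ => v) S t w =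
      fderivWithin ℝ θ S t w fun _ => v := fun v w t ht =>
    fderivWithin_continuousAlternatingMap_apply_const_apply (hSu t ht)
      ((hθ.differentiableOn (by simp)) t ht) _ _
  have hcont : ∀ v w, ContinuousOn (fun t => fderivWithin ℝ (fun t => θ t fun _ => v) S t w) S :=
    fun v w => ((hev v).continuousOn_fderivWithin hSu (by simp)).clm_apply continuousOn_const
  have hScomp : IsCompact S := by
    refine (isCompact_univ_pi fun _ : Fin 2 => isCompact_Icc (a := (0 : ℝ)) (b := 1)).of_isClosed_subset
      (isClosed_simplex 2) fun t ht j _ => ⟨ht.1 j, ?_⟩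
    exact (Finset.single_le_sum (fun i _ => ht.1 i) (Finset.mem_univ j)).trans ht.2
  have hgi : ∀ v w, IntegrableOn (fun t => fderivWithin ℝ (fun t => θ t fun _ => v) S t w) S :=
    fun v w => (hcont v w).integrableOn_compact hScomp
  -- On the standard frame `dθ(e₀, e₁) = ∂₀ (θ e₁) - ∂₁ (θ e₀)`, two integrals of partial
  -- derivatives over the triangle.
  have hL : simplexIntegral I (extD I η) σ =
      (∫ t in S, fderivWithin ℝ (fun t => θ t fun _ => e₁) S t e₀) -
        ∫ t in S, fderivWithin ℝ (fun t => θ t fun _ => e₀) S t e₁ := by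
    rw [← integral_sub (hgi _ _) (hgi _ _), simplexIntegral_eq_pullWithin]
    refine setIntegral_congr_fun (isClosed_simplex 2).measurableSet fun t ht => ?_
    have h1 := hη.extDerivWithin_pullWithin σ.smooth hSu ht (by
      rw [hS.closure_interior_eq_closure_of_nonempty_interior (interior_simplex_nonempty 2)]
      exact subset_closure ht)
    rw [← h1]
    change ContinuousAlternatingMap.alternatizeUncurryFin (fderivWithin ℝ θ S t) _ = _
    rw [alternatizeUncurryFin_one_apply, hfd _ _ t ht, hfd _ _ t ht]
  -- Each face is the affine segment from a vertex `p` to a vertex `q`, with constant velocity `q -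
  -- p`.
  have hface : ∀ (i : Fin 3) (p q : Fin 2 → ℝ), p ∈ S → q ∈ S →
      (∀ u : ℝ, faceMap i (fun _ => u) = p + u • (q - p)) →
      simplexIntegral I η (σ.face i) = ∫ u in (0 : ℝ)..1, θ (p + u • (q - p)) fun _ => q - p := by
    intro i p q hp hq hi
    rw [simplexIntegral_eq_lineIntegral]
    have h1 : lineIntegral I η (σ.face i).edge = lineIntegral I η fun u => f (p + u • (q - p)) :=
      lineIntegral_congr η fun u hu => by rw [σ.edge_face i hu, hi u]
    rw [h1, lineIntegral]
    refine intervalIntegral.integral_congr fun u hu => ?_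
    rw [uIcc_of_le zero_le_one] at hu
    exact pullWithin_line hS σ.smooth η hp hq hu
  have h0S : (0 : Fin 2 → ℝ) ∈ S := zero_mem_simplex 2
  have he₀' : e₀ = ![1, 0] := by ext j; fin_cases j <;> simp [he₀]
  have he₁' : e₁ = ![0, 1] := by ext j; fin_cases j <;> simp [he₁]
  have he₀S : e₀ ∈ S := by rw [he₀']; exact mem_simplex_two.2 (by simp [triangle])
  have he₁S : e₁ ∈ S := by rw [he₁']; exact mem_simplex_two.2 (by simp [triangle])
  have p0 : ∀ u : ℝ, e₀ + u • (e₁ - e₀) = ![1 - u, u] := fun u => by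
    rw [he₀', he₁']; ext j; fin_cases j <;> simp; ring
  have p1 : ∀ u : ℝ, 0 + u • e₁ = ![0, u] := fun u => by
    rw [he₁']; ext j; fin_cases j <;> simp
  have p2 : ∀ u : ℝ, 0 + u • e₀ = ![u, 0] := fun u => by
    rw [he₀']; ext j; fin_cases j <;> simp
  have hF0 := hface 0 e₀ e₁ he₀S he₁S fun u => by rw [faceMap_two_zero, p0]
  have hF1 := hface 1 0 e₁ h0S he₁S fun u => by rw [faceMap_two_one, sub_zero, p1]
  have hF2 := hface 2 0 e₀ h0S he₀S fun u => by rw [faceMap_two_two, sub_zero, p2]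
  rw [sub_zero] at hF1 hF2
  simp only [p0, p1, p2] at hF0 hF1 hF2
  have hsub : ∀ t, (θ t fun _ => e₁ - e₀) = (θ t fun _ => e₁) - θ t fun _ => e₀ := fun t =>
    map_sub (toCovector (θ t)) e₁ e₀
  simp only [hsub] at hF0
  have hii : ∀ (v : Fin 2 → ℝ) (c : ℝ → Fin 2 → ℝ), Continuous c → MapsTo c (Icc 0 1) S →
      IntervalIntegrable (fun u => θ (c u) fun _ => v) volume 0 1 := by
    intro v c hc hm
    refine ContinuousOn.intervalIntegrable ?_
    rw [uIcc_of_le zero_le_one]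
    exact (hev v).continuousOn.comp hc.continuousOn hm
  have c0 : Continuous fun u : ℝ => ![1 - u, u] :=
    continuous_vec.comp ((continuous_const.sub continuous_id).prodMk continuous_id)
  have c1 : Continuous fun u : ℝ => ![0, u] := continuous_vec.comp (continuous_const.prodMk continuous_id)
  have c2 : Continuous fun u : ℝ => ![u, 0] := continuous_vec.comp (continuous_id.prodMk continuous_const)
  have m0 : MapsTo (fun u : ℝ => ![1 - u, u]) (Icc 0 1) S := fun u hu =>
    mem_simplex_two.2 ⟨by simpa using hu.2, hu.1, by simp⟩
  have m1 : MapsTo (fun u : ℝ => ![0, u]) (Icc 0 1) S := fun u hu =>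
    mem_simplex_two.2 ⟨le_rfl, hu.1, by simpa using hu.2⟩
  have m2 : MapsTo (fun u : ℝ => ![u, 0]) (Icc 0 1) S := fun u hu =>
    mem_simplex_two.2 ⟨hu.1, le_rfl, by simpa using hu.2⟩
  -- The two partial integrations run along the hypotenuse in opposite directions; the substitution
  -- `x ↦ 1 - x` makes them comparable.
  have hrefl : (∫ x in (0 : ℝ)..1, θ ![x, 1 - x] fun _ => e₀) =
      ∫ x in (0 : ℝ)..1, θ ![1 - x, x] fun _ => e₀ := by
    have := intervalIntegral.integral_comp_sub_left (a := 0) (b := 1)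
      (fun x => θ ![x, 1 - x] fun _ => e₀) 1
    simp only [sub_sub_cancel, sub_zero, sub_self] at this
    exact this.symm
  have c0' : Continuous fun u : ℝ => ![u, 1 - u] :=
    continuous_vec.comp (continuous_id.prodMk (continuous_const.sub continuous_id))
  have m0' : MapsTo (fun u : ℝ => ![u, 1 - u]) (Icc 0 1) S := fun u hu =>
    mem_simplex_two.2 ⟨hu.1, by simpa using hu.2, by simp⟩
  rw [hL, integral_simplex_two_fderivWithin_zero ((hev e₁).of_le (by simp)),
    integral_simplex_two_fderivWithin_one ((hev e₀).of_le (by simp)),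
    intervalIntegral.integral_sub (hii e₁ _ c0 m0) (hii e₁ _ c1 m1),
    intervalIntegral.integral_sub (hii e₀ _ c0' m0') (hii e₀ _ c2 m2), hrefl,
    Fin.sum_univ_three, hF0, hF1, hF2,
    intervalIntegral.integral_sub (hii e₁ _ c0 m0) (hii e₀ _ c0 m0)]
  simp
  ring

end Simplices

/-! ### Integrals over chains and their invariance under homotopy. -/

section Chains

variable {E H Q : Type*} [NormedAddCommGroup E] [NormedSpace ℝ E] [TopologicalSpace H]
  {I : ModelWithCorners ℝ E H} [TopologicalSpace Q] [ChartedSpace H Q]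

theorem chainIntegral_eq_linearCombination {k : ℕ} (η : Form E Q k) (z : Chain Q I k) :
    chainIntegral I η z = Finsupp.linearCombination ℚ (simplexIntegral I η) z := by
  rw [chainIntegral, Finsupp.linearCombination_apply]
  exact Finsupp.sum_congr fun σ _ => (Rat.smul_def _ _).symm

theorem linearCombination_congr {k : ℕ} {J J' : SmoothSimplex Q I k → ℝ} {z : Chain Q I k}
    (h : ∀ σ ∈ z.support, J σ = J' σ) :
    Finsupp.linearCombination ℚ J z = Finsupp.linearCombination ℚ J' z := by
  rw [Finsupp.linearCombination_apply, Finsupp.linearCombination_apply]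
  exact Finsupp.sum_congr fun σ hσ => by rw [h σ hσ]

/-- A real function on simplices extends `ℚ`-linearly to chains. Moving the boundary operator onto
that function reduces statements about chains to single simplices. -/
theorem linearCombination_bdry {k : ℕ} (J : SmoothSimplex Q I k → ℝ) (z : Chain Q I (k + 1)) :
    Finsupp.linearCombination ℚ J (bdry Q I k z) = Finsupp.linearCombination ℚ
      (fun σ : SmoothSimplex Q I (k + 1) => ∑ i : Fin (k + 2), (-1 : ℝ) ^ (i : ℕ) * J (σ.face i)) z := by
  rw [← LinearMap.comp_apply]
  congr 1
  ext σ
  simp only [LinearMap.comp_apply, Finsupp.lsingle_apply, bdry, Finsupp.linearCombination_single,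
    one_smul, map_sum, map_smul]
  refine Finset.sum_congr rfl fun i _ => ?_
  rw [Rat.smul_def]
  push_cast
  rfl

theorem chainIntegral_zero_form {k : ℕ} (z : Chain Q I k) :
    chainIntegral I (0 : Form E Q k) z = 0 := by
  have h : ∀ σ : SmoothSimplex Q I k, simplexIntegral I (0 : Form E Q k) σ = 0 := fun σ =>
    integral_zero _ _
  simp [chainIntegral, h]

theorem mem_chainsIn {S : Set Q} {k : ℕ} {z : Chain Q I k} :
    z ∈ chainsIn I S k ↔ ∀ σ ∈ z.support, range σ.toFun ⊆ S := by
  rw [chainsIn, Finsupp.mem_supported]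
  rfl

theorem eq_zero_of_mem_chainsIn_empty {k : ℕ} {z : Chain Q I k} (hz : z ∈ chainsIn I ∅ k) :
    z = 0 := by
  rw [← Finsupp.support_eq_empty, Finset.eq_empty_iff_forall_notMem]
  intro σ hσ
  exact mem_chainsIn.1 hz σ hσ (mem_range_self ⟨0, zero_mem_simplex k⟩)

/-- The chain with a single point. -/
def pointChain (x : Q) : Chain Q I 0 := Finsupp.single (pointSimplex I x) 1

theorem bdry_single_one (σ : SmoothSimplex Q I 1) :
    bdry Q I 0 (Finsupp.single σ 1) = pointChain (σ.edge 1) - pointChain (σ.edge 0) := by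
  rw [bdry, Finsupp.linearCombination_single, one_smul, Fin.sum_univ_two, pointChain, pointChain,
    ← σ.point_face_zero, ← σ.point_face_one, pointSimplex_point, pointSimplex_point]
  simp [sub_eq_add_neg]

/-- The six end points of the three edges cancel in pairs. This degree is the one needed: the
boundary of a flux chain is a `1`-cycle in `∂Q`. -/
theorem bdry_bdry (z : Chain Q I 2) : bdry Q I 0 (bdry Q I 1 z) = 0 := by
  rw [← LinearMap.comp_apply]
  have : (bdry Q I 0).comp (bdry Q I 1) = 0 := by
    ext1 σ
    ext1
    have h : ∀ (i : Fin 3) (u : ℝ) (hu : u ∈ Icc (0 : ℝ) 1),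
        (σ.face i).edge u = extendSimplex σ.toFun (faceMap i fun _ => u) := fun i u hu =>
      σ.edge_face i hu
    have h0 : (0 : ℝ) ∈ Icc (0 : ℝ) 1 := by simp
    have h1 : (1 : ℝ) ∈ Icc (0 : ℝ) 1 := by simp
    simp only [LinearMap.comp_apply, Finsupp.lsingle_apply]
    rw [show bdry Q I 1 (Finsupp.single σ 1) = _ from Finsupp.linearCombination_single ..,
      one_smul, Fin.sum_univ_three]
    simp only [map_add, map_smul, bdry_single_one, h _ 0 h0, h _ 1 h1, faceMap_two_zero,
      faceMap_two_one, faceMap_two_two, sub_zero, sub_self]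
    simp
  rw [this]
  rfl

variable [IsManifold I ∞ Q]

theorem chainIntegral_extD {η : Form E Q 1} (hη : IsSmoothForm I η) (z : Chain Q I 2) :
    chainIntegral I (extD I η) z = chainIntegral I η (bdry Q I 1 z) := by
  rw [chainIntegral_eq_linearCombination, chainIntegral_eq_linearCombination, linearCombination_bdry]
  exact linearCombination_congr fun σ _ => simplexIntegral_extD hη σ

theorem chainIntegral_add_form {η θ : Form E Q 1} (hη : IsSmoothForm I η) (hθ : IsSmoothForm I θ)
    (z : Chain Q I 1) : chainIntegral I (η + θ) z = chainIntegral I η z + chainIntegral I θ z := by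
  rw [chainIntegral, chainIntegral, chainIntegral, ← Finsupp.sum_add]
  refine Finsupp.sum_congr fun σ _ => ?_
  rw [simplexIntegral_eq_lineIntegral, lineIntegral_add hη hθ σ.contMDiffOn_edge,
    simplexIntegral_eq_lineIntegral, simplexIntegral_eq_lineIntegral, mul_add]

theorem chainIntegral_smul_form (c : ℝ) (η : Form E Q 1) (z : Chain Q I 1) :
    chainIntegral I (c • η) z = c * chainIntegral I η z := by
  rw [chainIntegral, chainIntegral, Finsupp.mul_sum]
  refine Finsupp.sum_congr fun σ _ => ?_
  rw [simplexIntegral_eq_lineIntegral, lineIntegral_smul, simplexIntegral_eq_lineIntegral]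
  ring

theorem chainIntegral_sub_form {η θ : Form E Q 1} (hη : IsSmoothForm I η) (hθ : IsSmoothForm I θ)
    (z : Chain Q I 1) : chainIntegral I (η - θ) z = chainIntegral I η z - chainIntegral I θ z := by
  have h := chainIntegral_add_form (hη.sub hθ) hθ z
  rw [sub_add_cancel] at h
  linarith

/-- Telescoping: if integration along each edge is a difference of values at its ends, only the
boundary of the chain counts. No regularity of `J` is involved. -/
theorem chainIntegral_eq_linearCombination_bdry {η : Form E Q 1} {J : Q → ℝ} {z : Chain Q I 1}
    (h : ∀ σ ∈ z.support, lineIntegral I η σ.edge = J (σ.edge 1) - J (σ.edge 0)) :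
    chainIntegral I η z = Finsupp.linearCombination ℚ (fun τ : SmoothSimplex Q I 0 => J τ.point)
      (bdry Q I 0 z) := by
  rw [linearCombination_bdry, chainIntegral_eq_linearCombination]
  refine linearCombination_congr fun σ hσ => ?_
  rw [simplexIntegral_eq_lineIntegral, h σ hσ, Fin.sum_univ_two, σ.point_face_zero,
    σ.point_face_one]
  simp
  ring

theorem chainIntegral_differential {f : Q → ℝ} (hf : ContMDiff I 𝓘(ℝ, ℝ) ∞ f) {z : Chain Q I 1}
    (hz : bdry Q I 0 z = 0) : chainIntegral I (differential I f) z = 0 := by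
  rw [chainIntegral_eq_linearCombination_bdry (J := f)
    (fun σ _ => lineIntegral_differential hf σ.contMDiffOn_edge), hz, map_zero]

/-- Under a homotopy that preserves the boundary, the integrals over cycles in the boundary of a
`1`-form whose differential vanishes on the boundary do not change. -/
theorem chainIntegral_pullback_eq {A : Form E Q 1} (hA : IsSmoothForm I A)
    (hB : VanishesOnBoundary I (extD I A)) {φ : ℝ → Q → Q}
    (hφ : ContMDiffOn (𝓘(ℝ, ℝ).prod I) I ∞ (fun p : ℝ × Q => φ p.1 p.2) (Icc 0 1 ×ˢ univ))
    (hφb : ∀ u ∈ Icc (0 : ℝ) 1, ∀ x ∈ I.boundary Q, φ u x ∈ I.boundary Q) {z : Chain Q I 1}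
    (hz : z ∈ chainsIn I (I.boundary Q) 1) (hz0 : bdry Q I 0 z = 0) :
    chainIntegral I (pullback I I (φ 1) A) z = chainIntegral I (pullback I I (φ 0) A) z := by
  have h0 : (0 : ℝ) ∈ Icc (0 : ℝ) 1 := by simp
  have h1 : (1 : ℝ) ∈ Icc (0 : ℝ) 1 := by simp
  have hφ0 := contMDiff_of_family hφ h0
  have hφ1 := contMDiff_of_family hφ h1
  -- `J x` is the integral of `A` along the track `u ↦ φ u x` of the point under the homotopy.
  rw [← sub_eq_zero, ← chainIntegral_sub_form (hA.pullback hφ1) (hA.pullback hφ0),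
    chainIntegral_eq_linearCombination_bdry (J := fun x => lineIntegral I A fun u => φ u x), hz0,
    map_zero]
  intro σ hσ
  have hσb : ∀ t, σ.edge t ∈ I.boundary Q := fun t => mem_chainsIn.1 hz σ hσ (σ.edge_mem_range t)
  set S : Set (ℝ × ℝ) := Icc 0 1 ×ˢ Icc 0 1 with hSdef
  have hS : Convex ℝ S := (convex_Icc 0 1).prod (convex_Icc 0 1)
  have hSint : interior S = Ioo 0 1 ×ˢ Ioo 0 1 := by
    rw [hSdef, interior_prod_eq, interior_Icc]
  have hSi : (interior S).Nonempty := by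
    rw [hSint]
    exact ⟨(1 / 2, 1 / 2), by norm_num, by norm_num⟩
  have hSu : UniqueDiffOn ℝ S := uniqueDiffOn_convex hS hSi
  set Ψ : ℝ × ℝ → Q := fun p => φ p.1 (σ.edge p.2) with hΨdef
  have hΨ : ContMDiffOn 𝓘(ℝ, ℝ × ℝ) I ∞ Ψ S := by
    have h2 : ContMDiffOn 𝓘(ℝ, ℝ × ℝ) (𝓘(ℝ, ℝ).prod I) ∞
        (fun p : ℝ × ℝ => (p.1, σ.edge p.2)) S := by
      refine ContMDiffOn.prodMk contDiff_fst.contMDiff.contMDiffOn ?_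
      exact σ.contMDiffOn_edge.comp contDiff_snd.contMDiff.contMDiffOn fun p hp => hp.2
    exact hφ.comp h2 fun p hp => ⟨hp.1, mem_univ _⟩
  -- The square swept out by the edge lies in `∂Q`, so the pullback of `dA` to it is zero. The
  -- tangency condition asks for curves defined on both sides of time `0`, so this is shown in the
  -- interior of the square and extended by continuity.
  have hzero : EqOn (pullWithin I S Ψ (extD I A)) (fun _ => 0) (interior S) := by
    intro p hp
    have hpn : S ∈ 𝓝 p := mem_interior_iff_mem_nhds.1 hp
    have hpS := interior_subset hp
    ext v
    refine hB _ (hφb _ hpS.1 _ (hσb _)) _ fun j => ?_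
    have hline : HasFDerivAt (fun t : ℝ => p + t • v j)
        (ContinuousLinearMap.toSpanSingleton ℝ (v j)) 0 := by
      simpa using (((hasDerivAt_id (0 : ℝ)).smul_const (v j)).const_add p).hasFDerivAt
    refine ⟨fun t => Ψ (p + t • v j), by simp [hΨdef], ?_, ?_⟩
    · have h3 : ∀ᶠ t : ℝ in 𝓝 0, p + t • v j ∈ S :=
        hline.continuousAt (by simpa using hpn)
      filter_upwards [h3] with t ht
      exact hφb _ ht.1 _ (hσb _)
    · have hd := ((hΨ p hpS).mdifferentiableWithinAt (by simp)).hasMFDerivWithinAt.hasMFDerivAt hpn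
      have hd' : HasMFDerivAt 𝓘(ℝ, ℝ × ℝ) I Ψ (p + (0 : ℝ) • v j)
          (mfderivWithin 𝓘(ℝ, ℝ × ℝ) I Ψ S p : ℝ × ℝ →L[ℝ] E) := by
        rw [zero_smul, add_zero]
        exact hd
      have h3 := HasMFDerivAt.comp (0 : ℝ) hd' hline.hasMFDerivAt
      exact h3.congr_mfderiv (comp_toSpanSingleton_eq (E := ℝ × ℝ) (F := E)
        (mfderivWithin 𝓘(ℝ, ℝ × ℝ) I Ψ S p : ℝ × ℝ →L[ℝ] E) (v j))
  have hzero' : EqOn (pullWithin I S Ψ (extD I A)) (fun _ => 0) S :=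
    hzero.of_subset_closure (hA.extD.contDiffOn_pullWithin hΨ hSu).continuousOn continuousOn_const
      interior_subset (by
        rw [hS.closure_interior_eq_closure_of_nonempty_interior hSi]
        exact subset_closure)
  -- With a primitive `T` on the square, the integrals along the four sides are differences of `T`
  -- at the corners.
  obtain ⟨T, -, hT⟩ := exists_primitive_of_pullWithin_extD_eq_zero hS hSi hΨ hA hzero'
  have m : ∀ a ∈ Icc (0 : ℝ) 1, ∀ b ∈ Icc (0 : ℝ) 1, ((a, b) : ℝ × ℝ) ∈ S :=
    fun a ha b hb => ⟨ha, hb⟩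
  have hrow : ∀ a ∈ Icc (0 : ℝ) 1,
      lineIntegral I A (fun u => φ a (σ.edge u)) = T (a, 1) - T (a, 0) := by
    intro a ha
    rw [← lineIntegral_eq_sub hS hΨ hA hT (m a ha 0 h0) (m a ha 1 h1)]
    congr 1
    ext u
    simp [hΨdef]
  have hcol : ∀ b ∈ Icc (0 : ℝ) 1,
      lineIntegral I A (fun u => φ u (σ.edge b)) = T (1, b) - T (0, b) := by
    intro b hb
    rw [← lineIntegral_eq_sub hS hΨ hA hT (m 0 h0 b hb) (m 1 h1 b hb)]
    congr 1
    ext u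
    simp [hΨdef]
  have hsub : lineIntegral I (pullback I I (φ 1) A - pullback I I (φ 0) A) σ.edge =
      lineIntegral I (pullback I I (φ 1) A) σ.edge - lineIntegral I (pullback I I (φ 0) A) σ.edge := by
    have h := lineIntegral_add ((hA.pullback hφ1).sub (hA.pullback hφ0)) (hA.pullback hφ0)
      σ.contMDiffOn_edge
    rw [sub_add_cancel] at h
    linarith
  rw [hsub, lineIntegral_pullback A (hφ1.mdifferentiable (by simp)) σ.contMDiffOn_edge,
    lineIntegral_pullback A (hφ0.mdifferentiable (by simp)) σ.contMDiffOn_edge]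
  have e1 := hrow 1 h1
  have e0 := hrow 0 h0
  have f1 := hcol 1 h1
  have f0 := hcol 0 h0
  change lineIntegral I A (fun u => φ 1 (σ.edge u)) - lineIntegral I A (fun u => φ 0 (σ.edge u)) = _
  rw [e1, e0, f1, f0]
  ring

end Chains

/-! ### Periods of closed forms over the cycles of the boundary. -/

section Periods

variable {E H Q : Type*} [NormedAddCommGroup E] [NormedSpace ℝ E] [TopologicalSpace H]
  {I : ModelWithCorners ℝ E H} [TopologicalSpace Q] [ChartedSpace H Q] [IsManifold I ∞ Q]

theorem chainIntegral_add_chain {k : ℕ} (η : Form E Q k) (z w : Chain Q I k) :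
    chainIntegral I η (z + w) = chainIntegral I η z + chainIntegral I η w := by
  simp only [chainIntegral_eq_linearCombination, map_add]

theorem bdry_eq_zero_of_mem_relCycles {T : Set Q} {z : Chain Q I 1} (hz : z ∈ relCycles I T ∅ 0) :
    bdry Q I 0 z = 0 := eq_zero_of_mem_chainsIn_empty hz.2

theorem chainIntegral_eq_zero_of_mem_relBoundaries {ζ : Form E Q 1} (hζ : IsSmoothForm I ζ)
    (hd : extD I ζ = 0) {T : Set Q} {z : Chain Q I 1} (hz : z ∈ relBoundaries I T ∅ 0) :
    chainIntegral I ζ z = 0 := by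
  obtain ⟨a, ha, b, hb, rfl⟩ := Submodule.mem_sup.1 hz
  obtain ⟨w, -, rfl⟩ := hb
  rw [eq_zero_of_mem_chainsIn_empty ha, zero_add, ← chainIntegral_extD hζ, hd,
    chainIntegral_zero_form]

/-- A closed `1`-form with zero periods on a complement of the kernel of `H_1(∂Q) → H_1(Q)` has zero
periods on all the cycles of `∂Q`. -/
theorem HasZeroPeriods.chainIntegral_eq_zero {P : Submodule ℚ (H1Boundary Q I)}
    (hP : IsCompl P (LinearMap.ker (inclH1 Q I))) {ζ : Form E Q 1} (hζ : IsSmoothForm I ζ)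
    (hd : extD I ζ = 0) (h : HasZeroPeriods I P ζ) (z : relCycles I (I.boundary Q) ∅ 0) :
    chainIntegral I ζ (z : Chain Q I 1) = 0 := by
  have htop : (Submodule.Quotient.mk z : H1Boundary Q I) ∈ P ⊔ LinearMap.ker (inclH1 Q I) := by
    rw [hP.sup_eq_top]
    exact Submodule.mem_top
  -- The cycle is homologous in `∂Q` to `p + k` with `p` of class in `P` and `k` a boundary in `Q`.
  -- The hypothesis handles `p`; Stokes and closedness handle `k` and the homology.
  obtain ⟨a, ha, b, hb, hab⟩ := Submodule.mem_sup.1 htop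
  obtain ⟨p, rfl⟩ := Submodule.Quotient.mk_surjective _ a
  obtain ⟨k, rfl⟩ := Submodule.Quotient.mk_surjective _ b
  have h1 : chainIntegral I ζ (p : Chain Q I 1) = 0 := h p ha
  have h2 : chainIntegral I ζ (k : Chain Q I 1) = 0 := by
    have hk : inclH1 Q I (Submodule.Quotient.mk k) = 0 := hb
    have hk' : (Submodule.Quotient.mk (Submodule.inclusion
        (relCycles_mono I (subset_univ (I.boundary Q)) subset_rfl 0) k) :
          RelHomology I (univ : Set Q) ∅ 0) = 0 := hk
    rw [Submodule.Quotient.mk_eq_zero] at hk'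
    exact chainIntegral_eq_zero_of_mem_relBoundaries hζ hd hk'
  have h3 : chainIntegral I ζ ((z - (p + k) : relCycles I (I.boundary Q) ∅ 0) : Chain Q I 1) = 0 := by
    rw [← Submodule.Quotient.mk_add] at hab
    have h4 := (Submodule.Quotient.eq _).1 hab.symm
    exact chainIntegral_eq_zero_of_mem_relBoundaries hζ hd h4
  have h5 : (z : Chain Q I 1) = ((z - (p + k) : relCycles I (I.boundary Q) ∅ 0) : Chain Q I 1) +
      ((p : Chain Q I 1) + (k : Chain Q I 1)) := by
    simp
  rw [h5, chainIntegral_add_chain, chainIntegral_add_chain, h1, h2, h3]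
  simp

/-- The map factors through the range of `f`, and over a division ring a linear map extends from a
subspace. -/
theorem exists_comp_eq_of_ker_le {K V W U : Type*} [DivisionRing K] [AddCommGroup V] [Module K V]
    [AddCommGroup W] [Module K W] [AddCommGroup U] [Module K U] (f : V →ₗ[K] W) (g : V →ₗ[K] U)
    (h : LinearMap.ker f ≤ LinearMap.ker g) : ∃ L : W →ₗ[K] U, L.comp f = g := by
  obtain ⟨L, hL⟩ := LinearMap.exists_extend
    (((LinearMap.ker f).liftQ g h).comp f.quotKerEquivRange.symm.toLinearMap)
  refine ⟨L, ?_⟩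
  ext v
  have h1 := congrArg (fun F : LinearMap.range f →ₗ[K] U => F ⟨f v, LinearMap.mem_range_self f v⟩) hL
  refine Eq.trans h1 ?_
  have h2 : f.quotKerEquivRange.symm ⟨f v, LinearMap.mem_range_self f v⟩ =
      (LinearMap.ker f).mkQ v := by
    rw [LinearEquiv.symm_apply_eq]
    rfl
  simp [h2]

/-- A `1`-form whose periods on the cycles in `S` are zero is, on the curves in `S`, the
differential of a function. -/
theorem exists_function_of_periods_eq_zero {S : Set Q} {ζ : Form E Q 1}
    (h : ∀ z ∈ chainsIn I S 1, bdry Q I 0 z = 0 → chainIntegral I ζ z = 0) :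
    ∃ f : Q → ℝ, ∀ γ : ℝ → Q, ContMDiffOn 𝓘(ℝ, ℝ) I ∞ γ (Icc 0 1) → (∀ u ∈ Icc (0 : ℝ) 1, γ u ∈ S) →
      lineIntegral I ζ γ = f (γ 1) - f (γ 0) := by
  -- Integration over chains in `S` kills the cycles, so it is `L ∘ ∂` for a `ℚ`-linear `L` on
  -- `0`-chains, and `L` evaluated at a point is the function sought. The choice of `L` gives it no
  -- continuity on `Q`; only its differences along curves in `S` have a meaning.
  obtain ⟨L, hL⟩ := exists_comp_eq_of_ker_le ((bdry Q I 0).comp (chainsIn I S 1).subtype)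
    ((Finsupp.linearCombination ℚ (simplexIntegral I ζ)).comp (chainsIn I S 1).subtype)
    (fun z hz => by
      have := h z z.2 hz
      rwa [chainIntegral_eq_linearCombination] at this)
  refine ⟨fun x => L (pointChain x), fun γ hγ hγS => ?_⟩
  have hc : EqOn (extendSimplex fun t : simplex 1 => γ (t.1 0)) (fun t => γ (t 0)) (simplex 1) :=
    fun t ht => extendSimplex_of_mem _ ht
  have hm : MapsTo (fun t : Fin 1 → ℝ => t 0) (simplex 1) (Icc 0 1) := fun t ht => by
    have h2 := ht.2
    simp only [Finset.univ_unique, Fin.default_eq_zero, Finset.sum_singleton] at h2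
    exact ⟨ht.1 0, h2⟩
  set σ : SmoothSimplex Q I 1 := ⟨fun t => γ (t.1 0), by
    have h1 : ContDiff ℝ ∞ fun t : Fin 1 → ℝ => t 0 := by fun_prop
    exact (hγ.comp h1.contMDiff.contMDiffOn hm).congr hc⟩ with hσ
  have hedge : EqOn σ.edge γ (Icc 0 1) := fun u hu => hc (const_mem_simplex_one.2 hu)
  have hσS : Finsupp.single σ (1 : ℚ) ∈ chainsIn I S 1 := by
    refine mem_chainsIn.2 fun τ hτ => ?_
    rw [Finset.mem_singleton.1 (Finsupp.support_single_subset hτ)]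
    rintro _ ⟨t, rfl⟩
    exact hγS _ (hm t.2)
  have h1 := congrArg (fun F : chainsIn I S 1 →ₗ[ℚ] ℝ => F ⟨_, hσS⟩) hL
  simp only [LinearMap.comp_apply, Submodule.subtype_apply, Finsupp.linearCombination_single,
    one_smul, bdry_single_one, map_sub] at h1
  rw [simplexIntegral_eq_lineIntegral, lineIntegral_congr ζ hedge, hedge (by simp),
    hedge (by simp)] at h1
  exact h1.symm

end Periods

/-! ### Differentials of functions glued by a partition of unity. -/

section Differential

variable {E H Q : Type*} [NormedAddCommGroup E] [NormedSpace ℝ E] [TopologicalSpace H]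
  {I : ModelWithCorners ℝ E H} [TopologicalSpace Q] [ChartedSpace H Q]

theorem HasMFDerivAt.differential_eq {f : Q → ℝ} {x : Q} {L : E →L[ℝ] ℝ}
    (h : HasMFDerivAt I 𝓘(ℝ, ℝ) f x L) : differential I f x = ofCovector L := by
  rw [differential, h.mfderiv]

theorem ofCovector_toCovector (a : E [⋀^Fin 1]→L[ℝ] ℝ) : ofCovector (toCovector a) = a :=
  (ContinuousAlternatingMap.ofSubsingleton ℝ E ℝ (0 : Fin 1)).apply_symm_apply a

theorem norm_ofCovector (a : E →L[ℝ] ℝ) : ‖ofCovector a‖ = ‖a‖ :=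
  (ContinuousAlternatingMap.ofSubsingletonLIE (0 : Fin 1) :
      (E →L[ℝ] ℝ) ≃ₗᵢ[ℝ] (E [⋀^Fin 1]→L[ℝ] ℝ)).norm_map a

theorem differential_add {f g : Q → ℝ} {x : Q} (hf : MDifferentiableAt I 𝓘(ℝ, ℝ) f x)
    (hg : MDifferentiableAt I 𝓘(ℝ, ℝ) g x) :
    differential I (f + g) x = differential I f x + differential I g x := by
  rw [HasMFDerivAt.differential_eq (hf.hasMFDerivAt.add hg.hasMFDerivAt)]
  rfl

theorem differential_sub {f g : Q → ℝ} {x : Q} (hf : MDifferentiableAt I 𝓘(ℝ, ℝ) f x)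
    (hg : MDifferentiableAt I 𝓘(ℝ, ℝ) g x) :
    differential I (f - g) x = differential I f x - differential I g x := by
  rw [HasMFDerivAt.differential_eq (hf.hasMFDerivAt.sub hg.hasMFDerivAt)]
  rfl

theorem differential_mul {f g : Q → ℝ} {x : Q} (hf : MDifferentiableAt I 𝓘(ℝ, ℝ) f x)
    (hg : MDifferentiableAt I 𝓘(ℝ, ℝ) g x) :
    differential I (f * g) x = f x • differential I g x + g x • differential I f x := by
  rw [HasMFDerivAt.differential_eq (hf.hasMFDerivAt.mul hg.hasMFDerivAt)]
  rfl

theorem differential_const (c : ℝ) (x : Q) : differential I (fun _ : Q => c) x = 0 := by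
  rw [HasMFDerivAt.differential_eq (hasMFDerivAt_const c x)]
  rfl

theorem differential_congr {f g : Q → ℝ} {x : Q} (h : f =ᶠ[𝓝 x] g) :
    differential I f x = differential I g x := by
  rw [differential, h.mfderiv_eq]
  rfl

theorem differential_sum {ι : Type*} (s : Finset ι) {f : ι → Q → ℝ} {x : Q}
    (hf : ∀ i ∈ s, MDifferentiableAt I 𝓘(ℝ, ℝ) (f i) x) :
    MDifferentiableAt I 𝓘(ℝ, ℝ) (∑ i ∈ s, f i) x ∧
      differential I (∑ i ∈ s, f i) x = ∑ i ∈ s, differential I (f i) x := by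
  classical
  induction s using Finset.induction_on with
  | empty => exact ⟨mdifferentiableAt_const (c := (0 : ℝ)), differential_const 0 x⟩
  | insert a s ha ih =>
    obtain ⟨h1, h2⟩ := ih fun i hi => hf i (Finset.mem_insert_of_mem hi)
    have h3 := hf a (Finset.mem_insert_self a s)
    rw [Finset.sum_insert ha, Finset.sum_insert ha, differential_add h3 h1, h2]
    exact ⟨h3.add h1, rfl⟩

theorem differential_eq_zero_of_notMem_tsupport {f : Q → ℝ} {x : Q} (hx : x ∉ tsupport f) :
    differential I f x = 0 := by
  rw [differential_congr (g := fun _ => 0), differential_const]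
  exact notMem_tsupport_iff_eventuallyEq.1 hx

theorem contMDiff_mul_of_tsupport_subset {ρ g : Q → ℝ} {V : Set Q} (hV : IsOpen V)
    (hρ : ContMDiff I 𝓘(ℝ, ℝ) ∞ ρ) (hg : ContMDiffOn I 𝓘(ℝ, ℝ) ∞ g V) (h : tsupport ρ ⊆ V) :
    ContMDiff I 𝓘(ℝ, ℝ) ∞ (ρ * g) := by
  refine contMDiff_of_tsupport fun x hx => ?_
  have hxV : x ∈ V := h (tsupport_mul_subset_left hx)
  exact hρ.contMDiffAt.mul ((hg x hxV).contMDiffAt (hV.mem_nhds hxV))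

/-- The differential of a function glued from local ones. -/
theorem differential_glue {ι : Type*} (s : Finset ι) {ρ g : ι → Q → ℝ} {V : ι → Set Q}
    (hV : ∀ i, IsOpen (V i)) (hρ : ∀ i, ContMDiff I 𝓘(ℝ, ℝ) ∞ (ρ i))
    (hg : ∀ i ∈ s, ContMDiffOn I 𝓘(ℝ, ℝ) ∞ (g i) (V i)) (h : ∀ i, tsupport (ρ i) ⊆ V i) :
    ContMDiff I 𝓘(ℝ, ℝ) ∞ (∑ i ∈ s, ρ i * g i) ∧
      ∀ x, differential I (∑ i ∈ s, ρ i * g i) x =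
        ∑ i ∈ s, (ρ i x • differential I (g i) x + g i x • differential I (ρ i) x) := by
  have h1 : ∀ i ∈ s, ContMDiff I 𝓘(ℝ, ℝ) ∞ (ρ i * g i) := fun i hi =>
    contMDiff_mul_of_tsupport_subset (hV i) (hρ i) (hg i hi) (h i)
  refine ⟨?_, fun x => ?_⟩
  · have : (∑ i ∈ s, ρ i * g i) = fun x => ∑ i ∈ s, (ρ i * g i) x := by
      ext x
      simp
    rw [this]
    exact contMDiff_finsetSum h1
  · rw [(differential_sum s fun i hi => (h1 i hi).mdifferentiable (by simp) x).2]
    refine Finset.sum_congr rfl fun i hi => ?_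
    by_cases hx : x ∈ tsupport (ρ i)
    · exact differential_mul ((hρ i).mdifferentiable (by simp) x)
        (((hg i hi x (h i hx)).contMDiffAt ((hV i).mem_nhds (h i hx))).mdifferentiableAt (by simp))
    · have h0 : differential I (ρ i * g i) x = 0 := differential_eq_zero_of_notMem_tsupport
        (f := ρ i * g i) fun hx' => hx (tsupport_mul_subset_left hx')
      rw [image_eq_zero_of_notMem_tsupport hx, differential_eq_zero_of_notMem_tsupport hx, h0]
      simp

theorem sum_differential_eq_zero {ι : Type*} (s : Finset ι) {ρ : ι → Q → ℝ}
    (hρ : ∀ i, ContMDiff I 𝓘(ℝ, ℝ) ∞ (ρ i)) (hsum : ∀ x, ∑ i ∈ s, ρ i x = 1) (x : Q) :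
    ∑ i ∈ s, differential I (ρ i) x = 0 := by
  rw [← (differential_sum s fun i _ => (hρ i).mdifferentiable (by simp) x).2]
  have : (∑ i ∈ s, ρ i) = fun _ => 1 := by
    ext x
    rw [Finset.sum_apply, hsum]
  rw [this, differential_const]

end Differential

/-! ### Balls in charts. -/

section ChartBall

variable {E H Q : Type*} [NormedAddCommGroup E] [NormedSpace ℝ E] [TopologicalSpace H]
  {I : ModelWithCorners ℝ E H} [TopologicalSpace Q] [ChartedSpace H Q]

variable (I) in
/-- The points whose coordinates in the preferred chart at `x` are in a ball around those of `x`. -/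
def chartBall (x : Q) (r : ℝ) : Set Q :=
  (extChartAt I x).source ∩ extChartAt I x ⁻¹' Metric.ball (extChartAt I x x) r

variable (I) in
/-- The image of `chartBall I x r` in the chart. -/
def coordBall (x : Q) (r : ℝ) : Set E := Metric.ball (extChartAt I x x) r ∩ range I

theorem isOpen_chartBall (x : Q) (r : ℝ) : IsOpen (chartBall I x r) :=
  (continuousOn_extChartAt x).isOpen_inter_preimage (isOpen_extChartAt_source x) Metric.isOpen_ball

theorem mem_chartBall_self (x : Q) {r : ℝ} (hr : 0 < r) : x ∈ chartBall I x r :=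
  ⟨mem_extChartAt_source x, Metric.mem_ball_self hr⟩

/-- The closed ball, and not just the open one, lies in the target: its trace on `range I` is
compact in finite dimension, which gives uniform constants on the ball. -/
theorem exists_coordBall_subset (x : Q) {V : Set Q} (hV : V ∈ 𝓝 x) : ∃ r > 0,
    Metric.closedBall (extChartAt I x x) r ∩ range I ⊆ (extChartAt I x).target ∧
      chartBall I x r ⊆ V := by
  obtain ⟨a, ha, h1⟩ := (nhdsWithin_hasBasis Metric.nhds_basis_closedBall _).mem_iff.1
    (extChartAt_target_mem_nhdsWithin (I := I) x)
  have h2 : (extChartAt I x).symm ⁻¹' V ∈ 𝓝 (extChartAt I x x) := by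
    refine (continuousAt_extChartAt_symm (I := I) x).preimage_mem_nhds ?_
    rwa [extChartAt_to_inv]
  obtain ⟨b, hb, h3⟩ := Metric.nhds_basis_ball.mem_iff.1 h2
  refine ⟨min a b, lt_min ha hb, fun y hy => h1 ⟨?_, hy.2⟩, fun z hz => ?_⟩
  · exact Metric.closedBall_subset_closedBall (min_le_left _ _) hy.1
  · have h4 := h3 (Metric.ball_subset_ball (min_le_right a b) hz.2)
    simp only [mem_preimage] at h4
    rwa [(extChartAt I x).left_inv hz.1] at h4

theorem coordBall_subset_target {x : Q} {r : ℝ}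
    (hr : Metric.closedBall (extChartAt I x x) r ∩ range I ⊆ (extChartAt I x).target) :
    coordBall I x r ⊆ (extChartAt I x).target :=
  (inter_subset_inter_left _ Metric.ball_subset_closedBall).trans hr

theorem mapsTo_chartBall (x : Q) (r : ℝ) :
    MapsTo (extChartAt I x) (chartBall I x r) (coordBall I x r) :=
  fun z hz => ⟨hz.2, extChartAt_mem_range x z⟩

theorem symm_mem_chartBall {x : Q} {r : ℝ} (hr : coordBall I x r ⊆ (extChartAt I x).target) {y : E}
    (hy : y ∈ coordBall I x r) : (extChartAt I x).symm y ∈ chartBall I x r := by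
  refine ⟨(extChartAt I x).map_target (hr hy), ?_⟩
  rw [mem_preimage, (extChartAt I x).right_inv (hr hy)]
  exact hy.1

theorem convex_coordBall {ℓ : E →L[ℝ] ℝ} (hI : IsHalfSpaceModel I ℓ) (x : Q) (r : ℝ) :
    Convex ℝ (coordBall I x r) := by
  refine (convex_ball _ _).inter ?_
  rw [hI.range_eq]
  exact convex_halfSpace ℓ

theorem interior_coordBall_nonempty (x : Q) {r : ℝ} (hr : 0 < r) :
    (interior (coordBall I x r)).Nonempty := by
  have h1 : extChartAt I x x ∈ closure (interior (range I)) :=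
    I.range_subset_closure_interior (extChartAt_mem_range x x)
  obtain ⟨y, hy, hy'⟩ := mem_closure_iff.1 h1 _ Metric.isOpen_ball (Metric.mem_ball_self hr)
  refine ⟨y, ?_⟩
  rw [coordBall, interior_inter, Metric.isOpen_ball.interior_eq]
  exact ⟨hy, hy'⟩

theorem coordBall_mem_nhdsWithin {x : Q} {r : ℝ} {y : E} (hy : y ∈ coordBall I x r) :
    coordBall I x r ∈ 𝓝[range I] y :=
  inter_mem (mem_nhdsWithin_of_mem_nhds (Metric.isOpen_ball.mem_nhds hy.1)) self_mem_nhdsWithin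

variable [IsManifold I ∞ Q]

theorem inChart_eq_pullWithin_of_subset {k : ℕ} (η : Form E Q k) (x₀ : Q) {C : Set E}
    (hC : C ⊆ (extChartAt I x₀).target) (hCu : UniqueDiffOn ℝ C) {y : E} (hy : y ∈ C) :
    inChart I η x₀ y = pullWithin I C (extChartAt I x₀).symm η y := by
  have : IsManifold I 1 Q := isManifold_one I
  rw [inChart, pullWithin, mfderivWithin_subset
    (hC.trans (extChartAt_target_subset_range x₀))
    (hCu y hy).uniqueMDiffWithinAt (mdifferentiableWithinAt_extChartAt_symm (hC hy))]

/-- A function given in coordinates on a chart ball. -/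
theorem contMDiffOn_comp_extChartAt {x : Q} {r : ℝ} {T : E → ℝ}
    (hT : ContDiffOn ℝ ∞ T (coordBall I x r)) :
    ContMDiffOn I 𝓘(ℝ, ℝ) ∞ (T ∘ extChartAt I x) (chartBall I x r) := by
  refine hT.contMDiffOn.comp ((contMDiffOn_extChartAt (x := x)).mono fun z hz => ?_)
    (mapsTo_chartBall x r)
  simpa using hz.1

theorem differential_comp_extChartAt {x z : Q} {r : ℝ} {T : E → ℝ} {L : E →L[ℝ] ℝ}
    (hz : z ∈ chartBall I x r)
    (hT : HasFDerivWithinAt T L (coordBall I x r) (extChartAt I x z)) :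
    differential I (T ∘ extChartAt I x) z =
      (ofCovector L).compContinuousLinearMap (mfderiv I 𝓘(ℝ, E) (extChartAt I x) z : E →L[ℝ] E) := by
  have : IsManifold I 1 Q := isManifold_one I
  have h1 := (mdifferentiableAt_extChartAt (I := I) (x := x) (y := z)
    (by simpa using hz.1)).hasMFDerivAt.hasMFDerivWithinAt (s := chartBall I x r)
  have h2 := HasMFDerivWithinAt.comp z hT.hasMFDerivWithinAt h1 (mapsTo_chartBall x r)
  have h3 := h2.hasMFDerivAt ((isOpen_chartBall x r).mem_nhds hz)
  rw [HasMFDerivAt.differential_eq h3]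
  ext v
  rfl

end ChartBall

/-! ### Closed forms without periods do not contribute to helicity. -/

section ClosedForms

variable {E H Q : Type*} [NormedAddCommGroup E] [NormedSpace ℝ E] [TopologicalSpace H]
  {I : ModelWithCorners ℝ E H} [TopologicalSpace Q] [ChartedSpace H Q] [IsManifold I ∞ Q]
  [FiniteDimensional ℝ E] {ℓ : E →L[ℝ] ℝ}

/-- A local primitive of a closed `1`-form, equal on the boundary to a given function that is a
primitive along the boundary. -/
theorem exists_local_primitive (hI : IsHalfSpaceModel I ℓ) {ζ : Form E Q 1} (hζ : IsSmoothForm I ζ)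
    (hd : extD I ζ = 0) {f : Q → ℝ}
    (hf : ∀ γ : ℝ → Q, ContMDiffOn 𝓘(ℝ, ℝ) I ∞ γ (Icc 0 1) →
      (∀ u ∈ Icc (0 : ℝ) 1, γ u ∈ I.boundary Q) → lineIntegral I ζ γ = f (γ 1) - f (γ 0))
    {x : Q} {r : ℝ} (hr0 : 0 < r) (hr : coordBall I x r ⊆ (extChartAt I x).target) :
    ∃ g : Q → ℝ, ContMDiffOn I 𝓘(ℝ, ℝ) ∞ g (chartBall I x r) ∧
      (∀ z ∈ chartBall I x r, differential I g z = ζ z) ∧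
      ∀ z ∈ chartBall I x r, z ∈ I.boundary Q → g z = f z := by
  set C := coordBall I x r with hCdef
  have hC := convex_coordBall hI x r
  have hCi := interior_coordBall_nonempty (I := I) x hr0
  have hCu := uniqueDiffOn_convex hC hCi
  have hsymm : ContMDiffOn 𝓘(ℝ, E) I ∞ (extChartAt I x).symm C :=
    (contMDiffOn_extChartAt_symm x).mono hr
  obtain ⟨T, hT, hT'⟩ := exists_primitive_of_pullWithin_extD_eq_zero hC hCi hsymm hζ (fun t _ => by
    rw [hd]; rfl)
  have hdiff : ∀ c : ℝ, ∀ z ∈ chartBall I x r,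
      differential I ((fun y => T y + c) ∘ extChartAt I x) z = ζ z := by
    intro c z hz
    have h1 := (hT' _ (mapsTo_chartBall x r hz)).add_const c
    rw [differential_comp_extChartAt hz h1, ofCovector_toCovector,
      ← inChart_eq_pullWithin_of_subset ζ x hr hCu (mapsTo_chartBall x r hz),
      ← eq_inChart_comp (I := I) ζ x hz.1]
  have hsm : ∀ c : ℝ, ContMDiffOn I 𝓘(ℝ, ℝ) ∞ ((fun y => T y + c) ∘ extChartAt I x)
      (chartBall I x r) := fun c => contMDiffOn_comp_extChartAt (hT.add contDiffOn_const)
  by_cases hb : ∃ y₁ ∈ C, ℓ y₁ = 0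
  · obtain ⟨y₁, hy₁, hℓ₁⟩ := hb
    -- The constant makes the primitive agree with `f` at one boundary point of the ball. Another
    -- boundary point is joined to it by a segment in the boundary hyperplane, along which both
    -- functions change by the same line integral.
    set c := f ((extChartAt I x).symm y₁) - T y₁ with hc
    refine ⟨_, hsm c, hdiff c, fun z hz hzb => ?_⟩
    set y := extChartAt I x z with hy
    have hyC : y ∈ C := mapsTo_chartBall x r hz
    have hℓy : ℓ y = 0 := (hI.mem_boundary_iff x hz.1).1 hzb
    have h1 := hf _ (contMDiffOn_line hC hsymm hy₁ hyC) (fun u hu => by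
      refine (hI.mem_boundary_symm_iff x (hr (hC.add_smul_sub_mem hy₁ hyC hu))).2 ?_
      simp [hℓ₁, hℓy])
    rw [lineIntegral_eq_sub hC hsymm hζ hT' hy₁ hyC] at h1
    simp only [one_smul, add_sub_cancel, zero_smul, add_zero] at h1
    have h2 : (extChartAt I x).symm y = z := (extChartAt I x).left_inv hz.1
    rw [h2] at h1
    simp only [Function.comp_apply, hc, ← hy]
    linarith
  · refine ⟨_, hsm 0, hdiff 0, fun z hz hzb => absurd ?_ hb⟩
    exact ⟨_, mapsTo_chartBall x r hz, (hI.mem_boundary_iff x hz.1).1 hzb⟩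

variable [T2Space Q] [CompactSpace Q] [MeasurableSpace E] [BorelSpace E]

/-- A closed `1`-form with zero periods on the boundary becomes zero at the boundary after the
subtraction of the differential of a function. -/
theorem exists_differential_eq_on_boundary (hI : IsHalfSpaceModel I ℓ) {ζ : Form E Q 1}
    (hζ : IsSmoothForm I ζ) (hd : extD I ζ = 0) {f : Q → ℝ}
    (hf : ∀ γ : ℝ → Q, ContMDiffOn 𝓘(ℝ, ℝ) I ∞ γ (Icc 0 1) →
      (∀ u ∈ Icc (0 : ℝ) 1, γ u ∈ I.boundary Q) → lineIntegral I ζ γ = f (γ 1) - f (γ 0)) :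
    ∃ F : Q → ℝ, ContMDiff I 𝓘(ℝ, ℝ) ∞ F ∧ ∀ x ∈ I.boundary Q, differential I F x = ζ x := by
  choose r hr0 hr _ using fun x : Q => exists_coordBall_subset (I := I) x univ_mem
  choose g hg hgd hgb using fun x : Q =>
    exists_local_primitive hI hζ hd hf (hr0 x) (coordBall_subset_target (hr x))
  obtain ⟨ρ, hρ⟩ := SmoothPartitionOfUnity.exists_isSubordinate I (isClosed_univ (X := Q))
    (fun x => chartBall I x (r x)) (fun x => isOpen_chartBall x (r x))
    (fun x _ => mem_iUnion.2 ⟨x, mem_chartBall_self x (hr0 x)⟩)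
  obtain ⟨s, hs, hs1⟩ := exists_finset_partition ρ
  have hglue := differential_glue (I := I) s (ρ := fun i => ρ i) (g := g)
    (V := fun x => chartBall I x (r x)) (fun x => isOpen_chartBall x (r x))
    (fun i => (ρ i).contMDiff) (fun i _ => hg i) (fun i => hρ i)
  refine ⟨_, hglue.1, fun x hx => ?_⟩
  rw [hglue.2 x]
  -- At a boundary point every `g i` in play has the value `f x`, so the terms `g i • dρ i` add up
  -- to `f x • ∑ dρ i = 0`. Thus `f` may be used although it is not known to be smooth.
  have h1 : ∀ i ∈ s, ρ i x • differential I (g i) x + g i x • differential I (ρ i) x =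
      ρ i x • ζ x + f x • differential I (ρ i) x := by
    intro i _
    by_cases hxi : x ∈ tsupport (ρ i)
    · rw [hgd i x (hρ i hxi), hgb i x (hρ i hxi) hx]
    · rw [image_eq_zero_of_notMem_tsupport hxi, differential_eq_zero_of_notMem_tsupport hxi]
      simp
  rw [Finset.sum_congr rfl h1, Finset.sum_add_distrib, ← Finset.sum_smul, hs1, one_smul,
    ← Finset.smul_sum, sum_differential_eq_zero s (fun i => (ρ i).contMDiff) hs1, smul_zero, add_zero]

variable [Fact (finrank ℝ E = 3)]

/-- The product of a closed `1`-form that has zero periods on `P` with an exact field has integral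
zero. -/
theorem formIntegral_wedgeOne_eq_zero_of_hasZeroPeriods (hI : IsHalfSpaceModel I ℓ)
    {μ : Form E Q 3} (hμ : IsVolumeForm I μ) {P : Submodule ℚ (H1Boundary Q I)}
    (hP : IsCompl P (LinearMap.ker (inclH1 Q I))) {ζ : Form E Q 1} (hζ : IsSmoothForm I ζ)
    (hd : extD I ζ = 0) (h : HasZeroPeriods I P ζ) {B : Form E Q 2} (hB : B ∈ exactFields Q I) :
    formIntegral I μ (wedgeOne ζ B) = 0 := by
  obtain ⟨f, hf⟩ := exists_function_of_periods_eq_zero (I := I) (S := I.boundary Q) (ζ := ζ)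
    (fun z hz hz0 => h.chainIntegral_eq_zero hP hζ hd ⟨z, hz, by
      change bdry Q I 0 z ∈ chainsIn I ∅ 0
      rw [hz0]
      exact Submodule.zero_mem _⟩)
  obtain ⟨F, hF, hFb⟩ := exists_differential_eq_on_boundary hI hζ hd hf
  obtain ⟨hBs, ⟨A, hA, rfl⟩, hBb⟩ := hB
  have hdF := isSmoothForm_differential (I := I) hF
  -- `dF ∧ B = d(F B)`, where `B` restricts to zero on the boundary, and `(ζ - dF) ∧ dA = -d((ζ -
  -- dF) ∧ A)`, where `ζ - dF` vanishes on the boundary.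
  have hζ' := hζ.sub hdF
  have hsplit : ζ = (ζ - differential I F) + differential I F := by simp
  rw [hsplit, wedgeOne_add_left, formIntegral_add hμ (hζ'.wedgeOne hBs) (hdF.wedgeOne hBs)]
  have h1 : formIntegral I μ (wedgeOne (differential I F) (extD I A)) = 0 := by
    have h2 := extD_fun_smul hF hBs
    rw [hA.extD_extD] at h2
    have h3 : wedgeOne (differential I F) (extD I A) = extD I (fun x => F x • extD I A x) := by
      rw [h2]
      ext1 x
      simp
    rw [h3]
    exact formIntegral_extD_eq_zero hI hμ (hBs.fun_smul hF) (hBb.fun_smul F)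
  have h2 : formIntegral I μ (wedgeOne (ζ - differential I F) (extD I A)) = 0 := by
    have h3 := extD_wedgeOne hζ' hA
    rw [extD_sub hζ hdF, hd, extD_differential hF, sub_zero] at h3
    have h4 : wedgeOne A (0 : Form E Q 2) = 0 := by
      have := wedgeOne_smul_right (0 : ℝ) A (0 : Form E Q 2)
      simpa using this
    rw [h4, zero_sub] at h3
    have h5 : wedgeOne (ζ - differential I F) (extD I A) =
        (-1 : ℝ) • extD I (wedgeOne (ζ - differential I F) A) := by
      rw [h3]
      ext1 x
      simp
    rw [h5, formIntegral_smul, formIntegral_extD_eq_zero hI hμ (hζ'.wedgeOne hA), mul_zero]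
    refine VanishesOnBoundary.wedgeOne_left (fun x hx v _ => ?_) A
    rw [Pi.sub_apply, hFb x hx, sub_self]
    rfl
  rw [h1, h2, add_zero]

end ClosedForms

/-! ### Integrals depending on a parameter, and the radial homotopy. -/

section ParametricIntegral

universe u

variable {E : Type u} [NormedAddCommGroup E] [NormedSpace ℝ E]

/-- Differentiation under the integral sign on a convex set. -/
theorem hasFDerivWithinAt_parametric_integral {F : Type*} [NormedAddCommGroup F] [NormedSpace ℝ F]
    [CompleteSpace F] {C : Set E} (hC : Convex ℝ C) {H : E × ℝ → F} {D : E × ℝ → E →L[ℝ] F}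
    (hH : ContinuousOn H (C ×ˢ Icc 0 1)) (hDc : ContinuousOn D (C ×ˢ Icc 0 1))
    (hD : ∀ z ∈ C, ∀ t ∈ Icc (0 : ℝ) 1, HasFDerivWithinAt (fun z => H (z, t)) (D (z, t)) C z)
    {y : E} (hy : y ∈ C) :
    HasFDerivWithinAt (fun y => ∫ t in (0 : ℝ)..1, H (y, t)) (∫ t in (0 : ℝ)..1, D (y, t)) C y := by
  set S : Set (E × ℝ) := C ×ˢ Icc 0 1 with hS
  have hline : ∀ z ∈ C, MapsTo (fun t : ℝ => (z, t)) (Icc 0 1) S := fun z hz t ht => ⟨hz, ht⟩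
  have hcl : ∀ z : E, Continuous fun t : ℝ => (z, t) := fun z => by fun_prop
  have hHi : ∀ z ∈ C, IntervalIntegrable (fun t => H (z, t)) volume 0 1 := fun z hz => by
    refine ContinuousOn.intervalIntegrable ?_
    rw [uIcc_of_le zero_le_one]
    exact hH.comp (hcl z).continuousOn (hline z hz)
  have hDi : IntervalIntegrable (fun t => D (y, t)) volume 0 1 := by
    refine ContinuousOn.intervalIntegrable ?_
    rw [uIcc_of_le zero_le_one]
    exact hDc.comp (hcl y).continuousOn (hline y hy)
  rw [hasFDerivWithinAt_iff_isLittleO, Asymptotics.isLittleO_iff]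
  intro ε hε
  -- Continuity of `D` at the points `(y, t)` becomes uniform in `t`, since `[0, 1]` is compact.
  have hunif : ∀ᶠ z in 𝓝 y, ∀ t ∈ Icc (0 : ℝ) 1, t ∈ Icc (0 : ℝ) 1 → z ∈ C →
      ‖D (z, t) - D (y, t)‖ ≤ ε := by
    refine isCompact_Icc.eventually_forall_of_forall_eventually
      (P := fun z t => t ∈ Icc (0 : ℝ) 1 → z ∈ C → ‖D (z, t) - D (y, t)‖ ≤ ε) fun t₀ ht₀ => ?_
    have h1 := hDc (y, t₀) ⟨hy, ht₀⟩
    have h2 : ∀ᶠ p in 𝓝[S] (y, t₀), dist (D p) (D (y, t₀)) < ε / 2 :=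
      h1 (Metric.ball_mem_nhds _ (by positivity))
    have h3 : ∀ᶠ p in 𝓝 (y, t₀), p ∈ S → dist (D p) (D (y, t₀)) < ε / 2 :=
      eventually_nhdsWithin_iff.1 h2
    have h4 : Tendsto (fun p : E × ℝ => (y, p.2)) (𝓝 (y, t₀)) (𝓝 (y, t₀)) := by
      have : Continuous fun p : E × ℝ => (y, p.2) := by fun_prop
      exact this.tendsto' _ _ rfl
    filter_upwards [h3, h4.eventually h3] with p hp1 hp2 hpt hpC
    have e1 := hp1 ⟨hpC, hpt⟩
    have e2 := hp2 ⟨hy, hpt⟩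
    rw [← dist_eq_norm]
    exact (dist_triangle_right (D p) (D (y, p.2)) (D (y, t₀))).trans (by linarith)
  obtain ⟨r, hr, hball⟩ := Metric.eventually_nhds_iff_ball.1 hunif
  filter_upwards [mem_nhdsWithin_of_mem_nhds (Metric.ball_mem_nhds y hr), self_mem_nhdsWithin]
    with z hz hzC
  have hconv : Convex ℝ (Metric.ball y r ∩ C) := (convex_ball y r).inter hC
  have hDzi : IntervalIntegrable (fun t => D (y, t) (z - y)) volume 0 1 :=
    ⟨(ContinuousLinearMap.apply ℝ F (z - y)).integrable_comp hDi.1,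
      (ContinuousLinearMap.apply ℝ F (z - y)).integrable_comp hDi.2⟩
  rw [← intervalIntegral.integral_sub (hHi z hzC) (hHi y hy),
    ContinuousLinearMap.intervalIntegral_apply hDi,
    ← intervalIntegral.integral_sub ((hHi z hzC).sub (hHi y hy)) hDzi]
  refine (intervalIntegral.norm_integral_le_of_norm_le_const (C := ε * ‖z - y‖) ?_).trans (by simp)
  intro t ht
  rw [uIoc_of_le zero_le_one] at ht
  have ht' : t ∈ Icc (0 : ℝ) 1 := Ioc_subset_Icc_self ht
  exact hconv.norm_image_sub_le_of_norm_hasFDerivWithin_le' (f := fun z => H (z, t))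
    (fun w hw => (hD w hw.2 t ht').mono inter_subset_right)
    (fun w hw => hball w hw.1 t ht' ht' hw.2) ⟨Metric.mem_ball_self hr, hy⟩ ⟨hz, hzC⟩

theorem ContDiffOn.hasFDerivWithinAt_left {F : Type*} [NormedAddCommGroup F] [NormedSpace ℝ F]
    {C : Set E} {H : E × ℝ → F} (hH : ContDiffOn ℝ 1 H (C ×ˢ Icc 0 1)) {z : E} (hz : z ∈ C) {t : ℝ}
    (ht : t ∈ Icc (0 : ℝ) 1) :
    HasFDerivWithinAt (fun z => H (z, t)) ((fderivWithin ℝ H (C ×ˢ Icc 0 1) (z, t)).comp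
      (ContinuousLinearMap.inl ℝ E ℝ)) C z :=
  HasFDerivWithinAt.comp z (t := C ×ˢ Icc 0 1)
    ((hH.differentiableOn one_ne_zero) (z, t) ⟨hz, ht⟩).hasFDerivWithinAt
    (hasFDerivAt_prodMk_left z t).hasFDerivWithinAt
    (show MapsTo (fun w => (w, t)) C (C ×ˢ Icc 0 1) from fun _ hw => ⟨hw, ht⟩)

/-- Induction on the order: the derivative of the integral is the integral of the partial
derivative. Giving away one derivative is harmless, as only `∞` is wanted. `E` and `F` share a
universe so that the induction can pass from `F` to `E →L[ℝ] F`. -/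
theorem contDiffOn_nat_parametric_integral {C : Set E} (hC : Convex ℝ C) (hCu : UniqueDiffOn ℝ C)
    (n : ℕ) {F : Type u} [NormedAddCommGroup F] [NormedSpace ℝ F] [CompleteSpace F] {H : E × ℝ → F}
    (hH : ContDiffOn ℝ (n + 1 : ℕ) H (C ×ˢ Icc 0 1)) :
    ContDiffOn ℝ n (fun y => ∫ t in (0 : ℝ)..1, H (y, t)) C := by
  have hSu : UniqueDiffOn ℝ (C ×ˢ Icc (0 : ℝ) 1) := hCu.prod uniqueDiffOn_unitInterval
  have key : ∀ {F : Type u} [NormedAddCommGroup F] [NormedSpace ℝ F] [CompleteSpace F]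
      {H : E × ℝ → F}, ContDiffOn ℝ 1 H (C ×ˢ Icc 0 1) → ∀ y ∈ C,
      HasFDerivWithinAt (fun y => ∫ t in (0 : ℝ)..1, H (y, t))
        (∫ t in (0 : ℝ)..1, (fderivWithin ℝ H (C ×ˢ Icc 0 1) (y, t)).comp
          (ContinuousLinearMap.inl ℝ E ℝ)) C y := by
    intro F _ _ _ H hH y hy
    exact hasFDerivWithinAt_parametric_integral hC
      (D := fun p => (fderivWithin ℝ H (C ×ˢ Icc 0 1) p).comp (ContinuousLinearMap.inl ℝ E ℝ))
      hH.continuousOn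
      ((hH.continuousOn_fderivWithin hSu le_rfl).clm_comp continuousOn_const)
      (fun z hz t ht => ContDiffOn.hasFDerivWithinAt_left hH hz ht) hy
  induction n generalizing F with
  | zero =>
    refine contDiffOn_zero.2 fun y hy => ?_
    exact (key (by simpa using hH) y hy).continuousWithinAt
  | succ n ih =>
    have h1 : ContDiffOn ℝ 1 H (C ×ˢ Icc 0 1) := hH.of_le (by norm_cast; omega)
    have : ((n + 1 : ℕ) : WithTop ℕ∞) = n + 1 := by push_cast; rfl
    rw [this, contDiffOn_succ_iff_fderivWithin hCu]
    refine ⟨fun y hy => (key h1 y hy).differentiableWithinAt, by simp, ?_⟩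
    have hD : ContDiffOn ℝ (n + 1 : ℕ) (fun p => (fderivWithin ℝ H (C ×ˢ Icc 0 1) p).comp
        (ContinuousLinearMap.inl ℝ E ℝ)) (C ×ˢ Icc 0 1) :=
      (hH.fderivWithin hSu (by norm_cast)).clm_comp contDiffOn_const
    exact (ih hD).congr fun y hy => (key h1 y hy).fderivWithin (hCu y hy)

theorem contDiffOn_parametric_integral {C : Set E} (hC : Convex ℝ C) (hCu : UniqueDiffOn ℝ C)
    {F : Type u} [NormedAddCommGroup F] [NormedSpace ℝ F] [CompleteSpace F] {H : E × ℝ → F}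
    (hH : ContDiffOn ℝ ∞ H (C ×ˢ Icc 0 1)) :
    ContDiffOn ℝ ∞ (fun y => ∫ t in (0 : ℝ)..1, H (y, t)) C :=
  contDiffOn_infty.2 fun n => contDiffOn_nat_parametric_integral hC hCu n
    (hH.of_le (by exact_mod_cast le_top))

end ParametricIntegral

/-- On a convex set a smooth field of covectors differs from an exact one by at most a multiple of
the size of its exterior derivative. -/
theorem exists_norm_sub_fderivWithin_le {E : Type} [NormedAddCommGroup E] [NormedSpace ℝ E]
    {C : Set E} (hC : Convex ℝ C) (hCu : UniqueDiffOn ℝ C) {A : E → E →L[ℝ] ℝ}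
    (hA : ContDiffOn ℝ ∞ A C) {y₀ : E} (hy₀ : y₀ ∈ C) {ε : ℝ} (hε : 0 ≤ ε)
    (hd : ∀ z ∈ C, ∀ a b, |fderivWithin ℝ A C z a b - fderivWithin ℝ A C z b a| ≤ ε * ‖a‖ * ‖b‖) :
    ∃ G : E → ℝ, ContDiffOn ℝ ∞ G C ∧
      ∀ y ∈ C, ‖A y - fderivWithin ℝ G C y‖ ≤ ε * ‖y - y₀‖ := by
  set c : E × ℝ → E := fun p => y₀ + p.2 • (p.1 - y₀) with hc
  have hcs : ContDiff ℝ ∞ c := by fun_prop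
  have hcm : MapsTo c (C ×ˢ Icc 0 1) C := fun p hp => by
    exact hC.add_smul_sub_mem hy₀ hp.1 hp.2
  -- The candidate is the radial primitive `G y = ∫₀¹ A(y₀ + t (y - y₀)) (y - y₀) dt`, as in
  -- Poincaré's lemma.
  set H : E × ℝ → ℝ := fun p => A (c p) (p.1 - y₀) with hHd
  have hAc : ContDiffOn ℝ ∞ (fun p => A (c p)) (C ×ˢ Icc 0 1) := hA.comp hcs.contDiffOn hcm
  have hH : ContDiffOn ℝ ∞ H (C ×ˢ Icc 0 1) := hAc.clm_apply (by fun_prop)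
  set A' : E → E →L[ℝ] E →L[ℝ] ℝ := fderivWithin ℝ A C with hA'
  have hA's : ContDiffOn ℝ ∞ A' C := hA.fderivWithin hCu (by norm_num)
  have hA'c : ContinuousOn (fun p => A' (c p)) (C ×ˢ Icc 0 1) :=
    hA's.continuousOn.comp hcs.continuous.continuousOn hcm
  set D : E × ℝ → E →L[ℝ] ℝ := fun p => p.2 • (A' (c p)).flip (p.1 - y₀) + A (c p) with hDd
  have hDc : ContinuousOn D (C ×ˢ Icc 0 1) := by
    refine ContinuousOn.add (continuous_snd.continuousOn.smul ?_) hAc.continuousOn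
    refine ContinuousOn.clm_apply ?_ (by fun_prop)
    exact (ContinuousLinearMap.flipₗᵢ ℝ E E ℝ).continuous.comp_continuousOn hA'c
  have hD : ∀ z ∈ C, ∀ t ∈ Icc (0 : ℝ) 1,
      HasFDerivWithinAt (fun z => H (z, t)) (D (z, t)) C z := by
    intro z hz t ht
    have hcz : c (z, t) ∈ C := hcm (show (z, t) ∈ C ×ˢ Icc (0 : ℝ) 1 from ⟨hz, ht⟩)
    have h1 : HasFDerivWithinAt (fun z => c (z, t)) (t • ContinuousLinearMap.id ℝ E) C z :=
      (((hasFDerivWithinAt_id z C).sub_const y₀).const_smul t).const_add y₀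
    have h2 : HasFDerivWithinAt (fun z => A (c (z, t)))
        ((A' (c (z, t))).comp (t • ContinuousLinearMap.id ℝ E)) C z :=
      HasFDerivWithinAt.comp z (t := C) ((hA.differentiableOn (by simp) _ hcz).hasFDerivWithinAt) h1
        (fun w hw => hcm (show (w, t) ∈ C ×ˢ Icc (0 : ℝ) 1 from ⟨hw, ht⟩))
    refine (h2.clm_apply ((hasFDerivWithinAt_id z C).sub_const y₀)).congr_fderiv ?_
    ext a
    simp [D, add_comm]
  refine ⟨fun y => ∫ t in (0 : ℝ)..1, H (y, t), contDiffOn_parametric_integral hC hCu hH,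
    fun y hy => ?_⟩
  rw [(hasFDerivWithinAt_parametric_integral hC hH.continuousOn hDc hD hy).fderivWithin (hCu y hy)]
  have hmy : MapsTo (fun t : ℝ => (y, t)) (Icc 0 1) (C ×ˢ Icc 0 1) := fun t ht => ⟨hy, ht⟩
  have hcl : Continuous fun t : ℝ => (y, t) := by fun_prop
  have hii : ∀ {F : Type} [NormedAddCommGroup F] {f : E × ℝ → F},
      ContinuousOn f (C ×ˢ Icc 0 1) → IntervalIntegrable (fun t => f (y, t)) volume 0 1 := by
    intro F _ f hf
    refine ContinuousOn.intervalIntegrable ?_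
    rw [uIcc_of_le zero_le_one]
    exact hf.comp hcl.continuousOn hmy
  -- `D₂` differs from `D`, the derivative of `H`, by exchanging the arguments of `A'`. It is the
  -- derivative in `t` of `t • A (c (y, t))`, so it integrates to `A y`. Hence `A - dG` is the
  -- integral of `t` times the antisymmetrization of `A'`, which is what `hd` bounds.
  set D₂ : E × ℝ → E →L[ℝ] ℝ := fun p => p.2 • A' (c p) (p.1 - y₀) + A (c p) with hD₂
  have hD₂c : ContinuousOn D₂ (C ×ˢ Icc 0 1) :=
    ContinuousOn.add (continuous_snd.continuousOn.smul (hA'c.clm_apply (by fun_prop)))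
      hAc.continuousOn
  have hftc : ∫ t in (0 : ℝ)..1, D₂ (y, t) = A y := by
    have := intervalIntegral.integral_eq_sub_of_hasDeriv_right_of_le
      (f := fun t : ℝ => t • A (c (y, t))) (f' := fun t => D₂ (y, t)) zero_le_one
      (continuous_id.continuousOn.smul (hAc.continuousOn.comp hcl.continuousOn hmy)) ?_ (hii hD₂c)
    · simpa [c] using this
    intro t ht
    have ht' : t ∈ Icc (0 : ℝ) 1 := Ioo_subset_Icc_self ht
    have hcz : c (y, t) ∈ C := hcm (show (y, t) ∈ C ×ˢ Icc (0 : ℝ) 1 from ⟨hy, ht'⟩)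
    have h1 : HasDerivWithinAt (fun t => c (y, t)) (y - y₀) (Icc 0 1) t := by
      have := ((hasDerivWithinAt_id t (Icc (0 : ℝ) 1)).smul_const (y - y₀)).const_add y₀
      rw [one_smul] at this
      exact this
    have h2 : HasDerivWithinAt (fun t => A (c (y, t))) (A' (c (y, t)) (y - y₀)) (Icc 0 1) t :=
      HasFDerivWithinAt.comp_hasDerivWithinAt (t := C) t
        ((hA.differentiableOn (by simp) _ hcz).hasFDerivWithinAt) h1
        (fun w hw => hcm (show (y, w) ∈ C ×ˢ Icc (0 : ℝ) 1 from ⟨hy, hw⟩))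
    have h3 := ((hasDerivWithinAt_id t (Icc (0 : ℝ) 1)).smul h2)
    have h4 := (h3.hasDerivAt (Icc_mem_nhds ht.1 ht.2)).hasDerivWithinAt (s := Ioi t)
    refine h4.congr_deriv ?_
    simp [D₂]
  rw [← hftc, ← intervalIntegral.integral_sub (hii hD₂c) (hii hDc)]
  refine (intervalIntegral.norm_integral_le_of_norm_le_const (C := ε * ‖y - y₀‖) ?_).trans (by simp)
  intro t ht
  rw [uIoc_of_le zero_le_one] at ht
  have ht' : t ∈ Icc (0 : ℝ) 1 := Ioc_subset_Icc_self ht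
  have hcz : c (y, t) ∈ C := hcm (show (y, t) ∈ C ×ˢ Icc (0 : ℝ) 1 from ⟨hy, ht'⟩)
  refine ContinuousLinearMap.opNorm_le_bound _ (by positivity) fun a => ?_
  have hval : (D₂ (y, t) - D (y, t)) a
      = t * (A' (c (y, t)) (y - y₀) a - A' (c (y, t)) a (y - y₀)) := by
    simp [D₂, D]; ring
  rw [hval, norm_mul, Real.norm_of_nonneg ht'.1, Real.norm_eq_abs]
  calc t * |A' (c (y, t)) (y - y₀) a - A' (c (y, t)) a (y - y₀)|
      ≤ 1 * (ε * ‖y - y₀‖ * ‖a‖) := by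
        gcongr
        · exact ht'.2
        · exact hd _ hcz _ _
    _ = _ := one_mul _

/-! ### A pointwise norm on forms built from charts, and estimates of integrals by it. -/

section PointNorm

variable {E H Q : Type*} [NormedAddCommGroup E] [NormedSpace ℝ E] [TopologicalSpace H]
  {I : ModelWithCorners ℝ E H} [TopologicalSpace Q] [ChartedSpace H Q]
  [FiniteDimensional ℝ E] [MeasurableSpace E] [BorelSpace E] [IsManifold I ∞ Q]
  {E₁ : Type*} [NormedAddCommGroup E₁] [NormedSpace ℝ E₁]

/-- On a compact set, pullbacks are bounded by the coefficients in a chart. -/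
theorem exists_norm_pullWithin_le_norm_inChart (k : ℕ) {s : Set E₁} {f : E₁ → Q}
    (hf : ContMDiffOn 𝓘(ℝ, E₁) I ∞ f s) (hs : UniqueDiffOn ℝ s) {K : Set E₁} (hK : IsCompact K)
    (hKs : K ⊆ s) (j : Q) (hKj : ∀ t ∈ K, f t ∈ (extChartAt I j).source) :
    ∃ C : ℝ, 0 ≤ C ∧ ∀ (η : Form E Q k), ∀ t ∈ K,
      ‖pullWithin I s f η t‖ ≤ C * ‖inChart I η j (extChartAt I j (f t))‖ := by
  have hcont : ContinuousOn (fun t => fderivWithin ℝ (extChartAt I j ∘ f) s t) K := fun t ht =>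
    (((contDiffWithinAt_extChartAt_comp j (hf t (hKs ht)) (hKj t ht)).fderivWithin_right hs
      (m := 0) (by simp) (hKs ht)).continuousWithinAt).mono hKs
  obtain ⟨C, hC⟩ := hK.exists_bound_of_continuousOn hcont
  refine ⟨(max C 0) ^ k, by positivity, fun η t ht => ?_⟩
  rw [pullWithin_eq_inChart η j ((hf t (hKs ht)).mdifferentiableWithinAt (by simp)) (hs t (hKs ht))
    (hKj t ht)]
  refine (ContinuousAlternatingMap.norm_compContinuousLinearMap_le _ _).trans ?_
  rw [mul_comm, Fintype.card_fin]
  gcongr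
  exact (hC t ht).trans (le_max_left _ _)

variable [T2Space Q] [CompactSpace Q]

variable (I Q) in
/-- A finite set of indices outside of which `chartPartition` vanishes. -/
def partitionIndices : Finset Q := (exists_finset_partition (chartPartition Q I)).choose

theorem chartPartition_eq_zero {i : Q} (hi : i ∉ partitionIndices Q I) (x : Q) :
    chartPartition Q I i x = 0 :=
  (exists_finset_partition (chartPartition Q I)).choose_spec.1 i hi x

theorem sum_chartPartition (x : Q) : ∑ i ∈ partitionIndices Q I, chartPartition Q I i x = 1 :=
  (exists_finset_partition (chartPartition Q I)).choose_spec.2 x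

variable (I) in
/-- The size of a form at a point, averaged over the charts at the point. -/
def pointNorm {k : ℕ} (η : Form E Q k) (x : Q) : ℝ :=
  ∑ j ∈ partitionIndices Q I, chartPartition Q I j x * ‖inChart I η j (extChartAt I j x)‖

theorem pointNorm_nonneg {k : ℕ} (η : Form E Q k) (x : Q) : 0 ≤ pointNorm I η x :=
  Finset.sum_nonneg fun j _ => mul_nonneg ((chartPartition Q I).nonneg j x) (norm_nonneg _)

theorem inChart_congr_point {k : ℕ} {η θ : Form E Q k} {x : Q} (h : η x = θ x) {j : Q}
    (hx : x ∈ (extChartAt I j).source) :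
    inChart I η j (extChartAt I j x) = inChart I θ j (extChartAt I j x) := by
  rw [inChart_apply_extChartAt η j hx, inChart_apply_extChartAt θ j hx, h]

theorem pointNorm_congr {k : ℕ} {η θ : Form E Q k} {x : Q} (h : η x = θ x) :
    pointNorm I η x = pointNorm I θ x := by
  refine Finset.sum_congr rfl fun j _ => ?_
  by_cases hj : x ∈ tsupport (chartPartition Q I j)
  · rw [inChart_congr_point h (tsupport_chartPartition j hj)]
  · rw [image_eq_zero_of_notMem_tsupport hj, zero_mul, zero_mul]

theorem pointNorm_add_le {k : ℕ} (η θ : Form E Q k) (x : Q) :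
    pointNorm I (η + θ) x ≤ pointNorm I η x + pointNorm I θ x := by
  rw [pointNorm, pointNorm, pointNorm, ← Finset.sum_add_distrib]
  refine Finset.sum_le_sum fun j _ => ?_
  rw [← mul_add]
  refine mul_le_mul_of_nonneg_left ?_ ((chartPartition Q I).nonneg j x)
  rw [inChart_add]
  exact norm_add_le _ _

theorem pointNorm_fun_smul {k : ℕ} (f : Q → ℝ) (η : Form E Q k) (x : Q) :
    pointNorm I (fun z => f z • η z) x = |f x| * pointNorm I η x := by
  rw [pointNorm_congr (η := fun z => f z • η z) (θ := f x • η) rfl, pointNorm, pointNorm,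
    Finset.mul_sum]
  refine Finset.sum_congr rfl fun j _ => ?_
  rw [inChart_smul, Pi.smul_apply, norm_smul, Real.norm_eq_abs]
  ring

theorem pointNorm_smul {k : ℕ} (c : ℝ) (η : Form E Q k) (x : Q) :
    pointNorm I (c • η) x = |c| * pointNorm I η x :=
  pointNorm_fun_smul (fun _ => c) η x

theorem pointNorm_zero {k : ℕ} (x : Q) : pointNorm I (0 : Form E Q k) x = 0 := by
  have := pointNorm_smul (I := I) 0 (0 : Form E Q k) x
  simpa using this

theorem pointNorm_sum_le {k : ℕ} {ι : Type*} (s : Finset ι) (η : ι → Form E Q k) (x : Q) :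
    pointNorm I (∑ i ∈ s, η i) x ≤ ∑ i ∈ s, pointNorm I (η i) x := by
  classical
  induction s using Finset.induction_on with
  | empty => simp [pointNorm_zero]
  | insert i s hi ih =>
    rw [Finset.sum_insert hi, Finset.sum_insert hi]
    exact (pointNorm_add_le _ _ _).trans (by gcongr)

theorem IsSmoothForm.exists_pointNorm_le {k : ℕ} {η : Form E Q k} (hη : IsSmoothForm I η) :
    ∃ C : ℝ, 0 ≤ C ∧ ∀ x, pointNorm I η x ≤ C := by
  have h : ∀ j : Q, ∃ C : ℝ, 0 ≤ C ∧
      ∀ x, chartPartition Q I j x * ‖inChart I η j (extChartAt I j x)‖ ≤ C := by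
    intro j
    have hK : IsCompact (tsupport (chartPartition Q I j)) := (isClosed_tsupport _).isCompact
    have hc : ContinuousOn (fun x => inChart I η j (extChartAt I j x))
        (tsupport (chartPartition Q I j)) :=
      (hη j).continuousOn.comp ((continuousOn_extChartAt j).mono (tsupport_chartPartition j))
        fun x hx => (extChartAt I j).map_source (tsupport_chartPartition j hx)
    obtain ⟨C, hC⟩ := hK.exists_bound_of_continuousOn hc
    refine ⟨max C 0, le_max_right _ _, fun x => ?_⟩
    by_cases hx : x ∈ tsupport (chartPartition Q I j)
    · calc _ ≤ 1 * ‖inChart I η j (extChartAt I j x)‖ := by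
            gcongr
            exact (chartPartition Q I).le_one j x
        _ ≤ _ := by rw [one_mul]; exact (hC x hx).trans (le_max_left _ _)
    · rw [image_eq_zero_of_notMem_tsupport hx, zero_mul]
      exact le_max_right _ _
  choose C hC0 hC using h
  exact ⟨∑ j ∈ partitionIndices Q I, C j, Finset.sum_nonneg fun j _ => hC0 j,
    fun x => Finset.sum_le_sum fun j _ => hC j x⟩

/-- On a compact set, pullbacks are bounded by `pointNorm`. -/
theorem exists_norm_pullWithin_le (k : ℕ) {s : Set E₁} {f : E₁ → Q}
    (hf : ContMDiffOn 𝓘(ℝ, E₁) I ∞ f s) (hs : UniqueDiffOn ℝ s) {K : Set E₁} (hK : IsCompact K)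
    (hKs : K ⊆ s) :
    ∃ C : ℝ, 0 ≤ C ∧ ∀ (η : Form E Q k), ∀ t ∈ K,
      ‖pullWithin I s f η t‖ ≤ C * pointNorm I η (f t) := by
  -- `K` is cut into compact pieces that are sent into the supports of the partition; on each piece
  -- one chart suffices.
  set Kj : Q → Set E₁ := fun j => K ∩ f ⁻¹' tsupport (chartPartition Q I j) with hKj
  have hKjc : ∀ j, IsCompact (Kj j) := fun j => hK.of_isClosed_subset
    ((hf.continuousOn.mono hKs).preimage_isClosed_of_isClosed hK.isClosed (isClosed_tsupport _))
    inter_subset_left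
  choose C hC0 hC using fun j => exists_norm_pullWithin_le_norm_inChart k hf hs (hKjc j)
    (inter_subset_left.trans hKs) j (fun t ht => tsupport_chartPartition j ht.2)
  refine ⟨∑ j ∈ partitionIndices Q I, C j, Finset.sum_nonneg fun j _ => hC0 j, fun η t ht => ?_⟩
  have h1 : ‖pullWithin I s f η t‖ =
      ∑ j ∈ partitionIndices Q I, chartPartition Q I j (f t) * ‖pullWithin I s f η t‖ := by
    rw [← Finset.sum_mul, sum_chartPartition, one_mul]
  rw [h1, pointNorm, Finset.mul_sum]
  refine Finset.sum_le_sum fun j hj => ?_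
  by_cases htj : f t ∈ tsupport (chartPartition Q I j)
  · have h2 := hC j η t ⟨ht, htj⟩
    have h3 : C j ≤ ∑ j ∈ partitionIndices Q I, C j :=
      Finset.single_le_sum (f := C) (fun i _ => hC0 i) hj
    have h4 := (chartPartition Q I).nonneg j (f t)
    calc _ ≤ chartPartition Q I j (f t) *
          ((∑ j ∈ partitionIndices Q I, C j) * ‖inChart I η j (extChartAt I j (f t))‖) := by
            gcongr
            exact h2.trans (by gcongr)
      _ = _ := by ring
  · rw [image_eq_zero_of_notMem_tsupport htj]
    simp

theorem exists_norm_inChart_le (k : ℕ) (i : Q) {K : Set E} (hK : IsCompact K)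
    (hKi : K ⊆ (extChartAt I i).target) :
    ∃ C : ℝ, 0 ≤ C ∧ ∀ (η : Form E Q k), ∀ y ∈ K,
      ‖inChart I η i y‖ ≤ C * pointNorm I η ((extChartAt I i).symm y) := by
  obtain ⟨C, hC0, hC⟩ := exists_norm_pullWithin_le (I := I) k (contMDiffOn_extChartAt_symm i)
    (uniqueDiffOn_extChartAt_target i) hK hKi
  refine ⟨C, hC0, fun η y hy => ?_⟩
  rw [inChart_eq_pullWithin η i (hKi hy)]
  exact hC η y hy

/-- The converse of `exists_norm_inChart_le`: on a compact part of a chart `pointNorm` is equivalent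
to the norm of the coefficients in that chart. -/
theorem exists_pointNorm_le_norm_inChart (k : ℕ) (i : Q) {K : Set Q} (hK : IsCompact K)
    (hKi : K ⊆ (extChartAt I i).source) :
    ∃ C : ℝ, 0 ≤ C ∧ ∀ (η : Form E Q k), ∀ x ∈ K,
      pointNorm I η x ≤ C * ‖inChart I η i (extChartAt I i x)‖ := by
  have hKj : ∀ j : Q, IsCompact (extChartAt I j '' (K ∩ tsupport (chartPartition Q I j))) :=
    fun j => (hK.inter_right (isClosed_tsupport _)).image_of_continuousOn
      ((continuousOn_extChartAt j).mono
        (inter_subset_right.trans (tsupport_chartPartition j)))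
  choose C hC0 hC using fun j : Q => exists_norm_pullWithin_le_norm_inChart (I := I) k
    (contMDiffOn_extChartAt_symm j) (uniqueDiffOn_extChartAt_target j) (hKj j)
    (by
      rintro _ ⟨x, hx, rfl⟩
      exact (extChartAt I j).map_source (tsupport_chartPartition j hx.2)) i
    (by
      rintro _ ⟨x, hx, rfl⟩
      rw [(extChartAt I j).left_inv (tsupport_chartPartition j hx.2)]
      exact hKi hx.1)
  refine ⟨∑ j ∈ partitionIndices Q I, C j, Finset.sum_nonneg fun j _ => hC0 j, fun η x hx => ?_⟩
  rw [pointNorm, Finset.sum_mul]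
  refine Finset.sum_le_sum fun j _ => ?_
  by_cases hxj : x ∈ tsupport (chartPartition Q I j)
  · have hsrc := tsupport_chartPartition j hxj
    have h2 := hC j η _ (mem_image_of_mem _ ⟨hx, hxj⟩)
    rw [(extChartAt I j).left_inv hsrc,
      ← inChart_eq_pullWithin η j ((extChartAt I j).map_source hsrc)] at h2
    calc _ ≤ 1 * ‖inChart I η j (extChartAt I j x)‖ := by
          gcongr
          exact (chartPartition Q I).le_one j x
      _ ≤ _ := by rw [one_mul]; exact h2
  · rw [image_eq_zero_of_notMem_tsupport hxj, zero_mul]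
    exact mul_nonneg (hC0 j) (norm_nonneg _)

theorem exists_abs_formIntegral_wedgeOne_le [Fact (finrank ℝ E = 3)] (μ : Form E Q 3) :
    ∃ C : ℝ, 0 ≤ C ∧ ∀ (α : Form E Q 1) (β : Form E Q 2) (a b : ℝ), (∀ x, pointNorm I α x ≤ a) →
      (∀ x, pointNorm I β x ≤ b) → 0 ≤ a → 0 ≤ b →
      |formIntegral I μ (wedgeOne α β)| ≤ C * (a * b) := by
  have hKj : ∀ j : Q, IsCompact (extChartAt I j '' tsupport (chartPartition Q I j)) :=
    fun j => (isClosed_tsupport _).isCompact.image_of_continuousOn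
      ((continuousOn_extChartAt j).mono (tsupport_chartPartition j))
  have hKt : ∀ j : Q, extChartAt I j '' tsupport (chartPartition Q I j) ⊆ (extChartAt I j).target := by
    rintro j _ ⟨x, hx, rfl⟩
    exact (extChartAt I j).map_source (tsupport_chartPartition j hx)
  choose C₁ hC₁0 hC₁ using fun j : Q => exists_norm_inChart_le (I := I) 1 j (hKj j) (hKt j)
  choose C₂ hC₂0 hC₂ using fun j : Q => exists_norm_inChart_le (I := I) 2 j (hKj j) (hKt j)
  obtain ⟨C, hC0, hC⟩ := exists_abs_formIntegral_le (I := I) μ (s := partitionIndices Q I)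
    (fun i hi x => chartPartition_eq_zero hi x)
  set C' := ∑ j ∈ partitionIndices Q I, 3 * (C₁ j * C₂ j) with hC'
  have hnn : ∀ j, 0 ≤ 3 * (C₁ j * C₂ j) := fun j => by
    have := hC₁0 j
    have := hC₂0 j
    positivity
  have hC'0 : 0 ≤ C' := Finset.sum_nonneg fun j _ => hnn j
  refine ⟨C * C', mul_nonneg hC0 hC'0, fun α β a b hα hβ ha hb => ?_⟩
  rw [mul_assoc]
  refine hC _ _ (by positivity) fun j hj x hx => ?_
  have hy := mem_image_of_mem (extChartAt I j) hx
  have hsrc := tsupport_chartPartition j hx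
  have e1 := hC₁ j α _ hy
  have e2 := hC₂ j β _ hy
  rw [(extChartAt I j).left_inv hsrc] at e1 e2
  have e1' := e1.trans (mul_le_mul_of_nonneg_left (hα x) (hC₁0 j))
  have e2' := e2.trans (mul_le_mul_of_nonneg_left (hβ x) (hC₂0 j))
  rw [inChart_wedgeOne]
  refine (norm_wedgeForm_le _ _).trans ?_
  have h3 : 3 * (C₁ j * C₂ j) ≤ C' := Finset.single_le_sum (f := fun j => 3 * (C₁ j * C₂ j))
    (fun i _ => hnn i) hj
  have := hC₁0 j
  calc _ ≤ 3 * (C₁ j * a) * (C₂ j * b) := by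
        rw [show ((2 : ℕ) : ℝ) + 1 = 3 by norm_num]
        gcongr
    _ = 3 * (C₁ j * C₂ j) * (a * b) := by ring
    _ ≤ _ := by gcongr

theorem exists_abs_lineIntegral_le {γ : ℝ → Q} (hγ : ContMDiffOn 𝓘(ℝ, ℝ) I ∞ γ (Icc 0 1)) :
    ∃ C : ℝ, 0 ≤ C ∧ ∀ (η : Form E Q 1) (a : ℝ), (∀ x, pointNorm I η x ≤ a) →
      |lineIntegral I η γ| ≤ C * a := by
  obtain ⟨C, hC0, hC⟩ := exists_norm_pullWithin_le (I := I) 1 hγ uniqueDiffOn_unitInterval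
    isCompact_Icc subset_rfl
  refine ⟨C, hC0, fun η a ha => ?_⟩
  rw [← Real.norm_eq_abs]
  refine (intervalIntegral.norm_integral_le_of_norm_le_const (C := C * a) fun t ht => ?_).trans
    (by simp)
  rw [uIoc_of_le zero_le_one] at ht
  refine (ContinuousAlternatingMap.le_opNorm _ _).trans ?_
  simp only [norm_one, Finset.prod_const_one, mul_one]
  exact (hC η t (Ioc_subset_Icc_self ht)).trans (mul_le_mul_of_nonneg_left (ha _) hC0)

/-- The constant depends on the chain. It turns a small form into small periods. -/
theorem exists_abs_chainIntegral_le (z : Chain Q I 1) :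
    ∃ C : ℝ, 0 ≤ C ∧ ∀ (η : Form E Q 1) (a : ℝ), (∀ x, pointNorm I η x ≤ a) →
      |chainIntegral I η z| ≤ C * a := by
  choose C hC0 hC using fun σ : SmoothSimplex Q I 1 =>
    exists_abs_lineIntegral_le (I := I) σ.contMDiffOn_edge
  refine ⟨∑ σ ∈ z.support, |(z σ : ℝ)| * C σ,
    Finset.sum_nonneg fun σ _ => mul_nonneg (abs_nonneg _) (hC0 σ), fun η a ha => ?_⟩
  rw [chainIntegral, Finsupp.sum, Finset.sum_mul]
  refine (Finset.abs_sum_le_sum_abs _ _).trans (Finset.sum_le_sum fun σ _ => ?_)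
  rw [abs_mul, mul_assoc, simplexIntegral_eq_lineIntegral]
  exact mul_le_mul_of_nonneg_left (hC σ η a ha) (abs_nonneg _)

end PointNorm

/-! ### Approximate primitives on chart balls, star refinements and approximate solutions of linear
equations. -/

section LocalPrimitive

variable {E : Type} {H Q : Type*} [NormedAddCommGroup E] [NormedSpace ℝ E] [TopologicalSpace H]
  {I : ModelWithCorners ℝ E H} [TopologicalSpace Q] [ChartedSpace H Q]
  [FiniteDimensional ℝ E] [MeasurableSpace E] [BorelSpace E] [IsManifold I ∞ Q]
  [T2Space Q] [CompactSpace Q] {ℓ : E →L[ℝ] ℝ}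

theorem isCompact_closedBall_inter_range (I : ModelWithCorners ℝ E H) (y : E) (r : ℝ) :
    IsCompact (Metric.closedBall y r ∩ range I) := by
  have : ProperSpace E := FiniteDimensional.proper_real E
  exact (isCompact_closedBall y r).inter_right I.isClosed_range

/-- On a chart ball a smooth `1`-form differs from an exact one by at most a multiple of the size
of its exterior derivative. -/
theorem exists_local_approximate_primitive (hI : IsHalfSpaceModel I ℓ) {k : Q} {r : ℝ} (hr0 : 0 < r)
    (hr : Metric.closedBall (extChartAt I k k) r ∩ range I ⊆ (extChartAt I k).target) :
    ∃ C : ℝ, 0 ≤ C ∧ ∀ D : Form E Q 1, IsSmoothForm I D → ∀ ε : ℝ, 0 ≤ ε →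
      (∀ x, pointNorm I (extD I D) x ≤ ε) → ∃ g : Q → ℝ,
        ContMDiffOn I 𝓘(ℝ, ℝ) ∞ g (chartBall I k r) ∧
        ∀ z ∈ chartBall I k r, pointNorm I (D - differential I g) z ≤ C * ε := by
  have hK := isCompact_closedBall_inter_range I (extChartAt I k k) r
  have hrt := coordBall_subset_target hr
  obtain ⟨C₁, hC₁0, hC₁⟩ := exists_norm_inChart_le (I := I) 2 k hK hr
  obtain ⟨C₂, hC₂0, hC₂⟩ := exists_pointNorm_le_norm_inChart (I := I) 1 k
    (hK.image_of_continuousOn ((continuousOn_extChartAt_symm k).mono hr)) (by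
      rintro _ ⟨y, hy, rfl⟩
      exact (extChartAt I k).map_target (hr hy))
  set S := coordBall I k r with hS
  have hSc : Convex ℝ S := convex_coordBall hI k r
  have hSu : UniqueDiffOn ℝ S := uniqueDiffOn_convex hSc (interior_coordBall_nonempty k hr0)
  refine ⟨C₂ * (C₁ * r), by positivity, fun D hD ε hε hdD => ?_⟩
  set L : (E [⋀^Fin 1]→L[ℝ] ℝ) ≃ₗᵢ[ℝ] (E →L[ℝ] ℝ) :=
    (ContinuousAlternatingMap.ofSubsingletonLIE (0 : Fin 1)).symm with hL
  have hθ : ContDiffOn ℝ ∞ (inChart I D k) S := (hD k).mono hrt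
  have hLθ : ContDiffOn ℝ ∞ (fun t => toCovector (inChart I D k t)) S :=
    L.contDiff.comp_contDiffOn hθ
  have hfd : ∀ t ∈ S, ∀ v w, fderivWithin ℝ (fun t => toCovector (inChart I D k t)) S t v w =
      fderivWithin ℝ (inChart I D k) S t v fun _ => w := by
    intro t ht v w
    have h1 := L.toContinuousLinearEquiv.comp_fderivWithin (f := inChart I D k) (hSu t ht)
    exact congrArg (fun f : E →L[ℝ] E →L[ℝ] ℝ => f v w) h1
  have hy₀ : extChartAt I k k ∈ S := mapsTo_chartBall k r (mem_chartBall_self k hr0)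
  -- The antisymmetrized derivative of the coefficients of `D` is the coefficient of `dD`, which is
  -- at most `C₁ * ε` on the ball.
  obtain ⟨G, hG, hGd⟩ := exists_norm_sub_fderivWithin_le hSc hSu hLθ hy₀
    (mul_nonneg hC₁0 hε) (by
      intro z hz a b
      have hzK : z ∈ Metric.closedBall (extChartAt I k k) r ∩ range I :=
        ⟨Metric.ball_subset_closedBall hz.1, hz.2⟩
      rw [hfd z hz, hfd z hz]
      have h1 : inChart I (extD I D) k z = extDerivWithin (inChart I D k) S z := by
        rw [hD.inChart_extD k (hrt hz), extDerivWithin_of_subset (s := S) inter_subset_right (hSu z hz)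
          ((hD.contDiffWithinAt k (hrt hz)).differentiableWithinAt (by simp))]
      have h2 := (hC₁ (extD I D) z hzK).trans (mul_le_mul_of_nonneg_left (hdD _) hC₁0)
      have h3 := (inChart I (extD I D) k z).le_opNorm ![a, b]
      rw [Fin.prod_univ_two] at h3
      have h4 : inChart I (extD I D) k z ![a, b] = fderivWithin ℝ (inChart I D k) S z a (fun _ => b) -
          fderivWithin ℝ (inChart I D k) S z b (fun _ => a) := by
        rw [h1]
        exact alternatizeUncurryFin_one_apply (fderivWithin ℝ (inChart I D k) S z) ![a, b]
      rw [h4, Real.norm_eq_abs] at h3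
      simp only [Matrix.cons_val_zero, Matrix.cons_val_one] at h3
      refine h3.trans ?_
      rw [mul_assoc]
      gcongr)
  refine ⟨G ∘ extChartAt I k, contMDiffOn_comp_extChartAt hG, fun z hz => ?_⟩
  have hyS : extChartAt I k z ∈ S := mapsTo_chartBall k r hz
  have hzK : z ∈ (extChartAt I k).symm '' (Metric.closedBall (extChartAt I k k) r ∩ range I) :=
    ⟨extChartAt I k z, ⟨Metric.ball_subset_closedBall hyS.1, hyS.2⟩, (extChartAt I k).left_inv hz.1⟩
  have hmd : MDifferentiableAt I 𝓘(ℝ, ℝ) (G ∘ extChartAt I k) z :=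
    ((contMDiffOn_comp_extChartAt hG z hz).contMDiffAt
      ((isOpen_chartBall k r).mem_nhds hz)).mdifferentiableAt (by simp)
  have h5 : inChart I (differential I (G ∘ extChartAt I k)) k (extChartAt I k z) =
      ofCovector (fderivWithin ℝ G S (extChartAt I k z)) := by
    rw [inChart_differential k (hrt hyS) (by rwa [(extChartAt I k).left_inv hz.1])]
    congr 1
    have h6 : fderivWithin ℝ G S (extChartAt I k z) = fderivWithin ℝ G (range I) (extChartAt I k z) :=
      fderivWithin_subset inter_subset_right (hSu _ hyS)
        (((hG.differentiableOn (by simp)) _ hyS).mono_of_mem_nhdsWithin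
          (coordBall_mem_nhdsWithin hyS))
    rw [h6]
    refine Filter.EventuallyEq.fderivWithin_eq_of_mem ?_ hyS.2
    filter_upwards [coordBall_mem_nhdsWithin hyS] with w hw
    simp only [Function.comp_apply]
    rw [(extChartAt I k).right_inv (hrt hw)]
  refine (hC₂ _ z hzK).trans ?_
  rw [mul_assoc]
  refine mul_le_mul_of_nonneg_left ?_ hC₂0
  rw [inChart_sub, Pi.sub_apply, h5, ← ofCovector_toCovector (inChart I D k (extChartAt I k z))]
  have h7 : ofCovector (toCovector (inChart I D k (extChartAt I k z))) -
      ofCovector (fderivWithin ℝ G S (extChartAt I k z)) =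
      ofCovector (toCovector (inChart I D k (extChartAt I k z)) -
        fderivWithin ℝ G S (extChartAt I k z)) := rfl
  rw [h7, norm_ofCovector]
  refine (hGd _ hyS).trans ?_
  have h8 : ‖extChartAt I k z - extChartAt I k k‖ ≤ r := by
    rw [← dist_eq_norm]
    exact (Metric.mem_ball.1 hyS.1).le
  calc _ ≤ C₁ * ε * r := by gcongr
    _ = _ := by ring

/-- On a chart ball the oscillation of a function is bounded by its differential. -/
theorem exists_oscillation_le (hI : IsHalfSpaceModel I ℓ) {k : Q} {r : ℝ} (hr0 : 0 < r)
    (hr : Metric.closedBall (extChartAt I k k) r ∩ range I ⊆ (extChartAt I k).target) :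
    ∃ C : ℝ, 0 ≤ C ∧ ∀ h : Q → ℝ, ContMDiffOn I 𝓘(ℝ, ℝ) ∞ h (chartBall I k r) → ∀ ε : ℝ, 0 ≤ ε →
      (∀ z ∈ chartBall I k r, pointNorm I (differential I h) z ≤ ε) →
      ∀ x ∈ chartBall I k r, ∀ y ∈ chartBall I k r, |h x - h y| ≤ C * ε := by
  have hK := isCompact_closedBall_inter_range I (extChartAt I k k) r
  have hrt := coordBall_subset_target hr
  obtain ⟨C₁, hC₁0, hC₁⟩ := exists_norm_inChart_le (I := I) 1 k hK hr
  set S := coordBall I k r with hS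
  have hSc : Convex ℝ S := convex_coordBall hI k r
  have hSu : UniqueDiffOn ℝ S := uniqueDiffOn_convex hSc (interior_coordBall_nonempty k hr0)
  refine ⟨C₁ * (2 * r), by positivity, fun h hh ε hε hdh x hx y hy => ?_⟩
  set f : E → ℝ := h ∘ (extChartAt I k).symm with hf
  have hmaps : ∀ w ∈ S, (extChartAt I k).symm w ∈ chartBall I k r := fun w hw =>
    symm_mem_chartBall hrt hw
  have hfs : ContDiffOn ℝ ∞ f S :=
    (hh.comp ((contMDiffOn_extChartAt_symm k).mono hrt) hmaps).contDiffOn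
  have hbound : ∀ w ∈ S, ‖fderivWithin ℝ f S w‖ ≤ C₁ * ε := by
    intro w hw
    have hz := hmaps w hw
    have hmd : MDifferentiableAt I 𝓘(ℝ, ℝ) h ((extChartAt I k).symm w) :=
      ((hh _ hz).contMDiffAt ((isOpen_chartBall k r).mem_nhds hz)).mdifferentiableAt (by simp)
    have h1 := inChart_differential k (hrt hw) hmd
    have h2 : fderivWithin ℝ f S w = fderivWithin ℝ f (range I) w :=
      fderivWithin_subset inter_subset_right (hSu _ hw)
        (((hfs.differentiableOn (by simp)) _ hw).mono_of_mem_nhdsWithin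
          (coordBall_mem_nhdsWithin hw))
    rw [h2, ← norm_ofCovector, ← h1]
    exact (hC₁ _ w ⟨Metric.ball_subset_closedBall hw.1, hw.2⟩).trans
      (mul_le_mul_of_nonneg_left (hdh _ hz) hC₁0)
  have hxS := mapsTo_chartBall k r hx
  have hyS := mapsTo_chartBall k r hy
  have h3 := hSc.norm_image_sub_le_of_norm_fderivWithin_le (hfs.differentiableOn (by simp))
    hbound hyS hxS
  simp only [hf, Function.comp_apply, (extChartAt I k).left_inv hx.1,
    (extChartAt I k).left_inv hy.1, Real.norm_eq_abs] at h3
  refine h3.trans ?_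
  have h4 : ‖extChartAt I k x - extChartAt I k y‖ ≤ 2 * r := by
    rw [← dist_eq_norm]
    have h5 := Metric.mem_ball.1 hxS.1
    have h6 := Metric.mem_ball.1 hyS.1
    linarith [dist_triangle_right (extChartAt I k x) (extChartAt I k y) (extChartAt I k k)]
  calc _ ≤ C₁ * ε * (2 * r) := by gcongr
    _ = _ := by ring

end LocalPrimitive

/-- Neighbourhoods of points of a compact space have a star refinement. -/
theorem exists_star_refinement {X : Type*} [TopologicalSpace X] [CompactSpace X] [T2Space X]
    {U : X → Set X} (hU : ∀ x, U x ∈ 𝓝 x) :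
    ∃ (W : X → Set X) (κ : X → X), (∀ x, W x ∈ 𝓝 x) ∧
      ∀ x y, (W x ∩ W y).Nonempty → W y ⊆ U (κ x) := by
  -- The sets are balls of an entourage `T` three steps of which stay inside a Lebesgue entourage
  -- `V` of the cover. If the balls of `x` and `y` share `z`, any `w` in the ball of `y` is reached
  -- from `x` by the steps `x, z, y, w`.
  let _ : UniformSpace X := uniformSpaceOfCompactR1
  obtain ⟨V, hV, hVU⟩ := lebesgue_number_lemma_nhds (U := U) isCompact_univ (fun x _ => hU x)
  obtain ⟨V', hV', hV's, hV'V⟩ := comp_symm_mem_uniformity_sets hV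
  obtain ⟨T, hT, hTs, hTV⟩ := comp_symm_mem_uniformity_sets hV'
  have hTV' : T ⊆ V' := fun p hp => hTV ⟨p.1, refl_mem_uniformity hT, hp⟩
  choose κ hκ using fun x => hVU x (mem_univ x)
  refine ⟨fun x => UniformSpace.ball x T, κ, fun x => UniformSpace.ball_mem_nhds x hT, ?_⟩
  rintro x y ⟨z, hzx, hzy⟩ w hw
  refine hκ x (hV'V ⟨z, hTV' hzx, hTV ⟨y, ?_, hw⟩⟩)
  exact (UniformSpace.mem_ball_symmetry).1 hzy

/-- A vector at which given linear functionals are small is close to their common kernel. -/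
theorem exists_near_common_kernel {X Γ : Type*} [NormedAddCommGroup X] [NormedSpace ℝ X]
    [FiniteDimensional ℝ X] (f : Γ → X →ₗ[ℝ] ℝ) (c : Γ → ℝ) :
    ∃ C : ℝ, 0 ≤ C ∧ ∀ (m : X) (ε : ℝ), 0 ≤ ε → (∀ γ, |f γ m| ≤ c γ * ε) →
      ∃ z : X, (∀ γ, f γ z = 0) ∧ ‖m - z‖ ≤ C * ε := by
  -- The family may be infinite, but finitely many functionals span all of them. Subtracting from
  -- `m` a bounded right inverse applied to their values at `m` lands in the common kernel, and only
  -- those finitely many `c` enter the constant.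
  obtain ⟨b, hb, hspan, hind⟩ := exists_linearIndependent ℝ (range f)
  have : Fintype b := hind.setFinite.fintype
  choose γ hγ using fun g : b => hb g.2
  set L : X →ₗ[ℝ] (b → ℝ) := LinearMap.pi fun g => f (γ g) with hL
  obtain ⟨R, hR⟩ := L.rangeRestrict.exists_rightInverse_of_surjective L.range_rangeRestrict
  set R' := LinearMap.toContinuousLinearMap R with hR'
  refine ⟨‖R'‖ * ∑ g, |c (γ g)|, by positivity, fun m ε hε hm => ?_⟩
  refine ⟨m - R (L.rangeRestrict m), ?_, ?_⟩
  · have h1 : L (m - R (L.rangeRestrict m)) = 0 := by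
      rw [map_sub, sub_eq_zero]
      exact (congrArg Subtype.val (LinearMap.congr_fun hR (L.rangeRestrict m))).symm
    intro γ'
    have h2 : f γ' ∈ Submodule.span ℝ b := by
      rw [hspan]
      exact Submodule.subset_span ⟨γ', rfl⟩
    have h3 : Submodule.span ℝ b ≤
        LinearMap.ker (LinearMap.applyₗ (R := ℝ) (M₂ := ℝ) (m - R (L.rangeRestrict m))) := by
      rw [Submodule.span_le]
      intro g hg
      have h4 := congrFun h1 ⟨g, hg⟩
      simp only [hL, LinearMap.pi_apply, hγ] at h4
      exact h4
    exact h3 h2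
  · rw [sub_sub_cancel]
    refine (R'.le_opNorm _).trans ?_
    rw [mul_assoc]
    gcongr
    rw [Submodule.coe_norm, pi_norm_le_iff_of_nonneg (by positivity)]
    intro g
    change |f (γ g) m| ≤ _
    refine (hm (γ g)).trans ?_
    gcongr
    exact (le_abs_self _).trans
      (Finset.single_le_sum (f := fun g => |c (γ g)|) (fun _ _ => abs_nonneg _) (Finset.mem_univ g))

/-! ### The closed form of a Čech cocycle and the gluing of approximate primitives. -/

section CechForm

variable {E H Q : Type*} [NormedAddCommGroup E] [NormedSpace ℝ E] [TopologicalSpace H]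
  {I : ModelWithCorners ℝ E H} [TopologicalSpace Q] [ChartedSpace H Q]
  {ι : Type*} [Fintype ι]

theorem sub_smul_form {k : ℕ} (a b : ℝ) (v : E [⋀^Fin k]→L[ℝ] ℝ) :
    (a - b) • v = a • v - b • v := by
  ext w
  simp [sub_mul]

variable (I) in
/-- The `1`-form `∑ m_ij ρ_j dρ_i` associated with a Čech `1`-cochain and a partition of unity. -/
def cechForm (ρ : ι → Q → ℝ) (m : ι → ι → ℝ) : Form E Q 1 :=
  ∑ i, ∑ j, m i j • fun x => ρ j x • differential I (ρ i) x

theorem cechForm_add (ρ : ι → Q → ℝ) (m m' : ι → ι → ℝ) :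
    cechForm I ρ (m + m') = cechForm I ρ m + cechForm I ρ m' := by
  simp only [cechForm, Pi.add_apply, add_smul, Finset.sum_add_distrib]

theorem cechForm_smul (ρ : ι → Q → ℝ) (c : ℝ) (m : ι → ι → ℝ) :
    cechForm I ρ (c • m) = c • cechForm I ρ m := by
  simp only [cechForm, Pi.smul_apply, smul_eq_mul, mul_smul, Finset.smul_sum]

theorem cechForm_sub (ρ : ι → Q → ℝ) (m m' : ι → ι → ℝ) :
    cechForm I ρ (m - m') = cechForm I ρ m - cechForm I ρ m' :=
  eq_sub_of_add_eq (by rw [← cechForm_add, sub_add_cancel])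

theorem cechForm_apply (ρ : ι → Q → ℝ) (m : ι → ι → ℝ) (x : Q) :
    cechForm I ρ m x = ∑ i, ∑ j, (m i j * ρ j x) • differential I (ρ i) x := by
  simp only [cechForm, Finset.sum_apply, Pi.smul_apply, mul_smul]

variable [IsManifold I ∞ Q]

theorem isSmoothForm_cechForm {ρ : ι → Q → ℝ} (hρ : ∀ i, ContMDiff I 𝓘(ℝ, ℝ) ∞ (ρ i))
    (m : ι → ι → ℝ) : IsSmoothForm I (cechForm I ρ m) :=
  IsSmoothForm.sum _ fun i _ => IsSmoothForm.sum _ fun j _ =>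
    IsSmoothForm.const_smul _ (IsSmoothForm.fun_smul (hρ j) (isSmoothForm_differential (hρ i)))

/-- The `1`-form associated with a Čech cocycle is closed. -/
theorem extD_cechForm_eq_zero {ρ : ι → Q → ℝ} (hρ : ∀ i, ContMDiff I 𝓘(ℝ, ℝ) ∞ (ρ i))
    (hsum : ∀ x, ∑ i, ρ i x = 1) {V : ι → Set Q} (hV : ∀ i, IsOpen (V i))
    (hρV : ∀ i, tsupport (ρ i) ⊆ V i) {m : ι → ι → ℝ}
    (hm : ∀ i j k, (V i ∩ V j ∩ V k).Nonempty → m i j + m j k = m i k) :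
    extD I (cechForm I ρ m) = 0 := by
  ext1 x
  obtain ⟨k, hk⟩ : ∃ k, ρ k x ≠ 0 := by
    by_contra! h
    have h1 := hsum x
    rw [Finset.sum_eq_zero fun i _ => h i] at h1
    exact zero_ne_one h1
  have hxk : x ∈ V k := hρV k (subset_tsupport _ hk)
  have hf : ∀ i ∈ (Finset.univ : Finset ι), ContMDiff I 𝓘(ℝ, ℝ) ∞ (fun x => m i k * ρ i x) :=
    fun i _ => contMDiff_const.mul (hρ i)
  -- On `V k` the cocycle condition gives `m i j = m i k - m j k`, and `∑ dρ i = 0` kills the second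
  -- part; what is left is the differential of `∑ m i k * ρ i`.
  have hloc : cechForm I ρ m =ᶠ[𝓝 x] differential I (∑ i, fun x => m i k * ρ i x) := by
    filter_upwards [(hV k).mem_nhds hxk] with y hy
    rw [(differential_sum Finset.univ fun i hi => (hf i hi).mdifferentiable (by simp) y).2,
      cechForm_apply]
    have hterm : ∀ i j, (m i j * ρ j y) • differential I (ρ i) y =
        (m i k * ρ j y) • differential I (ρ i) y - (m j k * ρ j y) • differential I (ρ i) y := by
      intro i j
      by_cases hi : y ∈ tsupport (ρ i)
      · by_cases hj : y ∈ tsupport (ρ j)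
        · rw [← sub_smul_form, ← sub_mul,
            ← hm i j k ⟨y, ⟨hρV i hi, hρV j hj⟩, hy⟩, add_sub_cancel_right]
        · simp [image_eq_zero_of_notMem_tsupport hj]
      · simp [differential_eq_zero_of_notMem_tsupport hi]
    simp only [hterm, Finset.sum_sub_distrib]
    have h2 : ∑ i, ∑ j, (m j k * ρ j y) • differential I (ρ i) y = 0 := by
      rw [Finset.sum_comm]
      refine Finset.sum_eq_zero fun j _ => ?_
      rw [← Finset.smul_sum, sum_differential_eq_zero Finset.univ hρ hsum, smul_zero]
    rw [h2, sub_zero]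
    refine Finset.sum_congr rfl fun i _ => ?_
    rw [← Finset.sum_smul, ← Finset.mul_sum, hsum, mul_one]
    have h3 := differential_mul (I := I) (f := fun _ => m i k) (g := ρ i) (x := y)
      mdifferentiableAt_const ((hρ i).mdifferentiable (by simp) y)
    rw [differential_const, smul_zero, add_zero] at h3
    exact h3.symm
  have hF : ContMDiff I 𝓘(ℝ, ℝ) ∞ (∑ i, fun x => m i k * ρ i x) := by
    have h4 := contMDiff_finsetSum hf
    convert h4 using 1
    ext x
    simp
  rw [extD_congr hloc, extD_differential hF]

variable [FiniteDimensional ℝ E] [MeasurableSpace E] [BorelSpace E] [T2Space Q] [CompactSpace Q]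

theorem pointNorm_cechForm_le {ρ : ι → Q → ℝ} (hρ0 : ∀ i x, 0 ≤ ρ i x) (hρ1 : ∀ i x, ρ i x ≤ 1)
    {M : ℝ} (hM : ∀ i x, pointNorm I (differential I (ρ i)) x ≤ M) (m : ι → ι → ℝ)
    (x : Q) : pointNorm I (cechForm I ρ m) x ≤ Fintype.card ι * (Fintype.card ι * M) * ‖m‖ := by
  refine (pointNorm_sum_le _ _ _).trans ?_
  have h : ∀ i j, pointNorm I (m i j • fun x => ρ j x • differential I (ρ i) x) x ≤ M * ‖m‖ := by
    intro i j
    rw [pointNorm_smul, pointNorm_fun_smul, abs_of_nonneg (hρ0 j x)]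
    have h1 : |m i j| ≤ ‖m‖ := (norm_le_pi_norm (m i) j).trans (norm_le_pi_norm m i)
    have h2 := pointNorm_nonneg (I := I) (differential I (ρ i)) x
    calc _ ≤ ‖m‖ * (1 * M) := by
          gcongr
          · exact mul_nonneg (hρ0 j x) h2
          · exact hρ1 j x
          · exact hM i x
      _ = _ := by ring
  calc _ ≤ ∑ _i : ι, ∑ _j : ι, M * ‖m‖ := Finset.sum_le_sum fun i _ =>
        (pointNorm_sum_le _ _ _).trans (Finset.sum_le_sum fun j _ => h i j)
    _ = _ := by simp; ring

/-- The error made in gluing approximate local primitives. -/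
theorem pointNorm_sub_differential_glue_le {ρ g : ι → Q → ℝ} {V : ι → Set Q} {D : Form E Q 1}
    (hρ : ∀ i, ContMDiff I 𝓘(ℝ, ℝ) ∞ (ρ i)) (hρ0 : ∀ i x, 0 ≤ ρ i x) (hρ1 : ∀ i x, ρ i x ≤ 1)
    (hsum : ∀ x, ∑ i, ρ i x = 1) (hV : ∀ i, IsOpen (V i)) (hρV : ∀ i, tsupport (ρ i) ⊆ V i)
    (hg : ∀ i, ContMDiffOn I 𝓘(ℝ, ℝ) ∞ (g i) (V i)) {M a b : ℝ} (hb : 0 ≤ b) (hM0 : 0 ≤ M)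
    (hM : ∀ i x, pointNorm I (differential I (ρ i)) x ≤ M)
    (ha : ∀ i, ∀ x ∈ V i, pointNorm I (D - differential I (g i)) x ≤ a) {m : ι → ι → ℝ}
    (hm : ∀ i j, ∀ x ∈ V i ∩ V j, |m i j - (g i x - g j x)| ≤ b) (x : Q) :
    pointNorm I (D - differential I (∑ i, ρ i * g i) + cechForm I ρ m) x ≤
      a + Fintype.card ι * (Fintype.card ι * (b * M)) := by
  have hglue := (differential_glue (I := I) Finset.univ hV hρ (fun i _ => hg i) hρV).2 x
  -- From `∑ ρ i = 1` and `∑ dρ i = 0` one has `∑ g i dρ i = ∑∑ (g i - g j) ρ j dρ i`. The error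
  -- becomes a mean of the local errors plus terms measuring how far `m i j` is from `g i - g j` on
  -- the overlaps.
  have heq : (D - differential I (∑ i, ρ i * g i) + cechForm I ρ m) x =
      ((∑ i, fun z => ρ i z • (D - differential I (g i)) z) +
        ∑ i, ∑ j, fun z => ((m i j - (g i z - g j z)) * ρ j z) • differential I (ρ i) z) x := by
    simp only [Pi.add_apply, Pi.sub_apply, Finset.sum_apply]
    rw [hglue, cechForm_apply]
    have h1 : ∑ i, ρ i x • (D x - differential I (g i) x) =
        D x - ∑ i, ρ i x • differential I (g i) x := by
      simp only [smul_sub, Finset.sum_sub_distrib]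
      rw [← Finset.sum_smul, hsum, one_smul]
    have h2 : ∑ i, ∑ j, ((m i j - (g i x - g j x)) * ρ j x) • differential I (ρ i) x =
        ∑ i, ∑ j, (m i j * ρ j x) • differential I (ρ i) x -
          ∑ i, g i x • differential I (ρ i) x := by
      have h3 : ∑ i, ∑ j, (g j x * ρ j x) • differential I (ρ i) x = 0 := by
        rw [Finset.sum_comm]
        refine Finset.sum_eq_zero fun j _ => ?_
        rw [← Finset.smul_sum, sum_differential_eq_zero Finset.univ hρ hsum, smul_zero]
      have h4 : ∑ i, ∑ j, (g i x * ρ j x) • differential I (ρ i) x =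
          ∑ i, g i x • differential I (ρ i) x := by
        refine Finset.sum_congr rfl fun i _ => ?_
        rw [← Finset.sum_smul, ← Finset.mul_sum, hsum, mul_one]
      simp only [sub_mul, sub_smul_form, Finset.sum_sub_distrib]
      rw [h3, h4, sub_zero]
    rw [h1, h2, Finset.sum_add_distrib]
    abel
  rw [pointNorm_congr heq]
  refine (pointNorm_add_le _ _ _).trans (add_le_add ?_ ?_)
  · refine (pointNorm_sum_le _ _ _).trans ?_
    calc _ ≤ ∑ i, ρ i x * a := Finset.sum_le_sum fun i _ => by
          rw [pointNorm_fun_smul, abs_of_nonneg (hρ0 i x)]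
          by_cases hx : x ∈ tsupport (ρ i)
          · exact mul_le_mul_of_nonneg_left (ha i x (hρV i hx)) (hρ0 i x)
          · rw [image_eq_zero_of_notMem_tsupport hx, zero_mul, zero_mul]
      _ = a := by rw [← Finset.sum_mul, hsum, one_mul]
  · refine (pointNorm_sum_le _ _ _).trans ?_
    calc _ ≤ ∑ _i : ι, ∑ _j : ι, b * M := Finset.sum_le_sum fun i _ =>
          (pointNorm_sum_le _ _ _).trans (Finset.sum_le_sum fun j _ => by
            rw [pointNorm_fun_smul (fun z => (m i j - (g i z - g j z)) * ρ j z), abs_mul,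
              abs_of_nonneg (hρ0 j x)]
            by_cases hi : x ∈ tsupport (ρ i)
            · by_cases hj : x ∈ tsupport (ρ j)
              · have h5 := hm i j x ⟨hρV i hi, hρV j hj⟩
                have h6 := pointNorm_nonneg (I := I) (differential I (ρ i)) x
                calc _ ≤ b * 1 * M := by
                      gcongr
                      · exact hρ0 j x
                      · exact hρ1 j x
                      · exact hM i x
                  _ = _ := by ring
              · rw [image_eq_zero_of_notMem_tsupport hj, mul_zero, zero_mul]
                positivity
            · rw [pointNorm_congr (θ := 0) (differential_eq_zero_of_notMem_tsupport hi),
                pointNorm_zero, mul_zero]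
              positivity)
      _ = _ := by simp

end CechForm

/-! ### A bound for the distance to closed forms with zero periods. -/

section BoundedPrimitive

variable {E : Type} {H Q : Type*} [NormedAddCommGroup E] [NormedSpace ℝ E] [TopologicalSpace H]
  {I : ModelWithCorners ℝ E H} [TopologicalSpace Q] [ChartedSpace H Q]
  [FiniteDimensional ℝ E] [MeasurableSpace E] [BorelSpace E] [IsManifold I ∞ Q]
  [T2Space Q] [CompactSpace Q] {ℓ : E →L[ℝ] ℝ}

/-- A cover by chart balls on which `1`-forms have approximate primitives that agree up to constants
on the intersections. -/
theorem exists_cover_with_approximate_primitives (hI : IsHalfSpaceModel I ℓ) :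
    ∃ (V : Q → Set Q) (C b : Q → ℝ), (∀ i, IsOpen (V i)) ∧ (∀ i, i ∈ V i) ∧ (∀ i, 0 ≤ C i) ∧
      (∀ i, 0 ≤ b i) ∧
      ∀ D : Form E Q 1, IsSmoothForm I D → ∀ ε : ℝ, 0 ≤ ε → (∀ x, pointNorm I (extD I D) x ≤ ε) →
        ∃ g : Q → Q → ℝ, (∀ i, ContMDiffOn I 𝓘(ℝ, ℝ) ∞ (g i) (V i)) ∧
          (∀ i, ∀ x ∈ V i, pointNorm I (D - differential I (g i)) x ≤ C i * ε) ∧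
          ∀ i j, ∀ x ∈ V i ∩ V j, ∀ y ∈ V i ∩ V j,
            |(g i x - g j x) - (g i y - g j y)| ≤ b j * ((C i + C j) * ε) := by
  choose R hR0 hR _ using fun k : Q => exists_coordBall_subset (I := I) k univ_mem
  choose C hC0 hC using fun k : Q => exists_local_approximate_primitive hI (hR0 k) (hR k)
  -- An overlap of two balls may be disconnected. After refinement the larger ball carrying the
  -- primitive of `V i` contains all of `V j` whenever the two meet, so `g i - g j` extends to the
  -- whole ball `V j`, where its oscillation is controlled.
  obtain ⟨W, κ, hW, hκ⟩ := exists_star_refinement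
    fun k => (isOpen_chartBall (I := I) k (R k)).mem_nhds (mem_chartBall_self k (hR0 k))
  choose r hr0 hr hrW using fun i : Q => exists_coordBall_subset (I := I) i (hW i)
  choose b hb0 hb using fun k : Q => exists_oscillation_le hI (hr0 k) (hr k)
  refine ⟨fun i => chartBall I i (r i), fun i => C (κ i), b, fun i => isOpen_chartBall i _,
    fun i => mem_chartBall_self i (hr0 i), fun i => hC0 _, hb0, fun D hD ε hε hdD => ?_⟩
  choose h hh hhd using fun k => hC k D hD ε hε hdD
  have hsub : ∀ i j, (chartBall I i (r i) ∩ chartBall I j (r j)).Nonempty →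
      chartBall I j (r j) ⊆ chartBall I (κ i) (R (κ i)) := fun i j hij =>
    (hrW j).trans (hκ i j (hij.mono (inter_subset_inter (hrW i) (hrW j))))
  have hself : ∀ i, chartBall I i (r i) ⊆ chartBall I (κ i) (R (κ i)) := fun i =>
    hsub i i (by rw [inter_self]; exact ⟨i, mem_chartBall_self i (hr0 i)⟩)
  refine ⟨fun i => h (κ i), fun i => (hh _).mono (hself i), fun i x hx => hhd _ _ (hself i hx), ?_⟩
  intro i j x hx y hy
  have hsi := hsub i j ⟨x, hx⟩
  have hsj := hself j
  refine hb j (fun x => h (κ i) x - h (κ j) x) (((hh _).mono hsi).sub ((hh _).mono hsj)) _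
    (by have := hC0 (κ i); have := hC0 (κ j); positivity) ?_ x hx.2 y hy.2
  intro z hz
  have hmd : ∀ k, z ∈ chartBall I k (R k) → MDifferentiableAt I 𝓘(ℝ, ℝ) (h k) z := fun k hk =>
    ((hh k z hk).contMDiffAt ((isOpen_chartBall k _).mem_nhds hk)).mdifferentiableAt (by simp)
  have heq : differential I (fun x => h (κ i) x - h (κ j) x) z =
      ((-1 : ℝ) • (D - differential I (h (κ i))) + (D - differential I (h (κ j)))) z := by
    rw [show (fun x => h (κ i) x - h (κ j) x) = h (κ i) - h (κ j) from rfl,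
      differential_sub (hmd _ (hsi hz)) (hmd _ (hsj hz))]
    ext v
    simp
  rw [pointNorm_congr heq, add_mul]
  refine (pointNorm_add_le _ _ _).trans (add_le_add ?_ (hhd _ _ (hsj hz)))
  rw [pointNorm_smul]
  simpa using hhd _ _ (hsi hz)

/-- A `1`-form with zero periods on `P` differs from a closed one by at most a multiple of the size
of its exterior derivative. -/
theorem exists_closed_near (hI : IsHalfSpaceModel I ℓ) (P : Submodule ℚ (H1Boundary Q I)) :
    ∃ C : ℝ, 0 ≤ C ∧ ∀ D : Form E Q 1, IsSmoothForm I D → HasZeroPeriods I P D → ∀ ε : ℝ, 0 ≤ ε →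
      (∀ x, pointNorm I (extD I D) x ≤ ε) →
      ∃ ζ : Form E Q 1, IsSmoothForm I ζ ∧ extD I ζ = 0 ∧ HasZeroPeriods I P ζ ∧
        ∀ x, pointNorm I (D - ζ) x ≤ C * ε := by
  obtain ⟨V, C, b, hVo, hVm, hC0, hb0, hloc⟩ := exists_cover_with_approximate_primitives (Q := Q) hI
  obtain ⟨ρ', hρ'⟩ := SmoothPartitionOfUnity.exists_isSubordinate I (isClosed_univ (X := Q)) V hVo
    (fun x _ => mem_iUnion.2 ⟨x, hVm x⟩)
  obtain ⟨s, hs, hs1⟩ := exists_finset_partition ρ'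
  set ρ : s → Q → ℝ := fun i => ρ' i with hρdef
  have hρ : ∀ i, ContMDiff I 𝓘(ℝ, ℝ) ∞ (ρ i) := fun i => (ρ' i).contMDiff
  have hρ0 : ∀ i x, 0 ≤ ρ i x := fun i x => ρ'.nonneg i x
  have hρ1 : ∀ i x, ρ i x ≤ 1 := fun i x => ρ'.le_one i x
  have hsum : ∀ x, ∑ i, ρ i x = 1 := fun x => by
    rw [← hs1 x]
    exact Finset.sum_coe_sort s fun i => ρ' i x
  have hρV : ∀ i : s, tsupport (ρ i) ⊆ V i := fun i => hρ' i
  choose M hM0 hM using fun i : s => (isSmoothForm_differential (hρ i)).exists_pointNorm_le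
  set M' := ∑ i, M i with hM'
  have hM'0 : 0 ≤ M' := Finset.sum_nonneg fun i _ => hM0 i
  have hMM' : ∀ i x, pointNorm I (differential I (ρ i)) x ≤ M' := fun i x =>
    (hM i x).trans (Finset.single_le_sum (fun i _ => hM0 i) (Finset.mem_univ i))
  set C' := ∑ i : s, C i with hC'
  have hC'0 : 0 ≤ C' := Finset.sum_nonneg fun i _ => hC0 i
  have hCC' : ∀ i : s, C i ≤ C' := fun i =>
    Finset.single_le_sum (f := fun i : s => C i) (fun i _ => hC0 i) (Finset.mem_univ i)
  set b' := (∑ i : s, b i) * (C' + C') with hb'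
  have hbs0 : 0 ≤ ∑ i : s, b i := Finset.sum_nonneg fun i _ => hb0 i
  have hb'0 : 0 ≤ b' := by positivity
  have hbb' : ∀ i j : s, b j * (C i + C j) ≤ b' := fun i j => by
    have h1 : b j ≤ ∑ i : s, b i :=
      Finset.single_le_sum (f := fun i : s => b i) (fun i _ => hb0 i) (Finset.mem_univ j)
    have := hC0 i
    have := hC0 j
    have := hCC' i
    have := hCC' j
    rw [hb']
    gcongr
  choose K hK0 hK using fun z : Chain Q I 1 => exists_abs_chainIntegral_le (I := I) z
  set N : ℝ := ((Fintype.card s : ℕ) : ℝ) with hN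
  set C₃ : ℝ := C' + N * (N * (b' * M')) with hC₃
  -- the functionals that vanish on the cocycles whose forms have zero periods
  set Γ : Type _ := {t : s × s × s // (V t.1 ∩ V t.2.1 ∩ V t.2.2).Nonempty} ⊕
    {z : relCycles I (I.boundary Q) ∅ 0 // (Submodule.Quotient.mk z : H1Boundary Q I) ∈ P} with hΓ
  set f : Γ → (s → s → ℝ) →ₗ[ℝ] ℝ := fun γ => Sum.elim
    (fun t =>
      { toFun := fun m => m t.1.1 t.1.2.1 + m t.1.2.1 t.1.2.2 - m t.1.1 t.1.2.2
        map_add' := fun m m' => by simp only [Pi.add_apply]; ring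
        map_smul' := fun c m => by
          simp only [Pi.smul_apply, smul_eq_mul, RingHom.id_apply]; ring })
    (fun z =>
      { toFun := fun m => chainIntegral I (cechForm I ρ m) (z.1 : Chain Q I 1)
        map_add' := fun m m' => by
          rw [cechForm_add, chainIntegral_add_form (isSmoothForm_cechForm hρ m)
            (isSmoothForm_cechForm hρ m')]
        map_smul' := fun c m => by
          rw [cechForm_smul, chainIntegral_smul_form, RingHom.id_apply, smul_eq_mul] }) γ with hf
  -- Each of the three terms of a cocycle equation is off by at most `b' * ε`. The period of
  -- `cechForm I ρ m` over a cycle of class in `P` equals that of the gluing error, of size `C₃ *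
  -- ε`, because `D` and `dF` have no period there.
  set c : Γ → ℝ := fun γ => Sum.elim (fun _ => 3 * b') (fun z => K (z.1 : Chain Q I 1) * C₃) γ
    with hc
  obtain ⟨C₄, hC₄0, hC₄⟩ := exists_near_common_kernel f c
  refine ⟨C₃ + N * (N * M') * C₄, by positivity, fun D hD hDP ε hε hdD => ?_⟩
  obtain ⟨g, hg, hga, hgb⟩ := hloc D hD ε hε hdD
  classical
  -- `m i j` is a sample value of `g i - g j`. The default `0` on disjoint pairs is immaterial, as
  -- `ρ j dρ i` vanishes for them.
  set m : s → s → ℝ := fun i j => if h : (V i ∩ V j).Nonempty then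
    g i h.some - g j h.some else 0 with hm
  have hmb : ∀ i j : s, ∀ x ∈ V i ∩ V j, |m i j - (g i x - g j x)| ≤ b' * ε := by
    intro i j x hx
    have hne : (V i ∩ V j).Nonempty := ⟨x, hx⟩
    simp only [hm, dif_pos hne]
    refine (hgb i j _ hne.some_mem x hx).trans ?_
    rw [← mul_assoc]
    exact mul_le_mul_of_nonneg_right (hbb' i j) hε
  set F : Q → ℝ := ∑ i : s, ρ i * g i with hF
  have hFs : ContMDiff I 𝓘(ℝ, ℝ) ∞ F := (differential_glue (I := I) (Finset.univ : Finset s)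
    (fun i => hVo i) hρ (fun i _ => hg i) hρV).1
  have hE : ∀ x, pointNorm I (D - differential I F + cechForm I ρ m) x ≤ C₃ * ε := by
    intro x
    refine (pointNorm_sub_differential_glue_le hρ hρ0 hρ1 hsum (fun i : s => hVo i) hρV
      (fun i => hg i) (M := M') (a := C' * ε) (b := b' * ε) (by positivity) hM'0 hMM'
      (fun i x hx => (hga i x hx).trans (mul_le_mul_of_nonneg_right (hCC' i) hε)) hmb x).trans ?_
    rw [hC₃]
    apply le_of_eq
    ring
  have hdF := isSmoothForm_differential hFs
  have hDF := hD.sub hdF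
  obtain ⟨z, hz, hmz⟩ := hC₄ m ε hε (by
    rintro (⟨⟨i, j, k⟩, ⟨x, ⟨hxi, hxj⟩, hxk⟩⟩ | ⟨z, hzP⟩)
    · have h1 := abs_le.1 (hmb i j x ⟨hxi, hxj⟩)
      have h2 := abs_le.1 (hmb j k x ⟨hxj, hxk⟩)
      have h3 := abs_le.1 (hmb i k x ⟨hxi, hxk⟩)
      change |m i j + m j k - m i k| ≤ 3 * b' * ε
      rw [abs_le]
      constructor <;> linarith [h1.1, h1.2, h2.1, h2.2, h3.1, h3.2]
    · change |chainIntegral I (cechForm I ρ m) (z : Chain Q I 1)| ≤ K (z : Chain Q I 1) * C₃ * ε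
      have h1 := hK (z : Chain Q I 1) _ _ hE
      rw [chainIntegral_add_form hDF (isSmoothForm_cechForm hρ m),
        chainIntegral_sub_form hD hdF, hDP z hzP, chainIntegral_differential hFs
          (bdry_eq_zero_of_mem_relCycles z.2), sub_zero, zero_add] at h1
      rw [mul_assoc]
      exact h1)
  have hcz := isSmoothForm_cechForm (I := I) hρ z
  -- The distance from `D` splits into the gluing error for `m` and `cechForm I ρ (z - m)`, both
  -- `O(ε)`.
  refine ⟨differential I F - cechForm I ρ z, hdF.sub hcz, ?_, ?_, ?_⟩
  · rw [extD_sub hdF hcz, extD_differential hFs, extD_cechForm_eq_zero hρ hsum (fun i => hVo i) hρV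
      (fun i j k hijk => ?_), sub_zero]
    have h1 := hz (Sum.inl ⟨(i, j, k), hijk⟩)
    change z i j + z j k - z i k = 0 at h1
    linarith
  · intro w hw
    have h1 := hz (Sum.inr ⟨w, hw⟩)
    change chainIntegral I (cechForm I ρ z) (w : Chain Q I 1) = 0 at h1
    rw [chainIntegral_sub_form hdF hcz, h1, chainIntegral_differential hFs
      (bdry_eq_zero_of_mem_relCycles w.2), sub_zero]
  · intro x
    have h1 : D - (differential I F - cechForm I ρ z) =
        (D - differential I F + cechForm I ρ m) + cechForm I ρ (z - m) := by
      rw [cechForm_sub]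
      abel
    rw [h1, add_mul]
    refine (pointNorm_add_le _ _ _).trans (add_le_add (hE x) ?_)
    rw [mul_assoc]
    rw [norm_sub_rev] at hmz
    exact (pointNorm_cechForm_le hρ0 hρ1 hMM' _ x).trans (by gcongr)

end BoundedPrimitive

/-! ### Neighbourhoods in the `C^1`-topology. -/

section Jets

variable {E H Q : Type*} [NormedAddCommGroup E] [NormedSpace ℝ E] [TopologicalSpace H]
  {I : ModelWithCorners ℝ E H} [TopologicalSpace Q] [ChartedSpace H Q]

variable (I) in
/-- The derivative of the coefficients of a form in a chart. -/
def chartDeriv {k : ℕ} (η : Form E Q k) (x : Q) (y : E) : E →L[ℝ] E [⋀^Fin k]→L[ℝ] ℝ :=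
  fderivWithin ℝ (inChart I η x) (range I) y

variable (I) in
/-- The forms that are `C^1`-close to `B` on given sets in finitely many charts. -/
def c1Ball {k : ℕ} (s : Set Q) (K : Q → Set E) (B : Form E Q k) (ε : ℝ) : Set (Form E Q k) :=
  {η | ∀ x ∈ s, ∀ y ∈ K x, ‖inChart I η x y - inChart I B x y‖ ≤ ε ∧
    ‖chartDeriv I η x y - chartDeriv I B x y‖ ≤ ε}

theorem norm_combination_sub_le {F : Type*} [NormedAddCommGroup F] [NormedSpace ℝ F] {a b c : F}
    {ε u : ℝ} (ha : ‖a - c‖ ≤ ε) (hb : ‖b - c‖ ≤ ε) (hu : u ∈ Icc (0 : ℝ) 1) :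
    ‖(1 - u) • a + u • b - c‖ ≤ ε := by
  have h1 : (1 - u) • a + u • b - c = (1 - u) • (a - c) + u • (b - c) := by module
  rw [h1]
  refine (norm_add_le _ _).trans ?_
  rw [norm_smul, norm_smul, Real.norm_of_nonneg hu.1, Real.norm_of_nonneg (sub_nonneg.2 hu.2)]
  have h2 := mul_le_mul_of_nonneg_left ha (sub_nonneg.2 hu.2)
  have h3 := mul_le_mul_of_nonneg_left hb hu.1
  linarith

theorem norm_smul_sub_le {F : Type*} [NormedAddCommGroup F] [NormedSpace ℝ F] {a c : F}
    {ε M τ t : ℝ} (ha : ‖a - c‖ ≤ ε) (hM : ‖c‖ ≤ M) (ht : |t - 1| ≤ τ) (hτ : τ ≤ 1) :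
    ‖t • a - c‖ ≤ 2 * ε + τ * M := by
  have h1 : t • a - c = t • (a - c) + (t - 1) • c := by module
  rw [h1]
  refine (norm_add_le _ _).trans ?_
  rw [norm_smul, norm_smul, Real.norm_eq_abs, Real.norm_eq_abs]
  have h2 : |t| ≤ 2 := by
    have := abs_le.1 ht
    exact abs_le.2 ⟨by linarith, by linarith⟩
  gcongr
  exact (abs_nonneg _).trans ht

theorem norm_fderivWithin_combination_sub_le {F : Type*} [NormedAddCommGroup F] [NormedSpace ℝ F]
    {f g h : E → F} {s : Set E} {y : E} (hs : UniqueDiffWithinAt ℝ s y)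
    (hf : DifferentiableWithinAt ℝ f s y) (hg : DifferentiableWithinAt ℝ g s y) {ε u : ℝ}
    (ha : ‖fderivWithin ℝ f s y - fderivWithin ℝ h s y‖ ≤ ε)
    (hb : ‖fderivWithin ℝ g s y - fderivWithin ℝ h s y‖ ≤ ε) (hu : u ∈ Icc (0 : ℝ) 1) :
    ‖fderivWithin ℝ ((1 - u) • f + u • g) s y - fderivWithin ℝ h s y‖ ≤ ε := by
  rw [fderivWithin_add hs (hf.const_smul _) (hg.const_smul u), fderivWithin_const_smul hs hf,
    fderivWithin_const_smul hs hg]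
  exact norm_combination_sub_le ha hb hu

theorem norm_fderivWithin_smul_sub_le {F : Type*} [NormedAddCommGroup F] [NormedSpace ℝ F]
    {f h : E → F} {s : Set E} {y : E} (hs : UniqueDiffWithinAt ℝ s y)
    (hf : DifferentiableWithinAt ℝ f s y) {ε M τ t : ℝ}
    (ha : ‖fderivWithin ℝ f s y - fderivWithin ℝ h s y‖ ≤ ε)
    (hM : ‖fderivWithin ℝ h s y‖ ≤ M) (ht : |t - 1| ≤ τ) (hτ : τ ≤ 1) :
    ‖fderivWithin ℝ (t • f) s y - fderivWithin ℝ h s y‖ ≤ 2 * ε + τ * M := by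
  rw [fderivWithin_const_smul hs hf]
  exact norm_smul_sub_le ha hM ht hτ

theorem exists_norm_fderivWithin_le {F : Type*} [NormedAddCommGroup F] [NormedSpace ℝ F]
    {f : E → F} {s K : Set E} (hs : UniqueDiffOn ℝ s) (hK : IsCompact K) (hKs : K ⊆ s)
    (hf : ∀ y ∈ K, ContDiffWithinAt ℝ ∞ f s y) : ∃ M, ∀ y ∈ K, ‖fderivWithin ℝ f s y‖ ≤ M :=
  hK.exists_bound_of_continuousOn fun y hy =>
    (((hf y hy).fderivWithin_right hs (m := 0) (by simp) (hKs hy)).continuousWithinAt).mono hKs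

/-- Compact subsets of `T` are closed under finite unions, so the uniformities of convergence on
them have a basis given by a single `K` and `ε`. -/
theorem mem_comap_ofFun_iff {X Y F : Type*} [TopologicalSpace Y] [SeminormedAddCommGroup F]
    (T : Set Y) (g : X → Y → F) (B : X) (V : Set X) :
    V ∈ comap (fun η => UniformOnFun.ofFun {K : Set Y | IsCompact K ∧ K ⊆ T} (g η))
      (𝓝 (UniformOnFun.ofFun {K : Set Y | IsCompact K ∧ K ⊆ T} (g B))) ↔
    ∃ K : Set Y, IsCompact K ∧ K ⊆ T ∧ ∃ ε > 0, {η | ∀ y ∈ K, ‖g η y - g B y‖ ≤ ε} ⊆ V := by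
  have hb := UniformOnFun.hasBasis_nhds_of_basis Y F {K : Set Y | IsCompact K ∧ K ⊆ T}
    (UniformOnFun.ofFun {K : Set Y | IsCompact K ∧ K ⊆ T} (g B)) ⟨∅, isCompact_empty, empty_subset _⟩
    (fun K hK L hL => ⟨K ∪ L, ⟨hK.1.union hL.1, union_subset hK.2 hL.2⟩, subset_union_left,
      subset_union_right⟩) Metric.uniformity_basis_dist_le
  rw [(hb.comap _).mem_iff]
  constructor
  · rintro ⟨⟨K, ε⟩, ⟨⟨hK, hKT⟩, hε⟩, h⟩
    refine ⟨K, hK, hKT, ε, hε, fun η hη => h fun y hy => ?_⟩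
    change dist (g η y) (g B y) ≤ ε
    rw [dist_eq_norm]
    exact hη y hy
  · rintro ⟨K, hK, hKT, ε, hε, h⟩
    refine ⟨(K, ε), ⟨⟨hK, hKT⟩, hε⟩, fun η hη => h fun y hy => ?_⟩
    have h1 : dist (g η y) (g B y) ≤ ε := hη y hy
    rwa [dist_eq_norm] at h1

theorem nhds_induced_inf_induced {X Y Z : Type*} [t : TopologicalSpace Y] [t' : TopologicalSpace Z]
    (f : X → Y) (g : X → Z) (x : X) :
    @nhds _ (TopologicalSpace.induced f t ⊓ TopologicalSpace.induced g t') x =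
      comap f (𝓝 (f x)) ⊓ comap g (𝓝 (g x)) := by
  rw [@nhds_inf _ (TopologicalSpace.induced f t) (TopologicalSpace.induced g t') x, nhds_induced,
    nhds_induced]

/-- The topology is an infimum over all charts, and a neighbourhood in an infimum involves only
finitely many of them. So the coefficients need to be estimated on finitely many compact sets only.
-/
theorem mem_nhds_c1Topology_iff {k : ℕ} {B : Form E Q k} {U : Set (Form E Q k)} :
    U ∈ @nhds _ (c1Topology I k) B ↔ ∃ s : Set Q, s.Finite ∧ ∃ K : Q → Set E,
      (∀ x, IsCompact (K x) ∧ K x ⊆ (extChartAt I x).target) ∧ ∃ ε > 0, c1Ball I s K B ε ⊆ U := by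
  have hnhds : @nhds _ (c1Topology I k) B = ⨅ x : Q,
      (comap (fun η => UniformOnFun.ofFun {K : Set E | IsCompact K ∧ K ⊆ (extChartAt I x).target}
          (inChart I η x)) (𝓝 (UniformOnFun.ofFun _ (inChart I B x))) ⊓
        comap (fun η => UniformOnFun.ofFun {K : Set E | IsCompact K ∧ K ⊆ (extChartAt I x).target}
          (fderivWithin ℝ (inChart I η x) (range I)))
            (𝓝 (UniformOnFun.ofFun _ (fderivWithin ℝ (inChart I B x) (range I))))) := by
    rw [c1Topology, nhds_iInf]
    refine iInf_congr fun x => ?_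
    exact nhds_induced_inf_induced _ _ B
  rw [hnhds]
  constructor
  · intro h
    rw [Filter.mem_iInf] at h
    obtain ⟨s, hs, V, hV, rfl⟩ := h
    have hV' : ∀ x : s, ∃ K : Set E, IsCompact K ∧ K ⊆ (extChartAt I (x : Q)).target ∧ ∃ ε > 0,
        {η : Form E Q k | ∀ y ∈ K, ‖inChart I η (x : Q) y - inChart I B (x : Q) y‖ ≤ ε ∧
          ‖chartDeriv I η (x : Q) y - chartDeriv I B (x : Q) y‖ ≤ ε} ⊆ V x := by
      intro x
      obtain ⟨V₁, hV₁, V₂, hV₂, hVV⟩ := Filter.mem_inf_iff.1 (hV x)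
      obtain ⟨K₁, hK₁, hK₁t, ε₁, hε₁, h₁⟩ := (mem_comap_ofFun_iff _
        (fun η => inChart I η (x : Q)) B V₁).1 hV₁
      obtain ⟨K₂, hK₂, hK₂t, ε₂, hε₂, h₂⟩ := (mem_comap_ofFun_iff _
        (fun η => chartDeriv I η (x : Q)) B V₂).1 hV₂
      refine ⟨K₁ ∪ K₂, hK₁.union hK₂, union_subset hK₁t hK₂t, min ε₁ ε₂, lt_min hε₁ hε₂, ?_⟩
      intro η hη
      rw [hVV]
      refine ⟨h₁ fun y hy => ?_, h₂ fun y hy => ?_⟩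
      · exact (hη y (Or.inl hy)).1.trans (min_le_left _ _)
      · exact (hη y (Or.inr hy)).2.trans (min_le_right _ _)
    choose K hK hKt ε hε hsub using hV'
    classical
    have : Fintype s := hs.fintype
    obtain ⟨ε', hε', hle⟩ : ∃ ε' > 0, ∀ x : s, ε' ≤ ε x := by
      by_cases hne : Nonempty s
      · obtain ⟨x₀, hx₀⟩ := Finite.exists_min ε
        exact ⟨ε x₀, hε x₀, hx₀⟩
      · exact ⟨1, one_pos, fun x => absurd ⟨x⟩ hne⟩
    refine ⟨s, hs, fun x => if h : x ∈ s then K ⟨x, h⟩ else ∅, fun x => ?_, ε', hε', ?_⟩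
    · by_cases h : x ∈ s
      · simp only [dif_pos h]
        exact ⟨hK _, hKt _⟩
      · simp [dif_neg h]
    · intro η hη
      refine mem_iInter.2 fun x => hsub x fun y hy => ?_
      have h1 := hη x x.2 y (by simp only [dif_pos x.2]; exact hy)
      exact ⟨h1.1.trans (hle x), h1.2.trans (hle x)⟩
  · rintro ⟨s, hs, K, hK, ε, hε, h⟩
    refine Filter.mem_of_superset ((Filter.biInter_mem hs).2 fun x (_ : x ∈ s) =>
      Filter.mem_iInf_of_mem x (Filter.inter_mem_inf
        ((mem_comap_ofFun_iff _ (fun η => inChart I η x) B _).2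
          ⟨K x, (hK x).1, (hK x).2, ε, hε, subset_rfl⟩)
        ((mem_comap_ofFun_iff _ (fun η => chartDeriv I η x) B _).2
          ⟨K x, (hK x).1, (hK x).2, ε, hε, subset_rfl⟩))) fun η hη => h fun x hx y hy => ?_
    have h1 := mem_iInter₂.1 hη x hx
    exact ⟨h1.1 y hy, h1.2 y hy⟩

theorem c1Ball_combination {k : ℕ} {s : Set Q} {K : Q → Set E} {B η θ : Form E Q k} {ε : ℝ}
    (hK : ∀ x, K x ⊆ (extChartAt I x).target) (hη : IsSmoothForm I η) (hθ : IsSmoothForm I θ)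
    (hη' : η ∈ c1Ball I s K B ε) (hθ' : θ ∈ c1Ball I s K B ε) {u : ℝ} (hu : u ∈ Icc (0 : ℝ) 1) :
    (1 - u) • η + u • θ ∈ c1Ball I s K B ε := by
  intro x hx y hy
  have e : inChart I ((1 - u) • η + u • θ) x = (1 - u) • inChart I η x + u • inChart I θ x := by
    rw [inChart_add, inChart_smul, inChart_smul]
  rw [chartDeriv, e]
  refine ⟨norm_combination_sub_le (hη' x hx y hy).1 (hθ' x hx y hy).1 hu, ?_⟩
  exact norm_fderivWithin_combination_sub_le
    (I.uniqueDiffOn y (extChartAt_target_subset_range x (hK x hy)))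
    ((hη.contDiffWithinAt x (hK x hy)).differentiableWithinAt (by simp))
    ((hθ.contDiffWithinAt x (hK x hy)).differentiableWithinAt (by simp))
    (hη' x hx y hy).2 (hθ' x hx y hy).2 hu

/-- The cost of rescaling by `t` near `1`: as `|t| ≤ 2` the old error at most doubles, and `|t - 1|`
acts on `B` itself. -/
theorem c1Ball_smul {k : ℕ} {s : Set Q} {K : Q → Set E} {B η : Form E Q k} {ε M τ t : ℝ}
    (hK : ∀ x, K x ⊆ (extChartAt I x).target) (hη : IsSmoothForm I η)
    (hM : ∀ x ∈ s, ∀ y ∈ K x, ‖inChart I B x y‖ ≤ M ∧ ‖chartDeriv I B x y‖ ≤ M) (hη' : η ∈ c1Ball I s K B ε)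
    (ht : |t - 1| ≤ τ) (hτ : τ ≤ 1) :
    t • η ∈ c1Ball I s K B (2 * ε + τ * M) := by
  intro x hx y hy
  have e : inChart I (t • η) x = t • inChart I η x := by rw [inChart_smul]
  rw [chartDeriv, e]
  refine ⟨norm_smul_sub_le (hη' x hx y hy).1 (hM x hx y hy).1 ht hτ, ?_⟩
  exact norm_fderivWithin_smul_sub_le
    (I.uniqueDiffOn y (extChartAt_target_subset_range x (hK x hy)))
    ((hη.contDiffWithinAt x (hK x hy)).differentiableWithinAt (by simp))
    (hη' x hx y hy).2 (hM x hx y hy).2 ht hτ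

end Jets

/-! ### Continuity of helicity and part (A). -/

section HelicityNear

variable {E : Type} {H Q : Type*} [NormedAddCommGroup E] [NormedSpace ℝ E] [TopologicalSpace H]
  {I : ModelWithCorners ℝ E H} [TopologicalSpace Q] [ChartedSpace H Q]
  [FiniteDimensional ℝ E] [MeasurableSpace E] [BorelSpace E] [IsManifold I ∞ Q]
  [T2Space Q] [CompactSpace Q] {ℓ : E →L[ℝ] ℝ}

theorem exactFields_combination {B₀ B₁ : Form E Q 2} (h₀ : B₀ ∈ exactFields Q I)
    (h₁ : B₁ ∈ exactFields Q I) (a b : ℝ) : a • B₀ + b • B₁ ∈ exactFields Q I := by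
  obtain ⟨hs₀, ⟨A₀, hA₀, hd₀⟩, hb₀⟩ := h₀
  obtain ⟨hs₁, ⟨A₁, hA₁, hd₁⟩, hb₁⟩ := h₁
  refine ⟨(hs₀.const_smul a).add (hs₁.const_smul b), ⟨a • A₀ + b • A₁,
    (hA₀.const_smul a).add (hA₁.const_smul b), ?_⟩, (hb₀.const_smul a).add (hb₁.const_smul b)⟩
  rw [extD_add (hA₀.const_smul a) (hA₁.const_smul b), extD_smul, extD_smul, hd₀, hd₁]

theorem HasZeroPeriods.combination {P : Submodule ℚ (H1Boundary Q I)} {A₀ A₁ : Form E Q 1}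
    (hs₀ : IsSmoothForm I A₀) (hs₁ : IsSmoothForm I A₁) (h₀ : HasZeroPeriods I P A₀)
    (h₁ : HasZeroPeriods I P A₁) (a b : ℝ) : HasZeroPeriods I P (a • A₀ + b • A₁) := fun z hz => by
  rw [chainIntegral_add_form (hs₀.const_smul a) (hs₁.const_smul b), chainIntegral_smul_form,
    chainIntegral_smul_form, h₀ z hz, h₁ z hz, mul_zero, mul_zero, add_zero]

variable [Fact (finrank ℝ E = 3)]

/-- The helicity depends continuously on the field. -/
theorem exists_abs_helicity_sub_le (hI : IsHalfSpaceModel I ℓ) {μ : Form E Q 3}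
    (hμ : IsVolumeForm I μ) {P : Submodule ℚ (H1Boundary Q I)}
    (hP : IsCompl P (LinearMap.ker (inclH1 Q I))) {A : Form E Q 1} (hA : IsSmoothForm I A)
    (hAP : HasZeroPeriods I P A) :
    ∃ C : ℝ, 0 ≤ C ∧ ∀ A₀ : Form E Q 1, IsSmoothForm I A₀ → HasZeroPeriods I P A₀ →
      extD I A₀ ∈ exactFields Q I → ∀ ε : ℝ, 0 ≤ ε → ε ≤ 1 →
      (∀ x, pointNorm I (extD I A₀ - extD I A) x ≤ ε) →
      |formIntegral I μ (wedgeOne A₀ (extD I A₀)) - formIntegral I μ (wedgeOne A (extD I A))| ≤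
        C * ε := by
  obtain ⟨C, hC0, hC⟩ := exists_closed_near hI P
  obtain ⟨K, hK0, hK⟩ := exists_abs_formIntegral_wedgeOne_le (I := I) μ
  obtain ⟨a, ha0, ha⟩ := hA.exists_pointNorm_le
  obtain ⟨b, hb0, hb⟩ := hA.extD.exists_pointNorm_le
  refine ⟨K * a + K * (C * (b + 1)), by positivity, fun A₀ hA₀ hA₀P hB₀ ε hε hε1 hclose => ?_⟩
  have hD := hA₀.sub hA
  have hDP : HasZeroPeriods I P (A₀ - A) := fun z hz => by
    rw [chainIntegral_sub_form hA₀ hA, hA₀P z hz, hAP z hz, sub_zero]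
  obtain ⟨ζ, hζ, hζd, hζP, hζn⟩ := hC (A₀ - A) hD hDP ε hε (by
    rw [extD_sub hA₀ hA]
    exact hclose)
  have hδ := hA₀.extD.sub hA.extD
  have hDζ := hD.sub hζ
  -- The first two corrections are small, by the closeness of the fields and by the choice of `ζ`.
  -- The last one may be large as a form, but its integral is zero.
  have hsplit : wedgeOne A₀ (extD I A₀) = wedgeOne A (extD I A) +
      (wedgeOne A (extD I A₀ - extD I A) + (wedgeOne (A₀ - A - ζ) (extD I A₀) +
        wedgeOne ζ (extD I A₀))) := by
    rw [wedgeOne_sub_right, wedgeOne_sub_left, wedgeOne_sub_left]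
    abel
  rw [hsplit, formIntegral_add hμ (hA.wedgeOne hA.extD) ((hA.wedgeOne hδ).add
      ((hDζ.wedgeOne hA₀.extD).add (hζ.wedgeOne hA₀.extD))),
    formIntegral_add hμ (hA.wedgeOne hδ) ((hDζ.wedgeOne hA₀.extD).add (hζ.wedgeOne hA₀.extD)),
    formIntegral_add hμ (hDζ.wedgeOne hA₀.extD) (hζ.wedgeOne hA₀.extD),
    formIntegral_wedgeOne_eq_zero_of_hasZeroPeriods hI hμ hP hζ hζd hζP hB₀, add_zero,
    add_sub_cancel_left]
  have h1 := hK A (extD I A₀ - extD I A) a ε ha hclose ha0 hε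
  have h2 := hK (A₀ - A - ζ) (extD I A₀) (C * ε) (b + 1) hζn (fun x => by
    have h3 : extD I A₀ = extD I A + (extD I A₀ - extD I A) := by abel
    rw [h3]
    exact (pointNorm_add_le _ _ _).trans (add_le_add (hb x) ((hclose x).trans hε1)))
    (by positivity) (by positivity)
  refine (abs_add_le _ _).trans ((add_le_add h1 h2).trans (le_of_eq ?_))
  ring

theorem formIntegral_wedgeOne_combination {μ : Form E Q 3} (hμ : IsVolumeForm I μ)
    {A₀ A₁ : Form E Q 1} {B₀ B₁ : Form E Q 2} (hA₀ : IsSmoothForm I A₀) (hA₁ : IsSmoothForm I A₁)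
    (hB₀ : IsSmoothForm I B₀) (hB₁ : IsSmoothForm I B₁) (a b : ℝ) :
    formIntegral I μ (wedgeOne (a • A₀ + b • A₁) (a • B₀ + b • B₁)) =
      a ^ 2 * formIntegral I μ (wedgeOne A₀ B₀) + a * b * (formIntegral I μ (wedgeOne A₀ B₁) +
        formIntegral I μ (wedgeOne A₁ B₀)) + b ^ 2 * formIntegral I μ (wedgeOne A₁ B₁) := by
  have h : wedgeOne (a • A₀ + b • A₁) (a • B₀ + b • B₁) =
      (a * a) • wedgeOne A₀ B₀ + ((a * b) • wedgeOne A₀ B₁ +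
        ((b * a) • wedgeOne A₁ B₀ + (b * b) • wedgeOne A₁ B₁)) := by
    simp only [wedgeOne_add_left, wedgeOne_add_right, wedgeOne_smul_left, wedgeOne_smul_right,
      smul_smul, smul_add, mul_comm b a]
    abel
  rw [h, formIntegral_add hμ ((hA₀.wedgeOne hB₀).const_smul _)
      (((hA₀.wedgeOne hB₁).const_smul _).add (((hA₁.wedgeOne hB₀).const_smul _).add
        ((hA₁.wedgeOne hB₁).const_smul _))),
    formIntegral_add hμ ((hA₀.wedgeOne hB₁).const_smul _) (((hA₁.wedgeOne hB₀).const_smul _).add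
        ((hA₁.wedgeOne hB₁).const_smul _)),
    formIntegral_add hμ ((hA₁.wedgeOne hB₀).const_smul _) ((hA₁.wedgeOne hB₁).const_smul _),
    formIntegral_smul, formIntegral_smul, formIntegral_smul, formIntegral_smul]
  ring

/-- A family that is smooth on `[0, 1]` is a piecewise smooth path. -/
theorem IsSmoothFamilyOn.isPiecewiseSmoothPath {k : ℕ} {β : ℝ → Form E Q k}
    (h : IsSmoothFamilyOn I β 0 1) : IsPiecewiseSmoothPath I β := by
  refine ⟨1, fun i => (i : ℕ), ?_, by simp, by simp, ?_⟩
  · intro i j hij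
    change ((i : ℕ) : ℝ) < ((j : ℕ) : ℝ)
    exact_mod_cast hij
  · intro i
    fin_cases i
    simpa using h

theorem abs_sqrt_sub_one_le {q : ℝ} (hq : 0 ≤ q) : |√q - 1| ≤ |q - 1| := by
  have h1 : q - 1 = (√q - 1) * (√q + 1) := by
    have := Real.mul_self_sqrt hq
    linarith
  rw [h1, abs_mul]
  refine le_mul_of_one_le_right (abs_nonneg _) ?_
  rw [abs_of_nonneg (by positivity)]
  linarith [Real.sqrt_nonneg q]

theorem pointNorm_sub_le_of_mem_c1Ball {k : ℕ} {s : Set Q} {K : Q → Set E} {B η : Form E Q k} {ε : ℝ}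
    (hs : ∀ j ∈ partitionIndices Q I, j ∈ s)
    (hK : ∀ j, extChartAt I j '' tsupport (chartPartition Q I j) ⊆ K j)
    (h : η ∈ c1Ball I s K B ε) (x : Q) : pointNorm I (η - B) x ≤ ε := by
  calc _ ≤ ∑ j ∈ partitionIndices Q I, chartPartition Q I j x * ε := by
        refine Finset.sum_le_sum fun j hj => ?_
        by_cases hx : x ∈ tsupport (chartPartition Q I j)
        · refine mul_le_mul_of_nonneg_left ?_ ((chartPartition Q I).nonneg j x)
          have h1 := h j (hs j hj) _ (hK j (mem_image_of_mem _ hx))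
          exact h1.1
        · rw [image_eq_zero_of_notMem_tsupport hx, zero_mul, zero_mul]
    _ = ε := by rw [← Finset.sum_mul, sum_chartPartition, one_mul]

/-- Two fields close to a field with nonzero helicity and with equal helicities are joined by a path
of fields with the same helicity close to that field. -/
theorem exists_helicityConnected_nhd (hI : IsHalfSpaceModel I ℓ) {μ : Form E Q 3}
    (hμ : IsVolumeForm I μ) {P : Submodule ℚ (H1Boundary Q I)}
    (hP : IsCompl P (LinearMap.ker (inclH1 Q I))) {B'' : Set (Form E Q 2)}
    (hB'' : IsC1OpenIn I B'' (exactFields Q I)) {B : Form E Q 2} (hB : B ∈ B'') {c : ℝ}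
    (hc : HasHelicity I μ P B c) (hc0 : c ≠ 0) :
    ∃ N₀, IsC1NhdIn I N₀ B'' B ∧ IsHelicityConnected I μ P N₀ B'' := by
  obtain ⟨A, hA, rfl, hAP, rfl⟩ := hc
  set c := formIntegral I μ (wedgeOne A (extD I A)) with hcdef
  obtain ⟨U, hU, rfl⟩ := hB''
  obtain ⟨s₁, hs₁, K₁, hK₁, ε₀, hε₀, hsub⟩ := mem_nhds_c1Topology_iff.1
    (@IsOpen.mem_nhds _ (c1Topology I 2) _ _ hU hB.1)
  set B := extD I A with hBdef
  have hBs : IsSmoothForm I B := hA.extD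
  -- The charts and compact sets are enlarged so that membership in the ball also bounds
  -- `pointNorm`, hence the change of helicity.
  set s : Set Q := s₁ ∪ partitionIndices Q I with hs
  set K : Q → Set E := fun x => K₁ x ∪ extChartAt I x '' tsupport (chartPartition Q I x) with hKdef
  have hsfin : s.Finite := hs₁.union (partitionIndices Q I).finite_toSet
  have hK : ∀ x, IsCompact (K x) ∧ K x ⊆ (extChartAt I x).target := fun x => by
    refine ⟨(hK₁ x).1.union ((isClosed_tsupport _).isCompact.image_of_continuousOn
      ((continuousOn_extChartAt x).mono (tsupport_chartPartition x))),
      union_subset (hK₁ x).2 ?_⟩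
    rintro _ ⟨z, hz, rfl⟩
    exact (extChartAt I x).map_source (tsupport_chartPartition x hz)
  have hsub' : c1Ball I s K B ε₀ ⊆ U := fun η hη => hsub fun x hx y hy =>
    hη x (Or.inl hx) y (Or.inl hy)
  -- a bound for the coefficients of `B` and their derivatives
  obtain ⟨M, hM0, hM⟩ : ∃ M : ℝ, 0 < M ∧
      ∀ x ∈ s, ∀ y ∈ K x, ‖inChart I B x y‖ ≤ M ∧ ‖chartDeriv I B x y‖ ≤ M := by
    choose M hM using fun x => (hK x).1.exists_bound_of_continuousOn
      ((hBs x).continuousOn.mono (hK x).2)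
    choose M' hM' using fun x => exists_norm_fderivWithin_le I.uniqueDiffOn (hK x).1
      ((hK x).2.trans (extChartAt_target_subset_range x))
      (fun y hy => hBs.contDiffWithinAt x ((hK x).2 hy))
    have : Fintype s := hsfin.fintype
    have hle : ∀ x (hx : x ∈ s), |M x| + |M' x| ≤ ∑ x : s, (|M x| + |M' x|) := fun x hx =>
      Finset.single_le_sum (f := fun x : s => |M x| + |M' x|) (fun _ _ => by positivity)
        (Finset.mem_univ (⟨x, hx⟩ : s))
    refine ⟨∑ x : s, (|M x| + |M' x|) + 1, by positivity, fun x hx y hy =>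
      ⟨(hM x y hy).trans ?_, (hM' x y hy).trans ?_⟩⟩
    · linarith [le_abs_self (M x), abs_nonneg (M' x), hle x hx]
    · linarith [le_abs_self (M' x), abs_nonneg (M x), hle x hx]
  obtain ⟨C, hC0, hC⟩ := exists_abs_helicity_sub_le hI hμ hP hA hAP
  have hc' : 0 < |c| := abs_pos.2 hc0
  -- `τ` bounds the distance of the rescaling factor from `1`; it and `ε` satisfy `2 * ε + τ * M ≤
  -- ε₀`, so rescaled fields stay in `U`. The helicities differ from `c` by at most `|c| * τ / 4`,
  -- so `|h u| ≥ |c| / 2` and `|c' - h u| ≤ τ * |h u|`.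
  obtain ⟨τ, hτ0, hτ1, hτM⟩ : ∃ τ : ℝ, 0 < τ ∧ τ ≤ 1 ∧ τ * M ≤ ε₀ / 2 := by
    refine ⟨min 1 (ε₀ / 2 / M), lt_min one_pos (by positivity), min_le_left _ _, ?_⟩
    calc _ ≤ ε₀ / 2 / M * M := by gcongr; exact min_le_right _ _
      _ = _ := by field_simp
  obtain ⟨ε, hε0, hε1, hεε₀, hCε⟩ : ∃ ε : ℝ, 0 < ε ∧ ε ≤ 1 ∧ 2 * ε ≤ ε₀ / 2 ∧
      C * ε ≤ |c| * τ / 4 := by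
    have hpos : 0 < |c| * τ / 4 / (C + 1) := by positivity
    refine ⟨min 1 (min (ε₀ / 4) (|c| * τ / 4 / (C + 1))),
      lt_min one_pos (lt_min (by positivity) hpos), min_le_left _ _, ?_, ?_⟩
    · have : min 1 (min (ε₀ / 4) (|c| * τ / 4 / (C + 1))) ≤ ε₀ / 4 :=
        (min_le_right _ _).trans (min_le_left _ _)
      linarith
    · have : min 1 (min (ε₀ / 4) (|c| * τ / 4 / (C + 1))) ≤ |c| * τ / 4 / (C + 1) :=
        (min_le_right _ _).trans (min_le_right _ _)
      calc _ ≤ (C + 1) * (|c| * τ / 4 / (C + 1)) := by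
            gcongr
            linarith
        _ = _ := by field_simp
  have hCc : C * ε ≤ |c| / 4 := hCε.trans (by nlinarith)
  have hpn : ∀ η ∈ c1Ball I s K B ε, ∀ x, pointNorm I (η - B) x ≤ ε := fun η hη x =>
    pointNorm_sub_le_of_mem_c1Ball (fun j hj => Or.inr hj) (fun j => subset_union_right) hη x
  refine ⟨c1Ball I s K B ε ∩ (U ∩ exactFields Q I), ⟨inter_subset_right, ?_⟩, ?_⟩
  · have h1 : c1Ball I s K B ε ∈ @nhds _ (c1Topology I 2) B :=
      mem_nhds_c1Topology_iff.2 ⟨s, hsfin, K, hK, ε, hε0, subset_rfl⟩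
    obtain ⟨V, hV, hVo, hBV⟩ := (@mem_nhds_iff _ (c1Topology I 2) _ _).1 h1
    exact ⟨V, hVo, ⟨hBV, hB⟩, fun η hη => ⟨hV hη.1, hη.2⟩⟩
  rintro c' _ ⟨hB₀, -, hB₀e⟩ _ ⟨hB₁, -, hB₁e⟩ ⟨A₀, hA₀, rfl, hA₀P, hc₀⟩ ⟨A₁, hA₁, rfl, hA₁P, hc₁⟩
  set Au : ℝ → Form E Q 1 := fun u => (1 - u) • A₀ + u • A₁ with hAu
  have hAus : ∀ u, IsSmoothForm I (Au u) := fun u => (hA₀.const_smul _).add (hA₁.const_smul _)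
  have hdAu : ∀ u, extD I (Au u) = (1 - u) • extD I A₀ + u • extD I A₁ := fun u => by
    rw [hAu, extD_add (hA₀.const_smul _) (hA₁.const_smul _), extD_smul, extD_smul]
  have hBue : ∀ u, extD I (Au u) ∈ exactFields Q I := fun u => by
    rw [hdAu]
    exact exactFields_combination hB₀e hB₁e _ _
  set h : ℝ → ℝ := fun u => formIntegral I μ (wedgeOne (Au u) (extD I (Au u))) with hh
  have hheq : ∀ u, h u = (1 - u) ^ 2 * c' + (1 - u) * u *
      (formIntegral I μ (wedgeOne A₀ (extD I A₁)) + formIntegral I μ (wedgeOne A₁ (extD I A₀))) +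
        u ^ 2 * c' := fun u => by
    rw [hh]
    simp only
    rw [hdAu, hAu, formIntegral_wedgeOne_combination hμ hA₀ hA₁ hA₀.extD hA₁.extD, hc₀, hc₁]
  have hball : ∀ u ∈ Icc (0 : ℝ) 1, extD I (Au u) ∈ c1Ball I s K B ε := fun u hu => by
    rw [hdAu]
    exact c1Ball_combination (fun x => (hK x).2) hA₀.extD hA₁.extD hB₀ hB₁ hu
  have hhc : ∀ u ∈ Icc (0 : ℝ) 1, |h u - c| ≤ C * ε := fun u hu =>
    hC (Au u) (hAus u) (HasZeroPeriods.combination hA₀ hA₁ hA₀P hA₁P _ _) (hBue u) ε hε0.le hε1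
      (hpn _ (hball u hu))
  have hh0 : h 0 = c' := by rw [hheq]; ring
  have hh1 : h 1 = c' := by rw [hheq]; ring
  have hc'c : |c' - c| ≤ C * ε := by
    rw [← hh0]
    exact hhc 0 (by simp)
  have hhpos : ∀ u ∈ Icc (0 : ℝ) 1, 0 < c' / h u ∧ |c' / h u - 1| ≤ τ := by
    intro u hu
    have e1 := hhc u hu
    have e2 : |c| / 2 ≤ |h u| := by
      have := abs_sub_abs_le_abs_sub c (h u)
      rw [abs_sub_comm] at this
      linarith
    have hne : h u ≠ 0 := abs_pos.1 (by linarith)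
    have e3 : |c' / h u - 1| ≤ τ := by
      rw [div_sub_one hne, abs_div, div_le_iff₀ (abs_pos.2 hne)]
      have e4 : |c' - h u| ≤ |c' - c| + |h u - c| := by
        rw [abs_sub_comm (h u) c]
        exact abs_sub_le _ _ _
      calc _ ≤ τ * (|c| / 2) := by linarith
        _ ≤ _ := by gcongr
    refine ⟨?_, e3⟩
    rcases lt_or_gt_of_ne hc0 with hneg | hpos
    · rw [abs_of_neg hneg] at hCc
      have e5 := (abs_le.1 e1).2
      have e6 := (abs_le.1 hc'c).2
      exact div_pos_of_neg_of_neg (by linarith) (by linarith)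
    · rw [abs_of_pos hpos] at hCc
      have e5 := (abs_le.1 e1).1
      have e6 := (abs_le.1 hc'c).1
      exact div_pos (by linarith) (by linarith)
  have hhne : ∀ u ∈ Icc (0 : ℝ) 1, h u ≠ 0 := fun u hu hz => by
    have := (hhpos u hu).1
    rw [hz, div_zero] at this
    exact lt_irrefl _ this
  have hc'0 : c' ≠ 0 := by
    rw [← hh0]
    exact hhne 0 (by simp)
  set t : ℝ → ℝ := fun u => √(c' / h u) with ht
  -- By bilinearity `h` is a polynomial in `u`, so the factor `t` is smooth where `c' / h u > 0`.
  have hhs : ContDiff ℝ ∞ h := by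
    rw [funext hheq]
    fun_prop
  have hts : ContDiffOn ℝ ∞ t (Icc 0 1) :=
    (contDiffOn_const.div hhs.contDiffOn hhne).sqrt fun u hu => (hhpos u hu).1.ne'
  refine ⟨fun u => (t u * (1 - u)) • extD I A₀ + (t u * u) • extD I A₁, ?_, ?_, ?_, ?_⟩
  · refine IsSmoothFamilyOn.isPiecewiseSmoothPath (IsSmoothFamilyOn.add ?_ ?_)
    · exact hA₀.extD.isSmoothFamilyOn_smul (hts.mul (by fun_prop))
    · exact hA₁.extD.isSmoothFamilyOn_smul (hts.mul (by fun_prop))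
  · have : t 0 = 1 := by rw [ht]; simp only; rw [hh0, div_self hc'0, Real.sqrt_one]
    simp [this]
  · have : t 1 = 1 := by rw [ht]; simp only; rw [hh1, div_self hc'0, Real.sqrt_one]
    simp [this]
  · intro u hu
    have e1 : (t u * (1 - u)) • extD I A₀ + (t u * u) • extD I A₁ = t u • extD I (Au u) := by
      rw [hdAu, smul_add, smul_smul, smul_smul]
    have hsq : t u * t u = c' / h u := Real.mul_self_sqrt (hhpos u hu).1.le
    refine ⟨⟨?_, exactFields_combination hB₀e hB₁e _ _⟩, t u • Au u, (hAus u).const_smul _, ?_, ?_, ?_⟩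
    · refine hsub' ?_
      change (t u * (1 - u)) • extD I A₀ + (t u * u) • extD I A₁ ∈ _
      rw [e1]
      have h2 := c1Ball_smul (t := t u) (τ := τ) (fun x => (hK x).2) (hAus u).extD hM (hball u hu)
        ((abs_sqrt_sub_one_le (hhpos u hu).1.le).trans (hhpos u hu).2) hτ1
      exact fun x hx y hy => ⟨(h2 x hx y hy).1.trans (by linarith), (h2 x hx y hy).2.trans (by linarith)⟩
    · rw [extD_smul]
      exact e1.symm
    · intro z hz
      rw [chainIntegral_smul_form,
        HasZeroPeriods.combination hA₀ hA₁ hA₀P hA₁P _ _ z hz, mul_zero]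
    · change formIntegral I μ (wedgeOne (t u • Au u)
        ((t u * (1 - u)) • extD I A₀ + (t u * u) • extD I A₁)) = c'
      rw [e1, wedgeOne_smul_left, wedgeOne_smul_right, smul_smul, formIntegral_smul, hsq]
      exact div_mul_cancel₀ _ (hhne u hu)

end HelicityNear

/-! ### Invariance under isotopy, and concatenation of paths. -/

section Isotopy

variable {E H Q : Type*} [NormedAddCommGroup E] [NormedSpace ℝ E] [TopologicalSpace H]
  {I : ModelWithCorners ℝ E H} [TopologicalSpace Q] [ChartedSpace H Q]

theorem apply_basis_eq_mul_det {n : ℕ} (b : Basis (Fin n) ℝ E) (θ : E [⋀^Fin n]→L[ℝ] ℝ)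
    (v : Fin n → E) : θ v = θ b * b.det v :=
  congrArg (fun f : E [⋀^Fin n]→ₗ[ℝ] ℝ => f v)
    (AlternatingMap.eq_smul_basis_det b θ.toAlternatingMap)

theorem apply_basis_ne_zero {n : ℕ} (b : Basis (Fin n) ℝ E) {θ : E [⋀^Fin n]→L[ℝ] ℝ}
    (h : θ ≠ 0) : θ b ≠ 0 := by
  intro h0
  apply h
  ext v
  rw [apply_basis_eq_mul_det b, h0, zero_mul]
  rfl

theorem eq_div_smul {n : ℕ} (b : Basis (Fin n) ℝ E) {θ : E [⋀^Fin n]→L[ℝ] ℝ} (h : θ ≠ 0)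
    (ξ : E [⋀^Fin n]→L[ℝ] ℝ) : ξ = (ξ b / θ b) • θ := by
  have h0 := apply_basis_ne_zero b h
  ext v
  change ξ v = ξ b / θ b * θ v
  rw [apply_basis_eq_mul_det b ξ, apply_basis_eq_mul_det b θ v]
  field_simp

theorem pullback_apply_ne_zero [IsManifold I ∞ Q] {k : ℕ} (ψ : Diffeomorph I I Q Q ∞)
    {η : Form E Q k} {x : Q} (h : η (ψ x) ≠ 0) : pullback I I ψ η x ≠ 0 := by
  intro h0
  apply h
  have h1 := pullback_pullback (I := I) (I' := I) (I'' := I) (f := ψ.symm) (g := ψ) η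
    (ψ.symm.contMDiff.mdifferentiable (by simp)) (ψ.contMDiff.mdifferentiable (by simp))
  have h2 : (ψ : Q → Q) ∘ ψ.symm = id := by
    ext y
    simp
  rw [h2, pullback_id] at h1
  have h3 := congrFun h1 (ψ x)
  rw [← h3, pullback, ψ.symm_apply_apply, h0]
  rfl

theorem isIsotopicToId_refl : IsIsotopicToId I (Diffeomorph.refl I Q ∞) :=
  ⟨fun _ => Diffeomorph.refl I Q ∞, contMDiffOn_snd, rfl, rfl⟩

theorem contMDiffOn_isotopy_comp {φ : ℝ → Diffeomorph I I Q Q ∞}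
    (hφ : ContMDiffOn (𝓘(ℝ, ℝ).prod I) I ∞ (fun p : ℝ × Q => φ p.1 p.2) (Icc 0 1 ×ˢ univ))
    {g : ℝ → ℝ} (hg : ContDiff ℝ ∞ g) (hm : MapsTo g (Icc 0 1) (Icc 0 1)) :
    ContMDiffOn (𝓘(ℝ, ℝ).prod I) I ∞ (fun p : ℝ × Q => φ (g p.1) p.2) (Icc 0 1 ×ˢ univ) := by
  have h1 : ContMDiff (𝓘(ℝ, ℝ).prod I) (𝓘(ℝ, ℝ).prod I) ∞ (fun p : ℝ × Q => (g p.1, p.2)) :=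
    (hg.contMDiff.comp contMDiff_fst).prodMk contMDiff_snd
  exact hφ.comp h1.contMDiffOn fun p hp => ⟨hm hp.1, mem_univ _⟩

/-- The same isotopy, slowed down to the times `u * s`. -/
theorem isIsotopicToId_of_isotopy {φ : ℝ → Diffeomorph I I Q Q ∞}
    (hφ : ContMDiffOn (𝓘(ℝ, ℝ).prod I) I ∞ (fun p : ℝ × Q => φ p.1 p.2) (Icc 0 1 ×ˢ univ))
    (h0 : φ 0 = Diffeomorph.refl I Q ∞) {u : ℝ} (hu : u ∈ Icc (0 : ℝ) 1) :
    IsIsotopicToId I (φ u) :=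
  ⟨fun s => φ (u * s), contMDiffOn_isotopy_comp hφ (contDiff_const.mul contDiff_id)
    fun _ hs => ⟨mul_nonneg hu.1 hs.1, mul_le_one₀ hu.2 hs.1 hs.2⟩, by simp [h0], by simp⟩

/-- The isotopy is run back from time `1` to time `u` and followed by the fixed map `(φ 1)⁻¹`.
Information at time `1` passes to time `u` without knowing that inverses depend smoothly on the
time. -/
theorem isIsotopicToId_trans_symm {φ : ℝ → Diffeomorph I I Q Q ∞}
    (hφ : ContMDiffOn (𝓘(ℝ, ℝ).prod I) I ∞ (fun p : ℝ × Q => φ p.1 p.2) (Icc 0 1 ×ˢ univ))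
    {u : ℝ} (hu : u ∈ Icc (0 : ℝ) 1) : IsIsotopicToId I ((φ u).trans (φ 1).symm) := by
  refine ⟨fun s => (φ (1 - s * (1 - u))).trans (φ 1).symm, ?_, ?_, by simp⟩
  · have h1 := contMDiffOn_isotopy_comp hφ (g := fun s => 1 - s * (1 - u)) (by fun_prop)
      fun s hs => by
        have h2 : s * (1 - u) ≤ 1 := mul_le_one₀ hs.2 (sub_nonneg.2 hu.2) (by linarith [hu.1])
        have h3 : 0 ≤ s * (1 - u) := mul_nonneg hs.1 (sub_nonneg.2 hu.2)
        exact ⟨by linarith, by linarith⟩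
    exact (φ 1).symm.contMDiff.comp_contMDiffOn h1
  · ext x
    simp

variable [IsManifold I ∞ Q]

/-- Along the isotopy the coefficient of the pulled back volume form is continuous and never zero,
so its sign is that at time `0`. -/
theorem IsIsotopicToId.exists_pullback_eq_smul [FiniteDimensional ℝ E] {n : ℕ}
    [hn : Fact (finrank ℝ E = n)] {ψ : Diffeomorph I I Q Q ∞} (hψ : IsIsotopicToId I ψ)
    {μ : Form E Q n} (hμ : IsVolumeForm I μ) (x : Q) :
    ∃ a : ℝ, 0 < a ∧ pullback I I ψ μ x = a • μ x := by
  obtain ⟨φ, hφ, h0, rfl⟩ := hψ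
  set b := modelBasis E n
  set f : ℝ → ℝ := fun u => pullback I I (φ u) μ x b with hf
  have hne : ∀ u, f u ≠ 0 := fun u =>
    apply_basis_ne_zero b (pullback_apply_ne_zero (φ u) (hμ.2 _))
  have hf0 : f 0 = μ x b := by
    simp only [hf]
    rw [h0]
    exact congrArg (fun θ : Form E Q n => θ x b) (pullback_id μ)
  have hcont : ContinuousOn f (Icc 0 1) := by
    have h1 := (hμ.1.isSmoothFamilyOn_pullback (φ := fun u => φ u) zero_lt_one hφ x).continuousOn
    have h2 : ContinuousOn (fun u : ℝ => inChart I (pullback I I (φ u) μ) x (extChartAt I x x))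
        (Icc 0 1) :=
      h1.comp (f := fun u : ℝ => (u, extChartAt I x x)) (by fun_prop)
        fun u hu => ⟨hu, mem_extChartAt_target x⟩
    have h3 : ContinuousOn (fun u : ℝ => pullback I I (φ u) μ x) (Icc 0 1) :=
      h2.congr fun u _ => (inChart_self _ x).symm
    exact (ContinuousAlternatingMap.apply ℝ E ℝ b).continuous.comp_continuousOn h3
  have hpos : 0 < f 1 / μ x b := by
    rw [← hf0]
    by_contra hle
    have h1 : (0 : ℝ) ∈ uIcc (f 0) (f 1) := by
      rcases lt_or_gt_of_ne (hne 0) with h | h <;> rcases lt_or_gt_of_ne (hne 1) with h' | h'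
      · exact absurd (div_pos_of_neg_of_neg h' h) hle
      · exact mem_uIcc.2 (Or.inl ⟨h.le, h'.le⟩)
      · exact mem_uIcc.2 (Or.inr ⟨h'.le, h.le⟩)
      · exact absurd (div_pos h' h) hle
    obtain ⟨u, -, hu⟩ := intermediate_value_uIcc (a := (0 : ℝ)) (b := 1)
      (by rwa [uIcc_of_le zero_le_one]) h1
    exact hne u hu
  exact ⟨_, hpos, eq_div_smul b (hμ.2 x) _⟩

theorem IsIsotopicToId.chainIntegral_pullback {ψ : Diffeomorph I I Q Q ∞} [FiniteDimensional ℝ E]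
    (hψ : IsIsotopicToId I ψ)
    {A : Form E Q 1} (hA : IsSmoothForm I A) (hB : VanishesOnBoundary I (extD I A))
    {z : Chain Q I 1} (hz : z ∈ chainsIn I (I.boundary Q) 1) (hz0 : bdry Q I 0 z = 0) :
    chainIntegral I (pullback I I ψ A) z = chainIntegral I A z := by
  obtain ⟨φ, hφ, h0, rfl⟩ := hψ
  have h1 := chainIntegral_pullback_eq hA hB (φ := fun u => φ u) hφ
    (fun u _ x hx => by
      rw [← Diffeomorph.preimage_boundary (n := ∞) (by simp) (φ u)] at hx
      exact hx) hz hz0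
  refine h1.trans ?_
  have h2 : pullback I I (φ 0) A = A := by
    rw [h0]
    exact pullback_id A
  exact congrArg (fun θ => chainIntegral I θ z) h2

theorem pullback_mem_exactFields [FiniteDimensional ℝ E] {B : Form E Q 2}
    (hB : B ∈ exactFields Q I) (ψ : Diffeomorph I I Q Q ∞) :
    pullback I I ψ B ∈ exactFields Q I := by
  obtain ⟨hs, ⟨A, hA, hAB⟩, hb⟩ := hB
  exact ⟨hs.pullback ψ.contMDiff, ⟨pullback I I ψ A, hA.pullback ψ.contMDiff, by
    rw [hA.extD_pullback ψ.contMDiff, hAB]⟩, hb.pullback ψ⟩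

/-- By Stokes the flux through a chain is the integral of a primitive over its boundary, a cycle in
`∂Q`, and such integrals do not change under the isotopy. -/
theorem pullback_mem_fluxFiber [FiniteDimensional ℝ E] {Φ : Kappa Q I →ₗ[ℚ] ℝ} {B : Form E Q 2}
    (hB : B ∈ fluxFiber I Φ) {ψ : Diffeomorph I I Q Q ∞} (hψ : IsIsotopicToId I ψ) :
    pullback I I ψ B ∈ fluxFiber I Φ := by
  refine ⟨pullback_mem_exactFields hB.1 ψ, fun z => ?_⟩
  rw [← hB.2 z]
  obtain ⟨⟨-, ⟨A, hA, rfl⟩, hb⟩, -⟩ := hB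
  rw [← hA.extD_pullback ψ.contMDiff, chainIntegral_extD (hA.pullback ψ.contMDiff),
    chainIntegral_extD hA]
  exact hψ.chainIntegral_pullback hA hb z.2.2 (bdry_bdry _)

theorem hasHelicity_pullback [FiniteDimensional ℝ E] [MeasurableSpace E] [BorelSpace E]
    [T2Space Q] [CompactSpace Q] [Fact (finrank ℝ E = 3)] {μ : Form E Q 3}
    (hμ : IsVolumeForm I μ) {P : Submodule ℚ (H1Boundary Q I)} {B : Form E Q 2} {c : ℝ}
    (hb : VanishesOnBoundary I B) (h : HasHelicity I μ P B c) {ψ : Diffeomorph I I Q Q ∞}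
    (hψ : IsIsotopicToId I ψ) : HasHelicity I μ P (pullback I I ψ B) c := by
  obtain ⟨A, hA, rfl, hP, rfl⟩ := h
  refine ⟨pullback I I ψ A, hA.pullback ψ.contMDiff, hA.extD_pullback ψ.contMDiff, fun z hz => ?_,
    ?_⟩
  · rw [← hP z hz]
    exact hψ.chainIntegral_pullback hA hb z.2.1 (bdry_eq_zero_of_mem_relCycles z.2)
  · rw [← pullback_wedgeOne]
    exact formIntegral_pullback hμ (hA.wedgeOne hA.extD) ψ (hψ.exists_pullback_eq_smul hμ)

/-- The concatenation of three smooth paths of forms. -/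
theorem exists_path_of_three {k : ℕ} {β₁ β₂ β₃ : ℝ → Form E Q k} (T : Set (Form E Q k))
    (h₁ : IsSmoothFamilyOn I β₁ 0 1) (h₂ : IsSmoothFamilyOn I β₂ 0 1)
    (h₃ : IsSmoothFamilyOn I β₃ 0 1) (h₁₂ : β₁ 1 = β₂ 0) (h₂₃ : β₂ 1 = β₃ 0)
    (hT₁ : ∀ u ∈ Icc (0 : ℝ) 1, β₁ u ∈ T) (hT₂ : ∀ u ∈ Icc (0 : ℝ) 1, β₂ u ∈ T)
    (hT₃ : ∀ u ∈ Icc (0 : ℝ) 1, β₃ u ∈ T) :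
    ∃ β : ℝ → Form E Q k, IsPiecewiseSmoothPath I β ∧ β 0 = β₁ 0 ∧ β 1 = β₃ 1 ∧
      ∀ u ∈ Icc (0 : ℝ) 1, β u ∈ T := by
  classical
  set β : ℝ → Form E Q k := fun u => if u ≤ 1 / 3 then β₁ (3 * u + 0) else
    if u ≤ 2 / 3 then β₂ (3 * u + -1) else β₃ (3 * u + -2) with hβ
  have e₁ : ∀ u ∈ Icc (0 : ℝ) (1 / 3), β u = β₁ (3 * u + 0) := fun u hu => if_pos hu.2
  have e₂ : ∀ u ∈ Icc (1 / 3 : ℝ) (2 / 3), β u = β₂ (3 * u + -1) := by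
    intro u hu
    rcases hu.1.eq_or_lt with rfl | h
    · rw [e₁ _ ⟨by norm_num, le_rfl⟩]
      norm_num
      exact h₁₂
    · simp only [hβ]
      rw [if_neg (not_le.2 h), if_pos hu.2]
  have e₃ : ∀ u ∈ Icc (2 / 3 : ℝ) 1, β u = β₃ (3 * u + -2) := by
    intro u hu
    rcases hu.1.eq_or_lt with rfl | h
    · rw [e₂ _ ⟨by norm_num, le_rfl⟩]
      norm_num
      exact h₂₃
    · simp only [hβ]
      rw [if_neg (by linarith), if_neg (not_le.2 h)]
  have m₁ : ∀ u ∈ Icc (0 : ℝ) (1 / 3), 3 * u + 0 ∈ Icc (0 : ℝ) 1 := fun u hu =>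
    ⟨by linarith [hu.1], by linarith [hu.2]⟩
  have m₂ : ∀ u ∈ Icc (1 / 3 : ℝ) (2 / 3), 3 * u + -1 ∈ Icc (0 : ℝ) 1 := fun u hu =>
    ⟨by linarith [hu.1], by linarith [hu.2]⟩
  have m₃ : ∀ u ∈ Icc (2 / 3 : ℝ) 1, 3 * u + -2 ∈ Icc (0 : ℝ) 1 := fun u hu =>
    ⟨by linarith [hu.1], by linarith [hu.2]⟩
  refine ⟨β, ⟨3, ![0, 1 / 3, 2 / 3, 1], ?_, rfl, rfl, ?_⟩, ?_, ?_, fun u hu => ?_⟩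
  · refine Fin.strictMono_iff_lt_succ.2 fun i => ?_
    fin_cases i <;> simp <;> norm_num
  · intro i
    fin_cases i
    · exact (h₁.comp_affine m₁).congr e₁
    · exact (h₂.comp_affine m₂).congr e₂
    · exact (h₃.comp_affine m₃).congr e₃
  · rw [e₁ 0 ⟨le_rfl, by norm_num⟩]
    norm_num
  · rw [e₃ 1 ⟨by norm_num, le_rfl⟩]
    norm_num
  · rcases le_total u (1 / 3) with h | h
    · rw [e₁ u ⟨hu.1, h⟩]
      exact hT₁ _ (m₁ u ⟨hu.1, h⟩)
    · rcases le_total u (2 / 3) with h' | h'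
      · rw [e₂ u ⟨h, h'⟩]
        exact hT₂ _ (m₂ u ⟨h, h'⟩)
      · rw [e₃ u ⟨h', hu.2⟩]
        exact hT₃ _ (m₃ u ⟨h', hu.2⟩)

end Isotopy

/-! ### Integrals over chains that lie in the zero set of a form. -/

section Chains

variable {E H Q : Type*} [NormedAddCommGroup E] [NormedSpace ℝ E] [TopologicalSpace H]
  {I : ModelWithCorners ℝ E H} [TopologicalSpace Q] [ChartedSpace H Q]

theorem chainIntegral_eq_zero_of_mem_chainsIn {k : ℕ} {S : Set Q} {η : Form E Q k}
    (h : ∀ x ∈ S, η x = 0) {z : Chain Q I k} (hz : z ∈ chainsIn I S k) :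
    chainIntegral I η z = 0 := by
  refine Finset.sum_eq_zero fun σ hσ => ?_
  have h1 : simplexIntegral I η σ = 0 := by
    rw [simplexIntegral]
    refine (integral_congr_ae (Eventually.of_forall fun t => ?_)).trans (integral_zero _ _)
    have h2 : η (extendSimplex σ.toFun t) = 0 := by
      refine h _ (mem_chainsIn.1 hz σ hσ ?_)
      rw [extendSimplex]
      split_ifs
      exacts [mem_range_self _, mem_range_self _]
    simp only [h2]
    rfl
  change _ * simplexIntegral I η σ = 0
  rw [h1, mul_zero]

end Chains

/-! ### Positive integrals and the correction of helicity along a path. -/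

section Positivity

variable {E : Type} {H Q : Type*} [NormedAddCommGroup E] [NormedSpace ℝ E] [TopologicalSpace H]
  {I : ModelWithCorners ℝ E H} [TopologicalSpace Q] [ChartedSpace H Q] [IsManifold I ∞ Q]
  [FiniteDimensional ℝ E] [MeasurableSpace E] [BorelSpace E] [T2Space Q] [CompactSpace Q]
  {ℓ : E →L[ℝ] ℝ}

/-- The values of `ν` and `μ` on a fixed basis of `E` refer to a chart that changes with the point
and need not be continuous. Their ratio does not depend on the chart, and near `x₀` it is the ratio
of the coefficients in the chart at `x₀`. -/
theorem IsVolumeForm.exists_contMDiff_eq_smul {n : ℕ} [hn : Fact (finrank ℝ E = n)]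
    {μ ν : Form E Q n} (hμ : IsVolumeForm I μ) (hν : IsSmoothForm I ν) :
    ∃ s : Q → ℝ, ContMDiff I 𝓘(ℝ, ℝ) ∞ s ∧ ∀ x, ν x = s x • μ x := by
  set b := modelBasis E n
  set s : Q → ℝ := fun x => ν x b / μ x b
  have hs : ν = fun x => s x • μ x := funext fun x => eq_div_smul b (hμ.2 x) _
  refine ⟨s, fun x₀ => ?_, fun x => congrFun hs x⟩
  have hsm : ∀ θ : Form E Q n, IsSmoothForm I θ →
      ContDiffOn ℝ ∞ (fun y => inChart I θ x₀ y b) (extChartAt I x₀).target := fun θ hθ =>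
    (ContinuousAlternatingMap.apply ℝ E ℝ b).contDiff.comp_contDiffOn (hθ x₀)
  have h1 : ContDiffOn ℝ ∞ (fun y => inChart I ν x₀ y b / inChart I μ x₀ y b)
      (extChartAt I x₀).target :=
    (hsm ν hν).div (hsm μ hμ.1) fun y hy => inChart_basis_ne_zero hμ x₀ b hy
  have h2 : ContMDiffOn I 𝓘(ℝ, ℝ) ∞ ((fun y => inChart I ν x₀ y b / inChart I μ x₀ y b) ∘
      extChartAt I x₀) (chartAt H x₀).source :=
    h1.contMDiffOn.comp contMDiffOn_extChartAt fun x hx =>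
      (extChartAt I x₀).map_source (by rwa [extChartAt_source])
  have h3 := h2.contMDiffAt ((chartAt H x₀).open_source.mem_nhds (mem_chart_source H x₀))
  refine h3.congr_of_eventuallyEq ?_
  filter_upwards [(chartAt H x₀).open_source.mem_nhds (mem_chart_source H x₀)] with x hx
  have hx' : x ∈ (extChartAt I x₀).source := by rwa [extChartAt_source]
  have h4 := inChart_basis_ne_zero hμ x₀ b ((extChartAt I x₀).map_source hx')
  rw [Function.comp_apply, eq_div_iff h4, hs, inChart_fun_smul]
  simp only [(extChartAt I x₀).left_inv hx']
  rfl

/-- The orientation sign turns each integrand into `ρ i * g * |μ(b)| ≥ 0`. At an interior point it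
is nonzero on an open set of coordinates, which has positive measure. -/
theorem formIntegral_pos {n : ℕ} [hn : Fact (finrank ℝ E = n)] {μ ν : Form E Q n}
    (hμ : IsVolumeForm I μ) (hν : IsSmoothForm I ν) {g : Q → ℝ} (hg : ∀ x, 0 ≤ g x)
    (hνg : ∀ x, ν x = g x • μ x) {x : Q} (hx : x ∈ I.interior Q) (hgx : g x ≠ 0) :
    0 < formIntegral I μ ν := by
  have : IsManifold I 1 Q := isManifold_one I
  set b := modelBasis E n with hb
  obtain ⟨s, hs, hsum⟩ := exists_finset_partition (chartPartition Q I)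
  rw [formIntegral_eq_sum μ ν hs]
  have hform : ∀ i y, (SignType.sign (inChart I μ i y b) : ℝ) *
      inChart I (fun x => chartPartition Q I i x • ν x) i y b =
      chartPartition Q I i ((extChartAt I i).symm y) * g ((extChartAt I i).symm y) *
        |inChart I μ i y b| := by
    intro i y
    have h1 : (fun x => chartPartition Q I i x • ν x) =
        fun x => (chartPartition Q I i x * g x) • μ x := by
      ext1 z
      rw [hνg, smul_smul]
    rw [h1, inChart_fun_smul]
    change _ * (_ * inChart I μ i y b) = _
    rw [mul_left_comm, sign_mul_self]
  have hnn : ∀ i y, 0 ≤ (SignType.sign (inChart I μ i y b) : ℝ) *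
      inChart I (fun x => chartPartition Q I i x • ν x) i y b := by
    intro i y
    rw [hform]
    exact mul_nonneg (mul_nonneg ((chartPartition Q I).nonneg i _) (hg _)) (abs_nonneg _)
  obtain ⟨i, hi, hix⟩ : ∃ i ∈ s, chartPartition Q I i x ≠ 0 := by
    by_contra! h
    have := hsum x
    rw [Finset.sum_eq_zero h] at this
    exact zero_ne_one this
  refine Finset.sum_pos' (fun j _ => setIntegral_nonneg (measurableSet_target j)
    fun y _ => hnn j y) ⟨i, hi, ?_⟩
  have hsrc : x ∈ (extChartAt I i).source := tsupport_chartPartition i (subset_tsupport _ hix)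
  have hgi : extChartAt I i x ∈ interior (extChartAt I i).target :=
    (I.isInteriorPoint_iff_of_mem_atlas (n := 1) one_ne_zero (chart_mem_atlas H i)
      (by rwa [extChartAt_source] at hsrc)).1 hx
  rw [chartIntegral, setIntegral_pos_iff_support_of_nonneg_ae (Eventually.of_forall (hnn i))
    (integrableOn_chart hμ hν (chartPartition Q I i).contMDiff.continuous
      (tsupport_chartPartition i))]
  set f : E → ℝ := fun y => inChart I (fun x => chartPartition Q I i x • ν x) i y b
  have hfc : ContinuousOn f (interior (extChartAt I i).target) :=
    ((ContinuousAlternatingMap.apply ℝ E ℝ b).continuous.comp_continuousOn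
      ((hν.fun_smul (chartPartition Q I i).contMDiff) i).continuousOn).mono interior_subset
  have hopen : IsOpen (interior (extChartAt I i).target ∩ f ⁻¹' {0}ᶜ) :=
    hfc.isOpen_inter_preimage isOpen_interior isOpen_compl_singleton
  have hval : ∀ y ∈ (extChartAt I i).target, f y ≠ 0 →
      (SignType.sign (inChart I μ i y b) : ℝ) * f y ≠ 0 := by
    intro y hy hfy
    refine mul_ne_zero ?_ hfy
    have h1 := inChart_basis_ne_zero hμ i b hy
    rcases lt_or_gt_of_ne h1 with h | h
    · rw [sign_neg h]; simp
    · rw [sign_pos h]; simp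
  have hmem : extChartAt I i x ∈ interior (extChartAt I i).target ∩ f ⁻¹' {0}ᶜ := by
    refine ⟨hgi, fun h0 => ?_⟩
    have h1 := hform i (extChartAt I i x)
    change _ * f (extChartAt I i x) = _ at h1
    rw [show f (extChartAt I i x) = 0 from h0, mul_zero, (extChartAt I i).left_inv hsrc] at h1
    have h2 := inChart_basis_ne_zero hμ i b (interior_subset hgi)
    exact mul_ne_zero (mul_ne_zero hix hgx) (abs_ne_zero.2 h2) h1.symm
  refine (hopen.measure_pos b.addHaar ⟨_, hmem⟩).trans_le (measure_mono ?_)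
  exact fun y hy => ⟨hval y (interior_subset hy.1) hy.2, interior_subset hy.1⟩

/-- From any point a short move in a direction with `ℓ v > 0` leads into the interior. -/
theorem IsHalfSpaceModel.nonempty_interior (hI : IsHalfSpaceModel I ℓ) [Nonempty Q] :
    (I.interior Q).Nonempty := by
  obtain ⟨x⟩ := ‹Nonempty Q›
  obtain ⟨v, hv⟩ : ∃ v, 0 < ℓ v := by
    obtain ⟨w, hw⟩ : ∃ w, ℓ w ≠ 0 := by
      by_contra! h
      exact hI.ne_zero (ContinuousLinearMap.ext h)
    rcases lt_or_gt_of_ne hw with h | h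
    · exact ⟨-w, by simpa using h⟩
    · exact ⟨w, h⟩
  have h0 : 0 ≤ ℓ (extChartAt I x x) := hI.mem_range.1 (extChartAt_mem_range x x)
  have hc : ContinuousAt (fun t : ℝ => extChartAt I x x + t • v) 0 := by fun_prop
  have hc' : Tendsto (fun t : ℝ => extChartAt I x x + t • v) (𝓝[>] 0)
      (𝓝[range I] (extChartAt I x x)) := by
    refine tendsto_nhdsWithin_iff.2 ⟨?_, ?_⟩
    · have := hc.tendsto.mono_left (nhdsWithin_le_nhds (s := Ioi 0))
      simpa using this
    · filter_upwards [self_mem_nhdsWithin] with t ht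
      rw [hI.mem_range, map_add, map_smul]
      exact add_nonneg h0 (mul_nonneg (le_of_lt ht) hv.le)
  obtain ⟨t, ht, ht0⟩ := ((hc'.eventually (extChartAt_target_mem_nhdsWithin x)).and
    self_mem_nhdsWithin).exists
  refine ⟨(extChartAt I x).symm (extChartAt I x x + t • v), ?_⟩
  rw [← I.compl_boundary, mem_compl_iff, hI.mem_boundary_symm_iff x ht, map_add, map_smul]
  exact (add_pos_of_nonneg_of_pos h0 (mul_pos ht0 hv)).ne'

/-- A function, zero on the boundary, that carries `ν` to a nonnegative multiple of `μ`. -/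
theorem exists_cutoff (hI : IsHalfSpaceModel I ℓ) [Nonempty Q] {n : ℕ}
    [hn : Fact (finrank ℝ E = n)] {μ ν : Form E Q n} (hμ : IsVolumeForm I μ)
    (hν : IsVolumeForm I ν) :
    ∃ G g : Q → ℝ, ContMDiff I 𝓘(ℝ, ℝ) ∞ G ∧ (∀ x ∈ I.boundary Q, G x = 0) ∧ (∀ x, 0 ≤ g x) ∧
      (∀ x, G x • ν x = g x • μ x) ∧ ∃ x ∈ I.interior Q, g x ≠ 0 := by
  have : IsManifold I 1 Q := isManifold_one I
  obtain ⟨s, hs, hsν⟩ := hμ.exists_contMDiff_eq_smul hν.1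
  obtain ⟨f, hf, hfs, hf0⟩ := (I.isOpen_interior (M := Q) (n := 1) one_ne_zero
    ).exists_contMDiff_support_eq I (n := ⊤)
  obtain ⟨x, hx⟩ := hI.nonempty_interior (Q := Q)
  -- With `ν = s μ` and `f ≥ 0` supported exactly on the interior, `G = f s` gives `G ν = f s² μ`;
  -- the square makes the sign of `s`, which is not known, irrelevant.
  refine ⟨fun x => f x * s x, fun x => f x * s x ^ 2, hfs.mul hs, fun y hy => ?_,
    fun y => mul_nonneg (hf0 y) (sq_nonneg _), fun y => ?_, x, hx, ?_⟩
  · have h1 : y ∉ Function.support f := by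
      rw [hf, ← mem_compl_iff, I.compl_interior]
      exact hy
    change f y * s y = 0
    rw [Function.notMem_support.1 h1, zero_mul]
  · change (f y * s y) • ν y = (f y * s y ^ 2) • μ y
    rw [hsν, smul_smul, mul_assoc, sq]
  · have h1 : f x ≠ 0 := by
      rw [← Function.mem_support, hf]
      exact hx
    refine mul_ne_zero h1 (pow_ne_zero _ fun h0 => hν.2 x ?_)
    rw [hsν, h0]
    exact zero_smul ℝ (μ x)

/-- A path of primitives with constant helicity between two primitives with the same helicity. -/
theorem exists_corrected_path (hI : IsHalfSpaceModel I ℓ) [hn : Fact (finrank ℝ E = 3)]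
    {μ : Form E Q 3} (hμ : IsVolumeForm I μ) {P : Submodule ℚ (H1Boundary Q I)} {c : ℝ}
    {A₀ A₁ κ : Form E Q 1} (hA₀ : IsSmoothForm I A₀) (hA₁ : IsSmoothForm I A₁)
    (hκ : IsSmoothForm I κ) (hP₀ : HasZeroPeriods I P A₀) (hP₁ : HasZeroPeriods I P A₁)
    (h₀ : formIntegral I μ (wedgeOne A₀ (extD I A₀)) = c)
    (h₁ : formIntegral I μ (wedgeOne A₁ (extD I A₁)) = c)
    (hκb : ∀ x ∈ I.boundary Q, κ x = 0) (hκκ : wedgeOne κ (extD I κ) = 0)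
    (hp₀ : 0 < formIntegral I μ (wedgeOne κ (extD I A₀)))
    (hp₁ : 0 < formIntegral I μ (wedgeOne κ (extD I A₁))) :
    ∃ k : ℝ → ℝ, ContDiffOn ℝ ∞ k (Icc 0 1) ∧ k 0 = 0 ∧ k 1 = 0 ∧ ∀ u ∈ Icc (0 : ℝ) 1,
      HasHelicity I μ P ((1 - u) • extD I A₀ + u • extD I A₁ + k u • extD I κ) c := by
  set p₀ := formIntegral I μ (wedgeOne κ (extD I A₀))
  set p₁ := formIntegral I μ (wedgeOne κ (extD I A₁))
  set m := formIntegral I μ (wedgeOne A₀ (extD I A₁)) + formIntegral I μ (wedgeOne A₁ (extD I A₀))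
  set p : ℝ → ℝ := fun u => (1 - u) * p₀ + u * p₁ with hp
  set q : ℝ → ℝ := fun u => (1 - u) ^ 2 * c + (1 - u) * u * m + u ^ 2 * c with hq
  have hpos : ∀ u ∈ Icc (0 : ℝ) 1, 0 < p u := by
    intro u hu
    rcases hu.1.eq_or_lt with rfl | h
    · simpa [hp] using hp₀
    · exact add_pos_of_nonneg_of_pos (mul_nonneg (sub_nonneg.2 hu.2) hp₀.le) (mul_pos h hp₁)
  have hκv : VanishesOnBoundary I κ := fun x hx v _ => by
    rw [hκb x hx]
    rfl
  have hPκ : HasZeroPeriods I P κ := fun z _ =>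
    chainIntegral_eq_zero_of_mem_chainsIn hκb z.2.1
  -- At `(1 - u) A₀ + u A₁ + k κ` the helicity is `q u + 2 k (p u)`, without a term in `k²` because
  -- `κ ∧ dκ = 0`. Equating it to `c` determines `k`, which vanishes at the ends because `q 0 = q 1
  -- = c`.
  refine ⟨fun u => (c - q u) / (2 * p u), ?_, by simp [hq], by simp [hq], fun u hu => ?_⟩
  · refine ContDiffOn.div (by fun_prop) (by fun_prop) fun u hu => ?_
    have := hpos u hu
    positivity
  · set k := (c - q u) / (2 * p u) with hk
    have hĀ : IsSmoothForm I ((1 - u) • A₀ + u • A₁) := (hA₀.const_smul _).add (hA₁.const_smul _)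
    have hdĀ : extD I ((1 - u) • A₀ + u • A₁) = (1 - u) • extD I A₀ + u • extD I A₁ := by
      rw [extD_add (hA₀.const_smul _) (hA₁.const_smul _), extD_smul, extD_smul]
    refine ⟨(1 : ℝ) • ((1 - u) • A₀ + u • A₁) + k • κ,
      (hĀ.const_smul _).add (hκ.const_smul _), ?_, HasZeroPeriods.combination hĀ hκ
        (HasZeroPeriods.combination hA₀ hA₁ hP₀ hP₁ _ _) hPκ _ _, ?_⟩
    · rw [extD_add (hĀ.const_smul _) (hκ.const_smul _), extD_smul, extD_smul, hdĀ, one_smul]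
    · have e1 : (1 - u) • extD I A₀ + u • extD I A₁ + k • extD I κ =
          (1 : ℝ) • ((1 - u) • extD I A₀ + u • extD I A₁) + k • extD I κ := by rw [one_smul]
      rw [e1, formIntegral_wedgeOne_combination hμ hĀ hκ
        ((hA₀.extD.const_smul _).add (hA₁.extD.const_smul _)) hκ.extD,
        formIntegral_wedgeOne_combination hμ hA₀ hA₁ hA₀.extD hA₁.extD, hκκ, h₀, h₁]
      have e2 : formIntegral I μ (wedgeOne κ ((1 - u) • extD I A₀ + u • extD I A₁)) = p u := by
        rw [wedgeOne_add_right, wedgeOne_smul_right, wedgeOne_smul_right,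
          formIntegral_add hμ ((hκ.wedgeOne hA₀.extD).const_smul _)
            ((hκ.wedgeOne hA₁.extD).const_smul _), formIntegral_smul, formIntegral_smul]
      -- The two mixed terms are equal by Stokes, as `κ` vanishes on the boundary.
      have e3 : formIntegral I μ (wedgeOne ((1 - u) • A₀ + u • A₁) (extD I κ)) = p u := by
        have h2 := formIntegral_extD_eq_zero hI hμ (hĀ.wedgeOne hκ) (hκv.wedgeOne_right _)
        rw [extD_wedgeOne hĀ hκ, formIntegral_sub hμ (hκ.wedgeOne hĀ.extD)
          (hĀ.wedgeOne hκ.extD), hdĀ, e2] at h2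
        linarith
      have e4 : formIntegral I μ (0 : Form E Q 3) = 0 := by
        have := formIntegral_smul (I := I) (0 : ℝ) μ μ
        rw [zero_mul] at this
        rw [← this]
        congr 1
        ext x v
        simp
      have e5 : k * (2 * p u) = c - q u := by
        have := hpos u hu
        rw [hk]
        field_simp
      rw [e2, e3, e4]
      change (1 : ℝ) ^ 2 * q u + 1 * k * (p u + p u) + k ^ 2 * 0 = c
      linear_combination e5

end Positivity

/-! ### The form `dt` on the circle. -/

section Circle

theorem isSmoothForm_of_contDiff {F : Type*} [NormedAddCommGroup F] [NormedSpace ℝ F] {k : ℕ}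
    {η : Form F F k} (hη : ContDiff ℝ ∞ η) : IsSmoothForm 𝓘(ℝ, F) η := by
  intro x₀
  have h0 : ⇑(extChartAt 𝓘(ℝ, F) x₀).symm = id := by
    rw [extChartAt_model_space_eq_id]
    rfl
  have h : inChart 𝓘(ℝ, F) η x₀ = η := by
    ext y v
    have h1 : mfderivWithin 𝓘(ℝ, F) 𝓘(ℝ, F) (extChartAt 𝓘(ℝ, F) x₀).symm (range 𝓘(ℝ, F)) y =
        ContinuousLinearMap.id ℝ F := by
      rw [modelWithCornersSelf_coe, range_id, mfderivWithin_univ, h0]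
      exact mfderiv_id
    rw [inChart, h1, h0]
    rfl
  rw [h]
  exact hη.contDiffOn

/-- The form `dθ / 2π` on the unit circle, extended to the plane. -/
def angleForm : Form ℂ ℂ 1 := fun z =>
  ofCovector ((2 * Real.pi)⁻¹ • (Complex.imCLM.comp
    (ContinuousLinearMap.mul ℝ ℂ (starRingEnd ℂ z))))

theorem isSmoothForm_angleForm : IsSmoothForm 𝓘(ℝ, ℂ) angleForm := by
  refine isSmoothForm_of_contDiff ?_
  have h1 : ContDiff ℝ ∞ fun z : ℂ => ContinuousLinearMap.mul ℝ ℂ (starRingEnd ℂ z) :=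
    (ContinuousLinearMap.mul ℝ ℂ).contDiff.comp Complex.conjCLE.contDiff
  have h2 : ContDiff ℝ ∞ fun z : ℂ => (2 * Real.pi)⁻¹ • (Complex.imCLM.comp
      (ContinuousLinearMap.mul ℝ ℂ (starRingEnd ℂ z))) :=
    (contDiff_const.clm_comp h1).const_smul _
  exact (ContinuousAlternatingMap.ofSubsingletonLIE (0 : Fin 1) :
    (ℂ →L[ℝ] ℝ) ≃ₗᵢ[ℝ] ℂ [⋀^Fin 1]→L[ℝ] ℝ).contDiff.comp h2

theorem contMDiff_coe_circle : ContMDiff (𝓡 1) 𝓘(ℝ, ℂ) ∞ (fun w : Circle => (w : ℂ)) := by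
  have : Fact (finrank ℝ ℂ = 1 + 1) := Complex.finrank_real_complex_fact
  exact contMDiff_coe_sphere

theorem circleForm_eq_pullback :
    circleForm = pullback (𝓡 1) 𝓘(ℝ, ℂ) (fun w : Circle => (w : ℂ)) angleForm := by
  ext z v
  rfl

theorem isSmoothForm_circleForm : IsSmoothForm (𝓡 1) circleForm := by
  rw [circleForm_eq_pullback]
  exact isSmoothForm_angleForm.pullback contMDiff_coe_circle

theorem eq_zero_of_finrank_lt {F : Type*} [NormedAddCommGroup F] [NormedSpace ℝ F]
    [FiniteDimensional ℝ F] {k : ℕ} (h : finrank ℝ F < k) (θ : F [⋀^Fin k]→L[ℝ] ℝ) : θ = 0 := by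
  ext v
  refine θ.toAlternatingMap.map_linearDependent v fun hv => ?_
  have := hv.fintype_card_le_finrank
  rw [Fintype.card_fin] at this
  omega

theorem extD_circleForm : extD (𝓡 1) circleForm = 0 :=
  funext fun _ => eq_zero_of_finrank_lt (by simp) _

/-- The vector `iz` is tangent to the circle at `z`, and the form takes the value `1 / 2π` on it. -/
theorem exists_circleForm_ne_zero (z : Circle) :
    ∃ e : EuclideanSpace ℝ (Fin 1), circleForm z (fun _ => e) ≠ 0 := by
  have : Fact (finrank ℝ ℂ = 1 + 1) := Complex.finrank_real_complex_fact
  set L : EuclideanSpace ℝ (Fin 1) →L[ℝ] ℂ :=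
    mfderiv (𝓡 1) 𝓘(ℝ, ℂ) (fun w : Circle => (w : ℂ)) z with hL
  have h1 : L.range = (Submodule.span ℝ {(z : ℂ)})ᗮ :=
    range_mvfderiv_subtypeVal (E := ℂ) (n := 1) z
  have hz : starRingEnd ℂ (z : ℂ) * (z : ℂ) = 1 := by
    rw [← Complex.normSq_eq_conj_mul_self, Circle.normSq_coe]
    simp
  have h2 : Complex.I * (z : ℂ) ∈ (Submodule.span ℝ {(z : ℂ)})ᗮ := by
    rw [Submodule.mem_orthogonal_singleton_iff_inner_right, Complex.inner, mul_assoc,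
      mul_comm (z : ℂ), hz]
    simp
  rw [← h1] at h2
  obtain ⟨e, he⟩ := h2
  refine ⟨e, ?_⟩
  have h5 : circleForm z (fun _ => e) = (2 * Real.pi)⁻¹ * (starRingEnd ℂ (z : ℂ) * L e).im := rfl
  have h6 : L e = Complex.I * z := he
  rw [h5, h6, mul_left_comm, hz]
  simp [Real.pi_ne_zero]

end Circle

/-! ### Two identities for exterior products. -/

section Wedge

variable {E Q : Type*} [NormedAddCommGroup E] [NormedSpace ℝ E]

/-- With `α = dt` it serves twice: `dt ∧ dF ∧ dt = 0` removes `F` from `dt ∧ B_{η,F}`, and `dt ∧ dG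
∧ dt = 0` gives `κ ∧ dκ = 0` for `κ = G dt`. -/
theorem wedgeOne_wedgeOne_self (α β : Form E Q 1) : wedgeOne α (wedgeOne β α) = 0 := by
  ext x v
  change wedgeForm (α x) (wedgeForm (β x) (α x)) v = 0
  rw [wedgeForm_two_apply, wedgeForm_one_apply, wedgeForm_one_apply, wedgeForm_one_apply]
  simp only [Matrix.cons_val_zero, Matrix.cons_val_one]
  ring

theorem wedgeOne_fun_smul_left {k : ℕ} (f : Q → ℝ) (α : Form E Q 1) (η : Form E Q k) :
    wedgeOne (fun x => f x • α x) η = fun x => f x • wedgeOne α η x := by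
  ext1 x
  exact (wedgeCLM E k).map_smul₂ (f x) (α x) (η x)

end Wedge

/-! ### Forms on the product of a surface with the circle. -/

section Product

variable {M : Type*} [TopologicalSpace M] [ChartedSpace (EuclideanHalfSpace 2) M]
  [IsManifold (𝓡∂ 2) ∞ M]

variable (M) in
/-- The form `dt` on `M × S^1`. -/
def dCircle : Form (EuclideanSpace ℝ (Fin 2) × EuclideanSpace ℝ (Fin 1)) (M × Circle) 1 :=
  pullback prodModel (𝓡 1) Prod.snd circleForm

theorem isSmoothForm_dCircle : IsSmoothForm prodModel (dCircle M) :=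
  isSmoothForm_circleForm.pullback contMDiff_snd

theorem extD_dCircle : extD prodModel (dCircle M) = 0 := by
  rw [dCircle, isSmoothForm_circleForm.extD_pullback contMDiff_snd, extD_circleForm]
  rfl

theorem pullback_fst_apply {k : ℕ} (η : Form (EuclideanSpace ℝ (Fin 2)) M k) (x : M × Circle)
    (v : Fin k → EuclideanSpace ℝ (Fin 2) × EuclideanSpace ℝ (Fin 1)) :
    pullback prodModel (𝓡∂ 2) Prod.fst η x v = η x.1 fun i => (v i).1 := by
  have h := mfderiv_fst (I := 𝓡∂ 2) (I' := 𝓡 1) (x := x)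
  have h1 : ∀ w : EuclideanSpace ℝ (Fin 2) × EuclideanSpace ℝ (Fin 1),
      (mfderiv prodModel (𝓡∂ 2) (Prod.fst : M × Circle → M) x :
        EuclideanSpace ℝ (Fin 2) × EuclideanSpace ℝ (Fin 1) →L[ℝ] EuclideanSpace ℝ (Fin 2)) w =
        w.1 := fun w => congrArg (fun L : EuclideanSpace ℝ (Fin 2) × EuclideanSpace ℝ (Fin 1) →L[ℝ]
          EuclideanSpace ℝ (Fin 2) => L w) h
  exact congrArg (η x.1) (funext fun i => h1 (v i))

theorem dCircle_apply (x : M × Circle)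
    (v : Fin 1 → EuclideanSpace ℝ (Fin 2) × EuclideanSpace ℝ (Fin 1)) :
    dCircle M x v = circleForm x.2 fun i => (v i).2 := by
  have h := mfderiv_snd (I := 𝓡∂ 2) (I' := 𝓡 1) (x := x)
  have h1 : ∀ w : EuclideanSpace ℝ (Fin 2) × EuclideanSpace ℝ (Fin 1),
      (mfderiv prodModel (𝓡 1) (Prod.snd : M × Circle → Circle) x :
        EuclideanSpace ℝ (Fin 2) × EuclideanSpace ℝ (Fin 1) →L[ℝ] EuclideanSpace ℝ (Fin 1)) w =
        w.2 := fun w => congrArg (fun L : EuclideanSpace ℝ (Fin 2) × EuclideanSpace ℝ (Fin 1) →L[ℝ]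
          EuclideanSpace ℝ (Fin 1) => L w) h
  exact congrArg (circleForm x.2) (funext fun i => h1 (v i))

theorem dCircle_apply_eq_zero (x : M × Circle) (v : EuclideanSpace ℝ (Fin 2)) :
    dCircle M x (fun _ => (v, 0)) = 0 := by
  rw [dCircle_apply]
  exact (circleForm x.2).map_coord_zero (0 : Fin 1) rfl

theorem exists_apply_ne_zero {k : ℕ} {F : Type*} [NormedAddCommGroup F] [NormedSpace ℝ F]
    {θ : F [⋀^Fin k]→L[ℝ] ℝ} (h : θ ≠ 0) : ∃ v, θ v ≠ 0 := by
  by_contra! h0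
  exact h (ContinuousAlternatingMap.ext h0)

/-- On vectors tangent to `M` the form `dt` vanishes, so only `η` is seen. -/
theorem suspensionForm_apply_ne_zero {η : Form (EuclideanSpace ℝ (Fin 2)) M 2}
    (F : M × Circle → ℝ) {x : M × Circle} (h : η x.1 ≠ 0) : suspensionForm η F x ≠ 0 := by
  obtain ⟨v, hv⟩ := exists_apply_ne_zero h
  intro h0
  have h1 : suspensionForm η F x (fun i => (v i, 0)) = 0 := by
    rw [h0]
    rfl
  have h2 : suspensionForm η F x (fun i => (v i, 0)) =
      pullback prodModel (𝓡∂ 2) Prod.fst η x (fun i => (v i, 0)) -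
        wedgeForm (differential prodModel F x) (dCircle M x) (fun i => (v i, 0)) := rfl
  rw [h2, pullback_fst_apply, wedgeForm_one_apply, dCircle_apply_eq_zero, dCircle_apply_eq_zero] at h1
  apply hv
  simpa using h1

/-- The volume form `dt ∧ τ` on `M × S^1`. -/
theorem isVolumeForm_dCircle_wedge {τ : Form (EuclideanSpace ℝ (Fin 2)) M 2}
    (hτ : IsVolumeForm (𝓡∂ 2) τ) :
    IsVolumeForm prodModel (wedgeOne (dCircle M) (pullback prodModel (𝓡∂ 2) Prod.fst τ)) := by
  refine ⟨isSmoothForm_dCircle.wedgeOne (hτ.1.pullback contMDiff_fst), fun x h0 => ?_⟩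
  obtain ⟨v, hv⟩ := exists_apply_ne_zero (hτ.2 x.1)
  obtain ⟨e, he⟩ := exists_circleForm_ne_zero x.2
  set w : Fin 3 → EuclideanSpace ℝ (Fin 2) × EuclideanSpace ℝ (Fin 1) :=
    ![(0, e), (v 0, 0), (v 1, 0)] with hw
  have h1 : wedgeForm (dCircle M x) (pullback prodModel (𝓡∂ 2) Prod.fst τ x) w = 0 :=
    congrArg (fun θ : (EuclideanSpace ℝ (Fin 2) × EuclideanSpace ℝ (Fin 1)) [⋀^Fin 3]→L[ℝ] ℝ =>
      θ w) h0
  rw [wedgeForm_two_apply] at h1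
  have e1 : dCircle M x (fun _ => w 1) = 0 := dCircle_apply_eq_zero x (v 0)
  have e2 : dCircle M x (fun _ => w 2) = 0 := dCircle_apply_eq_zero x (v 1)
  have e0 : dCircle M x (fun _ => w 0) = circleForm x.2 (fun _ => e) := dCircle_apply x _
  have e3 : pullback prodModel (𝓡∂ 2) Prod.fst τ x ![w 1, w 2] = τ x.1 v := by
    rw [pullback_fst_apply]
    congr 1
    ext1 i
    fin_cases i <;> rfl
  rw [e0, e1, e2, e3, zero_mul, zero_mul, sub_zero, add_zero] at h1
  exact mul_ne_zero he hv h1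

theorem wedgeOne_dCircle_suspensionForm (η : Form (EuclideanSpace ℝ (Fin 2)) M 2)
    (F : M × Circle → ℝ) : wedgeOne (dCircle M) (suspensionForm η F) =
      wedgeOne (dCircle M) (pullback prodModel (𝓡∂ 2) Prod.fst η) := by
  rw [suspensionForm, wedgeOne_sub_right]
  change _ - wedgeOne (dCircle M) (wedgeOne _ (dCircle M)) = _
  rw [wedgeOne_wedgeOne_self, sub_zero]

theorem isSmoothForm_suspensionForm {η : Form (EuclideanSpace ℝ (Fin 2)) M 2}
    (hη : IsSmoothForm (𝓡∂ 2) η) {F : M × Circle → ℝ} (hF : ContMDiff prodModel 𝓘(ℝ, ℝ) ∞ F) :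
    IsSmoothForm prodModel (suspensionForm η F) :=
  (hη.pullback contMDiff_fst).sub ((isSmoothForm_differential hF).wedgeOne isSmoothForm_dCircle)

theorem differential_combination {E H Q : Type*} [NormedAddCommGroup E] [NormedSpace ℝ E]
    [TopologicalSpace H] {I : ModelWithCorners ℝ E H} [TopologicalSpace Q] [ChartedSpace H Q]
    {f g h : Q → ℝ} (hf : ContMDiff I 𝓘(ℝ, ℝ) ∞ f) (hg : ContMDiff I 𝓘(ℝ, ℝ) ∞ g)
    (hh : ContMDiff I 𝓘(ℝ, ℝ) ∞ h) (a b c : ℝ) :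
    differential I (a • f + b • g - c • h) =
      a • differential I f + b • differential I g - c • differential I h := by
  ext1 x
  have hf' := (hf.mdifferentiable (by simp) x).hasMFDerivAt.const_smul a
  have hg' := (hg.mdifferentiable (by simp) x).hasMFDerivAt.const_smul b
  have hh' := (hh.mdifferentiable (by simp) x).hasMFDerivAt.const_smul c
  rw [HasMFDerivAt.differential_eq ((hf'.add hg').sub hh')]
  rfl

/-- Adding a multiple of `dG ∧ dt` is a change of the function, so the corrected path stays among
suspension forms. The minus sign of `k • G` cancels the one in `-dF ∧ dt`. -/
theorem suspensionForm_combination (η₀ η₁ : Form (EuclideanSpace ℝ (Fin 2)) M 2)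
    {F₀ F₁ G : M × Circle → ℝ} (hF₀ : ContMDiff prodModel 𝓘(ℝ, ℝ) ∞ F₀)
    (hF₁ : ContMDiff prodModel 𝓘(ℝ, ℝ) ∞ F₁) (hG : ContMDiff prodModel 𝓘(ℝ, ℝ) ∞ G) (a b k : ℝ) :
    suspensionForm (a • η₀ + b • η₁) (a • F₀ + b • F₁ - k • G) =
      a • suspensionForm η₀ F₀ + b • suspensionForm η₁ F₁ +
        k • wedgeOne (differential prodModel G) (dCircle M) := by
  simp only [suspensionForm]
  rw [differential_combination hF₀ hF₁ hG, pullback_add, pullback_smul, pullback_smul,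
    wedgeOne_sub_left, wedgeOne_add_left, wedgeOne_smul_left, wedgeOne_smul_left,
    wedgeOne_smul_left]
  change _ = _ + k • wedgeOne (differential prodModel G) (pullback prodModel (𝓡 1) Prod.snd circleForm)
  ext x v
  simp only [Pi.add_apply, Pi.sub_apply, Pi.smul_apply, ContinuousAlternatingMap.add_apply,
    ContinuousAlternatingMap.sub_apply, ContinuousAlternatingMap.smul_apply, smul_eq_mul]
  ring

end Product

/-! ### The two models used are half-spaces. -/

section HalfSpace

theorem isHalfSpaceModel_euclidean (n : ℕ) [NeZero n] :
    IsHalfSpaceModel (𝓡∂ n) (EuclideanSpace.proj (0 : Fin n) : EuclideanSpace ℝ (Fin n) →L[ℝ] ℝ) where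
  ne_zero h := by
    have := congrArg (fun L : EuclideanSpace ℝ (Fin n) →L[ℝ] ℝ =>
      L (EuclideanSpace.single 0 1)) h
    simp at this
  range_eq := range_modelWithCornersEuclideanHalfSpace n

theorem isHalfSpaceModel_prodModel : IsHalfSpaceModel prodModel
    ((EuclideanSpace.proj (0 : Fin 2) : EuclideanSpace ℝ (Fin 2) →L[ℝ] ℝ).comp
      (ContinuousLinearMap.fst ℝ (EuclideanSpace ℝ (Fin 2)) (EuclideanSpace ℝ (Fin 1)))) where
  ne_zero h := by
    have := congrArg (fun L : EuclideanSpace ℝ (Fin 2) × EuclideanSpace ℝ (Fin 1) →L[ℝ] ℝ =>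
      L (EuclideanSpace.single 0 1, 0)) h
    simp at this
  range_eq := by
    rw [modelWithCorners_prod_coe, range_prodMap, range_modelWithCornersEuclideanHalfSpace]
    ext y
    simp

end HalfSpace

/-! ### Suspension forms and part (B). -/

section Suspension

variable {E H Q : Type*} [NormedAddCommGroup E] [NormedSpace ℝ E] [TopologicalSpace H]
  {I : ModelWithCorners ℝ E H} [TopologicalSpace Q] [ChartedSpace H Q] [IsManifold I ∞ Q]

variable (Q I) in
/-- The set of exact fields, or one of the fibres of the flux. -/
def IsFluxClass (B' : Set (Form E Q 2)) : Prop :=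
  (∃ Φ : Kappa Q I →ₗ[ℚ] ℝ, B' = fluxFiber I Φ) ∨ B' = exactFields Q I

theorem IsFluxClass.subset {B' : Set (Form E Q 2)} (h : IsFluxClass Q I B') :
    B' ⊆ exactFields Q I := by
  rcases h with ⟨Φ, rfl⟩ | rfl
  exacts [fun _ hB => hB.1, subset_rfl]

theorem IsFluxClass.pullback_mem [FiniteDimensional ℝ E] {B' : Set (Form E Q 2)}
    (h : IsFluxClass Q I B') {B : Form E Q 2} (hB : B ∈ B') {ψ : Diffeomorph I I Q Q ∞}
    (hψ : IsIsotopicToId I ψ) : pullback I I ψ B ∈ B' := by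
  rcases h with ⟨Φ, rfl⟩ | rfl
  exacts [pullback_mem_fluxFiber hB hψ, pullback_mem_exactFields hB ψ]

/-- The flux is linear in the field and the weights `1 - u` and `u` add up to `1`. The term `dκ` has
no flux, because `κ` vanishes on the boundary, where the boundary of a flux chain lies. -/
theorem IsFluxClass.combination_mem {B' : Set (Form E Q 2)} (h : IsFluxClass Q I B')
    {A₀ A₁ κ : Form E Q 1} (hA₀ : IsSmoothForm I A₀) (hA₁ : IsSmoothForm I A₁)
    (hκ : IsSmoothForm I κ) (h₀ : extD I A₀ ∈ B') (h₁ : extD I A₁ ∈ B')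
    (hκb : ∀ x ∈ I.boundary Q, κ x = 0) (hdκ : VanishesOnBoundary I (extD I κ)) (u k : ℝ) :
    (1 - u) • extD I A₀ + u • extD I A₁ + k • extD I κ ∈ B' := by
  have hĀ : IsSmoothForm I ((1 - u) • A₀ + u • A₁) := (hA₀.const_smul _).add (hA₁.const_smul _)
  have hd : extD I ((1 - u) • A₀ + u • A₁ + k • κ) =
      (1 - u) • extD I A₀ + u • extD I A₁ + k • extD I κ := by
    rw [extD_add hĀ (hκ.const_smul _), extD_add (hA₀.const_smul _) (hA₁.const_smul _), extD_smul,
      extD_smul, extD_smul]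
  have hex : (1 - u) • extD I A₀ + u • extD I A₁ + k • extD I κ ∈ exactFields Q I := by
    refine ⟨?_, ⟨_, hĀ.add (hκ.const_smul k), hd⟩, (((h.subset h₀).2.2.const_smul _).add
      ((h.subset h₁).2.2.const_smul _)).add (hdκ.const_smul _)⟩
    rw [← hd]
    exact (hĀ.add (hκ.const_smul k)).extD
  rcases h with ⟨Φ, rfl⟩ | rfl
  · refine ⟨hex, fun z => ?_⟩
    have e₀ := h₀.2 z
    have e₁ := h₁.2 z
    rw [chainIntegral_extD hA₀] at e₀
    rw [chainIntegral_extD hA₁] at e₁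
    rw [← hd, chainIntegral_extD (hĀ.add (hκ.const_smul k)),
      chainIntegral_add_form hĀ (hκ.const_smul k),
      chainIntegral_add_form (hA₀.const_smul _) (hA₁.const_smul _), chainIntegral_smul_form,
      chainIntegral_smul_form, chainIntegral_smul_form, e₀, e₁,
      chainIntegral_eq_zero_of_mem_chainsIn hκb (show bdry Q I 1 z ∈ _ from z.2.2)]
    ring
  · exact hex

/-- A tangent vector of the boundary is the velocity of a curve in the boundary, along which `f` is
constant. -/
theorem vanishesOnBoundary_differential {f : Q → ℝ} (hf : ContMDiff I 𝓘(ℝ, ℝ) ∞ f)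
    (h : ∀ x ∈ I.boundary Q, f x = 0) : VanishesOnBoundary I (differential I f) := by
  intro x hx v hv
  obtain ⟨γ, hγ0, hγ, hγd⟩ := hv 0
  subst hγ0
  have h1 := (hf.mdifferentiable (by simp) (γ 0)).hasMFDerivAt.comp 0 hγd
  have h2 : HasMFDerivAt 𝓘(ℝ, ℝ) 𝓘(ℝ, ℝ) (f ∘ γ) 0 (0 : ℝ →L[ℝ] ℝ) := by
    refine (hasMFDerivAt_const (0 : ℝ) (0 : ℝ)).congr_of_eventuallyEq ?_
    filter_upwards [hγ] with t ht
    exact h _ ht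
  have h3 := congrArg (fun L : ℝ →L[ℝ] ℝ => L 1) (hasMFDerivAt_unique h1 h2)
  have h4 : (mfderiv I 𝓘(ℝ, ℝ) f (γ 0) : E →L[ℝ] ℝ) ((1 : ℝ) • v 0) = 0 := h3
  rw [one_smul] at h4
  exact h4

variable {M : Type*} [TopologicalSpace M] [ChartedSpace (EuclideanHalfSpace 2) M]
  [IsManifold (𝓡∂ 2) ∞ M]

theorem suspensionFields_subset {τ : Form (EuclideanSpace ℝ (Fin 2)) M 2}
    (hτ : IsVolumeForm (𝓡∂ 2) τ)
    {B' : Set (Form (EuclideanSpace ℝ (Fin 2) × EuclideanSpace ℝ (Fin 1)) (M × Circle) 2)}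
    (hB' : IsFluxClass (M × Circle) prodModel B') :
    suspensionFields τ B' ⊆ B' ∩ nonvanishingFields (M × Circle) prodModel := by
  rintro B ⟨ψ, η, F, hψ, hη, -, -, hS, rfl⟩
  have h1 := hB'.pullback_mem hS hψ
  refine ⟨h1, hB'.subset h1, fun x => pullback_apply_ne_zero ψ
    (suspensionForm_apply_ne_zero F ?_)⟩
  obtain ⟨a, ha, hax⟩ := hη.2 (ψ x).1
  rw [hax]
  exact smul_ne_zero ha.ne' (hτ.2 _)

theorem suspensionForm_mem_suspensionFields {τ η : Form (EuclideanSpace ℝ (Fin 2)) M 2}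
    {B' : Set (Form (EuclideanSpace ℝ (Fin 2) × EuclideanSpace ℝ (Fin 1)) (M × Circle) 2)}
    {F : M × Circle → ℝ} (hη : IsPositiveVolumeForm (𝓡∂ 2) τ η) (hex : IsExact (𝓡∂ 2) η)
    (hF : ContMDiff prodModel 𝓘(ℝ, ℝ) ∞ F) (h : suspensionForm η F ∈ B') :
    suspensionForm η F ∈ suspensionFields τ B' :=
  ⟨Diffeomorph.refl _ _ _, η, F, isIsotopicToId_refl, hη, hex, hF, h, (pullback_id _).symm⟩

theorem IsPositiveVolumeForm.combination {n : ℕ} {τ η₀ η₁ : Form E Q n}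
    (h₀ : IsPositiveVolumeForm I τ η₀) (h₁ : IsPositiveVolumeForm I τ η₁) {u : ℝ}
    (hu : u ∈ Icc (0 : ℝ) 1) : IsPositiveVolumeForm I τ ((1 - u) • η₀ + u • η₁) := by
  refine ⟨(h₀.1.const_smul _).add (h₁.1.const_smul _), fun x => ?_⟩
  obtain ⟨a, ha, hax⟩ := h₀.2 x
  obtain ⟨b, hb, hbx⟩ := h₁.2 x
  refine ⟨(1 - u) * a + u * b, ?_, ?_⟩
  · rcases hu.1.eq_or_lt with rfl | h
    · simpa using ha
    · exact add_pos_of_nonneg_of_pos (mul_nonneg (sub_nonneg.2 hu.2) ha.le) (mul_pos h hb)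
  · change (1 - u) • η₀ x + u • η₁ x = _
    rw [hax, hbx]
    ext v
    simp only [ContinuousAlternatingMap.add_apply, ContinuousAlternatingMap.smul_apply, smul_eq_mul]
    ring

theorem IsExact.combination {k : ℕ} {η₀ η₁ : Form E Q (k + 1)} (h₀ : IsExact I η₀)
    (h₁ : IsExact I η₁) (a b : ℝ) : IsExact I (a • η₀ + b • η₁) := by
  obtain ⟨α₀, hα₀, rfl⟩ := h₀
  obtain ⟨α₁, hα₁, rfl⟩ := h₁
  refine ⟨a • α₀ + b • α₁, (hα₀.const_smul _).add (hα₁.const_smul _), ?_⟩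
  rw [extD_add (hα₀.const_smul _) (hα₁.const_smul _), extD_smul, extD_smul]

variable [T2Space M] [CompactSpace M]

/-- The path is linear in `η` and `F`, corrected by `dκ` with `κ = G dt`. Positivity of both area
forms with respect to the same `τ` keeps `η` positive along the way, and it makes `∫ κ ∧ B` positive
at both ends, as `exists_corrected_path` demands. -/
theorem exists_path_between_suspensionForms [Nonempty (M × Circle)]
    {τ : Form (EuclideanSpace ℝ (Fin 2)) M 2} (hτ : IsVolumeForm (𝓡∂ 2) τ)
    {μ : Form (EuclideanSpace ℝ (Fin 2) × EuclideanSpace ℝ (Fin 1)) (M × Circle) 3}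
    (hμ : IsVolumeForm prodModel μ) {P : Submodule ℚ (H1Boundary (M × Circle) prodModel)}
    {B' : Set (Form (EuclideanSpace ℝ (Fin 2) × EuclideanSpace ℝ (Fin 1)) (M × Circle) 2)}
    (hB' : IsFluxClass (M × Circle) prodModel B') {c : ℝ}
    {η₀ η₁ : Form (EuclideanSpace ℝ (Fin 2)) M 2} {F₀ F₁ : M × Circle → ℝ}
    (hη₀ : IsPositiveVolumeForm (𝓡∂ 2) τ η₀) (hη₁ : IsPositiveVolumeForm (𝓡∂ 2) τ η₁)
    (hex₀ : IsExact (𝓡∂ 2) η₀) (hex₁ : IsExact (𝓡∂ 2) η₁)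
    (hF₀ : ContMDiff prodModel 𝓘(ℝ, ℝ) ∞ F₀) (hF₁ : ContMDiff prodModel 𝓘(ℝ, ℝ) ∞ F₁)
    (hS₀ : suspensionForm η₀ F₀ ∈ B') (hS₁ : suspensionForm η₁ F₁ ∈ B')
    (hc₀ : HasHelicity prodModel μ P (suspensionForm η₀ F₀) c)
    (hc₁ : HasHelicity prodModel μ P (suspensionForm η₁ F₁) c) :
    ∃ β : ℝ → Form (EuclideanSpace ℝ (Fin 2) × EuclideanSpace ℝ (Fin 1)) (M × Circle) 2,
      IsSmoothFamilyOn prodModel β 0 1 ∧ β 0 = suspensionForm η₀ F₀ ∧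
      β 1 = suspensionForm η₁ F₁ ∧ ∀ u ∈ Icc (0 : ℝ) 1,
        β u ∈ suspensionFields τ B' ∧ HasHelicity prodModel μ P (β u) c := by
  obtain ⟨G, g, hG, hGb, hg, hGg, x, hx, hgx⟩ := exists_cutoff isHalfSpaceModel_prodModel hμ
    (isVolumeForm_dCircle_wedge hτ)
  set κ : Form (EuclideanSpace ℝ (Fin 2) × EuclideanSpace ℝ (Fin 1)) (M × Circle) 1 :=
    fun x => G x • dCircle M x with hκdef
  have hκ : IsSmoothForm prodModel κ := isSmoothForm_dCircle.fun_smul hG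
  have hdκ : extD prodModel κ = wedgeOne (differential prodModel G) (dCircle M) := by
    rw [hκdef, extD_fun_smul hG isSmoothForm_dCircle, extD_dCircle]
    ext y v
    simp
  have hκb : ∀ y ∈ prodModel.boundary (M × Circle), κ y = 0 := by
    intro y hy
    simp only [hκdef]
    rw [hGb y hy]
    exact zero_smul ℝ (dCircle M y)
  have hκκ : wedgeOne κ (extD prodModel κ) = 0 := by
    rw [hdκ, hκdef, wedgeOne_fun_smul_left, wedgeOne_wedgeOne_self]
    ext y v
    simp
  have hdκb : VanishesOnBoundary prodModel (extD prodModel κ) := by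
    rw [hdκ]
    exact (vanishesOnBoundary_differential hG hGb).wedgeOne_left _
  -- The product `κ ∧ B_{η,F}` is `G dt ∧ η`; with `η = a τ`, `a > 0`, and the choice of `G` it
  -- equals `a g μ`.
  have hpos : ∀ {η : Form (EuclideanSpace ℝ (Fin 2)) M 2} {F : M × Circle → ℝ},
      IsPositiveVolumeForm (𝓡∂ 2) τ η → ContMDiff prodModel 𝓘(ℝ, ℝ) ∞ F →
      0 < formIntegral prodModel μ (wedgeOne κ (suspensionForm η F)) := by
    intro η F hη hF
    choose a ha hax using hη.2
    refine formIntegral_pos hμ (hκ.wedgeOne (isSmoothForm_suspensionForm hη.1 hF))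
      (g := fun y => a y.1 * g y) (fun y => mul_nonneg (ha _).le (hg y)) (fun y => ?_) hx
      (mul_ne_zero (ha _).ne' hgx)
    have h1 : pullback prodModel (𝓡∂ 2) Prod.fst η y =
        a y.1 • pullback prodModel (𝓡∂ 2) Prod.fst τ y := by
      ext v
      rw [ContinuousAlternatingMap.smul_apply, pullback_fst_apply, pullback_fst_apply, hax]
      rfl
    have h2 : wedgeOne (dCircle M) (pullback prodModel (𝓡∂ 2) Prod.fst η) y =
        a y.1 • wedgeOne (dCircle M) (pullback prodModel (𝓡∂ 2) Prod.fst τ) y := by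
      change wedgeForm _ _ = _ • wedgeForm _ _
      rw [h1]
      exact (wedgeCLM _ 2 (dCircle M y)).map_smul _ _
    rw [hκdef, wedgeOne_fun_smul_left, wedgeOne_dCircle_suspensionForm]
    change G y • wedgeOne (dCircle M) (pullback prodModel (𝓡∂ 2) Prod.fst η) y = (a y.1 * g y) • μ y
    rw [h2, smul_comm, hGg, smul_smul]
  obtain ⟨A₀, hA₀, hd₀, hP₀, hi₀⟩ := hc₀
  obtain ⟨A₁, hA₁, hd₁, hP₁, hi₁⟩ := hc₁
  obtain ⟨k, hk, hk0, hk1, hhel⟩ := exists_corrected_path isHalfSpaceModel_prodModel hμ hA₀ hA₁ hκ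
    hP₀ hP₁ (by rw [hd₀, hi₀]) (by rw [hd₁, hi₁]) hκb hκκ (by rw [hd₀]; exact hpos hη₀ hF₀)
    (by rw [hd₁]; exact hpos hη₁ hF₁)
  have hcomb : ∀ u : ℝ, suspensionForm ((1 - u) • η₀ + u • η₁)
      ((1 - u) • F₀ + u • F₁ - k u • G) =
      (1 - u) • extD prodModel A₀ + u • extD prodModel A₁ + k u • extD prodModel κ := by
    intro u
    rw [suspensionForm_combination _ _ hF₀ hF₁ hG, hd₀, hd₁, hdκ]
  refine ⟨fun u => (1 - u) • extD prodModel A₀ + u • extD prodModel A₁ + k u • extD prodModel κ,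
    ?_, ?_, ?_, fun u hu => ⟨?_, hhel u hu⟩⟩
  · exact ((hA₀.extD.isSmoothFamilyOn_smul (c := fun u => 1 - u) (by fun_prop)).add
      (hA₁.extD.isSmoothFamilyOn_smul (c := fun u => u) (by fun_prop))).add
        (hκ.extD.isSmoothFamilyOn_smul hk)
  · ext y v
    simp [hk0, hd₀]
  · ext y v
    simp [hk1, hd₁]
  · change (1 - u) • extD prodModel A₀ + u • extD prodModel A₁ + k u • extD prodModel κ ∈ _
    rw [← hcomb u]
    have hsmul : ∀ (a : ℝ) {f : M × Circle → ℝ}, ContMDiff prodModel 𝓘(ℝ, ℝ) ∞ f →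
        ContMDiff prodModel 𝓘(ℝ, ℝ) ∞ (a • f) := fun a _ hf => contMDiff_const.mul hf
    refine suspensionForm_mem_suspensionFields (hη₀.combination hη₁ hu) (hex₀.combination hex₁ _ _)
      (((hsmul _ hF₀).add (hsmul _ hF₁)).sub (hsmul _ hG)) ?_
    rw [hcomb u]
    exact hB'.combination_mem hA₀ hA₁ hκ (by rwa [hd₀]) (by rwa [hd₁]) hκb hdκb u (k u)

/-- Three pieces: undo the first isotopy, pass between the two suspension forms, perform the second
isotopy. Flux class and helicity are constant along the isotopies. -/
theorem isHelicityConnected_suspensionFields [Nonempty (M × Circle)]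
    {τ : Form (EuclideanSpace ℝ (Fin 2)) M 2} (hτ : IsVolumeForm (𝓡∂ 2) τ)
    {μ : Form (EuclideanSpace ℝ (Fin 2) × EuclideanSpace ℝ (Fin 1)) (M × Circle) 3}
    (hμ : IsVolumeForm prodModel μ) {P : Submodule ℚ (H1Boundary (M × Circle) prodModel)}
    {B' : Set (Form (EuclideanSpace ℝ (Fin 2) × EuclideanSpace ℝ (Fin 1)) (M × Circle) 2)}
    (hB' : IsFluxClass (M × Circle) prodModel B') :
    IsHelicityConnected prodModel μ P (suspensionFields τ B') (suspensionFields τ B') := by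
  rintro c _ ⟨ψ₀, η₀, F₀, ⟨φ₀, hφ₀, hφ₀0, rfl⟩, hη₀, hex₀, hF₀, hS₀, rfl⟩ _
    ⟨ψ₁, η₁, F₁, ⟨φ₁, hφ₁, hφ₁0, rfl⟩, hη₁, hex₁, hF₁, hS₁, rfl⟩ hc₀ hc₁
  have hiso : ∀ {φ : ℝ → Diffeomorph prodModel prodModel (M × Circle) (M × Circle) ∞}
      {B : Form (EuclideanSpace ℝ (Fin 2) × EuclideanSpace ℝ (Fin 1)) (M × Circle) 2},
      ContMDiffOn (𝓘(ℝ, ℝ).prod prodModel) prodModel ∞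
        (fun p : ℝ × (M × Circle) => φ p.1 p.2) (Icc 0 1 ×ˢ univ) → B ∈ B' →
      HasHelicity prodModel μ P (pullback prodModel prodModel (φ 1) B) c →
      ∀ u ∈ Icc (0 : ℝ) 1, HasHelicity prodModel μ P (pullback prodModel prodModel (φ u) B) c := by
    intro φ B hφ hB hc u hu
    -- The pullback by `φ u` is the pullback by `(φ 1)⁻¹ ∘ φ u`, itself isotopic to the identity, of
    -- the field at time `1`, whose helicity is known.
    have h1 := hasHelicity_pullback hμ (((hB'.subset hB).2.2).pullback (φ 1)) hc
      (isIsotopicToId_trans_symm hφ hu)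
    rw [pullback_pullback B (((φ u).trans (φ 1).symm).contMDiff.mdifferentiable (by simp))
      ((φ 1).contMDiff.mdifferentiable (by simp))] at h1
    have h2 : (φ 1 : M × Circle → M × Circle) ∘ ((φ u).trans (φ 1).symm) = φ u := by
      ext1 y
      simp
    rwa [h2] at h1
  have hzero : ∀ {φ : ℝ → Diffeomorph prodModel prodModel (M × Circle) (M × Circle) ∞}
      (B : Form (EuclideanSpace ℝ (Fin 2) × EuclideanSpace ℝ (Fin 1)) (M × Circle) 2),
      φ 0 = Diffeomorph.refl prodModel (M × Circle) ∞ →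
      pullback prodModel prodModel (φ 0) B = B := by
    intro φ B h
    rw [h]
    exact pullback_id B
  have hfam : ∀ {φ : ℝ → Diffeomorph prodModel prodModel (M × Circle) (M × Circle) ∞}
      {B : Form (EuclideanSpace ℝ (Fin 2) × EuclideanSpace ℝ (Fin 1)) (M × Circle) 2},
      ContMDiffOn (𝓘(ℝ, ℝ).prod prodModel) prodModel ∞
        (fun p : ℝ × (M × Circle) => φ p.1 p.2) (Icc 0 1 ×ˢ univ) → B ∈ B' →
      IsSmoothFamilyOn prodModel (fun u => pullback prodModel prodModel (φ u) B) 0 1 :=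
    fun {φ} {B} hφ hB => (hB'.subset hB).1.isSmoothFamilyOn_pullback (φ := fun u => φ u) zero_lt_one hφ
  have h0 : (0 : ℝ) ∈ Icc (0 : ℝ) 1 := ⟨le_rfl, zero_le_one⟩
  have hc₀' := hiso hφ₀ hS₀ hc₀ 0 h0
  have hc₁' := hiso hφ₁ hS₁ hc₁ 0 h0
  rw [hzero _ hφ₀0] at hc₀'
  rw [hzero _ hφ₁0] at hc₁'
  obtain ⟨β, hβ, hβ0, hβ1, hβS⟩ := exists_path_between_suspensionForms hτ hμ hB' hη₀ hη₁ hex₀ hex₁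
    hF₀ hF₁ hS₀ hS₁ hc₀' hc₁'
  have hrev : ∀ u ∈ Icc (0 : ℝ) 1, -1 * u + 1 ∈ Icc (0 : ℝ) 1 := fun u hu =>
    ⟨by linarith [hu.2], by linarith [hu.1]⟩
  obtain ⟨γ, hγ, hγ0, hγ1, hγT⟩ := exists_path_of_three
    {B | B ∈ suspensionFields τ B' ∧ HasHelicity prodModel μ P B c}
    ((hfam hφ₀ hS₀).comp_affine hrev) hβ (hfam hφ₁ hS₁)
    (by
      rw [hβ0]
      refine (congrArg (fun t => pullback prodModel prodModel (φ₀ t) (suspensionForm η₀ F₀))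
        (by norm_num : (-1 : ℝ) * 1 + 1 = 0)).trans (hzero _ hφ₀0))
    (by
      rw [hβ1]
      exact (hzero _ hφ₁0).symm)
    (fun u hu => ⟨⟨_, η₀, F₀, isIsotopicToId_of_isotopy hφ₀ hφ₀0 (hrev u hu), hη₀, hex₀, hF₀, hS₀,
      rfl⟩, hiso hφ₀ hS₀ hc₀ _ (hrev u hu)⟩) hβS
    (fun u hu => ⟨⟨_, η₁, F₁, isIsotopicToId_of_isotopy hφ₁ hφ₁0 hu, hη₁, hex₁, hF₁, hS₁, rfl⟩,
      hiso hφ₁ hS₁ hc₁ _ hu⟩)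
  refine ⟨γ, hγ, ?_, hγ1, hγT⟩
  rw [hγ0]
  exact congrArg (fun t => pullback prodModel prodModel (φ₀ t) (suspensionForm η₀ F₀))
    (by norm_num : (-1 : ℝ) * 0 + 1 = 1)

end Suspension

end Helicity

end

open Helicity

theorem lemma1
    {Q : Type*} [TopologicalSpace Q] [ChartedSpace (EuclideanHalfSpace 3) Q]
    [IsManifold (𝓡∂ 3) ∞ Q] [T2Space Q] [CompactSpace Q]
    {M : Type*} [TopologicalSpace M] [ChartedSpace (EuclideanHalfSpace 2) M]
    [IsManifold (𝓡∂ 2) ∞ M] [T2Space M] [CompactSpace M] :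
    -- (A)
    (∀ μ : Form (EuclideanSpace ℝ (Fin 3)) Q 3, IsVolumeForm (𝓡∂ 3) μ →
      ∀ P : Submodule ℚ (H1Boundary Q (𝓡∂ 3)), IsCompl P (LinearMap.ker (inclH1 Q (𝓡∂ 3))) →
      ∀ B'' : Set (Form (EuclideanSpace ℝ (Fin 3)) Q 2),
        IsC1OpenIn (𝓡∂ 3) B'' (exactFields Q (𝓡∂ 3)) →
      ∀ B ∈ B'', ∀ c : ℝ, HasHelicity (𝓡∂ 3) μ P B c → c ≠ 0 →
        ∃ N₀, IsC1NhdIn (𝓡∂ 3) N₀ B'' B ∧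
          ∀ N, IsC1NhdIn (𝓡∂ 3) N B'' B → N ⊆ N₀ → IsHelicityConnected (𝓡∂ 3) μ P N B'') ∧
    -- (B)
    (((𝓡∂ 2).boundary M).Nonempty →
      ∀ τ : Form (EuclideanSpace ℝ (Fin 2)) M 2, IsVolumeForm (𝓡∂ 2) τ →
      ∀ μ : Form (EuclideanSpace ℝ (Fin 2) × EuclideanSpace ℝ (Fin 1)) (M × Circle) 3,
        IsVolumeForm prodModel μ →
      ∀ P : Submodule ℚ (H1Boundary (M × Circle) prodModel),
        IsCompl P (LinearMap.ker (inclH1 (M × Circle) prodModel)) →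
      ∀ B' : Set (Form (EuclideanSpace ℝ (Fin 2) × EuclideanSpace ℝ (Fin 1)) (M × Circle) 2),
        ((∃ Φ : Kappa (M × Circle) prodModel →ₗ[ℚ] ℝ, B' = fluxFiber prodModel Φ) ∨
          B' = exactFields (M × Circle) prodModel) →
        suspensionFields τ B' ⊆ B' ∩ nonvanishingFields (M × Circle) prodModel ∧
        IsHelicityConnected prodModel μ P (suspensionFields τ B') (suspensionFields τ B')) := by
  refine ⟨fun μ hμ P hP B'' hB'' B hB c hc hc0 => ?_, fun hne τ hτ μ hμ P _ B' hB' =>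
    ⟨suspensionFields_subset hτ hB', ?_⟩⟩
  · obtain ⟨N₀, hN₀, hconn⟩ := exists_helicityConnected_nhd (isHalfSpaceModel_euclidean 3) hμ hP hB''
      hB hc hc0
    -- The joining paths are only required to stay in `B''`, so the property passes from `N₀` to
    -- every smaller set.
    exact ⟨N₀, hN₀, fun N _ hN c' B₀ h₀ B₁ h₁ => hconn c' B₀ (hN h₀) B₁ (hN h₁)⟩
  -- A point is needed because the correction of helicity uses a cut-off that is nonzero somewhere.
  · obtain ⟨x, -⟩ := hne
    have : Nonempty (M × Circle) := ⟨(x, 1)⟩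
    exact isHelicityConnected_suspensionFields hτ hμ hB'
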